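/- Let $\Bbbk$ be a field. A graded gentle quiver $(Q,I)$ is a finite quiver $Q$ with integer degrees $|\alpha|$ on its arrows and an ideal $I\subseteq \Bbbk Q$ generated by paths of length two such that (paths are composed from right to left) at most two arrows start and at most two arrows end at each vertex, and for each arrow $\alpha$ there is at most one arrow $\beta$ with $s(\beta)=t(\alpha)$ and $\beta\alpha\in I$, at most one $\beta$ with $s(\beta)=t(\alpha)$ and $\beta\alpha\notin I$, at most one $\gamma$ with $t(\gamma)=s(\alpha)$ and $\alpha\gamma\in I$, and at most one $\gamma$ with $t(\gamma)=s(\alpha)$ and $\alpha\gamma\notin I$. Let $A=\Bbbk Q/I$ be the associated graded algebra. A closed path $u=\alpha_1\cdots\alpha_l$, $l\ge 1$, is a *complete anti-path* if $\alpha_1\alpha_2,\dots,\alpha_{l-1}\alpha_l,\alpha_l\alpha_1\in I$, and a *complete path* if none of these products lies in $I$. Let $\operatorname{rot}(u)=\alpha_2\cdots\alpha_l\alpha_1$; the period of $u$ is the least $r\ge 1$ with $\operatorname{rot}^r(u)=u$, and $u$ is *primitive* if its period is $l$. Put $\omega(u)=l(u)-|u|$ if $u$ is a complete anti-path and $\omega(u)=|u|$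 if $u$ is a complete path. Hochschild cohomology is $HH^i(A,A)=H^i\big(\prod_n \operatorname{Hom}^{\bullet-n}(A^{\otimes n},A)\big)$, with the topology given by the arity filtration, and $HH^{\bullet+1}(A,A)$ carries the Gerstenhaber bracket. For $p=\alpha_1\cdots\alpha_n$ with all $\alpha_i\alpha_{i+1}\in I$ (a vertex if $n=0$) and a parallel path $q\notin I$, let $(p,q)$ denote the Hochschild cochain of arity $n$ obtained, via the comparison map from the bar resolution to Bardzell's resolution, from the cochain $p\mapsto q$ (all other $p'\mapsto 0$). For a complete anti-path $p=\alpha_1\cdots\alpha_n$ of period $r$ set $$\mathcal N^0(p)=\sum_{i=0}^{r-1}(-1)^{in+|p||\alpha_1\cdots\alpha_i|}\big(\operatorname{rot}^i(p),s(\operatorname{rot}^i(p))\big),\qquad \mathcal N^1(p)=(\alpha_n p,\alpha_n),$$ and for a complete path $q=\beta_1\cdots\beta_n$ of period $r$ set $$\mathcal N^0(q)=\sum_{i=0}^{r-1}(-1)^{|q||\beta_1\cdots\beta_i|}\big(s(\operatorname{rot}^i(q)),\operatorname{rot}^i(q)\big),\qquad \mathcal N^1(q)=(\beta_n,\beta_n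 q).$$ For $d\in\mathbb Z$ with $d$ even or $\operatorname{char}\Bbbk=2$, let $\widehat{\mathcal U}_d=\prod_{m\ge1}\Bbbk e_m\times\prod_{m\ge1}\Bbbk f_m$ (product of graded vector spaces, $|e_m|=md$, $|f_m|=md-1$) be the graded Lie algebra with continuous bracket $[e_i,e_j]=(i-j)e_{i+j}$, $[f_i,e_j]=i f_{i+j}$, $[f_i,f_j]=0$, and let $\mathcal U_d\subseteq\widehat{\mathcal U}_d$ be the direct sum of the lines $\Bbbk e_m$, $\Bbbk f_m$. **Claim.** Let $u$ be a primitive complete anti-path (respectively a primitive complete path) of $(Q,I)$, and suppose that $\omega(u)$ is even or $\operatorname{char}\Bbbk=2$. Then for all $m\ge1$, $\mathcal N^0(u^m)$ and $\mathcal N^1(u^m)$ are cocycles of total degrees $m\omega(u)$ and $m\omega(u)+1$. The graded subspace of $HH^{\bullet+1}(A,A)$ which is the closed span (respectively the span) of their classes is closed under the Gerstenhaber bracket, and as a graded Lie algebra it is isomorphic to $\widehat{\mathcal U}_{\omega(u)}$ (respectively to $\mathcal U_{\omega(u)}$), by an isomorphism which sends $f_m$ to the class of $\mathcal N^0(u^m)$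 and $e_m$ to the class of $\mathcal N^1(u^m)$ up to sign, for all $m\ge1$. -/

import Mathlib

open scoped DirectSum

noncomputable section

/-! ## The bigraded Hochschild complex of a graded algebra

The total complex is the product totalisation
`C^i = ∏_n Hom^{i - n}(A^{⊗ n}, A)`.  An element of it is encoded as a function on words
(finite lists) of elements of `A`; its restriction to words of length `n` is the component of
arity `n`, a `k`-multilinear map of internal degree `i - n`. -/

namespace GradedHochschild

section

variable {k A : Type*} [Field k] [Ring A] [Algebra k A]
variable (𝒜 : ℤ → Submodule k A) [GradedAlgebra 𝒜]

/-- The Koszul sign operator: `a ↦ (-1)^{t |a|} a` on homogeneous `a`, extended linearly. -/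
def koszul (t : ℤ) : A →ₗ[k] A :=
  DirectSum.toModule k ℤ A (fun n => (t * n).negOnePow • (𝒜 n).subtype) ∘ₗ
    (DirectSum.decomposeLinearEquiv 𝒜).toLinearMap

/-- The space `C^i = ∏_n Hom^{i - n}(A^{⊗ n}, A)` of Hochschild cochains of total degree `i`. -/
def cochains (i : ℤ) : Submodule k (List A → A) where
  carrier := {f |
    (∀ (u v : List A) (a b : A), f (u ++ (a + b) :: v) = f (u ++ a :: v) + f (u ++ b :: v)) ∧
    (∀ (u v : List A) (c : k) (a : A), f (u ++ (c • a) :: v) = c • f (u ++ a :: v)) ∧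
    (∀ (w : List A) (e : List ℤ), List.Forall₂ (fun a n => a ∈ 𝒜 n) w e →
      f w ∈ 𝒜 (e.sum + (i - w.length)))}
  zero_mem' := by simp
  add_mem' := by
    rintro f g ⟨hf1, hf2, hf3⟩ ⟨hg1, hg2, hg3⟩
    refine ⟨fun u v a b => ?_, fun u v c a => ?_, fun w e h => ?_⟩
    · simp only [Pi.add_apply, hf1, hg1]; abel
    · simp only [Pi.add_apply, hf2, hg2, smul_add]
    · exact add_mem (hf3 w e h) (hg3 w e h)
  smul_mem' := by
    rintro c f ⟨hf1, hf2, hf3⟩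
    refine ⟨fun u v a b => ?_, fun u v c' a => ?_, fun w e h => ?_⟩
    · simp only [Pi.smul_apply, hf1, smul_add]
    · simp only [Pi.smul_apply, hf2, smul_comm c c']
    · exact Submodule.smul_mem _ c (hf3 w e h)

/-- The word `a_1 ⋯ a_l ⊗ (a_{l+1} a_{l+2}) ⊗ ⋯`: the letters at (zero-based) positions `l`
and `l + 1` are multiplied. -/
def mergeAt (l : ℕ) (w : List A) : List A :=
  w.take l ++ (w.getD l 0 * w.getD (l + 1) 0) :: w.drop (l + 2)

/-- The value of the Hochschild differential of a cochain `f` of total degree `i` on a word.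
On a word `a_1, …, a_{n+1}` only the component of arity `n`, of internal degree `t = i - n`,
contributes:
`(-1)^t ((-1)^{t |a_1|} a_1 f(a_2, …) + (-1)^{n+1} f(a_1, …, a_n) a_{n+1}
  + ∑_{l<n} (-1)^{l+1} f(…, a_{l+1} a_{l+2}, …))`. -/
def differentialFun (i : ℤ) (f : List A → A) : List A → A
  | [] => 0
  | a :: w =>
    (i - w.length).negOnePow •
      (koszul 𝒜 (i - w.length) a * f w
        + ((w.length : ℤ) + 1).negOnePow •
            (f (a :: w).dropLast * (a :: w).getLast (List.cons_ne_nil a w))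
        + ∑ l ∈ Finset.range w.length, ((l : ℤ) + 1).negOnePow • f (mergeAt l (a :: w)))

/-- The Hochschild differential on cochains of total degree `i`. -/
def differential (i : ℤ) : (List A → A) →ₗ[k] (List A → A) where
  toFun := differentialFun 𝒜 i
  map_add' f g := by
    funext w
    cases w with
    | nil => simp [differentialFun]
    | cons a w =>
      simp only [differentialFun, Pi.add_apply, mul_add, add_mul, smul_add,
        Finset.sum_add_distrib]
      abel
  map_smul' c f := by
    funext w
    cases w with
    | nil => simp [differentialFun]
    | cons a w =>
      simp only [differentialFun, Pi.smul_apply, RingHom.id_apply, mul_smul_comm, smul_mul_assoc,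
        smul_add, Finset.smul_sum, smul_comm c]

/-- Cocycles of total degree `i`. -/
def cocycles (i : ℤ) : Submodule k (List A → A) :=
  cochains 𝒜 i ⊓ LinearMap.ker (differential 𝒜 i)

/-- Coboundaries of total degree `i`. -/
def coboundaries (i : ℤ) : Submodule k (List A → A) :=
  (cochains 𝒜 (i - 1)).map (differential 𝒜 (i - 1))

/-- Hochschild cohomology `HH^i(A, A)`. -/
abbrev HH (i : ℤ) : Type _ :=
  cocycles 𝒜 i ⧸ (coboundaries 𝒜 i).comap (cocycles 𝒜 i).subtype

/-- The projection from cocycles to cohomology classes. -/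
def HH.mk (i : ℤ) : cocycles 𝒜 i →ₗ[k] HH 𝒜 i :=
  Submodule.mkQ _

/-- `f` is a cocycle of degree `i` and `x` is its class. -/
def HH.IsClassOf {i : ℤ} (x : HH 𝒜 i) (f : List A → A) : Prop :=
  ∃ h : f ∈ cocycles 𝒜 i, x = HH.mk 𝒜 i ⟨f, h⟩

/-- The filtration step `W_j HH^i`: classes of cocycles whose components of arity `< j` vanish.
These subspaces are the basic neighbourhoods of zero. -/
def HH.filtration (i : ℤ) (j : ℕ) : Submodule k (HH 𝒜 i) :=
  Submodule.map (HH.mk 𝒜 i)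
    { carrier := {f | ∀ w : List A, w.length < j → f.1 w = 0}
      zero_mem' := fun _ _ => rfl
      add_mem' := fun {f g} hf hg w hw => by simp [hf w hw, hg w hw]
      smul_mem' := fun c f hf w hw => by simp [hf w hw] }

/-- The closure of the span of `X` for the topology defined by the subspaces `W_j HH^i`. -/
def HH.closedSpan (i : ℤ) (X : Set (HH 𝒜 i)) : Submodule k (HH 𝒜 i) :=
  ⨅ j : ℕ, Submodule.span k X ⊔ HH.filtration 𝒜 i j

/-- The composition `f ∘ g = ∑_r (-1)^{(r-1)(n-1)} f ∘_r g`, where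
`f ∘_r g = (-1)^{(m-1)(n+s-1)} f(1^{⊗ (r-1)} ⊗ g ⊗ 1^{⊗ (m-r)})` for `f` of arity `m` and `g` of
arity `n` and internal degree `s = j - n`.  Here `j` is the total degree of `g` and `p = r - 1`
is the number of letters in front of `g`; on a word of length `L` one has `m - 1 = L - n`. -/
def circ (j : ℤ) (f g : List A → A) (w : List A) : A :=
  ∑ p ∈ Finset.range (w.length + 1), ∑ n ∈ Finset.range (w.length - p + 1),
    ((p : ℤ) * ((n : ℤ) - 1) + ((w.length : ℤ) - n) * (j - 1)).negOnePow •
      f ((w.take p).map (koszul 𝒜 (j - n)) ++ g ((w.drop p).take n) :: w.drop (p + n))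

/-- The Gerstenhaber bracket of cochains `f`, `g` of total degrees `i`, `j`. -/
def bracket (i j : ℤ) (f g : List A → A) : List A → A :=
  circ 𝒜 j f g - ((i - 1) * (j - 1)).negOnePow • circ 𝒜 i g f

/-- `z` is the Gerstenhaber bracket `[x, y]` of the classes `x` and `y`: for *all* cocycles `f`
and `g` representing `x` and `y`, the cochain `[f, g]` is a cocycle with class `z`. -/
def HH.IsBracket {i j l : ℤ} (x : HH 𝒜 i) (y : HH 𝒜 j) (z : HH 𝒜 l) : Prop :=
  ∀ f g : List A → A, HH.IsClassOf 𝒜 x f → HH.IsClassOf 𝒜 y g →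
    HH.IsClassOf 𝒜 z (bracket 𝒜 i j f g)

end

end GradedHochschild

/-! ## Graded gentle quivers and their algebras -/

/-- A graded gentle quiver with vertex set `V` and arrow set `E`.  The ideal `I` is generated by
the paths `α β` (first `β`, then `α`) of length two with `rel α β`. -/
structure GradedGentleQuiver (V E : Type*) where
  /-- start of an arrow -/
  src : E → V
  /-- end of an arrow -/
  tgt : E → V
  /-- degree of an arrow -/
  deg : E → ℤ
  /-- `rel α β` says that `α β` is a path of length two in `I` -/
  rel : E → E → Prop
  rel_comp : ∀ a b, rel a b → src a = tgt b
  src_le_two : ∀ x, {a | src a = x}.encard ≤ 2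
  tgt_le_two : ∀ x, {a | tgt a = x}.encard ≤ 2
  rel_left : ∀ a b c, rel b a → rel c a → b = c
  rel_right : ∀ a b c, rel a b → rel a c → b = c
  nonrel_left : ∀ a b c, src b = tgt a → ¬ rel b a → src c = tgt a → ¬ rel c a → b = c
  nonrel_right : ∀ a b c, src a = tgt b → ¬ rel a b → src a = tgt c → ¬ rel a c → b = c

namespace GradedGentleQuiver

variable {V E : Type*} (Q : GradedGentleQuiver V E)

/-- `α β` is a path of length two which does not lie in `I`. -/
def nonrel (a b : E) : Prop := Q.src a = Q.tgt b ∧ ¬ Q.rel a b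

/-- A path of `Q` which does not lie in `I`: its end vertex together with its arrows
`α_1 ⋯ α_l`, composed from right to left.  The list is empty for trivial paths. -/
@[ext]
structure NPath where
  /-- the vertex where the path ends -/
  tgt : V
  /-- the arrows of the path -/
  word : List E
  chain : word.IsChain Q.nonrel
  tgt_eq : ∀ a ∈ word.head?, Q.tgt a = tgt

variable {Q}

/-- The vertex where a path starts. -/
def NPath.src (p : Q.NPath) : V := p.word.getLast?.elim p.tgt Q.src

/-- `p q` is a path which does not lie in `I`. -/
def NPath.Comp (p q : Q.NPath) : Prop :=
  p.src = q.tgt ∧ (p.word ++ q.word).IsChain Q.nonrel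

/-- Concatenation. -/
def NPath.comp (p q : Q.NPath) (h : p.Comp q) : Q.NPath where
  tgt := p.tgt
  word := p.word ++ q.word
  chain := h.2
  tgt_eq := by
    intro a ha
    obtain ⟨h1, -⟩ := h
    have hp := p.tgt_eq
    have hq := q.tgt_eq
    unfold NPath.src at h1
    cases hw : p.word with
    | nil =>
      rw [hw] at h1 ha
      simp only [List.nil_append] at ha
      rw [hq a ha, ← h1]; rfl
    | cons b w =>
      rw [hw] at hp ha
      exact hp a (by simpa using ha)

variable (Q)

/-- The degree of a word of arrows. -/
def wdeg (w : List E) : ℤ := (w.map Q.deg).sum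

/-- The trivial path at a vertex. -/
def trivialPath (x : V) : Q.NPath := ⟨x, [], List.isChain_nil, by simp⟩

/-- The path consisting of a single arrow. -/
def arrowPath (a : E) : Q.NPath := ⟨Q.tgt a, [a], List.isChain_singleton a, by simp⟩

variable (k : Type*) [Field k]

/-- The gentle algebra `A = kQ / I`, on its basis of paths which do not lie in `I`. -/
def Alg : Type _ := Q.NPath →₀ k

instance : AddCommGroup (Q.Alg k) := inferInstanceAs (AddCommGroup (Q.NPath →₀ k))
instance : Module k (Q.Alg k) := inferInstanceAs (Module k (Q.NPath →₀ k))

/-- The basis of `A` consisting of the paths which do not lie in `I`. -/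
def pathBasis : Module.Basis Q.NPath k (Q.Alg k) := Finsupp.basisSingleOne

/-- The basis vector of a path. -/
def ofPath (p : Q.NPath) : Q.Alg k := Q.pathBasis k p

open Classical in
/-- The product of two basis paths: their concatenation if it is a path outside of `I`, and `0`
otherwise. -/
def mulPath (p q : Q.NPath) : Q.Alg k :=
  if h : p.Comp q then Q.ofPath k (p.comp q h) else 0

/-- The bilinear multiplication of `kQ / I`. -/
def mulLin : Q.Alg k →ₗ[k] Q.Alg k →ₗ[k] Q.Alg k :=
  (Q.pathBasis k).constr k fun p => (Q.pathBasis k).constr k fun q => Q.mulPath k p q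

instance : Mul (Q.Alg k) := ⟨fun a b => Q.mulLin k a b⟩

instance [Fintype V] : One (Q.Alg k) := ⟨∑ x, Q.ofPath k (Q.trivialPath x)⟩

variable {Q k}

theorem mul_eq (a b : Q.Alg k) : a * b = Q.mulLin k a b := rfl

theorem one_eq [Fintype V] : (1 : Q.Alg k) = ∑ x, Q.ofPath k (Q.trivialPath x) := rfl

theorem ofPath_mul_ofPath (p q : Q.NPath) :
    Q.ofPath k p * Q.ofPath k q = Q.mulPath k p q := by
  simp [mul_eq, mulLin, ofPath, Module.Basis.constr_basis]

theorem NPath.src_comp (p q : Q.NPath) (h : p.Comp q) : (p.comp q h).src = q.src := by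
  obtain ⟨h1, -⟩ := h
  unfold NPath.src at *
  change (p.word ++ q.word).getLast?.elim p.tgt Q.src = _
  cases hq : q.word with
  | nil => simpa using h1
  | cons b w =>
    rw [List.getLast?_append, List.getLast?_eq_some_getLast (List.cons_ne_nil b w)]
    rfl

theorem NPath.comp_left (p q r : Q.NPath) (h : p.Comp q) :
    (p.comp q h).Comp r ↔ q.src = r.tgt ∧ (p.word ++ q.word ++ r.word).IsChain Q.nonrel := by
  unfold NPath.Comp
  rw [NPath.src_comp]
  rfl

theorem NPath.comp_assoc_iff (p q r : Q.NPath) :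
    (∃ h : p.Comp q, (p.comp q h).Comp r) ↔ (∃ h : q.Comp r, p.Comp (q.comp r h)) := by
  constructor
  · rintro ⟨h, h'⟩
    rw [NPath.comp_left] at h'
    refine ⟨⟨h'.1, ?_⟩, ⟨h.1, ?_⟩⟩
    · have := h'.2
      rw [List.append_assoc] at this
      exact this.right_of_append
    · simpa [NPath.comp] using h'.2
  · rintro ⟨h, h'⟩
    have h2 : (p.word ++ (q.word ++ r.word)).IsChain Q.nonrel := h'.2
    rw [← List.append_assoc] at h2
    have h3 : p.Comp q := ⟨h'.1, h2.left_of_append⟩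
    exact ⟨h3, (NPath.comp_left p q r h3).2 ⟨h.1, h2⟩⟩

open Classical in
theorem ofPath_mul_assoc (p q r : Q.NPath) :
    Q.ofPath k p * Q.ofPath k q * Q.ofPath k r
      = Q.ofPath k p * (Q.ofPath k q * Q.ofPath k r) := by
  have zl : ∀ a : Q.Alg k, (0 : Q.Alg k) * a = 0 := fun a => by simp [mul_eq]
  have zr : ∀ a : Q.Alg k, a * (0 : Q.Alg k) = 0 := fun a => by simp [mul_eq]
  have key := NPath.comp_assoc_iff p q r
  rw [ofPath_mul_ofPath, ofPath_mul_ofPath]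
  unfold mulPath
  by_cases h : ∃ h : p.Comp q, (p.comp q h).Comp r
  · obtain ⟨h3, h4⟩ := key.1 h
    obtain ⟨h1, h2⟩ := h
    rw [dif_pos h1, dif_pos h3, ofPath_mul_ofPath, ofPath_mul_ofPath]
    unfold mulPath
    rw [dif_pos h2, dif_pos h4]
    congr 1
    ext1
    · rfl
    · simp [NPath.comp]
  · have h' := mt key.2 h
    push Not at h h'
    have e1 : (if h : p.Comp q then Q.ofPath k (p.comp q h) else 0) * Q.ofPath k r = 0 := by
      split_ifs with h1
      · rw [ofPath_mul_ofPath, mulPath, dif_neg (h h1)]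
      · exact zl _
    have e2 : Q.ofPath k p * (if h : q.Comp r then Q.ofPath k (q.comp r h) else 0) = 0 := by
      split_ifs with h1
      · rw [ofPath_mul_ofPath, mulPath, dif_neg (h' h1)]
      · exact zr _
    rw [e1, e2]

theorem mulLin_assoc (a b c : Q.Alg k) : a * b * c = a * (b * c) := by
  have e1 : (LinearMap.llcomp k (Q.Alg k) (Q.Alg k) (Q.Alg k →ₗ[k] Q.Alg k) (Q.mulLin k)) ∘ₗ
        Q.mulLin k
      = (LinearMap.llcomp k (Q.Alg k) (Q.Alg k) (Q.Alg k)).compl₂ (Q.mulLin k) ∘ₗ Q.mulLin k := by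
    refine (Q.pathBasis k).ext fun p => (Q.pathBasis k).ext fun q => (Q.pathBasis k).ext fun r => ?_
    exact ofPath_mul_assoc p q r
  exact LinearMap.congr_fun (LinearMap.congr_fun (LinearMap.congr_fun e1 a) b) c

theorem trivialPath_comp (x : V) (p : Q.NPath) : (Q.trivialPath x).Comp p ↔ x = p.tgt := by
  simp [NPath.Comp, trivialPath, NPath.src, p.chain]

theorem comp_trivialPath (x : V) (p : Q.NPath) : p.Comp (Q.trivialPath x) ↔ p.src = x := by
  simp [NPath.Comp, trivialPath, p.chain]

theorem one_mul_aux [Fintype V] (a : Q.Alg k) : 1 * a = a := by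
  have e : Q.mulLin k 1 = LinearMap.id := by
    refine (Q.pathBasis k).ext fun p => ?_
    change (1 : Q.Alg k) * Q.ofPath k p = Q.ofPath k p
    rw [one_eq, mul_eq, map_sum, LinearMap.sum_apply, Finset.sum_eq_single p.tgt]
    · have h := (trivialPath_comp p.tgt p).2 rfl
      rw [← mul_eq, ofPath_mul_ofPath, mulPath, dif_pos h]
      congr 1
    · intro x _ hx
      rw [← mul_eq, ofPath_mul_ofPath, mulPath, dif_neg]
      rwa [trivialPath_comp]
    · simp
  exact LinearMap.congr_fun e a

theorem mul_one_aux [Fintype V] (a : Q.Alg k) : a * 1 = a := by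
  have e : (Q.mulLin k).flip 1 = LinearMap.id := by
    refine (Q.pathBasis k).ext fun p => ?_
    change Q.ofPath k p * (1 : Q.Alg k) = Q.ofPath k p
    rw [one_eq, mul_eq, map_sum, Finset.sum_eq_single p.src]
    · have h := (comp_trivialPath p.src p).2 rfl
      rw [← mul_eq, ofPath_mul_ofPath, mulPath, dif_pos h]
      congr 1
      ext1
      · rfl
      · simp [NPath.comp, trivialPath]
    · intro x _ hx
      rw [← mul_eq, ofPath_mul_ofPath, mulPath, dif_neg]
      rw [comp_trivialPath]
      exact fun h => hx h.symm
    · simp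
  exact LinearMap.congr_fun e a

instance [Fintype V] : Ring (Q.Alg k) :=
  { (inferInstance : AddCommGroup (Q.Alg k)), (inferInstance : Mul (Q.Alg k)),
    (inferInstance : One (Q.Alg k)) with
    left_distrib := fun a b c => by simp [mul_eq]
    right_distrib := fun a b c => by simp [mul_eq]
    zero_mul := fun a => by simp [mul_eq]
    mul_zero := fun a => by simp [mul_eq]
    mul_assoc := mulLin_assoc
    one_mul := one_mul_aux
    mul_one := mul_one_aux }

instance [Fintype V] : Algebra k (Q.Alg k) :=
  Algebra.ofModule (fun c a b => by simp [mul_eq]) (fun c a b => by simp [mul_eq])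

variable (Q k)

/-- The degree of a path is the sum of the degrees of its arrows. -/
def NPath.deg {Q : GradedGentleQuiver V E} (p : Q.NPath) : ℤ := Q.wdeg p.word

/-- The grading of `A = kQ / I`: the degree `n` part is spanned by the paths of degree `n`. -/
def grading (n : ℤ) : Submodule k (Q.Alg k) :=
  Submodule.span k (Q.ofPath k '' {p | p.deg = n})

variable {Q k}

theorem ofPath_mem_grading (p : Q.NPath) : Q.ofPath k p ∈ Q.grading k p.deg :=
  Submodule.subset_span ⟨p, rfl, rfl⟩

/-- The decomposition of an element into its homogeneous components. -/
def decomposeLin : Q.Alg k →ₗ[k] ⨁ n, Q.grading k n :=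
  (Q.pathBasis k).constr k fun p =>
    DirectSum.lof k ℤ (fun n => Q.grading k n) p.deg ⟨Q.ofPath k p, ofPath_mem_grading p⟩

instance : DirectSum.Decomposition (Q.grading k) :=
  DirectSum.Decomposition.ofLinearMap (Q.grading k) decomposeLin
    (by
      refine (Q.pathBasis k).ext fun p => ?_
      simp [decomposeLin, Module.Basis.constr_basis, ofPath])
    (by
      refine DirectSum.linearMap_ext _ fun n => LinearMap.ext fun x => ?_
      obtain ⟨x, hx⟩ := x
      rw [LinearMap.comp_apply, LinearMap.comp_apply, DirectSum.coeLinearMap_lof,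
        LinearMap.id_comp]
      induction hx using Submodule.span_induction with
      | mem y hy =>
        obtain ⟨p, hp, rfl⟩ := hy
        obtain rfl : p.deg = n := hp
        simp [decomposeLin, ofPath, Module.Basis.constr_basis]
      | zero => rw [map_zero]; exact (map_zero _).symm
      | add y z hy hz h1 h2 =>
        rw [map_add, h1, h2, ← map_add]; rfl
      | smul c y hy h1 => rw [map_smul, h1, ← map_smul]; rfl)

instance [Fintype V] : GradedAlgebra (Q.grading k) where
  one_mem := by
    rw [one_eq]
    refine sum_mem fun x _ => ?_
    exact ofPath_mem_grading (Q.trivialPath x)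
  mul_mem := by
    intro i j a b ha hb
    induction ha using Submodule.span_induction with
    | zero => rw [zero_mul]; exact zero_mem _
    | add y z _ _ h1 h2 => rw [add_mul]; exact add_mem h1 h2
    | smul c y _ h1 => rw [smul_mul_assoc]; exact Submodule.smul_mem _ c h1
    | mem y hy =>
      obtain ⟨p, rfl, rfl⟩ := hy
      induction hb using Submodule.span_induction with
      | zero => rw [mul_zero]; exact zero_mem _
      | add y z _ _ h1 h2 => rw [mul_add]; exact add_mem h1 h2
      | smul c y _ h1 => rw [mul_smul_comm]; exact Submodule.smul_mem _ c h1
      | mem y hy =>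
        obtain ⟨q, rfl, rfl⟩ := hy
        rw [ofPath_mul_ofPath, mulPath]
        split_ifs with h
        · have : p.deg + q.deg = (p.comp q h).deg := by
            simp [NPath.deg, wdeg, NPath.comp]
          rw [this]
          exact ofPath_mem_grading _
        · exact zero_mem _

/-! ### Complete paths and anti-paths -/

section

variable (Q)

/-- `u = α_1 ⋯ α_l`, `l ≥ 1`, is a complete anti-path: all cyclically consecutive products
`α_1 α_2, …, α_{l-1} α_l, α_l α_1` are paths in `I`. -/
def IsCompleteAntipath (u : List E) : Prop := u ≠ [] ∧ (u ++ u.take 1).IsChain Q.rel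

/-- `u = α_1 ⋯ α_l`, `l ≥ 1`, is a complete path: all cyclically consecutive products
`α_1 α_2, …, α_{l-1} α_l, α_l α_1` are paths which do not lie in `I`. -/
def IsCompletePath (u : List E) : Prop := u ≠ [] ∧ (u ++ u.take 1).IsChain Q.nonrel

end

/-- The period of `u`: the smallest `n ≥ 1` such that the `n`-fold rotation of `u` is `u`. -/
def period (u : List E) : ℕ := Function.minimalPeriod (fun v : List E => v.rotate 1) u

/-- `u` is primitive: its exponent `l(u) / period u` is `1`. -/
def IsPrimitive (u : List E) : Prop := u.length = period u

/-- The power `u^m` of a closed path. -/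
def wpow (u : List E) (m : ℕ) : List E := (List.replicate m u).flatten

/-! ### Cochains from parallel paths -/

/-- The list of words `u α_1, α_2, …, α_{n-1}, α_n v` for `p = α_1 ⋯ α_n` (and `u α_1 v` if
`n = 1`, and the empty list if `n = 0`). -/
def padded (u v : List E) : List E → List (List E)
  | [] => []
  | [a] => [u ++ a :: v]
  | a :: b :: p => (u ++ [a]) :: padded [] v (b :: p)

/-- The function on words of elements of `A` which is multilinear in the letters and has
prescribed values on words of basis paths. -/
def multiExt : (List Q.NPath → Q.Alg k) → List (Q.Alg k) → Q.Alg k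
  | F, [] => F []
  | F, a :: w => ((Q.pathBasis k).repr a).sum fun p c => c • multiExt (fun l => F (p :: l)) w

variable [Fintype V]

variable (Q k)

/-- The element of `A` given by a word of arrows (the unit for the empty word). -/
def wordElt (w : List E) : Q.Alg k := (w.map fun a => Q.ofPath k (Q.arrowPath a)).prod

open Classical in
/-- The Hochschild cochain attached to an anti-path `p = α_1 ⋯ α_n` and an element `b` of `A`
parallel to `p`, where `s` is the degree of `b` minus the degree of `p`.  It is the cochain of
the minimal (Bardzell) bimodule resolution with `p ↦ b`, transported to the bar resolution along
the comparison map: for `n ≥ 2` it sends `(u α_1, α_2, …, α_{n-1}, α_n v)` to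
`(-1)^{s |u|} u b v`, for `n = 1` it sends a path `w` to the sum of `(-1)^{s |u|} u b v` over all
factorisations `w = u α_1 v`, and for `n = 0` it is the element `b`; it vanishes on all other
words of basis paths. -/
def parallelCochain (p : List E) (s : ℤ) (b : Q.Alg k) : List (Q.Alg k) → Q.Alg k :=
  multiExt fun l =>
    let first := l.head?.elim [] NPath.word
    let last := l.getLast?.elim [] NPath.word
    ∑ i ∈ Finset.range (first.length + 1), ∑ j ∈ Finset.range (last.length + 1),
      if padded (first.take i) (last.drop j) p = l.map NPath.word then
        (s * Q.wdeg (first.take i)).negOnePow •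
          (Q.wordElt k (first.take i) * b * Q.wordElt k (last.drop j))
      else 0

/-- The trivial path at the start of the path `w`, as an element of `A`. -/
def startIdem (w : List E) : Q.Alg k :=
  w.getLast?.elim 0 fun a => Q.ofPath k (Q.trivialPath (Q.src a))

/-- `N^0(p) = ∑_{i<r} (-1)^{i n + |p| |α_1 ⋯ α_i|} (rot^i p, s(rot^i p))` for a complete
anti-path `p = α_1 ⋯ α_n` of period `r`. -/
def antiN0 (p : List E) : List (Q.Alg k) → Q.Alg k :=
  ∑ i ∈ Finset.range (period p),
    ((i : ℤ) * p.length + Q.wdeg p * Q.wdeg (p.take i)).negOnePow •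
      Q.parallelCochain k (p.rotate i) (-Q.wdeg p) (Q.startIdem k (p.rotate i))

/-- `N^1(p) = (α_n p, α_n)` for a complete anti-path `p = α_1 ⋯ α_n`. -/
def antiN1 (p : List E) : List (Q.Alg k) → Q.Alg k :=
  p.getLast?.elim 0 fun a => Q.parallelCochain k (a :: p) (-Q.wdeg p) (Q.wordElt k [a])

/-- `N^0(q) = ∑_{i<r} (-1)^{|q| |β_1 ⋯ β_i|} (s(rot^i q), rot^i q)` for a complete path
`q = β_1 ⋯ β_n` of period `r`. -/
def pathN0 (q : List E) : List (Q.Alg k) → Q.Alg k :=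
  ∑ i ∈ Finset.range (period q),
    (Q.wdeg q * Q.wdeg (q.take i)).negOnePow •
      Q.parallelCochain k [] (Q.wdeg q) (Q.wordElt k (q.rotate i))

/-- `N^1(q) = (β_n, β_n q)` for a complete path `q = β_1 ⋯ β_n`. -/
def pathN1 (q : List E) : List (Q.Alg k) → Q.Alg k :=
  q.getLast?.elim 0 fun a => Q.parallelCochain k [a] (Q.wdeg q) (Q.wordElt k (a :: q))

open GradedHochschild

/-- The closed span in `HH^i(A, A)` of the classes of `N^0(u^m)` and `N^1(u^m)`, `m ≥ 1`, for a
complete anti-path `u`. -/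
def antiSpan (u : List E) (i : ℤ) : Submodule k (HH (Q.grading k) i) :=
  HH.closedSpan (Q.grading k) i {x | ∃ m : ℕ, 1 ≤ m ∧
    (HH.IsClassOf (Q.grading k) x (Q.antiN0 k (wpow u m)) ∨
      HH.IsClassOf (Q.grading k) x (Q.antiN1 k (wpow u m)))}

/-- The span in `HH^i(A, A)` of the classes of `N^0(u^m)` and `N^1(u^m)`, `m ≥ 1`, for a
complete path `u`. -/
def pathSpan (u : List E) (i : ℤ) : Submodule k (HH (Q.grading k) i) :=
  Submodule.span k {x | ∃ m : ℕ, 1 ≤ m ∧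
    (HH.IsClassOf (Q.grading k) x (Q.pathN0 k (wpow u m)) ∨
      HH.IsClassOf (Q.grading k) x (Q.pathN1 k (wpow u m)))}

end GradedGentleQuiver

/-! ## The semidirect extension of the graded Witt algebra -/

namespace GradedWitt

variable (k : Type*) [Field k] (d : ℤ)

/-- The degree `i` part of `Û_d = ∏_{m ≥ 1} k e_m × ∏_{m ≥ 1} k f_m`, where `e_m` has degree `m d`
and `f_m` has degree `m d - 1` (the product is taken in graded vector spaces).  A pair `(a, b)`
of sequences stands for `∑ a_m e_m + ∑ b_m f_m`. -/
def completed (i : ℤ) : Submodule k ((ℕ → k) × (ℕ → k)) where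
  carrier := {x | (∀ m : ℕ, x.1 m ≠ 0 → 1 ≤ m ∧ m * d = i) ∧
    (∀ m : ℕ, x.2 m ≠ 0 → 1 ≤ m ∧ m * d - 1 = i)}
  zero_mem' := by simp
  add_mem' := by
    rintro x y ⟨hx1, hx2⟩ ⟨hy1, hy2⟩
    refine ⟨fun m hm => ?_, fun m hm => ?_⟩
    · by_cases h : x.1 m = 0
      · exact hy1 m fun h' => hm (by simp [h, h'])
      · exact hx1 m h
    · by_cases h : x.2 m = 0
      · exact hy2 m fun h' => hm (by simp [h, h'])
      · exact hx2 m h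
  smul_mem' := by
    rintro c x ⟨hx1, hx2⟩
    exact ⟨fun m hm => hx1 m fun h => hm (by simp [h]),
      fun m hm => hx2 m fun h => hm (by simp [h])⟩

/-- The degree `i` part of `U_d = ⨁_{m ≥ 1} k e_m ⊕ ⨁_{m ≥ 1} k f_m`. -/
def uncompleted (i : ℤ) : Submodule k ((ℕ → k) × (ℕ → k)) where
  carrier := {x | x ∈ completed k d i ∧ x.1.support.Finite ∧ x.2.support.Finite}
  zero_mem' := by simp
  add_mem' := by
    rintro x y ⟨hx, hx1, hx2⟩ ⟨hy, hy1, hy2⟩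
    exact ⟨add_mem hx hy, (hx1.union hy1).subset (Function.support_add _ _),
      (hx2.union hy2).subset (Function.support_add _ _)⟩
  smul_mem' := by
    rintro c x ⟨hx, hx1, hx2⟩
    exact ⟨Submodule.smul_mem _ c hx, hx1.subset (Function.support_const_smul_subset c _),
      hx2.subset (Function.support_const_smul_subset c _)⟩

variable {k}

/-- The bracket with `[e_i, e_j] = (i - j) e_{i+j}`, `[f_i, e_j] = i f_{i+j}`,
`[e_i, f_j] = - j f_{i+j}` and `[f_i, f_j] = 0`, extended to infinite sums.  (If `d` is even or
the characteristic is `2`, then graded antisymmetry gives `[e_i, f_j] = - [f_j, e_i]`.) -/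
def bracketFun (x y : (ℕ → k) × (ℕ → k)) : (ℕ → k) × (ℕ → k) :=
  (fun n => ∑ p ∈ Finset.HasAntidiagonal.antidiagonal n, ((p.1 : k) - p.2) * (x.1 p.1 * y.1 p.2),
   fun n => ∑ p ∈ Finset.HasAntidiagonal.antidiagonal n,
    ((p.1 : k) * (x.2 p.1 * y.1 p.2) - (p.2 : k) * (x.1 p.1 * y.2 p.2)))

variable {d}

theorem bracketFun_mem {i j : ℤ} {x y : (ℕ → k) × (ℕ → k)} (hx : x ∈ completed k d i)
    (hy : y ∈ completed k d j) : bracketFun x y ∈ completed k d (i + j) := by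
  obtain ⟨hx1, hx2⟩ := hx
  obtain ⟨hy1, hy2⟩ := hy
  refine ⟨fun n hn => ?_, fun n hn => ?_⟩
  · simp only [bracketFun, ne_eq] at hn
    obtain ⟨p, hp, h⟩ := Finset.exists_ne_zero_of_sum_ne_zero hn
    rw [Finset.HasAntidiagonal.mem_antidiagonal] at hp
    obtain ⟨a1, a2⟩ := hx1 p.1 fun h' => h (by simp [h'])
    obtain ⟨b1, b2⟩ := hy1 p.2 fun h' => h (by simp [h'])
    refine ⟨by omega, ?_⟩
    rw [← hp, ← a2, ← b2]; push_cast; ring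
  · simp only [bracketFun, ne_eq] at hn
    obtain ⟨p, hp, h⟩ := Finset.exists_ne_zero_of_sum_ne_zero hn
    rw [Finset.HasAntidiagonal.mem_antidiagonal] at hp
    by_cases hc : x.2 p.1 * y.1 p.2 = 0
    · rw [hc, mul_zero, zero_sub] at h
      obtain ⟨a1, a2⟩ := hx1 p.1 fun h' => h (by simp [h'])
      obtain ⟨b1, b2⟩ := hy2 p.2 fun h' => h (by simp [h'])
      refine ⟨by omega, ?_⟩
      rw [← hp, ← a2, ← b2]; push_cast; ring
    · obtain ⟨a1, a2⟩ := hx2 p.1 fun h' => hc (by simp [h'])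
      obtain ⟨b1, b2⟩ := hy1 p.2 fun h' => hc (by simp [h'])
      refine ⟨by omega, ?_⟩
      rw [← hp, ← a2, ← b2]; push_cast; ring

theorem bracketFun_finite {x y : (ℕ → k) × (ℕ → k)}
    (hx : x.1.support.Finite ∧ x.2.support.Finite)
    (hy : y.1.support.Finite ∧ y.2.support.Finite) :
    (bracketFun x y).1.support.Finite ∧ (bracketFun x y).2.support.Finite := by
  obtain ⟨hx1, hx2⟩ := hx
  obtain ⟨hy1, hy2⟩ := hy
  constructor
  · refine (Set.Finite.image2 (fun a b : ℕ => a + b) hx1 hy1).subset fun n hn => ?_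
    simp only [bracketFun, ne_eq, Function.mem_support] at hn
    obtain ⟨p, hp, h⟩ := Finset.exists_ne_zero_of_sum_ne_zero hn
    rw [Finset.HasAntidiagonal.mem_antidiagonal] at hp
    exact ⟨p.1, fun h' => h (by simp [h']), p.2, fun h' => h (by simp [h']), hp⟩
  · refine ((Set.Finite.image2 (fun a b : ℕ => a + b) hx2 hy1).union
      (Set.Finite.image2 (fun a b : ℕ => a + b) hx1 hy2)).subset fun n hn => ?_
    simp only [bracketFun, ne_eq, Function.mem_support] at hn
    obtain ⟨p, hp, h⟩ := Finset.exists_ne_zero_of_sum_ne_zero hn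
    rw [Finset.HasAntidiagonal.mem_antidiagonal] at hp
    by_cases hc : x.2 p.1 * y.1 p.2 = 0
    · rw [hc, mul_zero, zero_sub] at h
      exact Or.inr ⟨p.1, fun h' => h (by simp [h']), p.2, fun h' => h (by simp [h']), hp⟩
    · exact Or.inl ⟨p.1, fun h' => hc (by simp [h']), p.2, fun h' => hc (by simp [h']), hp⟩

/-- The bracket of `Û_d`. -/
def completed.bracket {i j : ℤ} (x : completed k d i) (y : completed k d j) :
    completed k d (i + j) :=
  ⟨bracketFun x.1 y.1, bracketFun_mem x.2 y.2⟩

/-- The bracket of `U_d`. -/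
def uncompleted.bracket {i j : ℤ} (x : uncompleted k d i) (y : uncompleted k d j) :
    uncompleted k d (i + j) :=
  ⟨bracketFun x.1 y.1, bracketFun_mem x.2.1 y.2.1, bracketFun_finite x.2.2 y.2.2⟩

variable (k d)

/-- The generator `e_m`, `m ≥ 1`, of `U_d`. -/
def genE (m : ℕ) (hm : 1 ≤ m) : uncompleted k d (m * d) :=
  ⟨(Pi.single m 1, 0), ⟨fun n hn => by
      obtain rfl : n = m := by
        by_contra h
        exact hn (by simp [h])
      exact ⟨hm, rfl⟩, by simp⟩,
    (Set.finite_singleton m).subset Pi.support_single_subset, by simp⟩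

/-- The generator `f_m`, `m ≥ 1`, of `U_d`. -/
def genF (m : ℕ) (hm : 1 ≤ m) : uncompleted k d (m * d - 1) :=
  ⟨(0, Pi.single m 1), ⟨by simp, fun n hn => by
      obtain rfl : n = m := by
        by_contra h
        exact hn (by simp [h])
      exact ⟨hm, rfl⟩⟩,
    by simp, (Set.finite_singleton m).subset Pi.support_single_subset⟩

variable {k d}

/-- The inclusion of `U_d` into `Û_d`. -/
def toCompleted {i : ℤ} (x : uncompleted k d i) : completed k d i := ⟨x.1, x.2.1⟩

end GradedWitt

end

open GradedHochschild GradedWitt GradedGentleQuiver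

/-! Cochains are studied through their values on words of basis paths. After décalage the operation
`circ` is plain insertion of one multilinear function into another, with only a Koszul operator on
the letters to the left. The pre-Lie relation then says that the part of an iterated insertion in
which neither inserted function is an argument of the other is symmetric up to sign (`ins_ins`,
`circ_prelie`). The differential is the bracket with the multiplication, so it squares to zero, is a
derivation of the bracket, and the bracket of two classes can be computed on any representatives
(`HH.isBracket_of_sub_mem`).

The passage to Bardzell's small complex is a discrete Morse argument. Relative cochains are those
that are normalised and multilinear over the vertices. A walk of nontrivial paths is critical
(arrows whose consecutive products lie in `I`, the generators of Bardzell's resolution), or long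
(such arrows up to a first composable pair), or arises from a long word by multiplying that pair
(`walk_trichotomy`). Evaluating the differential on long words gives a recursion: a relative cocycle
that vanishes on long and critical words is zero (`eq_zero_of_long_of_crit`), and one that vanishes
on critical words is a coboundary (`mem_coboundaries_of_crit`). Hence cocycle conditions need only
be tested on long and critical words, and identities between classes only on words of arrows.

By gentleness a primitive `u` is a cycle of pairwise distinct arrows, recorded as a periodic
sequence `A`. For an anti-path, `N^1(u^m)` contracts the stretch of `m l + 1` letters starting at
`A_{l-1}` to the arrow `A_{l-1}`, and `N^0(u^m)` sends each stretch of `m l` letters to a vertex.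
Composing with `N^1(u^j)` counts the occurrences of `A_{l-1}`, of which there are `i + 1` for
`N^1(u^i)` and `i` for `N^0(u^i)`. Inserting `N^0` into a normalised cochain gives zero on words of
arrows. For a path, `N^1(u^m)` is the derivation that prolongs `A_{l-1}` by `m` turns, and it counts
occurrences of this letter in subpaths of the cycle; `N^0(u^m)` is the sum of the rotations of
`u^m`. This yields the structure constants `i - j` and `i`. The parity of `d` is what makes the
signs independent of the number of turns made.

The isomorphism sends a sequence of coefficients to the class of the corresponding sum. It is
injective because suitable coefficients of a differential, read once around the cycle, form a
telescoping sum that closes up. For anti-paths the arities grow, so infinite sums make sense, and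
independence holds up to any bound on the arity. Approximations of a class modulo the arity
filtration therefore have coefficients that stabilise, which identifies the image with the closed
span (`range_toHH_completed`). -/

set_option linter.unusedSectionVars false

open GradedHochschild GradedWitt GradedGentleQuiver

/-! ### Insertion of multilinear functions and the pre-Lie relation. -/

namespace GradedHochschild

section PreLie

variable {k A : Type*} [Field k] [Ring A] [Algebra k A]

/-- Multilinearity of a function on words. -/
def Multi (k : Type*) {A : Type*} [Field k] [Ring A] [Algebra k A] (f : List A → A) : Prop :=
  ∀ (u v : List A) (c : k) (a b : A),
    f (u ++ (c • a + b) :: v) = c • f (u ++ a :: v) + f (u ++ b :: v)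

theorem Multi.add {f : List A → A} (hf : Multi k f) (u v : List A) (a b : A) :
    f (u ++ (a + b) :: v) = f (u ++ a :: v) + f (u ++ b :: v) := by
  simpa using hf u v 1 a b

theorem Multi.zero {f : List A → A} (hf : Multi k f) (u v : List A) :
    f (u ++ 0 :: v) = 0 := by
  have := hf.add u v 0 0
  simpa using this

theorem Multi.smul {f : List A → A} (hf : Multi k f) (u v : List A) (c : k) (a : A) :
    f (u ++ (c • a) :: v) = c • f (u ++ a :: v) := by
  simpa [hf.zero] using hf u v c a 0

theorem Multi.units_smul {f : List A → A} (hf : Multi k f) (u v : List A) (s : ℤˣ) (a : A) :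
    f (u ++ (s • a) :: v) = s • f (u ++ a :: v) := by
  rw [Units.smul_def, Units.smul_def, ← Int.cast_smul_eq_zsmul k, ← Int.cast_smul_eq_zsmul k,
    hf.smul]

theorem Multi.head_add {f : List A → A} (hf : Multi k f) (v : List A) (a b : A) :
    f ((a + b) :: v) = f (a :: v) + f (b :: v) := hf.add [] v a b

theorem Multi.head_smul {f : List A → A} (hf : Multi k f) (v : List A) (c : k) (a : A) :
    f ((c • a) :: v) = c • f (a :: v) := hf.smul [] v c a

theorem Multi.head_zero {f : List A → A} (hf : Multi k f) (v : List A) :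
    f (0 :: v) = 0 := hf.zero [] v

theorem Multi.head_units_smul {f : List A → A} (hf : Multi k f) (v : List A) (s : ℤˣ) (a : A) :
    f ((s • a) :: v) = s • f (a :: v) := hf.units_smul [] v s a

theorem Multi.cons {f : List A → A} (hf : Multi k f) (a : A) :
    Multi k (fun v => f (a :: v)) := fun u v c x y => hf (a :: u) v c x y

/-- Insertion of `f` at the beginning of a word: `w ↦ ∑ φ (f w₁ :: w₂)` over `w = w₁ w₂`. -/
def headIns (φ : List A → A) : (List A → A) → List A → A
  | f, [] => φ [f []]
  | f, a :: w => φ (f [] :: a :: w) + headIns φ (fun v => f (a :: v)) w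

/-- Insertion of `f` at all places, where the letters to the left of `f` are acted on by `κ`. -/
def ins (κ : A → A) (f : List A → A) : (List A → A) → List A → A
  | φ, [] => φ [f []]
  | φ, a :: w => headIns φ f (a :: w) + ins κ f (fun v => φ (κ a :: v)) w

/-- The function on words given by a function of the first letter and the remaining word. -/
def onHead (F : A → List A → A) : List A → A
  | [] => 0
  | b :: r => F b r

theorem headIns_add_left (φ ψ f : List A → A) (w : List A) :
    headIns (fun v => φ v + ψ v) f w = headIns φ f w + headIns ψ f w := by
  induction w generalizing f with
  | nil => simp [headIns]
  | cons a w ih => simp only [headIns, ih]; abel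

theorem headIns_add_right {φ : List A → A} (hφ : Multi k φ) (f g : List A → A) (w : List A) :
    headIns φ (fun v => f v + g v) w = headIns φ f w + headIns φ g w := by
  induction w generalizing f g with
  | nil => simp [headIns, hφ.head_add]
  | cons a w ih => simp only [headIns, ih, hφ.head_add]; abel

theorem headIns_congr {φ ψ : List A → A} (h : ∀ b v, φ (b :: v) = ψ (b :: v))
    (f : List A → A) (w : List A) : headIns φ f w = headIns ψ f w := by
  induction w generalizing f with
  | nil => simp [headIns, h]
  | cons a w ih => simp only [headIns, ih, h]

theorem ins_add (κ : A → A) (φ ψ f : List A → A) (w : List A) :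
    ins κ f (fun v => φ v + ψ v) w = ins κ f φ w + ins κ f ψ w := by
  induction w generalizing φ ψ with
  | nil => simp [ins]
  | cons a w ih => simp only [ins, ih, headIns_add_left]; abel

theorem headIns_units_smul_left (s : ℤˣ) (φ f : List A → A) (w : List A) :
    headIns (fun v => s • φ v) f w = s • headIns φ f w := by
  induction w generalizing f with
  | nil => simp [headIns]
  | cons a w ih => simp only [headIns, ih, smul_add]

theorem ins_units_smul_left (κ : A → A) (s : ℤˣ) (φ f : List A → A) (w : List A) :
    ins κ f (fun v => s • φ v) w = s • ins κ f φ w := by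
  induction w generalizing φ with
  | nil => simp [ins]
  | cons a w ih => simp only [ins, ih, headIns_units_smul_left, smul_add]

theorem headIns_units_smul_right {φ : List A → A} (hφ : Multi k φ) (s : ℤˣ) (f : List A → A)
    (w : List A) : headIns φ (fun v => s • f v) w = s • headIns φ f w := by
  induction w generalizing f with
  | nil => simp [headIns, hφ.head_units_smul]
  | cons a w ih => simp only [headIns, ih, hφ.head_units_smul, smul_add]

theorem ins_units_smul_right (κ : A → A) {φ : List A → A} (hφ : Multi k φ) (s : ℤˣ)
    (f : List A → A) (w : List A) : ins κ (fun v => s • f v) φ w = s • ins κ f φ w := by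
  induction w generalizing φ with
  | nil => simp [ins, hφ.head_units_smul]
  | cons a w ih => simp only [ins, ih (hφ.cons _), headIns_units_smul_right hφ, smul_add]

theorem ins_add_right (κ : A → A) {φ : List A → A} (hφ : Multi k φ)
    (f g : List A → A) (w : List A) :
    ins κ (fun v => f v + g v) φ w = ins κ f φ w + ins κ g φ w := by
  induction w generalizing φ with
  | nil => simp [ins, hφ.head_add]
  | cons a w ih => simp only [ins, ih (hφ.cons _), headIns_add_right hφ]; abel

/-- Once `f` has been inserted at the front, its value is the first letter. The head insertion of
`g` then takes either no letter at all or a prefix that contains this value. -/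
theorem headIns_headIns {φ : List A → A} (hφ : Multi k φ) (f g : List A → A) (w : List A) :
    headIns (headIns φ g) f w
      = headIns φ (headIns g f) w + headIns (fun v => φ (g [] :: v)) f w := by
  induction w generalizing f with
  | nil => simp only [headIns]; abel
  | cons a w ih =>
    simp only [headIns]
    rw [ih, headIns_add_right hφ]
    abel

/-- Either `f` is inserted among the arguments of `g`, or it lies to the right of `g`, and then `κ`
has acted on all arguments of `g`. -/
theorem ins_headIns {φ : List A → A} (hφ : Multi k φ) (κ : A → A) (f g : List A → A)
    (w : List A) :
    ins κ f (headIns φ g) w = headIns φ (ins κ f g) w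
      + headIns (onHead fun b r => ins κ f (fun r => φ (b :: r)) r)
          (fun v => g (v.map κ)) w := by
  induction w generalizing g with
  | nil => simp [ins, headIns, onHead, add_comm]
  | cons a w ih =>
    have e : ins κ f (headIns φ g) (a :: w) = headIns (headIns φ g) f (a :: w)
      + (ins κ f (fun v => φ (g [] :: κ a :: v)) w
        + ins κ f (headIns φ (fun v => g (κ a :: v))) w) := by
      rw [ins, ← ins_add]
      rfl
    rw [e, ih, headIns_headIns hφ]
    simp only [headIns, ins, List.map_nil, List.map_cons, onHead]
    rw [headIns_add_right hφ (fun v => g (f [] :: a :: v) + headIns g (fun v => f (a :: v)) v)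
        (ins κ f fun v => g (κ a :: v)),
      headIns_add_right hφ (fun v => g (f [] :: a :: v)) (headIns g fun v => f (a :: v))]
    abel

/-- Insertion of `f` and, to the right of it, of `g`; the letters to the left of both are acted on
by `κ`, the value of `f` and the letters between them by `κg`. -/
def ins₂ (κ κg : A → A) (f g : List A → A) : (List A → A) → List A → A
  | φ, [] => φ [κg (f []), g []]
  | φ, a :: w =>
    headIns (onHead fun b r => ins κg g (fun r => φ (κg b :: r)) r) f (a :: w)
      + ins₂ κ κg f g (fun v => φ (κ a :: v)) w

/-- The rule `hg` moves `κ` from the arguments of `g` to its value at the cost of `s`. This makes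
insertions to the left and to the right of `g` comparable. -/
theorem headIns_sign {φ : List A → A} (hφ : Multi k φ) (κ : A → A) (s : ℤˣ) (f g : List A → A)
    (hg : ∀ v, κ (g v) = s • g (v.map κ)) (w : List A) :
    headIns (onHead fun b r => ins κ f (fun r => φ (b :: r)) r)
          (fun v => g (v.map κ)) w
     = s • headIns (onHead fun b r => ins κ f (fun r => φ (κ b :: r)) r) g w := by
  have hg' : ∀ v, g (v.map κ) = s • κ (g v) := by
    intro v; rw [hg, smul_smul, Int.units_mul_self, one_smul]
  have key : ∀ (G : List A → A) (w : List A), 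
      headIns (onHead fun b r => ins κ f (fun r => φ (b :: r)) r)
          (fun v => s • κ (G v)) w
     = s • headIns (onHead fun b r => ins κ f (fun r => φ (κ b :: r)) r) G w := by
    intro G w
    induction w generalizing G with
    | nil =>
      simp only [headIns, ins, onHead]
      rw [hφ.head_units_smul]
    | cons a w ih =>
      simp only [headIns, ih, smul_add, onHead]
      congr 1
      rw [← ins_units_smul_left]
      simp only [hφ.head_units_smul]
  simp only [hg']
  exact key g w

/-- In an iterated insertion `f` is an argument of `g`, or stands to its left, or to its right.
Swapping `f` and `g` exchanges the last two kinds of terms up to `s`: this is the pre-Lie relation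
before signs are restored. -/
theorem ins_ins {φ : List A → A} (hφ : Multi k φ) (κf κg : A → A) (hc : ∀ a, κf (κg a) = κg (κf a))
    (s : ℤˣ) (f g : List A → A)
    (hg : ∀ v, κf (g v) = s • g (v.map κf)) (w : List A) :
    ins κf f (ins κg g φ) w = ins (fun a => κf (κg a)) (ins κf f g) φ w
      + ins₂ (fun a => κf (κg a)) κg f g φ w + s • ins₂ (fun a => κf (κg a)) κf g f φ w := by
  induction w generalizing φ with
  | nil =>
    have := hg []
    simp only [List.map_nil] at this
    simp only [ins, headIns, ins₂, this, hφ.head_units_smul, smul_smul, Int.units_mul_self,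
      one_smul]
    abel
  | cons a w ih =>
    have e : ins κf f (ins κg g φ) (a :: w) = headIns (ins κg g φ) f (a :: w)
      + (ins κf f (fun v => headIns φ g (κf a :: v)) w
        + ins κf f (ins κg g (fun v => φ (κf (κg a) :: v))) w) := by
      rw [ins, ← ins_add]
      simp only [ins, hc]
    have e2 : headIns (ins κg g φ) f (a :: w) = headIns (headIns φ g) f (a :: w)
      + headIns (onHead fun b r => ins κg g (fun r => φ (κg b :: r)) r) f
          (a :: w) := by
      refine Eq.trans ?_ (headIns_add_left (A := A) (headIns φ g) _ f (a :: w))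
      apply headIns_congr
      intro b v
      rfl
    have e3 : headIns (headIns φ g) f (a :: w) + ins κf f (fun v => headIns φ g (κf a :: v)) w
        = ins κf f (headIns φ g) (a :: w) := rfl
    rw [e, e2, ih (hφ.cons _)]
    have e4 := ins_headIns hφ κf f g (a :: w)
    rw [headIns_sign hφ κf s f g hg] at e4
    rw [e4] at e3
    have e5 : ∀ (κ : A → A) (F : List A → A), ins κ F φ (a :: w)
        = headIns φ F (a :: w) + ins κ F (fun v => φ (κ a :: v)) w := fun _ _ => rfl
    rw [e5]
    simp only [ins₂, smul_add]
    linear_combination (norm := abel) e3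

end PreLie

end GradedHochschild

/-! ### Koszul signs on homogeneous elements. -/

namespace GradedHochschild

section Signs

variable {k A : Type*} [Field k] [Ring A] [Algebra k A]

theorem map_units_zsmul {B : Type*} [AddCommGroup B] [Module k B] (L : A →ₗ[k] B) (s : ℤˣ) (a : A) :
    L (s • a) = s • L a := by
  rw [Units.smul_def, Units.smul_def, map_zsmul]

theorem negOnePow_congr {m n : ℤ} (h : Even (m - n)) : m.negOnePow = n.negOnePow :=
  (Int.negOnePow_eq_iff m n).2 h

variable (𝒜 : ℤ → Submodule k A) [GradedAlgebra 𝒜]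

theorem koszul_of_mem {n : ℤ} {a : A} (ha : a ∈ 𝒜 n) (t : ℤ) :
    koszul 𝒜 t a = (t * n).negOnePow • a := by
  rw [koszul, LinearMap.comp_apply, LinearEquiv.coe_toLinearMap,
    DirectSum.decomposeLinearEquiv_apply, DirectSum.decompose_of_mem 𝒜 ha, ← DirectSum.lof_eq_of k,
    DirectSum.toModule_lof]
  rfl

theorem hom_induction {P : A → Prop} (h0 : P 0) (hom : ∀ n, ∀ a ∈ 𝒜 n, P a)
    (hadd : ∀ a b, P a → P b → P (a + b)) (a : A) : P a :=
  DirectSum.Decomposition.inductionOn 𝒜 h0 (fun m => hom _ m m.2) hadd a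

theorem koszul_koszul (s t : ℤ) (a : A) : koszul 𝒜 s (koszul 𝒜 t a) = koszul 𝒜 (s + t) a := by
  induction a using hom_induction 𝒜 with
  | h0 => simp
  | hom n a ha =>
    simp only [koszul_of_mem 𝒜 ha, map_units_zsmul, smul_smul, ← Int.negOnePow_add]
    congr 2; ring
  | hadd a b ha hb => simp [ha, hb]

theorem koszul_congr {s t : ℤ} (h : Even (s - t)) (a : A) : koszul 𝒜 s a = koszul 𝒜 t a := by
  induction a using hom_induction 𝒜 with
  | h0 => simp
  | hom n a ha =>
    simp only [koszul_of_mem 𝒜 ha]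
    rw [negOnePow_congr (n := t * n)]
    rw [← sub_mul]; exact h.mul_right n
  | hadd a b ha hb => simp [ha, hb]

theorem koszul_even {s : ℤ} (h : Even s) (a : A) : koszul 𝒜 s a = a := by
  induction a using hom_induction 𝒜 with
  | h0 => simp
  | hom n a ha =>
    rw [koszul_of_mem 𝒜 ha, Int.negOnePow_even _ (h.mul_right n), one_smul]
  | hadd a b ha hb => simp [ha, hb]

theorem koszul_mem {n : ℤ} {a : A} (ha : a ∈ 𝒜 n) (t : ℤ) : koszul 𝒜 t a ∈ 𝒜 n := by
  rw [koszul_of_mem 𝒜 ha, Units.smul_def]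
  exact zsmul_mem ha _

variable {𝒜}

theorem cochains_multi {i : ℤ} {f : List A → A} (hf : f ∈ cochains 𝒜 i) : Multi k f := by
  intro u v c a b
  rw [hf.1, hf.2.1]

theorem mem_cochains_iff {i : ℤ} {f : List A → A} : f ∈ cochains 𝒜 i ↔ Multi k f ∧
    ∀ (w : List A) (e : List ℤ), List.Forall₂ (fun a n => a ∈ 𝒜 n) w e →
      f w ∈ 𝒜 (e.sum + (i - w.length)) :=
  ⟨fun h => ⟨cochains_multi h, h.2.2⟩, fun h => ⟨h.1.add, h.1.smul, h.2⟩⟩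

-- Every element is a sum of homogeneous ones, so the letters can be made homogeneous one after the
-- other from the left.
variable (𝒜) in
theorem Multi.ext_hom {f g : List A → A} (hf : Multi k f) (hg : Multi k g)
    (h : ∀ (w : List A) (e : List ℤ), List.Forall₂ (fun a n => a ∈ 𝒜 n) w e → f w = g w)
    (w : List A) : f w = g w := by
  have key : ∀ (w u : List A) (e : List ℤ), List.Forall₂ (fun a n => a ∈ 𝒜 n) u e →
      f (u ++ w) = g (u ++ w) := by
    intro w
    induction w with
    | nil => intro u e hu; simpa using h u e hu
    | cons a w ih =>
      intro u e hu
      induction a using hom_induction 𝒜 with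
      | h0 => rw [hf.zero, hg.zero]
      | hom n a ha =>
        have := ih (u ++ [a]) (e ++ [n])
          (List.rel_append hu (List.Forall₂.cons ha List.Forall₂.nil))
        simpa using this
      | hadd a b ha hb => rw [hf.add, hg.add, ha, hb]
  exact key w [] [] List.Forall₂.nil

theorem Multi.comp_map {f : List A → A} (hf : Multi k f) (L : A →ₗ[k] A) :
    Multi k (fun w => f (w.map L)) := by
  intro u v c a b
  simp only [List.map_append, List.map_cons, map_add, map_smul]
  exact hf _ _ _ _ _

theorem Multi.lcomp {f : List A → A} (hf : Multi k f) (L : A →ₗ[k] A) :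
    Multi k (fun w => L (f w)) := by
  intro u v c a b
  simp only [hf u v c a b, map_add, map_smul]

theorem Multi.len_smul {f : List A → A} (hf : Multi k f) (s : ℕ → ℤˣ) :
    Multi k (fun w => s w.length • f w) := by
  intro u v c a b
  simp only [hf u v c a b, List.length_append, List.length_cons, smul_add, smul_comm c]

/-- A cochain of total degree `i` raises degrees by `i - n` on words of length `n`; by
multilinearity it is enough to see this on homogeneous letters. -/
theorem koszul_cochain {i : ℤ} {f : List A → A} (hf : f ∈ cochains 𝒜 i) (q : ℤ) (w : List A) :
    koszul 𝒜 q (f w) = (q * (i - w.length)).negOnePow • f (w.map (koszul 𝒜 q)) := by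
  have hm := cochains_multi hf
  refine Multi.ext_hom 𝒜 (f := fun w => koszul 𝒜 q (f w))
    (g := fun w => (q * (i - w.length)).negOnePow • f (w.map (koszul 𝒜 q))) (hm.lcomp _)
    ((hm.comp_map _).len_smul fun n => (q * (i - n)).negOnePow) (fun w e he => ?_) w
  have e1 : ∀ (u w : List A) (e : List ℤ), List.Forall₂ (fun a n => a ∈ 𝒜 n) w e →
      f (u ++ w.map (koszul 𝒜 q)) = (q * e.sum).negOnePow • f (u ++ w) := by
    intro u w e he
    induction he generalizing u with
    | nil => simp
    | @cons a n w e ha he ih =>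
      have := ih (u ++ [a])
      simp only [List.append_assoc, List.singleton_append] at this
      rw [List.map_cons, koszul_of_mem 𝒜 ha, hm.units_smul, this, smul_smul, ← Int.negOnePow_add,
        List.sum_cons, mul_add]
  have e2 := e1 [] w e he
  simp only [List.nil_append] at e2
  rw [koszul_of_mem 𝒜 (hf.2.2 w e he), e2, smul_smul, ← Int.negOnePow_add]
  congr 2; ring

end Signs

/-! ### Décalage: removing the signs from the composition. -/

section Twist

variable {k A : Type*} [Field k] [Ring A] [Algebra k A]
variable (𝒜 : ℤ → Submodule k A) [GradedAlgebra 𝒜]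

/-- The letter `a` followed by `q` letters is replaced by `(-1)^{(q + s)|a|} a`. -/
def twistWord (s : ℤ) : List A → List A
  | [] => []
  | a :: w => koszul 𝒜 (w.length + s) a :: twistWord s w

@[simp] theorem length_twistWord (s : ℤ) (w : List A) : (twistWord 𝒜 s w).length = w.length := by
  induction w with
  | nil => rfl
  | cons a w ih => simp [twistWord, ih]

theorem twistWord_append (s : ℤ) (u v : List A) :
    twistWord 𝒜 s (u ++ v) = twistWord 𝒜 (v.length + s) u ++ twistWord 𝒜 s v := by
  induction u with
  | nil => rfl
  | cons a w ih => simp [twistWord, ih, add_assoc]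

theorem twistWord_map (s t : ℤ) (w : List A) :
    (twistWord 𝒜 s w).map (koszul 𝒜 t) = twistWord 𝒜 (s + t) w := by
  induction w with
  | nil => rfl
  | cons a w ih =>
    simp only [twistWord, List.map_cons, ih, koszul_koszul]
    rw [show t + (↑w.length + s) = ↑w.length + (s + t) by ring]

theorem twistWord_map' (s t : ℤ) (w : List A) :
    twistWord 𝒜 s (w.map (koszul 𝒜 t)) = twistWord 𝒜 (s + t) w := by
  induction w with
  | nil => rfl
  | cons a w ih =>
    simp only [twistWord, List.map_cons, ih, koszul_koszul, List.length_map, add_assoc]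

theorem twistWord_congr {s t : ℤ} (h : Even (s - t)) (w : List A) :
    twistWord 𝒜 s w = twistWord 𝒜 t w := by
  induction w with
  | nil => rfl
  | cons a w ih =>
    simp only [twistWord, ih]
    rw [koszul_congr 𝒜 (t := w.length + t)]
    simpa using h

theorem twistWord_twistWord (w : List A) : twistWord 𝒜 0 (twistWord 𝒜 0 w) = w := by
  induction w with
  | nil => rfl
  | cons a w ih =>
    simp only [twistWord, ih, length_twistWord, koszul_koszul]
    rw [koszul_even]
    exact ⟨w.length, by ring⟩

/-- The sign `(-1)^{(n-1)(n-2)/2}`. -/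
def decSign (n : ℕ) : ℤˣ := (((n + 1).choose 2 : ℤ) + 1).negOnePow

/-- The décalage: the function `f` on words, as a function on words of suspended letters. -/
def decal (f : List A → A) (w : List A) : A := decSign w.length • f (twistWord 𝒜 0 w)

theorem decal_decal (f : List A → A) : decal 𝒜 (decal 𝒜 f) = f := by
  funext w
  simp [decal, twistWord_twistWord, smul_smul]

/-- The sign operator `a ↦ (-1)^{t (|a| + 1)} a`. -/
def susp (t : ℤ) (a : A) : A := t.negOnePow • koszul 𝒜 t a

theorem choose_two_add (m n : ℕ) :
    (m + n).choose 2 = m.choose 2 + n.choose 2 + m * n := by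
  induction n with
  | zero => simp
  | succ n ih =>
    rw [← add_assoc, Nat.choose_succ_succ' (m + n) 1, Nat.choose_succ_succ' n 1, ih]
    simp only [Nat.choose_one_right]; ring

/-- The quadratic exponent of `decSign` is chosen for this rule, which absorbs the
position-dependent sign in `circ`. -/
theorem decSign_mul (m n : ℕ) : decSign (m + n) =
    ((m : ℤ) * ((n : ℤ) - 1)).negOnePow * (decSign (m + 1) * decSign n) := by
  unfold decSign
  rw [← Int.negOnePow_add, ← Int.negOnePow_add]
  apply negOnePow_congr
  have h1 : (m + n + 1).choose 2 = m.choose 2 + (n + 1).choose 2 + m * (n + 1) := by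
    rw [add_assoc, choose_two_add]
  have h2 : (m + 1 + 1).choose 2 = m.choose 2 + 1 + 2 * m := by
    rw [choose_two_add (m + 1) 1, choose_two_add m 1]; simp; ring
  rw [h1, h2]
  push_cast
  exact ⟨-1, by ring⟩

variable {𝒜}

theorem Multi.map_units_smul {f : List A → A} (hf : Multi k f) (s : ℤˣ) (u v x : List A) :
    f (x ++ (u.map (s • ·) ++ v)) = s ^ u.length • f (x ++ (u ++ v)) := by
  induction u generalizing x with
  | nil => simp
  | cons a u ih =>
    have := ih (x ++ [a])
    simp only [List.append_assoc, List.singleton_append] at this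
    simp only [List.map_cons, List.cons_append, List.length_cons, pow_succ']
    rw [hf.units_smul, this, smul_smul]

/-- This is the comparison for one fixed position of the inserted function, where `x`, `y`, `z` are
the letters before, inside and after it. -/
theorem decal_insert {f g : List A → A} (hf : Multi k f) {j : ℤ} (hg : g ∈ cochains 𝒜 j)
    (x y z : List A) :
    decSign (x.length + y.length + z.length) •
      ((x.length : ℤ) * ((y.length : ℤ) - 1) + (x.length + z.length) * (j - 1)).negOnePow •
        f ((twistWord 𝒜 (y.length + z.length) x).map (koszul 𝒜 (j - y.length)) ++
            g (twistWord 𝒜 z.length y) :: twistWord 𝒜 0 z)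
      = decal 𝒜 f (x.map (susp 𝒜 (j - 1)) ++ decal 𝒜 g y :: z) := by
  have hx : x.map (susp 𝒜 (j - 1))
      = (x.map (koszul 𝒜 (j - 1))).map ((j - 1).negOnePow • ·) := by
    rw [List.map_map]; rfl
  have htw : ∀ (t s : ℤ) (u : ℤˣ) (w : List A), twistWord 𝒜 s (w.map (u • ·))
      = (twistWord 𝒜 s w).map (u • ·) := by
    intro t s u w
    induction w with
    | nil => rfl
    | cons a w ih => simp [twistWord, ih]
  have e3 : f ((twistWord 𝒜 (z.length + 1 + (j - 1)) x).map ((j - 1).negOnePow • ·) ++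
      koszul 𝒜 z.length (decSign y.length • g (twistWord 𝒜 0 y)) :: twistWord 𝒜 0 z)
      = (decSign y.length * (((j - 1).negOnePow) ^ x.length *
          ((z.length : ℤ) * (j - y.length)).negOnePow)) •
        f ((twistWord 𝒜 (y.length + z.length) x).map (koszul 𝒜 (j - y.length)) ++
            g (twistWord 𝒜 z.length y) :: twistWord 𝒜 0 z) := by
    rw [map_units_zsmul, koszul_cochain hg, length_twistWord, smul_smul, hf.units_smul,
      twistWord_map, twistWord_map]
    have := hf.map_units_smul (j - 1).negOnePow (twistWord 𝒜 (z.length + 1 + (j - 1)) x)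
      (g (twistWord 𝒜 (0 + z.length) y) :: twistWord 𝒜 0 z) []
    simp only [List.nil_append, length_twistWord] at this
    rw [this, smul_smul, zero_add]
    rw [twistWord_congr 𝒜 (s := z.length + 1 + (j - 1))
      (t := y.length + z.length + (j - y.length)) (by ring_nf; simp)]
    congr 1
    simp only [mul_comm, mul_assoc]
  simp only [decal, List.length_append, List.length_map, List.length_cons, twistWord_append,
    twistWord]
  rw [hx, htw (j-1), twistWord_map']
  simp only [add_zero] at e3 ⊢
  push_cast
  rw [e3, smul_smul, smul_smul]
  congr 1
  rw [show x.length + y.length + z.length = x.length + z.length + y.length by ring,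
    decSign_mul, ← add_assoc x.length z.length 1]
  rw [show (j - 1).negOnePow ^ x.length = ((x.length : ℤ) * (j - 1)).negOnePow by
    rw [← zpow_natCast]
    unfold Int.negOnePow
    rw [← zpow_mul, mul_comm]]
  have : ∀ a b c d e f : ℤˣ, d * b = e * f → d * (a * c) * b = a * (c * (e * f)) := by
    intro a b c d e f h
    rw [← h]; simp only [mul_comm, mul_left_comm]
  apply this
  rw [← Int.negOnePow_add, ← Int.negOnePow_add]
  apply negOnePow_congr
  push_cast
  refine ⟨x.length * (y.length - 1) + z.length * (y.length - 1), ?_⟩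
  ring

theorem headIns_eq_sum (φ f : List A → A) (w : List A) :
    headIns φ f w = ∑ n ∈ Finset.range (w.length + 1), φ (f (w.take n) :: w.drop n) := by
  induction w generalizing f with
  | nil => simp [headIns]
  | cons a w ih =>
    rw [headIns, ih, List.length_cons, Finset.sum_range_succ' _ (w.length + 1)]
    simp [add_comm]

theorem ins_eq_sum (κ : A → A) (φ f : List A → A) (w : List A) :
    ins κ f φ w = ∑ p ∈ Finset.range (w.length + 1), ∑ n ∈ Finset.range (w.length - p + 1),
      φ ((w.take p).map κ ++ f ((w.drop p).take n) :: w.drop (p + n)) := by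
  induction w generalizing φ with
  | nil => simp [ins]
  | cons a w ih =>
    rw [ins, ih, List.length_cons, Finset.sum_range_succ' _ (w.length + 1), headIns_eq_sum,
      add_comm]
    congr 1
    · refine Finset.sum_congr rfl fun p _ => ?_
      rw [Nat.add_sub_add_right]
      refine Finset.sum_congr rfl fun n _ => ?_
      rw [show p + 1 + n = p + n + 1 by ring]
      simp
    · simp

/-- On suspended letters the composition keeps no sign except the operator `susp` on the letters to
the left, so the combinatorics of `ins` applies to it. -/
theorem decal_circ {f g : List A → A} (hf : Multi k f) {j : ℤ} (hg : g ∈ cochains 𝒜 j) :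
    decal 𝒜 (circ 𝒜 j f g) = ins (susp 𝒜 (j - 1)) (decal 𝒜 g) (decal 𝒜 f) := by
  funext w
  rw [ins_eq_sum, decal, circ, Finset.smul_sum, length_twistWord]
  refine Finset.sum_congr rfl fun p hp => ?_
  rw [Finset.smul_sum]
  refine Finset.sum_congr rfl fun n hn => ?_
  rw [Finset.mem_range] at hp hn
  have hw : w = w.take p ++ (w.drop p).take n ++ w.drop (p + n) := by
    rw [List.append_assoc, ← List.drop_drop, List.take_append_drop, List.take_append_drop]
  generalize hx : w.take p = x at hw ⊢
  generalize hy : (w.drop p).take n = y at hw ⊢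
  generalize hz : w.drop (p + n) = z at hw ⊢
  have lx : x.length = p := by rw [← hx, List.length_take]; omega
  have ly : y.length = n := by rw [← hy, List.length_take, List.length_drop]; omega
  rw [← decal_insert hf hg, hw, twistWord_append, twistWord_append]
  simp only [add_zero, List.length_append]
  rw [List.take_append_of_le_length (by simp; omega), List.take_append_of_le_length (by simp; omega),
    List.take_of_length_le (by simp; omega), List.append_assoc,
    List.drop_append_of_le_length (by simp; omega), List.drop_of_length_le (by simp; omega),
    List.nil_append, List.take_append_of_le_length (by simp; omega),
    List.take_of_length_le (by simp; omega), ← List.append_assoc,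
    List.drop_append_of_le_length (by simp; omega), List.drop_of_length_le (by simp; omega)]
  subst lx ly
  simp only [List.nil_append]
  congr 4
  push_cast; ring_nf

end Twist
end GradedHochschild

/-! ### The Gerstenhaber bracket, the differential as a bracket, and the bracket on cohomology. -/

namespace GradedHochschild

section Brackets

variable {k A : Type*} [Field k] [Ring A] [Algebra k A]

theorem Multi.addf {f g : List A → A} (hf : Multi k f) (hg : Multi k g) :
    Multi k (fun w => f w + g w) := by
  intro u v c a b
  simp only [hf u v c a b, hg u v c a b, smul_add]; abel

theorem headIns_multi {φ f : List A → A} (hφ : Multi k φ) (hf : Multi k f) :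
    Multi k (headIns φ f) := by
  intro u v c a b
  induction u generalizing f with
  | nil =>
    simp only [List.nil_append, headIns]
    have h1 := hφ [f []] v c a b
    simp only [List.singleton_append] at h1
    have h2 : (fun w => f ((c • a + b) :: w)) = fun w => c • f (a :: w) + f (b :: w) := by
      funext w; exact hf [] w c a b
    rw [h1, h2, headIns_add_right hφ]
    have h3 : ∀ (F : List A → A) (w : List A), headIns φ (fun w => c • F w) w
        = c • headIns φ F w := by
      intro F w
      induction w generalizing F with
      | nil => simp [headIns, hφ.head_smul]
      | cons a w ih => simp only [headIns, ih, hφ.head_smul, smul_add]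
    rw [h3, smul_add]; abel
  | cons x u ih =>
    have h1 := hφ (f [] :: x :: u) v c a b
    simp only [List.cons_append, headIns] at h1 ⊢
    rw [h1, ih (hf.cons x), smul_add]; abel

theorem ins_multi (κ : A →ₗ[k] A) {φ f : List A → A} (hφ : Multi k φ) (hf : Multi k f) :
    Multi k (ins κ f φ) := by
  intro u v c a b
  induction u generalizing φ with
  | nil =>
    have h1 := headIns_multi hφ hf [] v c a b
    simp only [List.nil_append] at h1
    simp only [List.nil_append, ins]
    have h2 : (fun w => φ (κ (c • a + b) :: w))
        = fun w => c • φ (κ a :: w) + φ (κ b :: w) := by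
      funext w; rw [map_add, map_smul]; exact hφ [] w c _ _
    rw [h1, h2, ins_add]
    have h4 : ∀ (F : List A → A) (G : List A → A) (w : List A), headIns (fun w => c • F w) G w
        = c • headIns F G w := by
      intro F G w
      induction w generalizing G with
      | nil => simp [headIns]
      | cons a w ih => simp only [headIns, ih, smul_add]
    have h3 : ∀ (F : List A → A) (w : List A), ins κ f (fun w => c • F w) w
        = c • ins κ f F w := by
      intro F w
      induction w generalizing F with
      | nil => simp [ins]
      | cons a w ih => simp only [ins, ih, h4, smul_add]
    rw [h3, smul_add]; abel
  | cons x u ih =>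
    have h1 := headIns_multi hφ hf (x :: u) v c a b
    simp only [List.cons_append, ins] at h1 ⊢
    rw [h1, ih (hφ.cons _), smul_add]; abel

variable (𝒜 : ℤ → Submodule k A) [GradedAlgebra 𝒜]

/-- `susp` as a linear map. -/
def suspLin (t : ℤ) : A →ₗ[k] A := t.negOnePow • koszul 𝒜 t

theorem twistWord_multi {f : List A → A} (hf : Multi k f) (s : ℤ) :
    Multi k (fun w => f (twistWord 𝒜 s w)) := by
  intro u v c a b
  simp only [twistWord_append, twistWord, List.length_cons, map_add, map_smul]
  exact hf _ _ _ _ _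

theorem decal_multi {f : List A → A} (hf : Multi k f) : Multi k (decal 𝒜 f) :=
  (twistWord_multi 𝒜 hf 0).len_smul decSign

/-- On suspended letters a cochain of total degree `j` acts as a map of degree `j - 1`. This
supplies the hypothesis `hg` of `ins_ins`. -/
theorem susp_decal {f : List A → A} {j : ℤ} (hf : f ∈ cochains 𝒜 j) (t : ℤ) (w : List A) :
    susp 𝒜 t (decal 𝒜 f w) = (t * (j - 1)).negOnePow • decal 𝒜 f (w.map (susp 𝒜 t)) := by
  have hm := cochains_multi hf
  have hx : w.map (susp 𝒜 t) = (w.map (koszul 𝒜 t)).map (t.negOnePow • ·) := by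
    rw [List.map_map]; rfl
  have h2 := (decal_multi 𝒜 hm).map_units_smul t.negOnePow (w.map (koszul 𝒜 t)) [] []
  simp only [List.nil_append, List.append_nil, List.length_map] at h2
  rw [hx, h2]
  simp only [decal, susp, List.length_map]
  rw [map_units_zsmul, koszul_cochain hf, twistWord_map, twistWord_map', length_twistWord]
  simp only [smul_smul, mul_comm (decSign w.length), ← mul_assoc]
  congr 2
  rw [show t.negOnePow ^ w.length = ((w.length : ℤ) * t).negOnePow by
    rw [← zpow_natCast]
    unfold Int.negOnePow
    rw [← zpow_mul, mul_comm]]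
  rw [← Int.negOnePow_add, ← Int.negOnePow_add]
  apply negOnePow_congr
  exact ⟨t - w.length * t, by ring⟩

theorem susp_susp (s t : ℤ) (a : A) : susp 𝒜 s (susp 𝒜 t a) = susp 𝒜 (s + t) a := by
  simp only [susp, map_units_zsmul, koszul_koszul, smul_smul, Int.negOnePow_add]

theorem decal_injective : Function.Injective (decal 𝒜) :=
  Function.LeftInverse.injective (decal_decal 𝒜)

variable {𝒜}

theorem circ_multi {f g : List A → A} {j : ℤ} (hf : Multi k f) (hg : g ∈ cochains 𝒜 j) :
    Multi k (circ 𝒜 j f g) := by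
  rw [← decal_decal 𝒜 (circ 𝒜 j f g), decal_circ hf hg]
  exact decal_multi 𝒜
    (ins_multi (suspLin 𝒜 (j - 1)) (decal_multi 𝒜 hf) (decal_multi 𝒜 (cochains_multi hg)))

theorem units_smul_mem {M : Type*} [AddCommGroup M] [Module k M] (S : Submodule k M) (s : ℤˣ)
    {a : M} (ha : a ∈ S) : s • a ∈ S := by
  rw [Units.smul_def]; exact zsmul_mem ha _

theorem circ_mem {f g : List A → A} {i j : ℤ} (hf : f ∈ cochains 𝒜 i) (hg : g ∈ cochains 𝒜 j) :
    circ 𝒜 j f g ∈ cochains 𝒜 (i + j - 1) := by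
  rw [mem_cochains_iff]
  refine ⟨circ_multi (cochains_multi hf) hg, fun w e he => ?_⟩
  unfold circ
  refine sum_mem fun p hp => sum_mem fun n hn => units_smul_mem _ _ ?_
  rw [Finset.mem_range] at hp hn
  have hlen := he.length_eq
  have h1 : List.Forall₂ (fun a n => a ∈ 𝒜 n) ((w.take p).map (koszul 𝒜 (j - n))) (e.take p) := by
    rw [List.forall₂_map_left_iff]
    exact (List.forall₂_take p he).imp fun a n ha => koszul_mem 𝒜 ha _
  have h2 := hg.2.2 _ _ (List.forall₂_take n (List.forall₂_drop p he))
  have h3 := hf.2.2 _ _ (List.rel_append h1 (List.Forall₂.cons h2 (List.forall₂_drop (p + n) he)))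
  convert h3 using 2
  have hs : e.sum = (e.take p).sum + (((e.drop p).take n).sum + (e.drop (p + n)).sum) := by
    rw [← List.drop_drop, List.sum_take_add_sum_drop, List.sum_take_add_sum_drop]
  simp only [List.length_append, List.length_map, List.length_take, List.length_cons,
    List.length_drop, List.sum_append, List.sum_cons, hs]
  rw [min_eq_left (by omega : p ≤ w.length), min_eq_left (by omega : n ≤ w.length - p)]
  have : ((w.length - (p + n) : ℕ) : ℤ) = w.length - p - n := by omega
  push_cast
  rw [this]; ring

/-- In both differences the nested insertions cancel. What remains are the insertions at disjoint
places, which by `ins_ins` are symmetric in `g` and `h` up to sign. -/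
theorem circ_prelie {f g h : List A → A} {i j l : ℤ} (hf : f ∈ cochains 𝒜 i)
    (hg : g ∈ cochains 𝒜 j) (hh : h ∈ cochains 𝒜 l) :
    circ 𝒜 l (circ 𝒜 j f g) h - circ 𝒜 (j + l - 1) f (circ 𝒜 l g h)
      = ((j - 1) * (l - 1)).negOnePow •
        (circ 𝒜 j (circ 𝒜 l f h) g - circ 𝒜 (j + l - 1) f (circ 𝒜 j h g)) := by
  have hf' := cochains_multi hf
  have hg' := cochains_multi hg
  have hh' := cochains_multi hh
  have hhg := circ_mem hh hg
  rw [show l + j - 1 = j + l - 1 by ring] at hhg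
  apply decal_injective 𝒜
  have dsub : ∀ F G : List A → A, decal 𝒜 (F - G) = decal 𝒜 F - decal 𝒜 G := by
    intro F G; funext w; simp [decal, smul_sub]
  have dsm : ∀ (s : ℤˣ) (F : List A → A), decal 𝒜 (s • F) = s • decal 𝒜 F := by
    intro s F; funext w; simp [decal, smul_comm s]
  rw [dsub, dsm, dsub, decal_circ (circ_multi hf' hg) hh, decal_circ hf' hg,
    decal_circ hf' (circ_mem hg hh), decal_circ hg' hh, decal_circ (circ_multi hf' hh) hg,
    decal_circ hf' hh, decal_circ hf' hhg, decal_circ hh' hg]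
  funext w
  have hc : ∀ s t a, susp 𝒜 s (susp 𝒜 t a) = susp 𝒜 t (susp 𝒜 s a) := by
    intro s t a; rw [susp_susp, susp_susp, add_comm]
  have e1 := ins_ins (decal_multi 𝒜 hf') (susp 𝒜 (l - 1)) (susp 𝒜 (j - 1)) (hc _ _)
    _ (decal 𝒜 h) (decal 𝒜 g) (susp_decal 𝒜 hg _) w
  have e2 := ins_ins (decal_multi 𝒜 hf') (susp 𝒜 (j - 1)) (susp 𝒜 (l - 1)) (hc _ _)
    _ (decal 𝒜 g) (decal 𝒜 h) (susp_decal 𝒜 hh _) w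
  simp only [susp_susp] at e1 e2
  rw [show l - 1 + (j - 1) = j + l - 1 - 1 by ring] at e1
  rw [show j - 1 + (l - 1) = j + l - 1 - 1 by ring] at e2
  simp only [Pi.sub_apply, Pi.smul_apply, e1, e2, mul_comm (l - 1) (j - 1)]
  simp only [smul_sub, smul_add, smul_smul, Int.units_mul_self, one_smul]
  abel

theorem circ_add_left (j : ℤ) (f f' g : List A → A) :
    circ 𝒜 j (f + f') g = circ 𝒜 j f g + circ 𝒜 j f' g := by
  funext w; simp [circ, smul_add, Finset.sum_add_distrib]

theorem circ_smul_left (j : ℤ) (c : k) (f g : List A → A) :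
    circ 𝒜 j (c • f) g = c • circ 𝒜 j f g := by
  funext w; simp [circ, Finset.smul_sum, smul_comm c]

theorem circ_add_right (j : ℤ) {f : List A → A} (hf : Multi k f) (g g' : List A → A) :
    circ 𝒜 j f (g + g') = circ 𝒜 j f g + circ 𝒜 j f g' := by
  funext w; simp [circ, hf.add, smul_add, Finset.sum_add_distrib]

theorem circ_smul_right (j : ℤ) {f : List A → A} (hf : Multi k f) (c : k) (g : List A → A) :
    circ 𝒜 j f (c • g) = c • circ 𝒜 j f g := by
  funext w; simp [circ, Finset.smul_sum, smul_comm c, hf.smul]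

theorem units_smul_eq {M : Type*} [AddCommGroup M] [Module k M] (s : ℤˣ) (x : M) :
    s • x = ((s : ℤ) : k) • x := by
  rw [Int.cast_smul_eq_zsmul, Units.smul_def]

theorem circ_units_smul_left (j : ℤ) (s : ℤˣ) (f g : List A → A) :
    circ 𝒜 j (s • f) g = s • circ 𝒜 j f g := by
  rw [units_smul_eq (k := k), units_smul_eq (k := k), circ_smul_left]

theorem circ_units_smul_right (j : ℤ) {f : List A → A} (hf : Multi k f) (s : ℤˣ)
    (g : List A → A) : circ 𝒜 j f (s • g) = s • circ 𝒜 j f g := by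
  rw [units_smul_eq (k := k), units_smul_eq (k := k), circ_smul_right j hf]

theorem circ_sub_left (j : ℤ) (f f' g : List A → A) :
    circ 𝒜 j (f - f') g = circ 𝒜 j f g - circ 𝒜 j f' g := by
  rw [sub_eq_add_neg, ← neg_one_smul k f', circ_add_left, circ_smul_left, neg_one_smul,
    sub_eq_add_neg]

theorem circ_sub_right (j : ℤ) {f : List A → A} (hf : Multi k f) (g g' : List A → A) :
    circ 𝒜 j f (g - g') = circ 𝒜 j f g - circ 𝒜 j f g' := by
  rw [sub_eq_add_neg, ← neg_one_smul k g', circ_add_right j hf, circ_smul_right j hf,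
    neg_one_smul, sub_eq_add_neg]

theorem bracket_mem {f g : List A → A} {i j l : ℤ} (hf : f ∈ cochains 𝒜 i)
    (hg : g ∈ cochains 𝒜 j) (hl : l = i + j - 1) : bracket 𝒜 i j f g ∈ cochains 𝒜 l := by
  subst hl
  refine sub_mem (circ_mem hf hg) (units_smul_mem _ _ ?_)
  rw [add_comm]; exact circ_mem hg hf

/-- The multiplication as a cochain of arity two. -/
def mulCochain : List A → A
  | [a, b] => a * b
  | _ => 0

variable (𝒜) in
theorem mulCochain_mem : (mulCochain : List A → A) ∈ cochains 𝒜 2 := by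
  rw [mem_cochains_iff]
  constructor
  · intro u v c a b
    match u, v with
    | [], [] => simp [mulCochain]
    | [], [x] => simp [mulCochain, add_mul]
    | [], x :: y :: v => simp [mulCochain]
    | [x], [] => simp [mulCochain, mul_add]
    | [x], y :: v => simp [mulCochain]
    | x :: y :: u, v => 
      have : ∀ z, mulCochain (x :: y :: u ++ z :: v) = 0 := by
        intro z; cases u <;> simp [mulCochain]
      rw [this, this, this]; simp
  · intro w e he
    match w, e, he with
    | [], _, _ => exact zero_mem _
    | [_], _, _ => exact zero_mem _
    | _ :: _ :: _ :: _, _, _ => exact zero_mem _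
    | [a, b], _, .cons ha (.cons hb .nil) =>
      simpa [mulCochain] using SetLike.mul_mem_graded ha hb

theorem mulCochain_eq_zero {w : List A} (h : w.length ≠ 2) : mulCochain w = 0 := by
  match w with
  | [] => rfl
  | [_] => rfl
  | [_, _] => simp at h
  | _ :: _ :: _ :: _ => rfl

theorem circ_mulCochain_left (j : ℤ) (f : List A → A) (a : A) (w : List A) :
    circ 𝒜 j mulCochain f (a :: w) = (j - 1).negOnePow •
        (f (a :: w).dropLast * (a :: w).getLast (List.cons_ne_nil a w))
      + (w.length + j).negOnePow • (koszul 𝒜 (j - w.length) a * f w) := by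
  unfold circ
  rw [List.length_cons, Finset.sum_range_succ', Finset.sum_range_succ', Finset.sum_eq_zero,
    zero_add, add_comm]
  · congr 1
    · rw [Finset.sum_eq_single w.length]
      · have h1 := List.drop_length_sub_one (List.cons_ne_nil a w)
        rw [List.length_cons, Nat.add_sub_cancel] at h1
        rw [List.drop_zero, List.take_zero, List.map_nil, List.nil_append, zero_add, h1,
          List.dropLast_eq_take]
        simp [mulCochain]
      · intro n hn hne
        rw [mulCochain_eq_zero, smul_zero]
        simp only [Finset.mem_range] at hn
        simp; omega
      · simp
    · rw [Finset.sum_eq_single w.length]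
      · have h1 : List.drop (0 + 1 + w.length) (a :: w) = [] := by simp [add_comm 1]
        rw [h1]
        simp only [zero_add, List.take_succ_cons, List.take_zero, List.map_cons, List.map_nil,
          List.drop_succ_cons, List.drop_zero, List.take_length, List.cons_append, List.nil_append,
          mulCochain]
        congr 1
        apply negOnePow_congr
        exact ⟨-1, by push_cast; ring⟩
      · intro n hn hne
        rw [mulCochain_eq_zero, smul_zero]
        simp only [Finset.mem_range] at hn
        simp; omega
      · simp
  · intro p hp
    refine Finset.sum_eq_zero fun n hn => ?_
    rw [mulCochain_eq_zero, smul_zero]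
    simp only [Finset.mem_range] at hp hn
    simp; omega

theorem circ_mulCochain_right (f : List A → A) (hf : Multi k f) (a : A) (w : List A) :
    circ 𝒜 2 f mulCochain (a :: w) = ∑ l ∈ Finset.range w.length,
      ((w.length : ℤ) - 1 + l).negOnePow • f (mergeAt l (a :: w)) := by
  unfold circ
  rw [List.length_cons, Finset.sum_range_succ, Finset.sum_range_succ, add_assoc]
  refine Eq.trans ?_ (add_zero _)
  congr 1
  · refine Finset.sum_congr rfl fun p hp => ?_
    rw [Finset.mem_range] at hp
    rw [Finset.sum_eq_single 2]
    · have h1 : (List.drop p (a :: w)).take 2 = [(a :: w).getD p 0, (a :: w).getD (p + 1) 0] := by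
        rw [List.drop_eq_getElem_cons (by simp; omega), List.drop_eq_getElem_cons (by simp; omega)]
        simp only [List.take_succ_cons, List.take_zero]
        rw [List.getD_eq_getElem _ _ (by simp; omega), List.getD_eq_getElem _ _ (by simp; omega)]
      have h2 : ∀ u : List A, u.map (koszul 𝒜 ((2 : ℤ) - (2 : ℕ))) = u := by
        intro u
        conv_rhs => rw [← List.map_id u]
        exact List.map_congr_left fun a _ => koszul_even 𝒜 (by simp) a
      rw [h1, h2]
      simp only [mulCochain, mergeAt]
      congr 2
      push_cast; ring
    · intro n hn hne
      rw [Finset.mem_range] at hn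
      rw [mulCochain_eq_zero, hf.zero, smul_zero]
      simp; omega
    · intro h; simp at h; omega
  · rw [Finset.sum_eq_zero, Finset.sum_eq_zero, add_zero]
    · intro n hn
      rw [mulCochain_eq_zero, hf.zero, smul_zero]
      simp at hn ⊢
    · intro n hn
      rw [mulCochain_eq_zero, hf.zero, smul_zero]
      simp at hn ⊢
      omega

/-- Inserting `f` into the multiplication gives the two outer terms of the differential, and
inserting the multiplication into `f` gives the inner ones. -/
theorem differential_eq_bracket {i : ℤ} {f : List A → A} (hf : Multi k f) :
    differential 𝒜 i f = bracket 𝒜 2 i mulCochain f := by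
  funext w
  cases w with
  | nil =>
    change (0 : A) = _
    simp [bracket, circ, mulCochain, hf.head_zero]
  | cons a w =>
    change differentialFun 𝒜 i f (a :: w) = _
    simp only [bracket, Pi.sub_apply, Pi.smul_apply]
    rw [circ_mulCochain_left, circ_mulCochain_right _ hf]
    simp only [differentialFun, smul_add, smul_smul, ← Int.negOnePow_add, Finset.smul_sum]
    rw [add_comm (_ • (koszul 𝒜 _ a * f w)) _, sub_eq_add_neg (_ + _ : A), ← Finset.sum_neg_distrib]
    congr 1
    · congr 1
      · congr 1; apply negOnePow_congr; exact ⟨1, by ring⟩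
      · congr 1; apply negOnePow_congr; exact ⟨-w.length, by ring⟩
    · refine Finset.sum_congr rfl fun l _ => ?_
      rw [← Units.neg_smul, ← Int.negOnePow_succ]
      congr 1; apply negOnePow_congr; exact ⟨-w.length + 1, by ring⟩

theorem circ_mulCochain_self : circ 𝒜 2 mulCochain mulCochain = (0 : List A → A) := by
  funext w
  cases w with
  | nil => simp [circ, mulCochain]
  | cons a w =>
    rw [circ_mulCochain_left]
    match w with
    | [] => simp [mulCochain]
    | [b] => simp [mulCochain]
    | [b, c] => simp [mulCochain, koszul_even, mul_assoc, Int.negOnePow_even 4 (by decide)]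
    | b :: c :: d :: w => simp [mulCochain]


theorem differential_mem {i j : ℤ} {f : List A → A} (hf : f ∈ cochains 𝒜 i) (hj : j = i + 1) :
    differential 𝒜 i f ∈ cochains 𝒜 j := by
  rw [differential_eq_bracket (cochains_multi hf)]
  exact bracket_mem (mulCochain_mem 𝒜) hf (by rw [hj]; ring)

theorem negOnePow_cases (n : ℤ) : n.negOnePow = 1 ∨ n.negOnePow = -1 :=
  Int.units_eq_one_or _

theorem differential_differential {i : ℤ} {f : List A → A} (hf : f ∈ cochains 𝒜 i) :
    differential 𝒜 (i + 1) (differential 𝒜 i f) = 0 := by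
  have hm := cochains_multi hf
  have hμ := mulCochain_mem 𝒜
  have hμ' := cochains_multi hμ
  have h1 := circ_prelie hμ hf hμ
  have h0 := circ_mulCochain_self (𝒜 := 𝒜)
  -- The pre-Lie relation with both inserted cochains equal to the multiplication only shows that
  -- twice this expression vanishes, which says nothing in characteristic 2. In `ins_ins` itself the
  -- sign is `-1`, so the two disjoint terms cancel and only the associator is left.
  have h2 : circ 𝒜 2 (circ 𝒜 2 f mulCochain) mulCochain = 0 := by
    apply decal_injective 𝒜
    rw [decal_circ (circ_multi hm hμ) hμ, decal_circ hm hμ]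
    funext w
    have e := ins_ins (decal_multi 𝒜 hm) (susp 𝒜 (2 - 1)) (susp 𝒜 (2 - 1)) (fun _ => rfl)
      _ (decal 𝒜 mulCochain) (decal 𝒜 mulCochain) (susp_decal 𝒜 hμ _) w
    rw [e, ← decal_circ hμ' hμ, h0]
    have h3 : ((2 - 1 : ℤ) * (2 - 1)).negOnePow = -1 := by decide
    rw [h3, Units.neg_smul, one_smul, add_neg_cancel_right]
    have h4 : decal 𝒜 (0 : List A → A) = fun _ => (0 : k) • 0 := by funext w; simp [decal]
    have h5 := ins_units_smul_right (fun a => susp 𝒜 (2 - 1) (susp 𝒜 (2 - 1) a))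
      (decal_multi 𝒜 hm) (-1) (decal 𝒜 0) w
    have h6 := ins_add_right (fun a => susp 𝒜 (2 - 1) (susp 𝒜 (2 - 1) a))
      (decal_multi 𝒜 hm) (decal 𝒜 0) (decal 𝒜 0) w
    have h7 : (fun v => decal 𝒜 (0 : List A → A) v + decal 𝒜 0 v) = decal 𝒜 0 := by
      funext w; simp [decal]
    rw [h7] at h6
    have h8 : decal 𝒜 (0 : List A → A) w = 0 := by simp [decal]
    rw [h8]
    simpa using h6
  rw [differential_eq_bracket (cochains_multi (differential_mem hf rfl)),
    differential_eq_bracket hm]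
  simp only [bracket] at h1 ⊢
  have hfμ := cochains_multi (circ_mem hf hμ)
  rw [circ_sub_right _ hμ', circ_sub_left, circ_units_smul_right _ hμ', circ_units_smul_left,
    h2, smul_zero, sub_zero]
  rw [show i + 2 - 1 = i + 1 by ring, h0] at h1
  have hz : circ 𝒜 i (0 : List A → A) f = 0 := by
    funext w; simp [circ]
  rw [hz, zero_sub, sub_eq_iff_eq_add] at h1
  rw [h1]
  have e1 : ((2 - 1) * (i - 1)).negOnePow = - i.negOnePow := by
    rw [← Int.negOnePow_succ]; exact negOnePow_congr ⟨-1, by ring⟩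
  have e2 : ((2 - 1) * (i + 1 - 1)).negOnePow = i.negOnePow := by
    congr 1; ring
  have e3 : ((i - 1) * (2 - 1)).negOnePow = - i.negOnePow := by
    rw [← Int.negOnePow_succ]; exact negOnePow_congr ⟨-1, by ring⟩
  rw [e1, e2, e3]
  rcases negOnePow_cases i with h | h <;> rw [h] <;> simp only [Units.neg_smul, one_smul] <;>
    abel

/-- This is the Jacobi identity for the multiplication, `f` and `g`, a combination of the three
pre-Lie relations in which each of them in turn is the outermost function. -/
theorem differential_bracket {i j : ℤ} {f g : List A → A} (hf : f ∈ cochains 𝒜 i)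
    (hg : g ∈ cochains 𝒜 j) :
    differential 𝒜 (i + j - 1) (bracket 𝒜 i j f g)
      = bracket 𝒜 (i + 1) j (differential 𝒜 i f) g
        + (i - 1).negOnePow • bracket 𝒜 i (j + 1) f (differential 𝒜 j g) := by
  have hf' := cochains_multi hf
  have hg' := cochains_multi hg
  have hμ := mulCochain_mem 𝒜
  have hμ' := cochains_multi hμ
  have h1 := circ_prelie hμ hf hg
  have h2 := circ_prelie hf hμ hg
  have h3 := circ_prelie hg hμ hf
  rw [differential_eq_bracket (cochains_multi (bracket_mem hf hg rfl)),
    differential_eq_bracket hf', differential_eq_bracket hg']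
  simp only [bracket]
  simp only [circ_sub_right _ hμ', circ_sub_right _ hf', circ_sub_right _ hg', circ_sub_left,
    circ_units_smul_right _ hμ', circ_units_smul_right _ hf', circ_units_smul_right _ hg',
    circ_units_smul_left]
  rw [show (2 : ℤ) + j - 1 = j + 1 by ring] at h2
  rw [show (2 : ℤ) + i - 1 = i + 1 by ring] at h3
  have e1 : ((2 - 1) * (i - 1)).negOnePow = (i - 1).negOnePow := by rw [show (2 - 1) * (i - 1) = i - 1 by ring]
  have e2 : ((2 - 1) * (j - 1)).negOnePow = (j - 1).negOnePow := by rw [show (2 - 1) * (j - 1) = j - 1 by ring]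
  have e3 : ((2 - 1) * (i + j - 1 - 1)).negOnePow = (i - 1).negOnePow * (j - 1).negOnePow := by
    rw [← Int.negOnePow_add]; congr 1; ring
  have e4 : ((i + 1 - 1) * (j - 1)).negOnePow
      = ((i - 1) * (j - 1)).negOnePow * (j - 1).negOnePow := by
    rw [← Int.negOnePow_add]; congr 1; ring
  have e5 : ((i - 1) * (j + 1 - 1)).negOnePow
      = ((i - 1) * (j - 1)).negOnePow * (i - 1).negOnePow := by
    rw [← Int.negOnePow_add]; congr 1; ring
  rw [e2] at h2
  rw [e1] at h3
  rw [e1, e2, e3, e4, e5]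
  rw [sub_eq_iff_eq_add] at h1 h2 h3
  rw [h1, h2, h3]
  rcases negOnePow_cases (i - 1) with h | h <;> rcases negOnePow_cases (j - 1) with h' | h' <;>
    rcases negOnePow_cases ((i - 1) * (j - 1)) with h'' | h'' <;> rw [h, h', h''] <;>
    simp only [mul_neg, mul_one, neg_neg, Units.neg_smul, one_smul] <;> abel

theorem bracket_swap (i j : ℤ) (f g : List A → A) :
    bracket 𝒜 j i g f = -(((i - 1) * (j - 1)).negOnePow • bracket 𝒜 i j f g) := by
  simp only [bracket, smul_sub, smul_smul, Int.units_mul_self, one_smul, mul_comm (j - 1)]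
  abel

theorem bracket_add_left {i j : ℤ} {f f' g : List A → A} (hg : Multi k g) :
    bracket 𝒜 i j (f + f') g = bracket 𝒜 i j f g + bracket 𝒜 i j f' g := by
  simp only [bracket, circ_add_left, circ_add_right i hg, smul_add]; abel

theorem bracket_add_right {i j : ℤ} {f g g' : List A → A} (hf : Multi k f) :
    bracket 𝒜 i j f (g + g') = bracket 𝒜 i j f g + bracket 𝒜 i j f g' := by
  simp only [bracket, circ_add_left, circ_add_right j hf, smul_add]; abel

theorem bracket_mem_cocycles {i j l : ℤ} {f g : List A → A} (hf : f ∈ cocycles 𝒜 i)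
    (hg : g ∈ cocycles 𝒜 j) (hl : l = i + j - 1) : bracket 𝒜 i j f g ∈ cocycles 𝒜 l := by
  refine ⟨bracket_mem hf.1 hg.1 hl, ?_⟩
  have h1 : differential 𝒜 i f = 0 := hf.2
  have h2 : differential 𝒜 j g = 0 := hg.2
  have h3 : ∀ (a b : ℤ) (F : List A → A), Multi k F → bracket 𝒜 a b F 0 = 0 := by
    intro a b F hF
    have := bracket_add_right (𝒜 := 𝒜) (i := a) (j := b) (g := 0) (g' := 0) hF
    simpa using this
  change differential 𝒜 l (bracket 𝒜 i j f g) = 0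
  rw [hl, differential_bracket hf.1 hg.1, h1, h2, bracket_swap, h3 _ _ _ (cochains_multi hg.1),
    h3 _ _ _ (cochains_multi hf.1)]
  simp

/-- Since `f` is a cocycle, the derivation rule exhibits the bracket of `f` with a primitive of `g`
as a primitive, up to sign. -/
theorem bracket_coboundary_right {i j l : ℤ} {f g : List A → A} (hf : f ∈ cocycles 𝒜 i)
    (hg : g ∈ coboundaries 𝒜 j) (hl : l = i + j - 1) : bracket 𝒜 i j f g ∈ coboundaries 𝒜 l := by
  obtain ⟨h, hh, rfl⟩ := hg
  have h1 : differential 𝒜 i f = 0 := hf.2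
  have e := differential_bracket hf.1 hh
  have h3 : bracket 𝒜 (i + 1) (j - 1) 0 h = 0 := by
    have := bracket_add_left (𝒜 := 𝒜) (i := i + 1) (j := j - 1) (f := 0) (f' := 0)
      (cochains_multi hh)
    simpa using this
  rw [h1, h3, zero_add, sub_add_cancel] at e
  refine ⟨(i - 1).negOnePow • bracket 𝒜 i (j - 1) f h,
    units_smul_mem _ _ (bracket_mem hf.1 hh (by rw [hl]; ring)), ?_⟩
  rw [map_units_zsmul, show l - 1 = i + (j - 1) - 1 by rw [hl]; ring, e, smul_smul,
    Int.units_mul_self, one_smul]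

theorem bracket_coboundary_left {i j l : ℤ} {f g : List A → A} (hf : f ∈ coboundaries 𝒜 i)
    (hg : g ∈ cocycles 𝒜 j) (hl : l = i + j - 1) : bracket 𝒜 i j f g ∈ coboundaries 𝒜 l := by
  rw [bracket_swap j i]
  exact neg_mem (units_smul_mem _ _ (bracket_coboundary_right hg hf (by rw [hl]; ring)))

theorem HH.mk_eq_mk_iff {i : ℤ} (f g : cocycles 𝒜 i) :
    HH.mk 𝒜 i f = HH.mk 𝒜 i g ↔ f.1 - g.1 ∈ coboundaries 𝒜 i := by
  unfold HH.mk
  rw [Submodule.mkQ_apply, Submodule.mkQ_apply, Submodule.Quotient.eq]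
  rfl

/-- Changing representatives changes the bracket by a coboundary. So a single pair of
representatives decides, although `HH.IsBracket` quantifies over all of them. -/
theorem HH.isBracket_of_sub_mem {i j l : ℤ} (f : cocycles 𝒜 i) (g : cocycles 𝒜 j)
    (z : cocycles 𝒜 l) (hl : l = i + j - 1)
    (h : bracket 𝒜 i j f.1 g.1 - z.1 ∈ coboundaries 𝒜 l) :
    HH.IsBracket 𝒜 (HH.mk 𝒜 i f) (HH.mk 𝒜 j g) (HH.mk 𝒜 l z) := by
  rintro f' g' ⟨hf', ef⟩ ⟨hg', eg⟩
  rw [HH.mk_eq_mk_iff] at ef eg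
  refine ⟨bracket_mem_cocycles hf' hg' hl, ?_⟩
  rw [HH.mk_eq_mk_iff]
  dsimp only at *
  have e1 : bracket 𝒜 i j f.1 g.1 = bracket 𝒜 i j f' g'
      + (bracket 𝒜 i j f' (g.1 - g') + bracket 𝒜 i j (f.1 - f') g.1) := by
    rw [← add_assoc, ← bracket_add_right (cochains_multi hf'.1), add_sub_cancel,
      ← bracket_add_left (cochains_multi g.2.1), add_sub_cancel]
  have h2 := add_mem (bracket_coboundary_right hf' eg hl) (bracket_coboundary_left ef g.2 hl)
  have h3 := sub_mem h2 h
  rw [e1] at h3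
  convert h3 using 1
  abel

end Brackets
end GradedHochschild

/-! ### The inner terms of the differential as a recursion along the word. -/

namespace GradedHochschild

section Bd

variable {k A : Type*} [Field k] [Ring A] [Algebra k A]

/-- The alternating sum `∑ (-1)^{l+1} f (…, a_{l+1} a_{l+2}, …)` over a word `a w`. -/
def bdAux : (List A → A) → A → List A → A
  | _, _, [] => 0
  | f, a, b :: w => -f (a * b :: w) - bdAux (fun v => f (a :: v)) b w

theorem sum_mergeAt (f : List A → A) (a : A) (w : List A) :
    ∑ l ∈ Finset.range w.length, ((l : ℤ) + 1).negOnePow • f (mergeAt l (a :: w))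
      = bdAux f a w := by
  induction w generalizing f a with
  | nil => simp [bdAux]
  | cons b w ih =>
    rw [List.length_cons, Finset.sum_range_succ', bdAux, ← ih, add_comm, sub_eq_add_neg,
      ← Finset.sum_neg_distrib]
    congr 1
    · simp [mergeAt]
    · refine Finset.sum_congr rfl fun l _ => ?_
      rw [← Units.neg_smul, ← Int.negOnePow_succ]
      simp [mergeAt]

theorem bdAux_zero (a : A) (w : List A) : bdAux (fun _ => (0 : A)) a w = 0 := by
  induction w generalizing a with
  | nil => rfl
  | cons b w ih => simp [bdAux, ih]

theorem differential_cons (𝒜 : ℤ → Submodule k A) [GradedAlgebra 𝒜] (i : ℤ) (f : List A → A)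
    (a : A) (w : List A) : differential 𝒜 i f (a :: w) = (i - w.length).negOnePow •
      (koszul 𝒜 (i - w.length) a * f w
        + ((w.length : ℤ) + 1).negOnePow •
            (f (a :: w).dropLast * (a :: w).getLast (List.cons_ne_nil a w))
        + bdAux f a w) := by
  change differentialFun 𝒜 i f (a :: w) = _
  rw [differentialFun, sum_mergeAt]

end Bd

end GradedHochschild

/-! ### The path basis: coefficients and supports of products. -/

namespace GradedGentleQuiver

section Basis

variable {V E : Type*} [Fintype V] {Q : GradedGentleQuiver V E} {k : Type*} [Field k]

variable (Q k) in
/-- The coefficient of a path. -/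
noncomputable def coef (q : Q.NPath) : Q.Alg k →ₗ[k] k := (Q.pathBasis k).coord q

open Classical in
theorem coef_ofPath (p q : Q.NPath) : coef Q k q (Q.ofPath k p) = if p = q then 1 else 0 := by
  simp [coef, ofPath, Finsupp.single_apply]

theorem coef_ofPath_ne {p q : Q.NPath} (h : coef Q k q (Q.ofPath k p) ≠ 0) : p = q := by
  classical
  rw [coef_ofPath] at h
  by_contra h'
  simp [h'] at h

theorem coef_ext {a b : Q.Alg k} (h : ∀ q, coef Q k q a = coef Q k q b) : a = b :=
  (Q.pathBasis k).ext_elem h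

theorem eq_zero_of_coef {a : Q.Alg k} (h : ∀ q, coef Q k q a ≠ 0 → False) : a = 0 :=
  coef_ext fun q => by
    rw [map_zero]; by_contra h'; exact h q h'

theorem coef_units_smul_ne {s : ℤˣ} {q : Q.NPath} {a : Q.Alg k}
    (h : coef Q k q (s • a) ≠ 0) : coef Q k q a ≠ 0 := by
  intro h'; rw [map_units_zsmul, h', smul_zero] at h; exact h rfl

theorem coef_sum_ne {ι : Type*} {s : Finset ι} {F : ι → Q.Alg k} {q : Q.NPath}
    (h : coef Q k q (∑ i ∈ s, F i) ≠ 0) : ∃ i ∈ s, coef Q k q (F i) ≠ 0 := by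
  rw [map_sum] at h
  exact Finset.exists_ne_zero_of_sum_ne_zero h

theorem coef_add_ne {a b : Q.Alg k} {q : Q.NPath}
    (h : coef Q k q (a + b) ≠ 0) : coef Q k q a ≠ 0 ∨ coef Q k q b ≠ 0 := by
  by_contra! h'; rw [map_add, h'.1, h'.2, add_zero] at h; exact h rfl

theorem coef_sub_ne {a b : Q.Alg k} {q : Q.NPath}
    (h : coef Q k q (a - b) ≠ 0) : coef Q k q a ≠ 0 ∨ coef Q k q b ≠ 0 := by
  by_contra! h'; rw [map_sub, h'.1, h'.2, sub_zero] at h; exact h rfl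

theorem eq_sum_coef (a : Q.Alg k) :
    a = ∑ q ∈ ((Q.pathBasis k).repr a).support, coef Q k q a • Q.ofPath k q := by
  have := (Q.pathBasis k).linearCombination_repr a
  rw [Finsupp.linearCombination_apply, Finsupp.sum] at this
  exact this.symm

/-- A linear functional on `A` which is nonzero at `a` is nonzero on a basis vector which occurs in `a`. -/
theorem exists_coef_of_ne {M : Type*} [AddCommGroup M] [Module k M] (L : Q.Alg k →ₗ[k] M)
    {a : Q.Alg k} (h : L a ≠ 0) : ∃ q, coef Q k q a ≠ 0 ∧ L (Q.ofPath k q) ≠ 0 := by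
  rw [eq_sum_coef a, map_sum] at h
  obtain ⟨q, -, hq⟩ := Finset.exists_ne_zero_of_sum_ne_zero h
  rw [map_smul] at hq
  refine ⟨q, fun h' => hq (by rw [h', zero_smul]), fun h' => hq (by rw [h', smul_zero])⟩

variable (Q k) in
/-- A word of paths as a word of elements of `A`. -/
noncomputable def pword (l : List Q.NPath) : List (Q.Alg k) := l.map (Q.ofPath k)

@[simp] theorem pword_nil : pword Q k [] = [] := rfl
@[simp] theorem pword_cons (p : Q.NPath) (l : List Q.NPath) :
    pword Q k (p :: l) = Q.ofPath k p :: pword Q k l := rfl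
@[simp] theorem pword_append (l l' : List Q.NPath) :
    pword Q k (l ++ l') = pword Q k l ++ pword Q k l' := List.map_append
@[simp] theorem length_pword (l : List Q.NPath) : (pword Q k l).length = l.length :=
  List.length_map _

/-- This traces a path occurring in a composite back to a path occurring in the value that was
inserted. -/
theorem _root_.GradedHochschild.Multi.exists_coef {f : List (Q.Alg k) → Q.Alg k} (hf : Multi k f)
    (u v : List (Q.Alg k)) (b : Q.Alg k) {q : Q.NPath} (h : coef Q k q (f (u ++ b :: v)) ≠ 0) :
    ∃ r, coef Q k r b ≠ 0 ∧ coef Q k q (f (u ++ Q.ofPath k r :: v)) ≠ 0 := by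
  let L : Q.Alg k →ₗ[k] k :=
    { toFun := fun b => coef Q k q (f (u ++ b :: v))
      map_add' := fun a b => by rw [hf.add, map_add]
      map_smul' := fun c a => by rw [hf.smul, map_smul]; rfl }
  exact exists_coef_of_ne L h

theorem _root_.GradedHochschild.Multi.ext_pword {f g : List (Q.Alg k) → Q.Alg k} (hf : Multi k f) (hg : Multi k g)
    (h : ∀ l, f (pword Q k l) = g (pword Q k l)) : f = g := by
  have key : ∀ (w : List (Q.Alg k)) (u : List Q.NPath),
      f (pword Q k u ++ w) = g (pword Q k u ++ w) := by
    intro w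
    induction w with
    | nil => intro u; simpa using h u
    | cons a w ih =>
      intro u
      have e : ∀ p : Q.NPath, f (pword Q k u ++ Q.ofPath k p :: w)
          = g (pword Q k u ++ Q.ofPath k p :: w) := by
        intro p
        have := ih (u ++ [p])
        simpa using this
      let Lf : Q.Alg k →ₗ[k] Q.Alg k :=
        { toFun := fun b => f (pword Q k u ++ b :: w)
          map_add' := fun a b => by rw [hf.add]
          map_smul' := fun c a => by rw [hf.smul]; rfl }
      let Lg : Q.Alg k →ₗ[k] Q.Alg k :=
        { toFun := fun b => g (pword Q k u ++ b :: w)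
          map_add' := fun a b => by rw [hg.add]
          map_smul' := fun c a => by rw [hg.smul]; rfl }
      have : Lf = Lg := (Q.pathBasis k).ext e
      exact LinearMap.congr_fun this a
  funext w
  exact key w []

theorem multi_multiExt (F : List Q.NPath → Q.Alg k) : Multi k (multiExt F) := by
  intro u v c a b
  induction u generalizing F with
  | nil =>
    simp only [List.nil_append, multiExt]
    rw [map_add, map_smul, Finsupp.sum_add_index', Finsupp.sum_smul_index', Finsupp.smul_sum]
    · simp [smul_smul]
    · simp
    · simp
    · intros; rw [add_smul]
  | cons x u ih =>
    simp only [List.cons_append, multiExt, Finsupp.sum, ih, smul_add, Finset.sum_add_distrib,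
      Finset.smul_sum, smul_comm c]

theorem multiExt_pword (F : List Q.NPath → Q.Alg k) (l : List Q.NPath) :
    multiExt F (pword Q k l) = F l := by
  induction l generalizing F with
  | nil => rfl
  | cons p l ih =>
    simp only [pword_cons, multiExt]
    rw [ofPath, Module.Basis.repr_self, Finsupp.sum_single_index, one_smul]
    · exact ih _
    · simp

/-- The total degree of a word of paths. -/
def ldeg (l : List Q.NPath) : ℤ := (l.map NPath.deg).sum

theorem koszul_ofPath (t : ℤ) (p : Q.NPath) :
    koszul (Q.grading k) t (Q.ofPath k p) = (t * p.deg).negOnePow • Q.ofPath k p :=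
  koszul_of_mem _ (ofPath_mem_grading p) t

theorem _root_.GradedHochschild.Multi.koszul_pword {f : List (Q.Alg k) → Q.Alg k} (hf : Multi k f) (t : ℤ)
    (x : List (Q.Alg k)) (u : List Q.NPath) (v : List (Q.Alg k)) :
    f (x ++ ((pword Q k u).map (koszul (Q.grading k) t) ++ v))
      = (t * ldeg u).negOnePow • f (x ++ (pword Q k u ++ v)) := by
  induction u generalizing x with
  | nil => simp [ldeg]
  | cons p u ih =>
    have := ih (x ++ [Q.ofPath k p])
    simp only [List.append_assoc, List.singleton_append] at this
    simp only [pword_cons, List.map_cons, List.cons_append, koszul_ofPath, hf.units_smul, this,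
      smul_smul, ← Int.negOnePow_add]
    congr 2
    simp only [ldeg, List.map_cons, List.sum_cons]; ring

theorem mem_cochains_of_pword {f : List (Q.Alg k) → Q.Alg k} (hf : Multi k f) {i : ℤ}
    (h : ∀ l : List Q.NPath, f (pword Q k l) ∈ Q.grading k (ldeg l + (i - l.length))) :
    f ∈ cochains (Q.grading k) i := by
  rw [mem_cochains_iff]
  refine ⟨hf, ?_⟩
  have key : ∀ (w : List (Q.Alg k)) (e : List ℤ), List.Forall₂ (fun a n => a ∈ Q.grading k n) w e →
      ∀ u : List Q.NPath, f (pword Q k u ++ w)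
        ∈ Q.grading k (ldeg u + e.sum + (i - (u.length + w.length))) := by
    intro w e he
    induction he with
    | nil => intro u; simpa using h u
    | @cons a n w e ha he ih =>
      intro u
      induction ha using Submodule.span_induction with
      | zero => rw [hf.zero]; exact zero_mem _
      | add y z _ _ h1 h2 => rw [hf.add]; exact add_mem h1 h2
      | smul c y _ h1 => rw [hf.smul]; exact Submodule.smul_mem _ c h1
      | mem y hy =>
        obtain ⟨p, rfl, rfl⟩ := hy
        have := ih (u ++ [p])
        simp only [pword_append, pword_cons, pword_nil, List.append_assoc,
          List.singleton_append] at this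
        convert this using 2
        simp [ldeg]; ring
  intro w e he
  have := key w e he []
  simpa [ldeg] using this

theorem coef_ofPath_mul {p q : Q.NPath} {b : Q.Alg k} (h : coef Q k q (Q.ofPath k p * b) ≠ 0) :
    ∃ (r : Q.NPath) (hc : p.Comp r), coef Q k r b ≠ 0 ∧ q = p.comp r hc := by
  obtain ⟨r, hr, h'⟩ := exists_coef_of_ne
    (coef Q k q ∘ₗ LinearMap.mulLeft k (Q.ofPath k p)) h
  simp only [LinearMap.comp_apply, LinearMap.mulLeft_apply, ofPath_mul_ofPath, mulPath] at h'
  split_ifs at h' with hc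
  · exact ⟨r, hc, hr, (coef_ofPath_ne h').symm⟩
  · simp at h'

theorem coef_mul_ofPath {p q : Q.NPath} {b : Q.Alg k} (h : coef Q k q (b * Q.ofPath k p) ≠ 0) :
    ∃ (r : Q.NPath) (hc : r.Comp p), coef Q k r b ≠ 0 ∧ q = r.comp p hc := by
  obtain ⟨r, hr, h'⟩ := exists_coef_of_ne
    (coef Q k q ∘ₗ LinearMap.mulRight k (Q.ofPath k p)) h
  simp only [LinearMap.comp_apply, LinearMap.mulRight_apply, ofPath_mul_ofPath, mulPath] at h'
  split_ifs at h' with hc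
  · exact ⟨r, hc, hr, (coef_ofPath_ne h').symm⟩
  · simp at h'

theorem ofPath_mul_of_comp {p q : Q.NPath} (h : p.Comp q) :
    Q.ofPath k p * Q.ofPath k q = Q.ofPath k (p.comp q h) := by
  rw [ofPath_mul_ofPath, mulPath, dif_pos h]

theorem ofPath_mul_of_not_comp {p q : Q.NPath} (h : ¬ p.Comp q) :
    Q.ofPath k p * Q.ofPath k q = 0 := by
  rw [ofPath_mul_ofPath, mulPath, dif_neg h]

theorem trivialPath_mul {b : Q.Alg k} {x : V} (h : ∀ q, coef Q k q b ≠ 0 → q.tgt = x) :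
    Q.ofPath k (Q.trivialPath x) * b = b := by
  rw [eq_sum_coef b, Finset.mul_sum]
  refine Finset.sum_congr rfl fun q hq => ?_
  have hx : q.tgt = x := h q (by simpa [coef] using hq)
  rw [mul_smul_comm, ofPath_mul_of_comp ((trivialPath_comp x q).2 hx.symm)]
  congr 2
  ext1
  · exact hx.symm
  · rfl

theorem mul_trivialPath {b : Q.Alg k} {x : V} (h : ∀ q, coef Q k q b ≠ 0 → q.src = x) :
    b * Q.ofPath k (Q.trivialPath x) = b := by
  rw [eq_sum_coef b, Finset.sum_mul]
  refine Finset.sum_congr rfl fun q hq => ?_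
  have hx : q.src = x := h q (by simpa [coef] using hq)
  rw [smul_mul_assoc, ofPath_mul_of_comp ((comp_trivialPath x q).2 hx)]
  congr 2
  ext1
  · rfl
  · simp [NPath.comp, trivialPath]

theorem trivialPath_mul_eq_zero {b : Q.Alg k} {x : V} (h : ∀ q, coef Q k q b ≠ 0 → q.tgt ≠ x) :
    Q.ofPath k (Q.trivialPath x) * b = 0 := by
  refine eq_zero_of_coef fun q hq => ?_
  obtain ⟨r, hc, hr, -⟩ := coef_ofPath_mul hq
  exact h r hr ((trivialPath_comp x r).1 hc).symm

theorem mul_trivialPath_eq_zero {b : Q.Alg k} {x : V} (h : ∀ q, coef Q k q b ≠ 0 → q.src ≠ x) :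
    b * Q.ofPath k (Q.trivialPath x) = 0 := by
  refine eq_zero_of_coef fun q hq => ?_
  obtain ⟨r, hc, hr, -⟩ := coef_mul_ofPath hq
  exact h r hr ((comp_trivialPath x r).1 hc)

theorem NPath.eq_trivialPath {p : Q.NPath} (h : p.word = []) : p = Q.trivialPath p.tgt := by
  ext1
  · rfl
  · exact h

end Basis

/-! ### Cochains that are normalised and multilinear over the vertices. -/

section Relative

variable {V E : Type*} [Fintype V] {Q : GradedGentleQuiver V E} {k : Type*} [Field k]

/-- `l` is a walk of nontrivial paths from `y` to `x` (read from right to left). -/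
def Walk : V → List Q.NPath → V → Prop
  | x, [], y => x = y
  | x, p :: l, y => p.tgt = x ∧ p.word ≠ [] ∧ Walk p.src l y

theorem walk_append {x y : V} {l l' : List Q.NPath} :
    Walk x (l ++ l') y ↔ ∃ z, Walk x l z ∧ Walk z l' y := by
  induction l generalizing x with
  | nil => simp [Walk]
  | cons p l ih => simp [Walk, ih, and_assoc]

/-- Cochains which are normalised and multilinear over the vertices. -/
def Relative (f : List (Q.Alg k) → Q.Alg k) : Prop :=
  ∀ (l : List Q.NPath) (q : Q.NPath), coef Q k q (f (pword Q k l)) ≠ 0 → Walk q.tgt l q.src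

theorem Relative.add {f g : List (Q.Alg k) → Q.Alg k} (hf : Relative f) (hg : Relative g) :
    Relative (f + g) := fun l q h => (coef_add_ne h).elim (hf l q) (hg l q)

theorem Relative.sub {f g : List (Q.Alg k) → Q.Alg k} (hf : Relative f) (hg : Relative g) :
    Relative (f - g) := fun l q h => (coef_sub_ne h).elim (hf l q) (hg l q)

theorem Relative.units_smul {f : List (Q.Alg k) → Q.Alg k} (hf : Relative f) (s : ℤˣ) :
    Relative (s • f) := fun l q h => hf l q (coef_units_smul_ne h)

/-- A path occurring in the inserted value is parallel to the walk of its arguments, so that walk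
can be spliced into the walk obtained from `f`. -/
theorem Relative.circ {f g : List (Q.Alg k) → Q.Alg k} (hm : Multi k f) (hf : Relative f)
    (hg : Relative g) (j : ℤ) : Relative (circ (Q.grading k) j f g) := by
  intro l q h
  obtain ⟨p, -, h⟩ := coef_sum_ne h
  obtain ⟨n, -, h⟩ := coef_sum_ne h
  have e1 : ((pword Q k l).take p) = pword Q k (l.take p) := by simp [pword, List.map_take]
  have e2 : ((pword Q k l).drop p).take n = pword Q k ((l.drop p).take n) := by
    simp [pword, List.map_take, List.map_drop]
  have e3 : ((pword Q k l).drop (p + n)) = pword Q k (l.drop (p + n)) := by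
    simp [pword, List.map_drop]
  have h := coef_units_smul_ne h
  rw [e1, e2, e3] at h
  have e4 := hm.koszul_pword (j - n) [] (l.take p)
    (g (pword Q k ((l.drop p).take n)) :: pword Q k (l.drop (p + n)))
  simp only [List.nil_append] at e4
  rw [e4] at h
  obtain ⟨r, hr, h'⟩ := Multi.exists_coef hm _ _ _ (coef_units_smul_ne h)
  have w1 := hg _ _ hr
  rw [← pword_cons, ← pword_append] at h'
  have w2 := hf _ _ h'
  rw [walk_append] at w2
  obtain ⟨z, hz, rfl, -, hz'⟩ := w2
  have hl : l = l.take p ++ ((l.drop p).take n ++ l.drop (p + n)) := by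
    rw [← List.drop_drop, List.take_append_drop, List.take_append_drop]
  rw [hl, walk_append]
  refine ⟨_, hz, walk_append.2 ⟨_, w1, hz'⟩⟩

theorem Relative.bracket {f g : List (Q.Alg k) → Q.Alg k} (hm : Multi k f) (hf : Relative f)
    (hm' : Multi k g) (hg : Relative g) (i j : ℤ) : Relative (bracket (Q.grading k) i j f g) :=
  (hf.circ hm hg j).sub ((hg.circ hm' hf i).units_smul _)

theorem Relative.eq_zero {f : List (Q.Alg k) → Q.Alg k} (hf : Relative f) {l : List Q.NPath}
    (h : ∀ x y, ¬ Walk x l y) : f (pword Q k l) = 0 :=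
  eq_zero_of_coef fun q hq => h _ _ (hf l q hq)

theorem not_walk_trivial {u v : List Q.NPath} {p : Q.NPath} (hp : p.word = []) (x y : V) :
    ¬ Walk x (u ++ p :: v) y := by
  rw [walk_append]
  rintro ⟨z, -, -, h, -⟩
  exact h hp

theorem not_walk_junction {u v : List Q.NPath} {p q : Q.NPath} (h : p.src ≠ q.tgt) (x y : V) :
    ¬ Walk x (u ++ p :: q :: v) y := by
  rw [walk_append]
  rintro ⟨z, -, -, -, h', -⟩
  exact h h'.symm

/-- Functions on words which vanish at words with a trivial path or with two consecutive paths which cannot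
be concatenated. -/
def Normal (f : List (Q.Alg k) → Q.Alg k) : Prop :=
  (∀ (u v : List Q.NPath) (p : Q.NPath), p.word = [] → f (pword Q k (u ++ p :: v)) = 0) ∧
  ∀ (u v : List Q.NPath) (p q : Q.NPath), p.src ≠ q.tgt → f (pword Q k (u ++ p :: q :: v)) = 0

theorem Relative.normal {f : List (Q.Alg k) → Q.Alg k} (hf : Relative f) : Normal f :=
  ⟨fun _ _ _ hp => hf.eq_zero (not_walk_trivial hp),
    fun _ _ _ _ h => hf.eq_zero (not_walk_junction h)⟩

theorem Normal.cons {f : List (Q.Alg k) → Q.Alg k} (hf : Normal f) (p : Q.NPath) :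
    Normal (fun v => f (Q.ofPath k p :: v)) :=
  ⟨fun u v r hr => hf.1 (p :: u) v r hr, fun u v r s h => hf.2 (p :: u) v r s h⟩

theorem _root_.GradedHochschild.Multi.eq_zero_of_basis {f : List (Q.Alg k) → Q.Alg k} (hf : Multi k f) {a : Q.Alg k}
    {v : List (Q.Alg k)} (h : ∀ q, coef Q k q a ≠ 0 → f (Q.ofPath k q :: v) = 0) :
    f (a :: v) = 0 := by
  refine eq_zero_of_coef fun q hq => ?_
  obtain ⟨r, hr, h'⟩ := Multi.exists_coef hf [] v a hq
  have := h r hr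
  simp only [List.nil_append] at h'
  rw [this, map_zero] at h'
  exact h' rfl

theorem bdAux_eq_zero {f : List (Q.Alg k) → Q.Alg k} (hm : Multi k f)
    (h : ∀ l, f (pword Q k l) = 0) (a : Q.Alg k) (w : List (Q.Alg k)) : bdAux f a w = 0 := by
  have : f = fun _ => 0 := Multi.ext_pword hm (fun u v c a b => by simp) h
  rw [this, bdAux_zero]

theorem bdAux_trivial {f : List (Q.Alg k) → Q.Alg k} (hm : Multi k f) (hf : Normal f) (x : V)
    (q : Q.NPath) (v : List Q.NPath) :
    bdAux f (Q.ofPath k (Q.trivialPath x)) (pword Q k (q :: v))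
      = -f (Q.ofPath k (Q.trivialPath x) * Q.ofPath k q :: pword Q k v) := by
  rw [pword_cons, bdAux, bdAux_eq_zero (hm.cons _), sub_zero]
  intro l
  exact hf.1 [] l _ rfl

/-- Multiplying the trivial path into its left or into its right neighbour gives the same word with
opposite signs. If a neighbour does not start or end at `x`, its product is zero, and a surviving
term has a broken junction, where `f` vanishes. -/
theorem bdAux_trivial_inner {f : List (Q.Alg k) → Q.Alg k} (hm : Multi k f) (hf : Normal f)
    (x : V) (p : Q.NPath) (u : List Q.NPath) (q : Q.NPath) (v : List Q.NPath) :
    bdAux f (Q.ofPath k p) (pword Q k (u ++ Q.trivialPath x :: q :: v)) = 0 := by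
  induction u generalizing f p with
  | nil =>
    rw [List.nil_append, pword_cons, bdAux, bdAux_trivial (hm.cons _) (hf.cons p)]
    by_cases h1 : p.src = x
    · by_cases h2 : q.tgt = x
      · rw [mul_trivialPath, trivialPath_mul]
        · simp
        · intro r hr; rw [← coef_ofPath_ne hr, h2]
        · intro r hr; rw [← coef_ofPath_ne hr, h1]
      · rw [mul_trivialPath (by intro r hr; rw [← coef_ofPath_ne hr, h1]),
          trivialPath_mul_eq_zero (by intro r hr; rwa [← coef_ofPath_ne hr])]
        have := hf.2 [] v p q (by rw [h1]; exact Ne.symm h2)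
        have h0 := hm.zero [Q.ofPath k p] (pword Q k v)
        simp only [List.nil_append, List.singleton_append, pword_cons] at this h0
        rw [pword_cons, this, h0]; simp
    · rw [mul_trivialPath_eq_zero (by intro r hr; rwa [← coef_ofPath_ne hr]), hm.head_zero]
      by_cases h2 : q.tgt = x
      · rw [trivialPath_mul (by intro r hr; rw [← coef_ofPath_ne hr, h2])]
        have := hf.2 [] v p q (by rw [h2]; exact h1)
        simp only [List.nil_append, pword_cons] at this
        rw [this]; simp
      · rw [trivialPath_mul_eq_zero (by intro r hr; rwa [← coef_ofPath_ne hr])]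
        have h0 := hm.zero [Q.ofPath k p] (pword Q k v)
        simp only [List.singleton_append] at h0
        rw [h0]; simp
  | cons r u ih =>
    rw [List.cons_append, pword_cons, bdAux, ih (hm.cons _) (hf.cons p),
      Multi.eq_zero_of_basis hm]
    · simp
    · intro s _
      exact hf.1 (s :: u) _ _ rfl

-- Only the merge of the last two letters gets rid of the trivial path. In the differential it
-- cancels against the right outer term.
open Classical in
theorem bdAux_trivial_last {f : List (Q.Alg k) → Q.Alg k} (hm : Multi k f) (hf : Normal f)
    (x : V) (u : List Q.NPath) (p r : Q.NPath) (hr : (p :: u).getLast (List.cons_ne_nil p u) = r) :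
    bdAux f (Q.ofPath k p) (pword Q k (u ++ [Q.trivialPath x]))
      = if r.src = x then ((u.length : ℤ) + 1).negOnePow • f (pword Q k (p :: u)) else 0 := by
  induction u generalizing f p with
  | nil =>
    obtain rfl : p = r := hr
    simp only [List.nil_append, pword_cons, pword_nil, bdAux, sub_zero]
    split_ifs with h
    · rw [mul_trivialPath (by intro r hr; rw [← coef_ofPath_ne hr, h])]; simp
    · rw [mul_trivialPath_eq_zero (by intro r hr; rwa [← coef_ofPath_ne hr]), hm.head_zero,
        neg_zero]
  | cons s u ih =>
    rw [List.getLast_cons (List.cons_ne_nil s u)] at hr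
    rw [List.cons_append, pword_cons, bdAux, ih (hm.cons _) (hf.cons p) s hr,
      Multi.eq_zero_of_basis hm]
    · split_ifs
      · rw [neg_zero, zero_sub, ← Units.neg_smul, ← Int.negOnePow_succ]
        simp
      · simp
    · intro s _
      exact hf.1 (s :: u) _ _ rfl

theorem bdAux_walk {f : List (Q.Alg k) → Q.Alg k} (hm : Multi k f) (hf : Relative f)
    (u : List Q.NPath) (p : Q.NPath) (l : List Q.NPath) (hl : ∀ r ∈ p :: l, r.word ≠ [])
    (q : Q.NPath)
    (h : coef Q k q (bdAux (fun v => f (pword Q k u ++ v)) (Q.ofPath k p) (pword Q k l)) ≠ 0) :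
    Walk q.tgt (u ++ p :: l) q.src := by
  induction l generalizing u p with
  | nil => simp [bdAux] at h
  | cons r l ih =>
    rw [pword_cons, bdAux] at h
    rcases coef_sub_ne h with h | h
    · have h' : coef Q k q (f (pword Q k u ++ (Q.ofPath k p * Q.ofPath k r) :: pword Q k l)) ≠ 0 := by
        intro h0; apply h; rw [map_neg, h0, neg_zero]
      by_cases hc : p.Comp r
      · rw [ofPath_mul_of_comp hc, ← pword_cons, ← pword_append] at h'
        have hw := hf _ _ h'
        rw [walk_append] at hw ⊢
        obtain ⟨z, h1, h2, h3, h4⟩ := hw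
        refine ⟨z, h1, h2, hl p (by simp), hc.1.symm, hl r (by simp), ?_⟩
        rwa [NPath.src_comp] at h4
      · rw [ofPath_mul_of_not_comp hc, hm.zero] at h'
        simp at h'
    · have := ih (u ++ [p]) r (fun s hs => hl s (List.mem_cons_of_mem _ hs))
      simp only [pword_append, pword_cons, pword_nil, List.append_assoc,
        List.singleton_append] at this
      exact this h

theorem differential_pword (i : ℤ) (f : List (Q.Alg k) → Q.Alg k) (p : Q.NPath)
    (l : List Q.NPath) : differential (Q.grading k) i f (pword Q k (p :: l))
      = (i - l.length).negOnePow •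
      (koszul (Q.grading k) (i - l.length) (Q.ofPath k p) * f (pword Q k l)
        + ((l.length : ℤ) + 1).negOnePow •
            (f (pword Q k (p :: l).dropLast)
              * Q.ofPath k ((p :: l).getLast (List.cons_ne_nil p l)))
        + bdAux f (Q.ofPath k p) (pword Q k l)) := by
  rw [pword_cons, differential_cons]
  simp only [length_pword]
  congr 5
  · simp only [← pword_cons]
    rw [pword, pword, List.map_dropLast]
  · simp only [← pword_cons]
    simp only [pword, List.getLast_map]

theorem commute_trivialPath {b : Q.Alg k} (h : ∀ q, coef Q k q b ≠ 0 → q.tgt = q.src) (x : V) :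
    Q.ofPath k (Q.trivialPath x) * b = b * Q.ofPath k (Q.trivialPath x) := by
  rw [eq_sum_coef b, Finset.mul_sum, Finset.sum_mul]
  refine Finset.sum_congr rfl fun q hq => ?_
  have hx : q.tgt = q.src := h q (by simpa [coef] using hq)
  rw [mul_smul_comm, smul_mul_assoc]
  congr 1
  by_cases h2 : q.tgt = x
  · rw [trivialPath_mul (by intro r hr; rw [← coef_ofPath_ne hr, h2]),
      mul_trivialPath (by intro r hr; rw [← coef_ofPath_ne hr, ← hx, h2])]
  · rw [trivialPath_mul_eq_zero (by intro r hr; rwa [← coef_ofPath_ne hr]),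
      mul_trivialPath_eq_zero (by intro r hr; rwa [← coef_ofPath_ne hr, ← hx])]

/-- For nontrivial letters each term of the differential preserves endpoints. If some letter is
trivial, the terms that do not contain it any more cancel in pairs: the merges with its two
neighbours, or a merge and an outer term at an end of the word, or the two outer terms of a
one-letter word. -/
theorem Relative.differential {f : List (Q.Alg k) → Q.Alg k} (hm : Multi k f)
    (hf : Relative f) (i : ℤ) : Relative (differential (Q.grading k) i f) := by
  intro l q h
  rcases l with _ | ⟨p, l⟩
  · exact absurd (map_zero _) h
  rw [differential_pword] at h
  have h := coef_units_smul_ne h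
  by_cases hl : ∀ r ∈ p :: l, r.word ≠ []
  · rcases coef_add_ne h with h | h
    · rcases coef_add_ne h with h | h
      · rw [koszul_ofPath, smul_mul_assoc] at h
        obtain ⟨r, hc, hr, rfl⟩ := coef_ofPath_mul (coef_units_smul_ne h)
        have := hf _ _ hr
        rw [NPath.src_comp]
        refine ⟨rfl, hl p (by simp), ?_⟩
        rwa [hc.1]
      · have h := coef_units_smul_ne h
        obtain ⟨u, r, hu⟩ : ∃ u r, p :: l = u ++ [r] :=
          ⟨_, _, (List.dropLast_append_getLast (List.cons_ne_nil p l)).symm⟩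
        simp only [hu, List.dropLast_concat, List.getLast_append_singleton] at h
        obtain ⟨s, hc, hs, rfl⟩ := coef_mul_ofPath h
        rw [hu, NPath.src_comp, walk_append]
        exact ⟨s.src, hf _ _ hs, hc.1.symm, hl r (by rw [hu]; simp), rfl⟩
    · exact bdAux_walk hm hf [] p l hl q h
  · exfalso
    apply h
    push Not at hl
    obtain ⟨e, he, he'⟩ := hl
    obtain ⟨u, v, huv⟩ := List.append_of_mem he
    have hn := hf.normal
    rw [NPath.eq_trivialPath he'] at huv
    generalize e.tgt = x at huv
    rcases u with _ | ⟨p', u⟩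
    · obtain ⟨rfl, rfl⟩ : p = Q.trivialPath x ∧ l = v := by simpa using huv
      have hκ : koszul (Q.grading k) (i - l.length) (Q.ofPath k (Q.trivialPath x))
          = Q.ofPath k (Q.trivialPath x) := by
        rw [koszul_ofPath]; simp [NPath.deg, wdeg, trivialPath]
      rw [hκ]
      rcases l with _ | ⟨q', l⟩
      · have := commute_trivialPath (fun q hq => hf [] q hq) x (b := f [])
        simp [bdAux, this]
      · rw [bdAux_trivial hm hn]
        have h1 := hn.1 [] (q' :: l).dropLast (Q.trivialPath x) rfl
        rw [List.nil_append, ← List.dropLast_cons_of_ne_nil (List.cons_ne_nil _ _)] at h1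
        rw [h1]
        by_cases h2 : q'.tgt = x
        · rw [trivialPath_mul, trivialPath_mul]
          · simp
          · intro r hr; rw [← coef_ofPath_ne hr, h2]
          · intro r hr
            rw [← (hf _ _ hr).1, h2]
        · rw [trivialPath_mul_eq_zero, trivialPath_mul_eq_zero, hm.head_zero]
          · simp
          · intro r hr; rwa [← coef_ofPath_ne hr]
          · intro r hr
            rwa [← (hf _ _ hr).1]
    · obtain ⟨rfl, rfl⟩ : p = p' ∧ l = u ++ Q.trivialPath x :: v := by simpa using huv
      rw [hn.1 u v _ rfl, mul_zero, zero_add]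
      rcases v with _ | ⟨q', v⟩
      · rw [bdAux_trivial_last hm hn x u p _ rfl]
        simp only [← List.cons_append, List.dropLast_concat, List.getLast_append_singleton]
        set r := (p :: u).getLast (List.cons_ne_nil p u) with hr
        have hend : ∀ q, coef Q k q (f (pword Q k (p :: u))) ≠ 0 → q.src = r.src := by
          intro q hq
          have hw := hf _ _ hq
          rw [← List.dropLast_append_getLast (List.cons_ne_nil p u), walk_append] at hw
          obtain ⟨z, -, -, -, h3⟩ := hw
          exact h3.symm
        split_ifs with h2
        · rw [mul_trivialPath (by intro q hq; rw [hend q hq, h2])]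
          simp only [List.length_append, List.length_singleton]
          push_cast
          rw [Int.negOnePow_succ ((u.length : ℤ) + 1), Units.neg_smul]
          simp
        · rw [mul_trivialPath_eq_zero (by intro q hq; rwa [hend q hq])]
          simp
      · rw [bdAux_trivial_inner hm hn]
        have h1 := hn.1 (p :: u) (q' :: v).dropLast (Q.trivialPath x) rfl
        rw [← List.dropLast_cons_of_ne_nil (List.cons_ne_nil _ _),
          ← List.dropLast_append_of_ne_nil (List.cons_ne_nil _ _), List.cons_append] at h1
        rw [h1]; simp

end Relative

end GradedGentleQuiver

/-! ### The matching of words: critical, long and merged words. -/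

namespace GradedGentleQuiver

section Splitting

variable {V E : Type*} {Q : GradedGentleQuiver V E}

/-- The first arrow of a path, as a path. -/
def NPath.headPath (p : Q.NPath) : Q.NPath where
  tgt := p.tgt
  word := p.word.take 1
  chain := p.chain.take 1
  tgt_eq := by
    intro a ha
    apply p.tgt_eq a
    rcases h : p.word with _ | ⟨b, w⟩ <;> simp_all

/-- A path without its first arrow. -/
def NPath.tail (p : Q.NPath) : Q.NPath where
  tgt := p.word.head?.elim p.tgt Q.src
  word := p.word.tail
  chain := p.chain.tail
  tgt_eq := by
    intro a ha
    have hc := p.chain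
    rcases h : p.word with _ | ⟨b, _ | ⟨c, w⟩⟩
    · simp [h] at ha
    · simp [h] at ha
    · rw [h] at ha hc
      simp only [List.tail_cons, List.head?_cons, Option.mem_def, Option.some.injEq] at ha
      subst ha
      simp only [List.isChain_cons_cons] at hc
      exact hc.1.1.symm

theorem NPath.src_eq {p : Q.NPath} {w : List E} {a : E} (h : p.word = w ++ [a]) :
    p.src = Q.src a := by
  simp [NPath.src, h]

theorem NPath.headPath_src {p : Q.NPath} (hp : p.word ≠ []) : p.headPath.src = p.tail.tgt := by
  rcases h : p.word with _ | ⟨b, w⟩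
  · exact absurd h hp
  · simp [NPath.src, NPath.headPath, NPath.tail, h]

theorem NPath.tail_src {p : Q.NPath} (hp : p.word ≠ []) : p.tail.src = p.src := by
  rcases h : p.word with _ | ⟨b, _ | ⟨c, w⟩⟩
  · exact absurd h hp
  · simp [NPath.src, NPath.tail, h]
  · simp [NPath.src, NPath.tail, h, List.getLast?_eq_some_getLast (List.cons_ne_nil c w)]

theorem NPath.head_comp_tail {p : Q.NPath} (hp : p.word ≠ []) :
    ∃ h : p.headPath.Comp p.tail, p.headPath.comp p.tail h = p := by
  have hw : p.headPath.word ++ p.tail.word = p.word := by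
    rcases h : p.word with _ | ⟨b, w⟩
    · exact absurd h hp
    · simp [NPath.headPath, NPath.tail, h]
  have hc : p.headPath.Comp p.tail := ⟨NPath.headPath_src hp, by rw [hw]; exact p.chain⟩
  refine ⟨hc, ?_⟩
  ext1
  · rfl
  · exact hw

theorem NPath.headPath_comp {p q : Q.NPath} (h : p.Comp q) (hp : p.word.length = 1) :
    (p.comp q h).headPath = p := by
  obtain ⟨a, ha⟩ := List.length_eq_one_iff.1 hp
  ext1
  · rfl
  · simp [NPath.headPath, NPath.comp, ha]

theorem NPath.tail_comp {p q : Q.NPath} (h : p.Comp q) (hp : p.word.length = 1) :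
    (p.comp q h).tail = q := by
  obtain ⟨a, ha⟩ := List.length_eq_one_iff.1 hp
  ext1
  · rw [← h.1]; simp [NPath.tail, NPath.comp, NPath.src, ha]
  · simp [NPath.tail, NPath.comp, ha]

/-- A single arrow followed by a nontrivial path which starts with the same arrow. -/
theorem comp_iff_of_head {p q r : Q.NPath} (hp : p.word.length = 1) (ht : q.tgt = r.tgt)
    (h : q.word.head? = r.word.head?) : p.Comp q ↔ p.Comp r := by
  obtain ⟨a, ha⟩ := List.length_eq_one_iff.1 hp
  unfold NPath.Comp
  rw [ht, ha]
  refine and_congr_right fun _ => ?_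
  have hq := q.chain
  have hr := r.chain
  rcases h1 : q.word with _ | ⟨b, w⟩ <;> rcases h2 : r.word with _ | ⟨c, w'⟩ <;>
    simp_all

theorem length_comp {p q : Q.NPath} (h : p.Comp q) :
    (p.comp q h).word.length = p.word.length + q.word.length := List.length_append

/-- `LongWord L s m`: `L = p₁ ⋯ p_i q ⋯` where the `p` are arrows with `p_1 p_2 = ⋯ = 0` and
`p_i q ≠ 0`; the word `m` is obtained by multiplying `p_i` and `q`, and `s = (-1)^i`. -/
inductive LongWord : List Q.NPath → ℤˣ → List Q.NPath → Prop
  | base (p q : Q.NPath) (l : List Q.NPath) (h : p.Comp q) (hp : p.word.length = 1)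
      (hq : q.word ≠ []) : LongWord (p :: q :: l) (-1) (p.comp q h :: l)
  | step (p q r : Q.NPath) (l m : List Q.NPath) (s : ℤˣ) (h : ¬ p.Comp q) (ht : p.src = q.tgt)
      (hp : p.word.length = 1) (hl : LongWord (q :: l) s (r :: m)) :
      LongWord (p :: q :: l) (-s) (p :: r :: m)

/-- Words of arrows whose consecutive products lie in the ideal. -/
def CritWord (l : List Q.NPath) : Prop :=
  (∀ p ∈ l, p.word.length = 1) ∧ l.IsChain fun p q => p.src = q.tgt ∧ ¬ p.Comp q

/-- Both words begin with the same arrow, hence an arrow placed in front composes with one first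
letter exactly if it composes with the other. -/
theorem LongWord.head {L m : List Q.NPath} {s : ℤˣ} (h : LongWord L s m) :
    ∃ q l r m', L = q :: l ∧ m = r :: m' ∧ q.word.length = 1 ∧ q.tgt = r.tgt ∧
      q.word.head? = r.word.head? ∧ r.word ≠ [] := by
  cases h with
  | base p q l h hp hq =>
    obtain ⟨a, ha⟩ := List.length_eq_one_iff.1 hp
    exact ⟨_, _, _, _, rfl, rfl, hp, rfl, by simp [NPath.comp, ha], by simp [NPath.comp, ha]⟩
  | step p q r l m s h ht hp hl =>
    exact ⟨_, _, _, _, rfl, rfl, hp, rfl, rfl, by intro h'; simp [h'] at hp⟩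

theorem LongWord.length {L m : List Q.NPath} {s : ℤˣ} (h : LongWord L s m) :
    L.length = m.length + 1 := by
  induction h with
  | base => simp
  | step p q r l m s h ht hp hl ih => simpa using ih

theorem LongWord.tail_iff {p q : Q.NPath} {l : List Q.NPath} (hp : p.word.length = 1)
    (ht : p.src = q.tgt) (h : ∃ s m, LongWord (q :: l) s m) : ∃ s m, LongWord (p :: q :: l) s m := by
  obtain ⟨s, m, h⟩ := h
  obtain ⟨q', l', r, m', e1, e2, h1, h2, h3, h4⟩ := h.head
  obtain ⟨rfl, rfl⟩ : q = q' ∧ l = l' := by simpa using e1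
  subst e2
  by_cases hc : p.Comp q
  · exact ⟨_, _, .base p q l hc hp (by intro h'; simp [h'] at h1)⟩
  · exact ⟨_, _, .step p q r l m' s hc ht hp h⟩

/-- The first letter decides. A path of length at least two comes from the long word in which its
first arrow is split off. An arrow that composes with the next letter starts a long word. Otherwise
the type of the remaining word is inherited. -/
theorem walk_trichotomy {l : List Q.NPath} {x y : V} (h : Walk x l y) :
    CritWord l ∨ (∃ s m, LongWord l s m) ∨ ∃ L s, LongWord L s l := by
  induction l generalizing x with
  | nil => exact Or.inl ⟨by simp, List.isChain_nil⟩
  | cons p l ih =>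
    obtain ⟨-, hp, hl⟩ := h
    by_cases h1 : p.word.length = 1
    · rcases l with _ | ⟨q, l⟩
      · exact Or.inl ⟨by simpa using h1, List.isChain_singleton p⟩
      · have ht : p.src = q.tgt := hl.1.symm
        by_cases hc : p.Comp q
        · exact Or.inr (Or.inl ⟨_, _, .base p q l hc h1 hl.2.1⟩)
        · rcases ih hl with h | h | ⟨L, s, h⟩
          · refine Or.inl ⟨?_, List.isChain_cons_cons.2 ⟨⟨ht, hc⟩, h.2⟩⟩
            intro r hr
            rcases List.mem_cons.1 hr with rfl | hr
            · exact h1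
            · exact h.1 r hr
          · exact Or.inr (Or.inl (LongWord.tail_iff h1 ht h))
          · obtain ⟨q', l', r, m', rfl, e2, h2, h3, h4, h5⟩ := h.head
            obtain ⟨rfl, rfl⟩ : q = r ∧ l = m' := by simpa using e2
            refine Or.inr (Or.inr ⟨_, _, .step p q' q l' l s ?_ ?_ h1 h⟩)
            · rwa [comp_iff_of_head h1 h3 h4]
            · rw [ht, h3]
    · obtain ⟨hc, e⟩ := NPath.head_comp_tail hp
      have h2 : 2 ≤ p.word.length := by
        have := List.length_pos_iff.2 hp
        omega
      have := LongWord.base p.headPath p.tail l hc (by simp [NPath.headPath]; omega) (by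
        intro h'
        have h3 : p.word.tail.length = 0 := by
          change p.tail.word.length = 0
          rw [h']; rfl
        rw [List.length_tail] at h3; omega)
      rw [e] at this
      exact Or.inr (Or.inr ⟨_, _, this⟩)

/-- The dropped letter comes after the composable pair, and the word stays long, or it is the second
member of the pair, and a critical word remains. -/
theorem LongWord.dropLast {L m : List Q.NPath} {s : ℤˣ} (h : LongWord L s m) :
    CritWord L.dropLast ∨ ∃ s m, LongWord L.dropLast s m := by
  induction h with
  | base p q l h hp hq =>
    rcases l with _ | ⟨r, l⟩
    · exact Or.inl ⟨by simpa using hp, List.isChain_singleton p⟩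
    · rw [List.dropLast_cons_of_ne_nil (by simp), List.dropLast_cons_of_ne_nil (by simp)]
      exact Or.inr ⟨_, _, .base p q _ h hp hq⟩
  | step p q r l m s h ht hp hl ih =>
    rw [List.dropLast_cons_of_ne_nil (by simp)]
    rcases l with _ | ⟨q', l⟩
    · cases hl
    · rw [List.dropLast_cons_of_ne_nil (by simp)] at ih ⊢
      rcases ih with ih | ih
      · refine Or.inl ⟨?_, List.isChain_cons_cons.2 ⟨⟨ht, h⟩, ih.2⟩⟩
        intro r hr
        rcases List.mem_cons.1 hr with rfl | hr
        · exact hp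
        · exact ih.1 r hr
      · exact Or.inr (LongWord.tail_iff hp ht ih)

end Splitting

/-! ### The contracting homotopy and reduction to critical words. -/

section Homotopy

variable {V E : Type*} [Fintype V] {Q : GradedGentleQuiver V E} {k : Type*} [Field k]

theorem bdAux_long_base {f : List (Q.Alg k) → Q.Alg k} (hm : Multi k f) (p q : Q.NPath)
    (hc : p.Comp q) (hp : p.word.length = 1) (hq : q.word ≠ [])
    (h : ∀ (q' : Q.NPath) l, p.Comp q' → q'.word ≠ [] → f (pword Q k (q' :: l)) = 0)
    (l : List Q.NPath) : bdAux f (Q.ofPath k q) (pword Q k l) = 0 := by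
  rcases l with _ | ⟨r, l⟩
  · rfl
  · rw [pword_cons, bdAux, bdAux_eq_zero (hm.cons _) (fun l => h q l hc hq), sub_zero, neg_eq_zero]
    by_cases hc' : q.Comp r
    · rw [ofPath_mul_of_comp hc', ← pword_cons]
      refine h _ _ ((comp_iff_of_head (q := q) (r := q.comp r hc') hp rfl ?_).1 hc) ?_
      · rcases h1 : q.word with _ | ⟨b, w⟩
        · exact absurd h1 hq
        · simp [NPath.comp, h1]
      · simp [NPath.comp, hq]
    · rw [ofPath_mul_of_not_comp hc', hm.head_zero]

/-- Merges before the composable pair are products in the ideal, and merges after it leave the word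
long. Only the merge of the pair itself contributes. -/
theorem bdAux_long {L m : List Q.NPath} {s : ℤˣ} (hL : LongWord L s m)
    {f : List (Q.Alg k) → Q.Alg k} (hm : Multi k f) (hn : Normal f)
    (h : ∀ L, (∃ s m, LongWord L s m) → f (pword Q k L) = 0) (p : Q.NPath) (l : List Q.NPath)
    (hpl : L = p :: l) : bdAux f (Q.ofPath k p) (pword Q k l) = s • f (pword Q k m) := by
  induction hL generalizing f p l with
  | base p' q l' hc hp hq =>
    obtain ⟨rfl, rfl⟩ : p' = p ∧ q :: l' = l := by simpa using hpl
    rw [pword_cons, bdAux, ofPath_mul_of_comp hc, bdAux_long_base (hm.cons _) p' q hc hp hq,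
      sub_zero, Units.neg_smul, one_smul, pword_cons]
    intro q' l hc' hq'
    exact h _ ⟨_, _, .base p' q' l hc' hp hq'⟩
  | step p' q r l' m s hc ht hp hl ih =>
    obtain ⟨rfl, rfl⟩ : p' = p ∧ q :: l' = l := by simpa using hpl
    rw [pword_cons, bdAux, ofPath_mul_of_not_comp hc, hm.head_zero,
      ih (hm.cons _) (hn.cons p') ?_ q l' rfl]
    · simp
    · intro L hL
      obtain ⟨_, _, hL'⟩ := hL
      obtain ⟨q', l, _, _, rfl, _, h1, _⟩ := hL'.head
      by_cases ht' : p'.src = q'.tgt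
      · exact h _ (LongWord.tail_iff hp ht' ⟨_, _, hL'⟩)
      · exact hn.2 [] l p' q' ht'

/-- The right outer term disappears by `LongWord.dropLast`. What is left is a relation between the
value on the merged word and the value on the word without its first arrow, which drives all
recursions below. -/
theorem differential_long {L m : List Q.NPath} {s : ℤˣ} (hL : LongWord L s m)
    {f : List (Q.Alg k) → Q.Alg k} (hm : Multi k f) (hn : Normal f)
    (h : ∀ L, (∃ s m, LongWord L s m) → f (pword Q k L) = 0)
    (h' : ∀ L, CritWord L → f (pword Q k L) = 0) (p : Q.NPath) (l : List Q.NPath)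
    (hpl : L = p :: l) (i : ℤ) :
    differential (Q.grading k) i f (pword Q k L) = (i - l.length).negOnePow •
      (koszul (Q.grading k) (i - l.length) (Q.ofPath k p) * f (pword Q k l)
        + s • f (pword Q k m)) := by
  have h1 : f (pword Q k L.dropLast) = 0 := hL.dropLast.elim (h' _) (h _)
  have h2 := bdAux_long hL hm hn h p l hpl
  subst hpl
  rw [differential_pword, h1, h2]
  simp

theorem differential_crit {L : List Q.NPath} (hL : CritWord L) 
    {f : List (Q.Alg k) → Q.Alg k} (hm : Multi k f)
    (h' : ∀ L, CritWord L → f (pword Q k L) = 0) (i : ℤ) :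
    differential (Q.grading k) i f (pword Q k L) = 0 := by
  rcases L with _ | ⟨p, l⟩
  · rfl
  have h1 : CritWord l := ⟨fun r hr => hL.1 r (List.mem_cons_of_mem _ hr), hL.2.tail⟩
  have h2 : CritWord (p :: l).dropLast :=
    ⟨fun r hr => hL.1 r (List.dropLast_subset _ hr), hL.2.dropLast⟩
  have h3 : ∀ (f : List (Q.Alg k) → Q.Alg k), Multi k f → ∀ p l, CritWord (p :: l) →
      bdAux f (Q.ofPath k p) (pword Q k l) = 0 := by
    intro f hm p l hl
    induction l generalizing p f with
    | nil => rfl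
    | cons q l ih =>
      have hc := hl.2
      rw [List.isChain_cons_cons] at hc
      rw [pword_cons, bdAux, ofPath_mul_of_not_comp hc.1.2, hm.head_zero,
        ih _ (hm.cons _) q ⟨fun r hr => hl.1 r (List.mem_cons_of_mem _ hr), hc.2⟩]
      simp
  rw [differential_pword, h' _ h1, h' _ h2, h3 f hm p l hL]
  simp

/-- A relative cocycle which vanishes on long and on critical words is zero. -/
theorem eq_zero_of_long_of_crit {i : ℤ} {f : List (Q.Alg k) → Q.Alg k} (hm : Multi k f)
    (hr : Relative f) (hd : differential (Q.grading k) i f = 0)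
    (h : ∀ L, (∃ s m, LongWord L s m) → f (pword Q k L) = 0)
    (h' : ∀ L, CritWord L → f (pword Q k L) = 0) : f = 0 := by
  -- The induction is on the length of the first letter. If the word is merged from `L`, the cocycle
  -- equation on `L` reduces its value to that on `L` without its first arrow, which either begins
  -- with a shorter path or is again long.
  have key : ∀ (n : ℕ) (p : Q.NPath) (l : List Q.NPath), p.word.length = n →
      f (pword Q k (p :: l)) = 0 := by
    intro n
    induction n with
    | zero =>
      intro p l hp
      exact hr.normal.1 [] l p (List.length_eq_zero_iff.1 hp)
    | succ n ih =>
      intro p l hp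
      by_cases hw : ∃ x y, Walk x (p :: l) y
      · obtain ⟨x, y, hw⟩ := hw
        rcases walk_trichotomy hw with hc | hc | ⟨L, s, hL⟩
        · exact h' _ hc
        · exact h _ hc
        · obtain ⟨q, l', r, m', rfl, e2, h2, h3, h4, h5⟩ := hL.head
          have hdL := differential_long hL hm hr.normal h h' q l' rfl i
          rw [hd] at hdL
          have hz : f (pword Q k l') = 0 := by
            cases hL with
            | base p' q' l'' hc hp' hq' =>
              apply ih
              have := length_comp hc
              omega
            | step p' q' r' l'' m'' s' hc ht hp' hl => exact h _ ⟨_, _, hl⟩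
          rw [hz, mul_zero, zero_add, smul_smul] at hdL
          exact ((smul_eq_zero_iff_eq _).1 hdL.symm)
      · push Not at hw
        exact hr.eq_zero hw
  refine Multi.ext_pword (g := 0) hm (fun u v c a b => by simp) fun l => ?_
  rcases l with _ | ⟨p, l⟩
  · exact h' [] ⟨by simp, List.isChain_nil⟩
  · exact key _ p l rfl

open Classical in
/-- The part of the homotopy which splits the first letter that is not an arrow. -/
noncomputable def innerSplit : List Q.NPath → (List Q.NPath → Q.Alg k) → Q.Alg k
  | [], _ => 0
  | p :: l, f =>
    if 2 ≤ p.word.length then f (p.headPath :: p.tail :: l)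
    else if ∃ q ∈ l.head?, p.Comp q then 0 else -innerSplit l fun v => f (p :: v)

open Classical in
/-- The homotopy on words with a given remainder `l`, by recursion along the first letter. -/
noncomputable def firstSplit (t : ℤ) (f : List Q.NPath → Q.Alg k) (l : List Q.NPath) :
    ℕ → Q.NPath → Q.Alg k
  -- The counter is the length of the current path, and a normalised cochain vanishes on trivial
  -- paths.
  | 0, _ => 0
  | n + 1, p =>
    if 2 ≤ p.word.length then (t + 1).negOnePow • f (p.headPath :: p.tail :: l)
      + koszul (Q.grading k) t (Q.ofPath k p.headPath) * firstSplit t f l n p.tail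
    else if ∃ q ∈ l.head?, p.Comp q then 0
    else (t + 1).negOnePow • -innerSplit l fun v => f (p :: v)

/-- The contracting homotopy applied to a cochain of total degree `i`. -/
noncomputable def splitHomotopy (i : ℤ) (f : List (Q.Alg k) → Q.Alg k) :
    List (Q.Alg k) → Q.Alg k :=
  multiExt fun l => match l with
    | [] => 0
    -- The exponent is the internal degree of `f` on the split word, which has `l.length + 2`
    -- letters.
    | p :: l => firstSplit (i - (l.length + 2)) (fun l => f (pword Q k l)) l p.word.length p

theorem splitHomotopy_pword (i : ℤ) (f : List (Q.Alg k) → Q.Alg k) (p : Q.NPath)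
    (l : List Q.NPath) : splitHomotopy i f (pword Q k (p :: l))
      = firstSplit (i - (l.length + 2)) (fun l => f (pword Q k l)) l p.word.length p := by
  rw [splitHomotopy, multiExt_pword]

theorem innerSplit_of_comp {p q : Q.NPath} {l : List Q.NPath} (f : List Q.NPath → Q.Alg k)
    (hp : p.word.length = 1) (hc : p.Comp q) : innerSplit (p :: q :: l) f = 0 := by
  rw [innerSplit, if_neg (by omega), if_pos ⟨q, rfl, hc⟩]

theorem innerSplit_of_not_comp {p : Q.NPath} {l : List Q.NPath} (f : List Q.NPath → Q.Alg k)
    (hp : p.word.length = 1) (hc : ∀ q ∈ l.head?, ¬ p.Comp q) :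
    innerSplit (p :: l) f = -innerSplit l fun v => f (p :: v) := by
  rw [innerSplit, if_neg (by omega), if_neg (by push Not; exact hc)]

theorem innerSplit_long {L m : List Q.NPath} {s : ℤˣ} (h : LongWord L s m)
    (f : List Q.NPath → Q.Alg k) : innerSplit L f = 0 := by
  induction h generalizing f with
  | base p q l h hp hq => exact innerSplit_of_comp f hp h
  | step p q r l m s h ht hp hl ih =>
    rw [innerSplit_of_not_comp f hp (by simpa using h), ih, neg_zero]

theorem innerSplit_crit {L : List Q.NPath} (h : CritWord L)
    (f : List Q.NPath → Q.Alg k) : innerSplit L f = 0 := by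
  induction L generalizing f with
  | nil => rfl
  | cons p l ih =>
    rw [innerSplit_of_not_comp f (h.1 p (by simp)), ih, neg_zero]
    · exact ⟨fun r hr => h.1 r (List.mem_cons_of_mem _ hr), h.2.tail⟩
    · intro q hq
      rcases l with _ | ⟨r, l⟩
      · simp at hq
      · obtain rfl : r = q := by simpa using hq
        exact (List.isChain_cons_cons.1 h.2).1.2

/-- The first letter of a merged word that is not an arrow is the product of the composable pair, so
splitting it recovers `L`. -/
theorem innerSplit_merged {L m : List Q.NPath} {s : ℤˣ} (h : LongWord L s m)
    (f : List Q.NPath → Q.Alg k) : innerSplit m f = -(s • f L) := by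
  induction h generalizing f with
  | base p q l h hp hq =>
    have := List.length_pos_iff.2 hq
    rw [innerSplit, if_pos (by rw [length_comp]; omega), NPath.headPath_comp h hp,
      NPath.tail_comp h hp]
    simp
  | step p q r l m s h ht hp hl ih =>
    obtain ⟨q', l', r', m', e1, e2, h2, h3, h4, h5⟩ := hl.head
    obtain ⟨rfl, rfl⟩ : q = q' ∧ l = l' := by simpa using e1
    obtain ⟨rfl, rfl⟩ : r = r' ∧ m = m' := by simpa using e2
    rw [innerSplit_of_not_comp f hp, ih]
    · simp
    · simp only [List.head?_cons, Option.mem_def, Option.some.injEq, forall_eq']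
      rwa [← comp_iff_of_head hp h3 h4]

theorem firstSplit_eq_inner {t : ℤ} {f : List Q.NPath → Q.Alg k} {p : Q.NPath}
    {l : List Q.NPath} (hp : p.word.length = 1) :
    firstSplit t f l p.word.length p = (t + 1).negOnePow • innerSplit (p :: l) f := by
  have h : ¬ 2 ≤ p.word.length := by omega
  rw [hp]
  simp only [firstSplit, innerSplit, if_neg h]
  split_ifs <;> simp

theorem splitHomotopy_multi (i : ℤ) (f : List (Q.Alg k) → Q.Alg k) :
    Multi k (splitHomotopy i f) := multi_multiExt _

theorem splitHomotopy_long (i : ℤ) (f : List (Q.Alg k) → Q.Alg k) {L : List Q.NPath}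
    (h : ∃ s m, LongWord L s m) : splitHomotopy i f (pword Q k L) = 0 := by
  obtain ⟨s, m, h⟩ := h
  obtain ⟨q, l, _, _, rfl, _, h1, _⟩ := h.head
  rw [splitHomotopy_pword, firstSplit_eq_inner h1, innerSplit_long h, smul_zero]

theorem splitHomotopy_crit (i : ℤ) (f : List (Q.Alg k) → Q.Alg k) {L : List Q.NPath}
    (h : CritWord L) : splitHomotopy i f (pword Q k L) = 0 := by
  rcases L with _ | ⟨p, l⟩
  · rfl
  · rw [splitHomotopy_pword, firstSplit_eq_inner (h.1 p (by simp)), innerSplit_crit h, smul_zero]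

/-- The homotopy vanishes on long and critical words, so `differential_long` leaves two terms, and
the recursion of `firstSplit` is made so that these add up to `f`. -/
theorem differential_splitHomotopy {i : ℤ} {f : List (Q.Alg k) → Q.Alg k}
    (hn : Normal (splitHomotopy i f)) {L m : List Q.NPath} {s : ℤˣ} (hL : LongWord L s m) :
    differential (Q.grading k) (i - 1) (splitHomotopy i f) (pword Q k L) = f (pword Q k L) := by
  obtain ⟨p, l, r, m', rfl, rfl, h1, -⟩ := hL.head
  rw [differential_long hL (splitHomotopy_multi i f) hn (fun L h => splitHomotopy_long i f h)
    (fun L h => splitHomotopy_crit i f h) p l rfl]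
  have hlen := hL.length
  simp only [List.length_cons, Nat.add_right_cancel_iff] at hlen
  have ht : i - 1 - (l.length : ℤ) = i - (m'.length + 2) := by rw [hlen]; push_cast; ring
  rw [ht, splitHomotopy_pword i f r]
  cases hL with
  -- The summand of `firstSplit` with the first arrow as a left factor cancels the left outer term.
  | base _ q l' hc hp hq =>
    have := List.length_pos_iff.2 hq
    obtain ⟨n, hn⟩ : ∃ n, q.word.length = n + 1 := ⟨q.word.length - 1, by omega⟩
    have e : (p.comp q hc).word.length = q.word.length + 1 := by rw [length_comp, hp, add_comm]
    rw [e, firstSplit, if_pos (by omega), NPath.headPath_comp hc hp, NPath.tail_comp hc hp,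
      splitHomotopy_pword]
    rw [Units.neg_smul, one_smul, neg_add, add_comm (-_), add_neg_cancel_left,
      Int.negOnePow_succ, Units.neg_smul, neg_neg, smul_smul, Int.units_mul_self, one_smul]
  -- Here the word without its first arrow is still long, so there is no left outer term to cancel.
  | step _ q r' l' _ s' hc ht' hp hl =>
    rw [splitHomotopy_long i f ⟨_, _, hl⟩, mul_zero, zero_add, firstSplit_eq_inner hp,
      innerSplit_merged (.step p q r' l' _ s' hc ht' hp hl), Int.negOnePow_succ]
    rcases negOnePow_cases (i - ((r' :: _).length + 2)) with h | h <;> rw [h] <;>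
      rcases Int.units_eq_one_or s' with h | h <;> simp [h]

theorem headPath_word_ne {p : Q.NPath} (hp : p.word ≠ []) : p.headPath.word ≠ [] := by
  rcases h : p.word with _ | ⟨b, w⟩
  · exact absurd h hp
  · simp [NPath.headPath, h]

theorem walk_split {p : Q.NPath} (hp : 2 ≤ p.word.length) (x y : V) (l : List Q.NPath) :
    Walk x (p.headPath :: p.tail :: l) y ↔ Walk x (p :: l) y := by
  have hne : p.word ≠ [] := by intro h; simp [h] at hp
  have h1 := headPath_word_ne hne
  have h2 : p.tail.word ≠ [] := by
    intro h
    have : (p.word.tail).length = 0 := by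
      change p.tail.word.length = 0
      rw [h]; rfl
    simp at this; omega
  have h3 : p.headPath.tgt = p.tgt := rfl
  simp [Walk, hne, h1, h2, h3, NPath.tail_src hne, NPath.headPath_src hne]

theorem innerSplit_walk (f : List Q.NPath → Q.Alg k) (u l : List Q.NPath) (x y : V)
    (q : Q.NPath) (hf : ∀ v, coef Q k q (f v) ≠ 0 → Walk x (u ++ v) y)
    (h : coef Q k q (innerSplit l f) ≠ 0) : Walk x (u ++ l) y := by
  induction l generalizing f u with
  | nil => simp [innerSplit] at h
  | cons p l ih =>
    rw [innerSplit] at h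
    split_ifs at h with h1 h2
    · have := hf _ h
      rw [walk_append] at this ⊢
      obtain ⟨z, h3, h4⟩ := this
      exact ⟨z, h3, (walk_split h1 _ _ _).1 h4⟩
    · simp at h
    · have := ih (fun v => f (p :: v)) (u ++ [p]) (by simpa using fun v => hf (p :: v))
        (by intro h0; apply h; rw [map_neg, h0, neg_zero])
      simpa using this

theorem splitHomotopy_relative (i : ℤ) {f : List (Q.Alg k) → Q.Alg k} (hf : Relative f) :
    Relative (splitHomotopy i f) := by
  intro L q h
  rcases L with _ | ⟨p, l⟩
  · simp [splitHomotopy, multiExt] at h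
  rw [splitHomotopy_pword] at h
  generalize i - ((l.length : ℤ) + 2) = t at h
  have key : ∀ (n : ℕ) (p q : Q.NPath), p.word.length = n →
      coef Q k q (firstSplit t (fun l => f (pword Q k l)) l n p) ≠ 0 →
      Walk q.tgt (p :: l) q.src := by
    intro n
    induction n with
    | zero => intro p q _ h; simp [firstSplit] at h
    | succ n ih =>
      intro p q hp h
      have hne : p.word ≠ [] := by intro h; simp [h] at hp
      rw [firstSplit] at h
      split_ifs at h with h1 h2
      · rcases coef_add_ne h with h | h
        · exact (walk_split h1 _ _ _).1 (hf _ _ (coef_units_smul_ne h))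
        · rw [koszul_ofPath, smul_mul_assoc] at h
          obtain ⟨r, hc, hr, rfl⟩ := coef_ofPath_mul (coef_units_smul_ne h)
          have := ih p.tail r (by simp [NPath.tail, hp]) hr
          refine (walk_split h1 _ _ _).1 ⟨rfl, headPath_word_ne hne, ?_⟩
          rw [NPath.src_comp, hc.1]; exact this
      · simp at h
      · have h := coef_units_smul_ne h
        exact innerSplit_walk (fun v => f (pword Q k (p :: v))) [p] l _ _ q
          (fun v hv => hf _ _ hv) (by intro h0; apply h; rw [map_neg, h0, neg_zero])
  exact key _ p q rfl h

theorem deg_head_tail {p : Q.NPath} (hp : p.word ≠ []) : p.headPath.deg + p.tail.deg = p.deg := by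
  obtain ⟨hc, e⟩ := NPath.head_comp_tail hp
  conv_rhs => rw [← e]
  simp [NPath.deg, wdeg, NPath.comp]

theorem innerSplit_mem (f : List Q.NPath → Q.Alg k) (l : List Q.NPath) (c : ℤ)
    (hf : ∀ v, v.length = l.length + 1 → f v ∈ Q.grading k (ldeg v + c)) :
    innerSplit l f ∈ Q.grading k (ldeg l + c) := by
  induction l generalizing f c with
  | nil => exact zero_mem _
  | cons p l ih =>
    rw [innerSplit]
    split_ifs with h1 h2
    · have hne : p.word ≠ [] := by intro h; simp [h] at h1
      have := hf (p.headPath :: p.tail :: l) (by simp)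
      convert this using 2
      simp only [ldeg, List.map_cons, List.sum_cons, ← deg_head_tail hne]
      ring
    · exact zero_mem _
    · refine neg_mem ?_
      have := ih (fun v => f (p :: v)) (p.deg + c) fun v hv => by
        have := hf (p :: v) (by simp [hv])
        convert this using 2
        simp [ldeg]; ring
      convert this using 2
      simp [ldeg]; ring

theorem splitHomotopy_mem {i : ℤ} {f : List (Q.Alg k) → Q.Alg k}
    (hf : f ∈ cochains (Q.grading k) i) :
    splitHomotopy i f ∈ cochains (Q.grading k) (i - 1) := by
  have hfp : ∀ l : List Q.NPath, f (pword Q k l) ∈ Q.grading k (ldeg l + (i - l.length)) := by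
    intro l
    have := hf.2.2 (pword Q k l) (l.map NPath.deg) (by
      rw [pword, List.forall₂_map_left_iff, List.forall₂_map_right_iff]
      exact List.forall₂_same.2 fun p _ => ofPath_mem_grading p)
    rwa [length_pword] at this
  refine mem_cochains_of_pword (splitHomotopy_multi i f) fun L => ?_
  rcases L with _ | ⟨p, l⟩
  · exact zero_mem _
  rw [splitHomotopy_pword]
  have e : i - 1 - ((p :: l).length : ℤ) = i - ((l.length : ℤ) + 2) := by
    rw [List.length_cons]; push_cast; ring
  rw [e]
  clear e
  have e2 : ∀ v : List Q.NPath, v.length = l.length + 2 →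
      f (pword Q k v) ∈ Q.grading k (ldeg v + (i - ((l.length : ℤ) + 2))) := by
    intro v hv
    have := hfp v
    rw [hv] at this
    exact_mod_cast this
  generalize i - ((l.length : ℤ) + 2) = t at e2
  generalize hn : p.word.length = n
  induction n generalizing p with
  | zero => exact zero_mem _
  | succ n ih =>
    have hne : p.word ≠ [] := by intro h; simp [h] at hn
    rw [firstSplit]
    split_ifs with h1 h2
    · refine add_mem (units_smul_mem _ _ ?_) ?_
      · convert e2 (p.headPath :: p.tail :: l) (by simp) using 2
        simp only [ldeg, List.map_cons, List.sum_cons, ← deg_head_tail hne]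
        ring
      · have h3 := ih p.tail (by simp [NPath.tail, hn])
        have h4 := SetLike.mul_mem_graded
          (koszul_mem (Q.grading k) (ofPath_mem_grading p.headPath) t) h3
        convert h4 using 2
        simp only [ldeg, List.map_cons, List.sum_cons, ← deg_head_tail hne]
        ring
    · exact zero_mem _
    · refine units_smul_mem _ _ (neg_mem ?_)
      have := innerSplit_mem (fun v => f (pword Q k (p :: v))) l (p.deg + t) fun v hv => by
        have := e2 (p :: v) (by simp [hv])
        convert this using 2
        simp [ldeg]; ring
      convert this using 2
      simp [ldeg]; ring

/-- Relative cocycles which vanish on critical words are coboundaries. -/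
theorem mem_coboundaries_of_crit {i : ℤ} {f : List (Q.Alg k) → Q.Alg k}
    (hf : f ∈ cocycles (Q.grading k) i) (hr : Relative f)
    (h : ∀ L, CritWord L → f (pword Q k L) = 0) : f ∈ coboundaries (Q.grading k) i := by
  have hm := cochains_multi hf.1
  have hh := splitHomotopy_mem hf.1
  have hhr := splitHomotopy_relative i hr
  have hd : differential (Q.grading k) i f = 0 := hf.2
  refine ⟨splitHomotopy i f, hh, ?_⟩
  have hdm := differential_mem hh rfl
  rw [sub_add_cancel] at hdm
  -- The difference is a relative cocycle. It vanishes on long words by the choice of the homotopy,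
  -- and on critical words because the homotopy vanishes there and all inner products of such words
  -- are zero.
  have key : f - differential (Q.grading k) (i - 1) (splitHomotopy i f) = 0 := by
    refine eq_zero_of_long_of_crit (i := i) (cochains_multi (sub_mem hf.1 hdm))
      (hr.sub (hhr.differential (splitHomotopy_multi i f) (i - 1))) ?_ ?_ ?_
    · have := differential_differential hh
      rw [sub_add_cancel] at this
      rw [map_sub, hd, this, sub_zero]
    · rintro L ⟨s, m, hL⟩
      rw [Pi.sub_apply, differential_splitHomotopy hhr.normal hL, sub_self]
    · intro L hL
      rw [Pi.sub_apply, h L hL, differential_crit hL (splitHomotopy_multi i f)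
        (fun L h => splitHomotopy_crit i f h), sub_self]
  exact (sub_eq_zero.1 key).symm

end Homotopy

end GradedGentleQuiver

/-! ### Words of arrows as elements of the algebra. -/

namespace GradedGentleQuiver

section WordElt

variable {V E : Type*} [Fintype V] {Q : GradedGentleQuiver V E} {k : Type*} [Field k]

@[simp] theorem wordElt_nil : Q.wordElt k [] = 1 := rfl

theorem wordElt_cons (a : E) (w : List E) :
    Q.wordElt k (a :: w) = Q.ofPath k (Q.arrowPath a) * Q.wordElt k w := by
  simp [wordElt]

theorem wordElt_append (u v : List E) :
    Q.wordElt k (u ++ v) = Q.wordElt k u * Q.wordElt k v := by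
  simp [wordElt]

theorem wordElt_singleton (a : E) : Q.wordElt k [a] = Q.ofPath k (Q.arrowPath a) := by
  simp [wordElt]

theorem comp_iff_of_src {p q : Q.NPath} {u v : List E} {a b : E} (hp : p.word = u ++ [a])
    (hq : q.word = b :: v) : p.Comp q ↔ Q.nonrel a b := by
  have h1 := p.chain
  have h2 := q.chain
  have h3 := q.tgt_eq
  rw [hp] at h1
  rw [hq] at h2
  unfold NPath.Comp
  rw [NPath.src_eq hp, hp, hq, ← h3 b (by simp [hq])]
  constructor
  · rintro ⟨-, h⟩
    rw [List.isChain_append] at h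
    exact h.2.2 a (by simp) b (by simp)
  · intro h
    refine ⟨h.1, List.isChain_append.2 ⟨h1, h2, ?_⟩⟩
    intro x hx y hy
    simp only [List.getLast?_append, List.getLast?_singleton, Option.some_or, Option.mem_def,
      Option.some.injEq, List.head?_cons] at hx hy
    rwa [← hx, ← hy]

theorem wordElt_path {p : Q.NPath} (hp : p.word ≠ []) : Q.wordElt k p.word = Q.ofPath k p := by
  have key : ∀ (n : ℕ) (p : Q.NPath), p.word.length = n + 1 →
      Q.wordElt k p.word = Q.ofPath k p := by
    intro n
    induction n with
    | zero =>
      intro p hn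
      obtain ⟨a, ha⟩ := List.length_eq_one_iff.1 hn
      rw [ha, wordElt_singleton]
      congr 1
      ext1
      · exact p.tgt_eq a (by simp [ha])
      · exact ha.symm
    | succ n ih =>
      intro p hn
      have hne : p.word ≠ [] := by intro h; simp [h] at hn
      obtain ⟨hc, e⟩ := NPath.head_comp_tail hne
      obtain ⟨a, w, ha⟩ := List.exists_cons_of_ne_nil hne
      conv_rhs => rw [← e, ← ofPath_mul_of_comp hc]
      rw [← ih p.tail (by simp [NPath.tail, hn]), ha, wordElt_cons]
      congr 2
      · ext1
        · exact p.tgt_eq a (by simp [ha])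
        · simp [NPath.headPath, ha, arrowPath]
      · simp [NPath.tail, ha]
  have := List.length_pos_iff.2 hp
  exact key (p.word.length - 1) p (by omega)

theorem wordElt_mem (w : List E) : Q.wordElt k w ∈ Q.grading k (Q.wdeg w) := by
  induction w with
  | nil => exact SetLike.one_mem_graded (Q.grading k)
  | cons a w ih =>
    rw [wordElt_cons, wdeg, List.map_cons, List.sum_cons]
    have h := ofPath_mem_grading (k := k) (Q.arrowPath a)
    have h2 : (Q.arrowPath a).deg = Q.deg a := by simp [NPath.deg, wdeg, arrowPath]
    rw [h2] at h
    exact SetLike.mul_mem_graded h ih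

theorem wdeg_append (u v : List E) : Q.wdeg (u ++ v) = Q.wdeg u + Q.wdeg v := by
  simp [wdeg]

theorem wdeg_cons (a : E) (v : List E) : Q.wdeg (a :: v) = Q.deg a + Q.wdeg v := by
  simp [wdeg]

theorem arrow_mul_arrow_eq_zero {a b : E} (h : ¬ Q.nonrel a b) :
    Q.ofPath k (Q.arrowPath a) * Q.ofPath k (Q.arrowPath b) = 0 := by
  apply ofPath_mul_of_not_comp
  rwa [comp_iff_of_src (u := []) (v := []) (a := a) (b := b) rfl rfl]

theorem coef_wordElt_mul {u : List E} {c : Q.Alg k} {q : Q.NPath}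
    (h : coef Q k q (Q.wordElt k u * c) ≠ 0) :
    ∃ r, coef Q k r c ≠ 0 ∧ q.src = r.src ∧ q.tgt = u.head?.elim r.tgt Q.tgt := by
  induction u generalizing q with
  | nil => exact ⟨q, by simpa using h, rfl, rfl⟩
  | cons a u ih =>
    rw [wordElt_cons, mul_assoc] at h
    obtain ⟨r, hc, hr, rfl⟩ := coef_ofPath_mul h
    obtain ⟨r', h1, h2, h3⟩ := ih hr
    exact ⟨r', h1, by rw [NPath.src_comp, h2], rfl⟩

theorem coef_mul_wordElt {v : List E} {c : Q.Alg k} {q : Q.NPath}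
    (h : coef Q k q (c * Q.wordElt k v) ≠ 0) :
    ∃ r, coef Q k r c ≠ 0 ∧ q.tgt = r.tgt ∧ q.src = v.getLast?.elim r.src Q.src := by
  induction v using List.reverseRecOn generalizing q with
  | nil => exact ⟨q, by simpa using h, rfl, rfl⟩
  | append_singleton v a ih =>
    rw [wordElt_append, ← mul_assoc, wordElt_singleton] at h
    obtain ⟨r, hc, hr, rfl⟩ := coef_mul_ofPath h
    obtain ⟨r', h1, h2, h3⟩ := ih hr
    refine ⟨r', h1, h2, ?_⟩
    rw [NPath.src_comp]
    simp [NPath.src, arrowPath]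

end WordElt

/-! ### Parallel cochains on words of paths. -/

section Parallel

variable {V E : Type*} [Fintype V] {Q : GradedGentleQuiver V E} {k : Type*} [Field k]

theorem padded_length (u v p : List E) : (padded u v p).length = p.length := by
  induction p generalizing u with
  | nil => rfl
  | cons a p ih =>
    rcases p with _ | ⟨b, p⟩
    · rfl
    · simp only [padded, List.length_cons, ih]

theorem parallelCochain_multi (p : List E) (s : ℤ) (b : Q.Alg k) :
    Multi k (Q.parallelCochain k p s b) := multi_multiExt _

open Classical in
theorem parallelCochain_pword (p : List E) (s : ℤ) (b : Q.Alg k) (l : List Q.NPath) :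
    Q.parallelCochain k p s b (pword Q k l) =
      ∑ i ∈ Finset.range ((l.head?.elim [] NPath.word).length + 1),
      ∑ j ∈ Finset.range ((l.getLast?.elim [] NPath.word).length + 1),
      if padded ((l.head?.elim [] NPath.word).take i) ((l.getLast?.elim [] NPath.word).drop j) p
          = l.map NPath.word then
        (s * Q.wdeg ((l.head?.elim [] NPath.word).take i)).negOnePow •
          (Q.wordElt k ((l.head?.elim [] NPath.word).take i) * b
            * Q.wordElt k ((l.getLast?.elim [] NPath.word).drop j))
      else 0 := by
  rw [parallelCochain, multiExt_pword]

theorem parallelCochain_length {p : List E} {s : ℤ} {b : Q.Alg k} {l : List Q.NPath}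
    (h : l.length ≠ p.length) : Q.parallelCochain k p s b (pword Q k l) = 0 := by
  rw [parallelCochain_pword]
  refine Finset.sum_eq_zero fun i _ => Finset.sum_eq_zero fun j _ => if_neg fun h' => h ?_
  rw [← padded_length _ _ p, h', List.length_map]

/-- `b` is a combination of paths which are parallel to the nonempty path `p`. -/
def ParallelTo (p : List E) (b : Q.Alg k) : Prop :=
  ∀ r, coef Q k r b ≠ 0 → (∀ a ∈ p.head?, r.tgt = Q.tgt a) ∧ ∀ a ∈ p.getLast?, r.src = Q.src a

theorem walk_of_padded {p u v : List E} {l : List Q.NPath} (hp : p ≠ []) (hc : p.IsChain Q.rel)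
    (h : padded u v p = l.map NPath.word) {x y : V}
    (hx : ∀ a ∈ p.head?, x = u.head?.elim (Q.tgt a) Q.tgt)
    (hy : ∀ a ∈ p.getLast?, y = v.getLast?.elim (Q.src a) Q.src) : Walk x l y := by
  induction p generalizing u l x with
  | nil => exact absurd rfl hp
  | cons a p ih =>
    rcases l with _ | ⟨q, l⟩
    · have := congrArg List.length h
      rw [padded_length] at this; simp at this
    rcases p with _ | ⟨b, p⟩
    · simp only [padded, List.map_cons, List.cons.injEq] at h
      obtain ⟨h1, h2⟩ := h
      have hl : l = [] := by simpa using h2.symm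
      subst hl
      have h3 := hx a (by simp)
      have h4 := hy a (by simp)
      refine ⟨?_, by rw [← h1]; simp, ?_⟩
      · rw [h3]
        rcases u with _ | ⟨c, u⟩
        · exact (q.tgt_eq a (by rw [← h1]; rfl)).symm
        · exact (q.tgt_eq c (by rw [← h1]; rfl)).symm
      · change q.src = y
        rw [h4, NPath.src, ← h1]
        rcases List.eq_nil_or_concat v with rfl | ⟨v, c, rfl⟩
        · simp
        · have : u ++ a :: (v ++ [c]) = (u ++ a :: v) ++ [c] := by simp
          rw [List.concat_eq_append, this, List.getLast?_concat, List.getLast?_concat]; rfl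
    · simp only [padded, List.map_cons, List.cons.injEq] at h
      obtain ⟨h1, h2⟩ := h
      have h3 := hx a (by simp)
      rw [List.isChain_cons_cons] at hc
      refine ⟨?_, by rw [← h1]; simp, ih (by simp) hc.2 h2 ?_ ?_⟩
      · rw [h3]
        rcases u with _ | ⟨c, u⟩
        · exact (q.tgt_eq a (by rw [← h1]; rfl)).symm
        · exact (q.tgt_eq c (by rw [← h1]; rfl)).symm
      · intro c hc'
        obtain rfl : b = c := by simpa using hc'
        rw [NPath.src_eq h1.symm]
        exact Q.rel_comp _ _ hc.1
      · intro c hc'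
        exact hy c (by simpa using hc')

theorem ldeg_of_padded {p u v : List E} {l : List Q.NPath} (hp : p ≠ [])
    (h : padded u v p = l.map NPath.word) : ldeg l = Q.wdeg u + Q.wdeg p + Q.wdeg v := by
  induction p generalizing u l with
  | nil => exact absurd rfl hp
  | cons a p ih =>
    rcases l with _ | ⟨q, l⟩
    · have := congrArg List.length h
      rw [padded_length] at this; simp at this
    rcases p with _ | ⟨b, p⟩
    · simp only [padded, List.map_cons, List.cons.injEq] at h
      obtain ⟨h1, h2⟩ := h
      have hl : l = [] := by simpa using h2.symm
      subst hl
      simp [ldeg, NPath.deg, ← h1, wdeg]; ring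
    · simp only [padded, List.map_cons, List.cons.injEq] at h
      obtain ⟨h1, h2⟩ := h
      have := ih (by simp) h2
      simp only [ldeg, List.map_cons, List.sum_cons] at this ⊢
      rw [this, NPath.deg, ← h1]
      simp [wdeg]; ring

theorem parallelCochain_relative {p : List E} (hp : p ≠ []) (hc : p.IsChain Q.rel) (s : ℤ)
    {b : Q.Alg k} (hb : ParallelTo p b) : Relative (Q.parallelCochain k p s b) := by
  intro l q h
  rw [parallelCochain_pword] at h
  obtain ⟨i, -, h⟩ := coef_sum_ne h
  obtain ⟨j, -, h⟩ := coef_sum_ne h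
  split_ifs at h with h1
  · have h := coef_units_smul_ne h
    obtain ⟨r, hr, e1, e2⟩ := coef_mul_wordElt h
    obtain ⟨r', hr', e3, e4⟩ := coef_wordElt_mul hr
    refine walk_of_padded hp hc h1 ?_ ?_
    · intro a ha
      rw [e1, e4, (hb r' hr').1 a ha]
    · intro a ha
      rw [e2, e3, (hb r' hr').2 a ha]
  · simp at h

theorem parallelCochain_mem {p : List E} {s i n : ℤ} {b : Q.Alg k} (hb : b ∈ Q.grading k n)
    (hn : n = Q.wdeg p + s) (hi : i = s + p.length) :
    Q.parallelCochain k p s b ∈ cochains (Q.grading k) i := by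
  refine mem_cochains_of_pword (parallelCochain_multi p s b) fun l => ?_
  by_cases hl : l.length = p.length
  · rw [parallelCochain_pword]
    refine sum_mem fun x _ => sum_mem fun y _ => ?_
    split_ifs with h
    · refine units_smul_mem _ _ ?_
      have h2 := SetLike.mul_mem_graded (SetLike.mul_mem_graded (wordElt_mem (k := k) 
        ((l.head?.elim [] NPath.word).take x)) hb)
        (wordElt_mem (k := k) ((l.getLast?.elim [] NPath.word).drop y))
      convert h2 using 2
      rcases p with _ | ⟨a, p⟩
      · have : l = [] := by simpa using hl
        subst this
        simp [ldeg, hi, hn, wdeg]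
      · rw [ldeg_of_padded (by simp) h, hi, hn, hl]; ring
    · exact zero_mem _
  · rw [parallelCochain_length hl]; exact zero_mem _

theorem parallelCochain_add (p : List E) (s : ℤ) (b c : Q.Alg k) :
    Q.parallelCochain k p s (b + c) = Q.parallelCochain k p s b + Q.parallelCochain k p s c := by
  refine Multi.ext_pword (parallelCochain_multi _ _ _)
    ((parallelCochain_multi _ _ _).addf (parallelCochain_multi _ _ _)) fun l => ?_
  simp only [Pi.add_apply, parallelCochain_pword, ← Finset.sum_add_distrib]
  refine Finset.sum_congr rfl fun i _ => Finset.sum_congr rfl fun j _ => ?_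
  split_ifs
  · rw [mul_add, add_mul, smul_add]
  · simp

theorem parallelCochain_zero (p : List E) (s : ℤ) :
    Q.parallelCochain k p s 0 = 0 := by
  have := parallelCochain_add (k := k) (Q := Q) p s 0 0
  simpa using this

open Classical in
/-- The contribution to a parallel cochain of the letters after the first one. -/
noncomputable def tailValue (b : Q.Alg k) : List E → List Q.NPath → Q.Alg k
  | [c], [z] => if z.word.head? = some c then b * Q.wordElt k z.word.tail else 0
  | a :: c :: m, y :: w => if y.word = [a] then tailValue b (c :: m) w else 0
  | _, _ => 0

open Classical in
/-- The contribution to a parallel cochain of the first letter. -/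
noncomputable def headValue (s : ℤ) (a : E) (x : Q.NPath) : Q.Alg k :=
  if x.word.getLast? = some a then
    (s * Q.wdeg x.word.dropLast).negOnePow • Q.wordElt k x.word.dropLast else 0

open Classical in
theorem sum_tailValue (b : Q.Alg k) (m : List E) (hm : m ≠ []) (w : List Q.NPath) :
    ∑ j ∈ Finset.range ((w.getLast?.elim [] NPath.word).length + 1),
      (if padded [] ((w.getLast?.elim [] NPath.word).drop j) m = w.map NPath.word then
        b * Q.wordElt k ((w.getLast?.elim [] NPath.word).drop j) else 0) = tailValue b m w := by
  induction m generalizing w with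
  | nil => exact absurd rfl hm
  | cons a m ih =>
    rcases m with _ | ⟨c, m⟩
    · match w with
      | [] => simp [tailValue, padded]
      | [z] =>
        simp only [tailValue, padded, List.getLast?_singleton, Option.elim_some, List.map_cons,
          List.map_nil, List.cons.injEq, and_true, List.nil_append]
        rcases h : z.word with _ | ⟨d, z'⟩
        · simp
        -- The last letter must consist of the prescribed arrow followed by the padding, so the
        -- padding starts after exactly one arrow.
        · rw [Finset.sum_eq_single 1]
          · simp [eq_comm]
          · intro j hj' hj
            rw [if_neg]
            intro h'
            have := congrArg List.length h'
            simp only [List.length_cons, List.length_drop, Finset.mem_range] at this hj'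
            omega
          · simp
      | z :: z' :: w =>
        simp only [tailValue]
        refine Finset.sum_eq_zero fun j _ => if_neg fun h => ?_
        have := congrArg List.length h
        simp [padded] at this
    · match w with
      | [] => simp [tailValue, padded]
      | [y] =>
        have : ∀ w, tailValue b (c :: m) w = 0 ∨ w ≠ [] := by
          intro w
          rcases w with _ | ⟨z, w⟩
          · left; rcases m with _ | ⟨d, m⟩ <;> rfl
          · right; simp
        have h0 := (this []).resolve_right (by simp)
        simp only [tailValue, h0, ite_self]
        refine Finset.sum_eq_zero fun j _ => if_neg fun h => ?_
        have := congrArg List.length h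
        simp [padded, padded_length] at this
      | y :: z :: w =>
        simp only [tailValue]
        rw [← ih (by simp) (z :: w)]
        simp only [padded, List.map_cons, List.cons.injEq, List.getLast?_cons_cons,
          List.nil_append]
        by_cases h : y.word = [a]
        · simp [h]
        · have h' : ¬ [a] = y.word := fun h' => h h'.symm
          simp [h, h']

/-- As soon as the first and the last letter are different, the two paddings are independent of each
other and the double sum factors. -/
theorem parallelCochain_cons (a : E) (m : List E) (hm : m ≠ []) (s : ℤ) (b : Q.Alg k)
    (x : Q.NPath) (w : List Q.NPath) :
    Q.parallelCochain k (a :: m) s b (pword Q k (x :: w)) = headValue s a x * tailValue b m w := by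
  classical
  rw [parallelCochain_pword]
  obtain ⟨c, m', rfl⟩ := List.exists_cons_of_ne_nil hm
  rcases w with _ | ⟨y, w⟩
  · have h0 : tailValue b (c :: m') [] = 0 := by rcases m' with _ | ⟨d, m⟩ <;> rfl
    rw [h0, mul_zero]
    refine Finset.sum_eq_zero fun i _ => Finset.sum_eq_zero fun j _ => if_neg fun h => ?_
    have := congrArg List.length h
    simp [padded, padded_length] at this
  · rw [← sum_tailValue b _ hm]
    simp only [List.head?_cons, Option.elim_some, padded, List.map_cons, List.cons.injEq,
      List.getLast?_cons_cons, Finset.mul_sum]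
    -- The left padding is everything but the last arrow of the first letter. If that letter is
    -- trivial the index is `0` by truncated subtraction, and `headValue` is zero.
    rw [Finset.sum_eq_single (x.word.length - 1)]
    · refine Finset.sum_congr rfl fun j _ => ?_
      rw [headValue, ← List.dropLast_eq_take]
      by_cases h : x.word.getLast? = some a
      · have h2 : x.word.dropLast ++ [a] = x.word := List.dropLast_append_getLast? a h
        rw [if_pos h]
        simp only [h2, true_and]
        split_ifs
        · rw [smul_mul_assoc, mul_assoc]
        · simp
      · rw [if_neg h, zero_mul, if_neg]
        rintro ⟨h2, -⟩
        rw [← h2] at h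
        simp at h
    · intro i hi hne
      refine Finset.sum_eq_zero fun j _ => if_neg ?_
      rintro ⟨h, -⟩
      have := congrArg List.length h
      simp at this hi
      omega
    · intro h; simp at h

open Classical in
/-- The extension of `a ↦ b` to words of arrows as a graded derivation. -/
noncomputable def derWord (a : E) (s : ℤ) (b : Q.Alg k) : List E → Q.Alg k
  | [] => 0
  | c :: w => (if c = a then b * Q.wordElt k w else 0)
      + (s * Q.deg c).negOnePow • (Q.wordElt k [c] * derWord a s b w)

/-- With one letter both paddings are cut from the same path, and the sum over the factorisations is
the Leibniz rule. -/
theorem parallelCochain_singleton (a : E) (s : ℤ) (b : Q.Alg k) (x : Q.NPath) :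
    Q.parallelCochain k [a] s b (pword Q k [x]) = derWord a s b x.word := by
  classical
  rw [parallelCochain_pword]
  simp only [List.head?_cons, Option.elim_some, List.getLast?_singleton, padded, List.map_cons,
    List.map_nil, List.cons.injEq, and_true]
  generalize x.word = w
  induction w with
  | nil => simp [derWord]
  | cons c w ih =>
    rw [List.length_cons, Finset.sum_range_succ', derWord, ← ih, add_comm]
    congr 1
    · rw [Finset.sum_eq_single 1]
      · simp [wdeg, eq_comm]
      · intro j hj' hj
        rw [if_neg]
        intro h'
        have := congrArg List.length h'
        simp only [List.take_zero, List.nil_append, List.length_cons, List.length_drop,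
          Finset.mem_range] at this hj'
        omega
      · simp
    · simp only [Finset.mul_sum, Finset.smul_sum]
      refine Finset.sum_congr rfl fun i _ => ?_
      rw [Finset.sum_range_succ', if_neg, add_zero]
      · refine Finset.sum_congr rfl fun j _ => ?_
        simp only [List.take_succ_cons, List.drop_succ_cons, List.cons_append, List.cons.injEq,
          true_and]
        split_ifs
        · rw [wdeg_cons, mul_add, Int.negOnePow_add, mul_smul_comm, smul_smul, wordElt_cons,
            wordElt_singleton]
          simp only [mul_assoc]
        · simp
      · intro h'
        have := congrArg List.length h'
        simp at this
        omega

theorem parallelCochain_nil (s : ℤ) (b : Q.Alg k) : Q.parallelCochain k [] s b [] = b := by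
  have := parallelCochain_pword [] s b []
  simpa [padded, wdeg] using this

end Parallel
end GradedGentleQuiver

/-! ### Testing cocycles on long words and on words of arrows. -/

namespace GradedGentleQuiver

section CocycleCriterion

variable {V E : Type*} [Fintype V] {Q : GradedGentleQuiver V E} {k : Type*} [Field k]

/-- The differential of `f` is itself a relative cocycle, so `eq_zero_of_long_of_crit` applies to
it. -/
theorem mem_cocycles_of_long_of_crit {i : ℤ} {f : List (Q.Alg k) → Q.Alg k}
    (hf : f ∈ cochains (Q.grading k) i) (hr : Relative f)
    (h : ∀ L, (∃ s m, LongWord L s m) → differential (Q.grading k) i f (pword Q k L) = 0)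
    (h' : ∀ L, CritWord L → differential (Q.grading k) i f (pword Q k L) = 0) :
    f ∈ cocycles (Q.grading k) i := by
  refine ⟨hf, ?_⟩
  have hd := differential_mem hf rfl
  exact eq_zero_of_long_of_crit (i := i + 1) (cochains_multi hd)
    (hr.differential (cochains_multi hf) i) (differential_differential hf) h h'

theorem bdAux_crit {f : List (Q.Alg k) → Q.Alg k} (hm : Multi k f) (p : Q.NPath)
    (l : List Q.NPath) (hl : CritWord (p :: l)) :
    bdAux f (Q.ofPath k p) (pword Q k l) = 0 := by
  induction l generalizing p f with
  | nil => rfl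
  | cons q l ih =>
    have hc := hl.2
    rw [List.isChain_cons_cons] at hc
    rw [pword_cons, bdAux, ofPath_mul_of_not_comp hc.1.2, hm.head_zero,
      ih (hm.cons _) q ⟨fun r hr => hl.1 r (List.mem_cons_of_mem _ hr), hc.2⟩]
    simp

variable (Q) in
/-- A word of arrows as a word of paths. -/
def aword (v : List E) : List Q.NPath := v.map Q.arrowPath

@[simp] theorem aword_nil : aword Q [] = [] := rfl
@[simp] theorem aword_cons (a : E) (v : List E) : aword Q (a :: v) = Q.arrowPath a :: aword Q v :=
  rfl
@[simp] theorem aword_append (u v : List E) : aword Q (u ++ v) = aword Q u ++ aword Q v :=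
  List.map_append
@[simp] theorem length_aword (v : List E) : (aword Q v).length = v.length := List.length_map _

@[simp] theorem arrowPath_word (a : E) : (Q.arrowPath a).word = [a] := rfl

theorem arrowPath_comp_iff {a b : E} : (Q.arrowPath a).Comp (Q.arrowPath b) ↔ Q.nonrel a b :=
  comp_iff_of_src (u := []) (v := []) rfl rfl

theorem critWord_aword {v : List E} : CritWord (aword Q v) ↔ v.IsChain Q.rel := by
  have key : ∀ a b, ((Q.arrowPath a).src = (Q.arrowPath b).tgt ∧
      ¬ (Q.arrowPath a).Comp (Q.arrowPath b)) ↔ Q.rel a b := by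
    intro a b
    rw [arrowPath_comp_iff, nonrel]
    change (Q.src a = Q.tgt b ∧ _) ↔ _
    have := Q.rel_comp a b
    tauto
  constructor
  · intro h
    have h2 := h.2
    rw [aword, List.isChain_map] at h2
    exact h2.imp fun a b hab => (key a b).1 hab
  · intro h
    refine ⟨by simp [aword], ?_⟩
    rw [aword, List.isChain_map]
    exact h.imp fun a b hab => (key a b).2 hab

theorem CritWord.exists_aword {L : List Q.NPath} (h : CritWord L) :
    ∃ v : List E, v.IsChain Q.rel ∧ L = aword Q v := by
  have : ∃ v, L = aword Q v := by
    have h1 := h.1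
    clear h
    induction L with
    | nil => exact ⟨[], rfl⟩
    | cons p l ih =>
      obtain ⟨v, rfl⟩ := ih fun q hq => h1 q (List.mem_cons_of_mem _ hq)
      obtain ⟨a, ha⟩ := List.length_eq_one_iff.1 (h1 p (by simp))
      refine ⟨a :: v, ?_⟩
      rw [aword_cons]
      congr 1
      ext1
      · exact (p.tgt_eq a (by simp [ha])).symm
      · exact ha
  obtain ⟨v, rfl⟩ := this
  exact ⟨v, critWord_aword.1 h, rfl⟩

/-- The differential on a critical word. -/
theorem differential_aword {f : List (Q.Alg k) → Q.Alg k} (hm : Multi k f) (i : ℤ) (a : E)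
    (v w : List E) (b : E) (hv : (a :: v).IsChain Q.rel) (hw : a :: v = w ++ [b]) :
    differential (Q.grading k) i f (pword Q k (aword Q (a :: v)))
      = (i - v.length).negOnePow •
        (((i - v.length) * Q.deg a).negOnePow • (Q.wordElt k [a] * f (pword Q k (aword Q v)))
          + ((v.length : ℤ) + 1).negOnePow • (f (pword Q k (aword Q w)) * Q.wordElt k [b])) := by
  rw [aword_cons, differential_pword, bdAux_crit hm _ (aword Q v) (critWord_aword.2 hv), add_zero,
    koszul_ofPath, wordElt_singleton, wordElt_singleton, smul_mul_assoc, length_aword]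
  have h1 : (Q.arrowPath a).deg = Q.deg a := by simp [NPath.deg, wdeg, arrowPath]
  have h2 : Q.arrowPath a :: aword Q v = aword Q w ++ [Q.arrowPath b] := by
    rw [← aword_cons, hw]; simp
  simp only [h1, h2, List.dropLast_concat, List.getLast_append_singleton]

end CocycleCriterion

/-! ### Parallel cochains satisfy the cocycle condition on long words. -/

section ParallelCocycle

variable {V E : Type*} [Fintype V] {Q : GradedGentleQuiver V E} {k : Type*} [Field k]

theorem tailValue_length {b : Q.Alg k} {m : List E} {w : List Q.NPath}
    (h : w.length ≠ m.length) : tailValue b m w = 0 := by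
  induction m generalizing w with
  | nil => rcases w with _ | ⟨z, w⟩ <;> rfl
  | cons a m ih =>
    rcases m with _ | ⟨c, m⟩
    · match w with
      | [] => rfl
      | [z] => simp at h
      | y :: z :: w => rfl
    · match w with
      | [] => rfl
      | y :: w =>
        rw [tailValue, ih (by simpa using h), ite_self]

theorem tailValue_head {b : Q.Alg k} {m : List E} {z : Q.NPath} {w : List Q.NPath}
    (h : tailValue b m (z :: w) ≠ 0) : z.word.head? = m.head? := by
  classical
  match m, w with
  | [], w => exact absurd rfl h
  | [c], [] =>
    rw [tailValue] at h
    by_contra h'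
    exact h (if_neg h')
  | [c], y :: w => exact absurd rfl h
  | a :: c :: m, w =>
    rw [tailValue] at h
    by_contra h'
    refine h (if_neg fun h2 => h' ?_)
    rw [h2]; rfl

theorem not_comp_of_rel {p q : Q.NPath} {a c : E} (h : Q.rel a c) (hp : p.word.getLast? = some a)
    (hq : q.word.head? = some c) : ¬ p.Comp q := by
  obtain ⟨v, hv⟩ := List.head?_eq_some_iff.1 hq
  have := List.dropLast_append_getLast? a hp
  rw [comp_iff_of_src this.symm hv]
  exact fun h' => h'.2 h

theorem tailValue_long {b : Q.Alg k} {m : List E} (hm : m.IsChain Q.rel) {L M : List Q.NPath}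
    {s : ℤˣ} (hL : LongWord L s M) : tailValue b m L = 0 := by
  classical
  induction hL generalizing m with
  | base p q l h hp hq =>
    match m with
    | [] => rfl
    | [c] => rfl
    | a :: c :: m =>
      rw [tailValue]
      split_ifs with h1
      · by_contra h2
        exact not_comp_of_rel (List.isChain_cons_cons.1 hm).1 (by simp [h1]) (tailValue_head h2) h
      · rfl
  | step p q r l m' s h ht hp hl ih =>
    match m with
    | [] => rfl
    | [c] => rfl
    | a :: c :: m =>
      rw [tailValue, ih (List.isChain_cons_cons.1 hm).2, ite_self]

/-- Only a composable pair at the very end of the word can contribute. Merging it, or splitting off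
the last letter and multiplying by it afterwards, both produce `b` times that letter. -/
theorem tailValue_merge {b : Q.Alg k} {m : List E} (hm : m.IsChain Q.rel) {L M : List Q.NPath}
    {s : ℤˣ} (hL : LongWord L s M) (w : List Q.NPath) (z : Q.NPath) (hw : L = w ++ [z]) :
    s • tailValue b m M + (L.length : ℤ).negOnePow • (tailValue b m w * Q.ofPath k z) = 0 := by
  classical
  induction hL generalizing m w with
  | base p q l h hp hq =>
    obtain ⟨d, hd⟩ := List.length_eq_one_iff.1 hp
    rcases List.eq_nil_or_concat l with rfl | ⟨l, z', rfl⟩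
    · obtain ⟨rfl, rfl⟩ : [p] = w ∧ q = z := by
        have : [p] ++ [q] = w ++ [z] := by simpa using hw
        exact ⟨(List.append_inj' this rfl).1, by simpa using (List.append_inj' this rfl).2⟩
      match m with
      | [] => simp [tailValue]
      | [c] =>
        have e : ((2 : ℕ) : ℤ).negOnePow = 1 := Int.negOnePow_even _ (by decide)
        simp only [tailValue, NPath.comp, hd, List.cons_append, List.nil_append, List.head?_cons,
          List.tail_cons, wordElt_nil, mul_one, List.length_cons, List.length_nil, zero_add,
          Nat.reduceAdd, e, wordElt_path hq, one_smul, Units.neg_smul]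
        split_ifs <;> simp
      | a :: c :: m =>
        rw [tailValue_length (by simp), tailValue_length (w := [p]) (by simp)]; simp
    · obtain ⟨rfl, rfl⟩ : p :: q :: l = w ∧ z' = z := by
        have : (p :: q :: l) ++ [z'] = w ++ [z] := by simpa using hw
        exact ⟨(List.append_inj' this rfl).1, by simpa using (List.append_inj' this rfl).2⟩
      rw [tailValue_long hm (.base p q l h hp hq), zero_mul, smul_zero, add_zero]
      match m with
      | [] => simp [tailValue]
      | [c] => rw [tailValue_length (by simp), smul_zero]
      | a :: c :: m =>
        rw [tailValue, if_neg, smul_zero]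
        intro h'
        have := congrArg List.length h'
        rw [length_comp] at this
        have := List.length_pos_iff.2 hq
        simp at *; omega
  | step p q r l m' s h ht hp hl ih =>
    rcases w with _ | ⟨p', w⟩
    · simp at hw
    obtain ⟨rfl, hw'⟩ : p = p' ∧ q :: l = w ++ [z] := by simpa using hw
    match m with
    | [] => simp [tailValue]
    | [c] =>
      have := hl.length
      have h2 := congrArg List.length hw'
      rw [tailValue_length (by simp), tailValue_length (w := p :: w)]
      · simp
      · intro h3
        cases hl <;> simp_all
    | a :: c :: m =>
      have := ih (List.isChain_cons_cons.1 hm).2 w hw'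
      rw [tailValue, tailValue]
      split_ifs
      · rw [List.length_cons]
        push_cast
        rw [Int.negOnePow_succ, Units.neg_smul, Units.neg_smul, ← neg_add, neg_eq_zero]
        exact this
      · simp

theorem headValue_comp (s : ℤ) (a : E) {p q : Q.NPath} (h : p.Comp q) (hp : p.word ≠ [])
    (hq : q.word ≠ []) : headValue s a (p.comp q h)
      = (s * p.deg).negOnePow • (Q.ofPath k p * headValue s a q) := by
  classical
  unfold headValue
  have e1 : (p.comp q h).word.getLast? = q.word.getLast? := by
    change (p.word ++ q.word).getLast? = _
    rw [List.getLast?_append_of_ne_nil _ hq]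
  have e2 : (p.comp q h).word.dropLast = p.word ++ q.word.dropLast := by
    change (p.word ++ q.word).dropLast = _
    rw [List.dropLast_append_of_ne_nil hq]
  rw [e1, e2]
  split_ifs
  · rw [wdeg_append, mul_add, Int.negOnePow_add, wordElt_append, wordElt_path hp, mul_smul_comm,
      smul_smul]
    rfl
  · simp

/-- In arity at least two a nonzero value forces a relation at every junction, whereas a long word
contains a composable pair. Smaller arities are excluded because long words have at least two
letters. -/
theorem parallelCochain_long {p : List E} (hc : p.IsChain Q.rel) (s : ℤ) (b : Q.Alg k)
    {L M : List Q.NPath} {σ : ℤˣ} (hL : LongWord L σ M) :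
    Q.parallelCochain k p s b (pword Q k L) = 0 := by
  classical
  rcases p with _ | ⟨a, m⟩
  · apply parallelCochain_length
    have := hL.length
    simp only [List.length_nil]; omega
  rcases m with _ | ⟨c, m⟩
  · apply parallelCochain_length
    cases hL <;> simp
  rw [List.isChain_cons_cons] at hc
  cases hL with
  | base p q l h hp hq =>
    rw [parallelCochain_cons _ _ (by simp)]
    by_contra h'
    have h1 : headValue (k := k) s a p ≠ 0 := fun h => h' (by rw [h, zero_mul])
    have h2 : tailValue b (c :: m) (q :: l) ≠ 0 := fun h => h' (by rw [h, mul_zero])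
    refine not_comp_of_rel hc.1 ?_ (tailValue_head h2) h
    by_contra h3
    exact h1 (if_neg h3)
  | step p q r l m' s h ht hp hl =>
    rw [parallelCochain_cons _ _ (by simp), tailValue_long hc.2 hl, mul_zero]

theorem derWord_append (a : E) (s : ℤ) (b : Q.Alg k) (u v : List E) :
    derWord a s b (u ++ v) = derWord a s b u * Q.wordElt k v
      + (s * Q.wdeg u).negOnePow • (Q.wordElt k u * derWord a s b v) := by
  classical
  induction u with
  | nil => simp [derWord, wdeg]
  | cons c u ih =>
    simp only [List.cons_append, derWord, ih, wdeg_cons, wordElt_cons c u, wordElt_append,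
      mul_add s, Int.negOnePow_add, add_mul, smul_mul_assoc, mul_add, smul_add, mul_smul_comm,
      smul_smul, add_assoc, mul_assoc, ite_mul, zero_mul, wordElt_singleton]

/-- In arity one this is the Leibniz rule `derWord_append`. In higher arity, if the composable pair
is at the front, the left outer term cancels its merge by `headValue_comp`; if it comes later, the
right outer term cancels it by `tailValue_merge`. -/
theorem differential_parallelCochain_long {p : List E} (hp : p ≠ []) (hc : p.IsChain Q.rel)
    {s i : ℤ} (hi : i = s + p.length) {b : Q.Alg k} (hb : ParallelTo p b)
    {L M : List Q.NPath} {σ : ℤˣ} (hL : LongWord L σ M) :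
    differential (Q.grading k) i (Q.parallelCochain k p s b) (pword Q k L) = 0 := by
  have hm := parallelCochain_multi (k := k) (Q := Q) p s b
  have hr := parallelCochain_relative hp hc s hb
  obtain ⟨x, l, _, _, rfl, -, -⟩ := hL.head
  have hbd := bdAux_long hL hm hr.normal
    (fun L ⟨_, _, hL⟩ => parallelCochain_long hc s b hL) x l rfl
  rw [differential_pword, hbd, koszul_ofPath]
  suffices h : ((i - l.length) * x.deg).negOnePow • Q.ofPath k x *
      Q.parallelCochain k p s b (pword Q k l) + ((l.length : ℤ) + 1).negOnePow •
      (Q.parallelCochain k p s b (pword Q k (x :: l).dropLast)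
        * Q.ofPath k ((x :: l).getLast (List.cons_ne_nil x l)))
      + σ • Q.parallelCochain k p s b (pword Q k M) = 0 by rw [h, smul_zero]
  obtain ⟨a, m, rfl⟩ := List.exists_cons_of_ne_nil hp
  rcases m with _ | ⟨c, m⟩
  · cases hL with
    | base _ q l h hx hq =>
      rcases l with _ | ⟨z, l⟩
      · have hx' : x.word ≠ [] := by intro h'; simp [h'] at hx
        have e : i - 1 = s := by simp [hi]
        have e2 : (1 + 1 : ℤ).negOnePow = 1 := Int.negOnePow_even _ (by decide)
        simp only [List.dropLast_cons_cons, List.dropLast_singleton, List.getLast_cons_cons,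
          List.getLast_singleton, parallelCochain_singleton, List.length_singleton, Nat.cast_one,
          e, e2, one_smul, Units.neg_smul, smul_mul_assoc]
        have := derWord_append a s b x.word q.word
        rw [wordElt_path hx', wordElt_path hq] at this
        change _ + _ + -derWord a s b (x.word ++ q.word) = 0
        rw [this, NPath.deg]
        abel
      · rw [parallelCochain_length (by simp), parallelCochain_length (by simp),
          parallelCochain_length (by simp)]
        simp
    | step _ q r l m' s' h ht hx hl =>
      have h1 := hl.length
      simp only [List.length_cons] at h1
      have h2 : l ≠ [] := by rintro rfl; cases hl
      have h3 := List.length_pos_iff.2 h2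
      rw [parallelCochain_length (by simpa using h2), parallelCochain_length (by simp; omega),
        parallelCochain_length (by simp)]
      simp
  · rw [List.isChain_cons_cons] at hc
    have hcc := hc.2
    cases hL with
    | base _ q l h hx hq =>
      have hx' : x.word ≠ [] := by intro h'; simp [h'] at hx
      have hdrop : Q.parallelCochain k (a :: c :: m) s b (pword Q k (x :: q :: l).dropLast) = 0 := by
        rcases l with _ | ⟨z, l⟩
        · exact parallelCochain_length (by simp)
        · rw [List.dropLast_cons_of_ne_nil (by simp), List.dropLast_cons_of_ne_nil (by simp)]
          exact parallelCochain_long (List.isChain_cons_cons.2 hc) s b (.base x q _ h hx hq)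
      rw [hdrop, zero_mul, smul_zero, add_zero, parallelCochain_cons _ _ (by simp),
        parallelCochain_cons _ _ (by simp)]
      by_cases hlen : l.length = (c :: m).length
      · have e : i - ((q :: l).length : ℤ) = s := by
          rw [hi]; simp only [List.length_cons] at hlen ⊢; push_cast; rw [hlen]; push_cast; ring
        rw [e, headValue_comp _ _ h hx' hq, Units.neg_smul, one_smul, smul_mul_assoc,
          smul_mul_assoc, mul_assoc, add_neg_cancel]
      · rw [tailValue_length hlen]; simp
    | step _ q r l m' s' h ht hx hl =>
      rw [parallelCochain_long (List.isChain_cons_cons.2 hc) s b hl, mul_zero, zero_add,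
        List.dropLast_cons_of_ne_nil (by simp), List.getLast_cons (by simp),
        parallelCochain_cons _ _ (by simp), parallelCochain_cons _ _ (by simp)]
      have := tailValue_merge (b := b) hcc hl _ _
        (List.dropLast_append_getLast (List.cons_ne_nil q l)).symm
      have h2 := congrArg (headValue s a x * ·) this
      simp only [mul_add, mul_zero, mul_smul_comm] at h2
      rw [Int.negOnePow_succ, Units.neg_smul, Units.neg_smul, ← neg_add, neg_eq_zero, mul_assoc,
        add_comm, h2]

-- A word of arrows leaves no room for padding.
open Classical in
theorem parallelCochain_aword {p : List E} (hp : p ≠ []) (s : ℤ) (b : Q.Alg k) (v : List E) :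
    Q.parallelCochain k p s b (pword Q k (aword Q v)) = if v = p then b else 0 := by
  have ht : ∀ (m v : List E), m ≠ [] →
      tailValue b m (aword Q v) = if v = m then b else 0 := by
    intro m
    induction m with
    | nil => intro v h; exact absurd rfl h
    | cons c m ih =>
      intro v _
      rcases m with _ | ⟨d, m⟩
      · match v with
        | [] => simp [tailValue]
        | [x] => simp [tailValue]
        | x :: y :: v => simp [tailValue]
      · match v with
        | [] => simp [tailValue]
        | x :: v =>
          rw [aword_cons, tailValue, ih v (by simp)]
          by_cases h : x = c <;> simp [h]
  obtain ⟨a, m, rfl⟩ := List.exists_cons_of_ne_nil hp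
  rcases m with _ | ⟨c, m⟩
  · match v with
    | [] => rw [parallelCochain_length (by simp)]; simp
    | [x] =>
      rw [aword_cons, aword_nil, parallelCochain_singleton]
      simp [derWord]
    | x :: y :: v => rw [parallelCochain_length (by simp)]; simp
  · match v with
    | [] => rw [parallelCochain_length (by simp)]; simp
    | x :: v =>
      rw [aword_cons, parallelCochain_cons _ _ (by simp), ht _ _ (by simp), headValue]
      by_cases h : x = a <;> simp [h, wdeg]

end ParallelCocycle
end GradedGentleQuiver

/-! ### Primitive cycles as periodic sequences with distinct letters. -/

namespace GradedGentleQuiver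

section Cyclic

variable {E : Type*}

/-- The word `A_r A_{r+1} ⋯ A_{r+N-1}`. -/
def seg (A : ℕ → E) (r N : ℕ) : List E := (List.range N).map fun t => A (r + t)

/-- `A` is the sequence of letters of a cyclic word of length `l` with distinct letters. -/
structure CyclicWord (A : ℕ → E) (l : ℕ) : Prop where
  pos : 0 < l
  per : ∀ t, A (t + l) = A t
  inj : ∀ s t, A s = A t → s ≡ t [MOD l]

@[simp] theorem length_seg (A : ℕ → E) (r N : ℕ) : (seg A r N).length = N := by simp [seg]

@[simp] theorem seg_zero (A : ℕ → E) (r : ℕ) : seg A r 0 = [] := rfl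

theorem seg_add (A : ℕ → E) (r M N : ℕ) : seg A r (M + N) = seg A r M ++ seg A (r + M) N := by
  simp only [seg, List.range_add, List.map_append, List.map_map]
  congr 2
  funext t
  simp [add_assoc]

theorem seg_one (A : ℕ → E) (r : ℕ) : seg A r 1 = [A r] := rfl

theorem seg_succ (A : ℕ → E) (r N : ℕ) : seg A r (N + 1) = A r :: seg A (r + 1) N := by
  rw [add_comm, seg_add, seg_one]; rfl

theorem seg_concat (A : ℕ → E) (r N : ℕ) : seg A r (N + 1) = seg A r N ++ [A (r + N)] := by
  rw [seg_add, seg_one]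

theorem seg_isChain {A : ℕ → E} {R : E → E → Prop} (h : ∀ t, R (A t) (A (t + 1))) (r N : ℕ) :
    (seg A r N).IsChain R := by
  induction N generalizing r with
  | zero => exact List.isChain_nil
  | succ N ih =>
    rcases N with _ | N
    · exact List.isChain_singleton _
    · rw [seg_succ, seg_succ, List.isChain_cons_cons, ← seg_succ]
      exact ⟨h r, ih _⟩

theorem eq_seg_of_isChain {A : ℕ → E} {R : E → E → Prop} (h : ∀ t, R (A t) (A (t + 1)))
    (hR : ∀ a b c, R a b → R a c → b = c) (r : ℕ) (v : List E) (hv : (A r :: v).IsChain R) :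
    A r :: v = seg A r (v.length + 1) := by
  induction v generalizing r with
  | nil => rfl
  | cons b v ih =>
    rw [List.isChain_cons_cons] at hv
    obtain rfl := hR _ _ _ hv.1 (h r)
    rw [List.length_cons, seg_succ, ih _ hv.2]

namespace CyclicWord

variable {A : ℕ → E} {l : ℕ}

theorem per_mul (hA : CyclicWord A l) (t q : ℕ) : A (t + q * l) = A t := by
  induction q with
  | zero => simp
  | succ q ih => rw [Nat.succ_mul, ← add_assoc, hA.per, ih]

theorem congr (hA : CyclicWord A l) {s t : ℕ} (h : s ≡ t [MOD l]) : A s = A t := by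
  have key : ∀ s, A s = A (s % l) := fun s => by
    conv_lhs => rw [← Nat.mod_add_div s l, mul_comm, hA.per_mul]
  rw [key s, key t, h]

theorem seg_congr (hA : CyclicWord A l) {r s : ℕ} (h : r ≡ s [MOD l]) (N : ℕ) :
    seg A r N = seg A s N := by
  rw [seg, seg]
  congr 1
  funext t
  exact hA.congr (h.add_right t)

theorem seg_inj (hA : CyclicWord A l) {r s N : ℕ} (hN : 0 < N) (h : seg A r N = seg A s N) :
    r ≡ s [MOD l] := by
  obtain ⟨N, rfl⟩ := Nat.exists_eq_succ_of_ne_zero hN.ne'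
  rw [Nat.succ_eq_add_one, seg_succ, seg_succ] at h
  exact hA.inj _ _ (List.cons.inj h).1

theorem rotate_seg (hA : CyclicWord A l) {m : ℕ} (hm : 1 ≤ m) (i : ℕ) :
    (seg A 0 (m * l)).rotate i = seg A i (m * l) := by
  induction i with
  | zero => simp
  | succ i ih =>
    rw [← List.rotate_rotate, ih]
    have hpos : 0 < m * l := Nat.mul_pos hm hA.pos
    obtain ⟨N, hN⟩ := Nat.exists_eq_succ_of_ne_zero hpos.ne'
    rw [hN, Nat.succ_eq_add_one, seg_succ, List.rotate_cons_succ, List.rotate_zero, seg_concat]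
    congr 2
    rw [← hA.per_mul i m, hN]
    congr 1
    omega

theorem period_seg (hA : CyclicWord A l) {m : ℕ} (hm : 1 ≤ m) :
    period (seg A 0 (m * l)) = l := by
  have hpos : 0 < m * l := Nat.mul_pos hm hA.pos
  have key : ∀ n, Function.IsPeriodicPt (fun v : List E => v.rotate 1) n (seg A 0 (m * l)) ↔
      l ∣ n := by
    intro n
    have h1 : (fun v : List E => v.rotate 1)^[n] (seg A 0 (m * l)) = seg A n (m * l) := by
      induction n with
      | zero => rfl
      | succ n ih =>
        rw [Function.iterate_succ_apply', ih, ← hA.rotate_seg hm, List.rotate_rotate,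
          hA.rotate_seg hm]
    rw [Function.IsPeriodicPt, Function.IsFixedPt, h1, ← Nat.modEq_zero_iff_dvd]
    exact ⟨fun h => hA.seg_inj hpos h, fun h => hA.seg_congr h _⟩
  exact Nat.dvd_antisymm (((key l).2 dvd_rfl).minimalPeriod_dvd)
    ((key _).1 (Function.isPeriodicPt_minimalPeriod _ _))

theorem wpow_seg (hA : CyclicWord A l) (m : ℕ) : wpow (seg A 0 l) m = seg A 0 (m * l) := by
  induction m with
  | zero => simp [wpow]
  | succ m ih =>
    rw [wpow, List.replicate_succ, List.flatten_cons, ← wpow, ih, Nat.succ_mul, add_comm, seg_add,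
      hA.seg_congr (r := 0 + l) (s := 0)]
    simp [Nat.ModEq]

end CyclicWord

/-- If two letters agree, uniqueness of `R`-successors makes the sequence invariant under the
difference of their positions, and primitivity forces this difference to be a multiple of the
length. So a primitive cycle repeats no letter. -/
theorem exists_cyclicWord {R : E → E → Prop} (hR : ∀ a b c, R a b → R a c → b = c) {u : List E}
    (hu : u ≠ []) (hc : (u ++ u.take 1).IsChain R) (hp : IsPrimitive u) :
    ∃ A : ℕ → E, CyclicWord A u.length ∧ (∀ t, R (A t) (A (t + 1))) ∧
      u = seg A 0 u.length := by
  have hl : 0 < u.length := List.length_pos_iff.2 hu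
  let A : ℕ → E := fun t => u[t % u.length]'(Nat.mod_lt _ hl)
  have hper : ∀ t, A (t + u.length) = A t := fun t => by simp [A]
  have hAR : ∀ t, R (A t) (A (t + 1)) := by
    intro t
    rw [List.isChain_iff_getElem] at hc
    have ht := Nat.mod_lt t hl
    have := hc (t % u.length) (by simp; omega)
    rw [List.getElem_append_left ht] at this
    convert this using 1
    by_cases h : t % u.length + 1 < u.length
    · rw [List.getElem_append_left h]
      have : (t + 1) % u.length = t % u.length + 1 := by
        rw [Nat.add_mod, Nat.mod_eq_of_lt (a := 1) (by omega), Nat.mod_eq_of_lt h]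
      simp only [A, this]
    · have h' : t % u.length + 1 = u.length := by omega
      have : (t + 1) % u.length = 0 := by
        rw [← Nat.mod_add_mod, h', Nat.mod_self]
      rw [List.getElem_append_right (by omega)]
      simp [A, this, h']
  have hseg : u = seg A 0 u.length := by
    refine List.ext_getElem (by simp) fun n h1 h2 => ?_
    simp [seg, A, Nat.mod_eq_of_lt h1]
  have hstep : ∀ s t, A s = A t → ∀ n, A (s + n) = A (t + n) := by
    intro s t h n
    induction n with
    | zero => exact h
    | succ n ih => exact hR _ _ _ (hAR (s + n)) (by rw [ih]; exact hAR (t + n))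
  have hmul : ∀ t q, A (t + q * u.length) = A t := by
    intro t q
    induction q with
    | zero => simp
    | succ q ih => rw [Nat.succ_mul, ← add_assoc, hper, ih]
  have hdvd : ∀ n, (∀ t, A (t + n) = A t) → u.length ∣ n := by
    intro n hn
    rw [hp, period]
    refine Function.IsPeriodicPt.minimalPeriod_dvd ?_
    have h1 : ∀ n, (fun v : List E => v.rotate 1)^[n] u = u.rotate n := by
      intro n
      induction n with
      | zero => simp
      | succ n ih => rw [Function.iterate_succ_apply', ih, List.rotate_rotate]
    rw [Function.IsPeriodicPt, Function.IsFixedPt, h1]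
    refine List.ext_getElem (by simp) fun j h1 h2 => ?_
    rw [List.getElem_rotate]
    have := hn j
    simpa [A, Nat.mod_eq_of_lt h2] using this
  have hle : ∀ s t, s ≤ t → A s = A t → s ≡ t [MOD u.length] := by
    intro s t hst h
    refine (Nat.modEq_iff_dvd' hst).2 (hdvd _ fun n => ?_)
    -- Shifting by the multiple `s * u.length` of the period allows one to go back by `s` without
    -- leaving the natural numbers.
    have h1 := hstep s t h (n + s * u.length - s)
    have h2 : s ≤ s * u.length := Nat.le_mul_of_pos_right s hl
    rw [show s + (n + s * u.length - s) = n + s * u.length by omega,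
      show t + (n + s * u.length - s) = n + (t - s) + s * u.length by omega, hmul, hmul] at h1
    exact h1.symm
  refine ⟨A, ⟨hl, hper, fun s t h => ?_⟩, hAR, hseg⟩
  rcases le_total s t with hst | hst
  · exact hle s t hst h
  · exact (hle t s hst h.symm).symm

end Cyclic

/-! ### Degrees of full turns, and signs modulo the parity of `d`. -/

section Degree

variable {V E : Type*} (Q : GradedGentleQuiver V E) {A : ℕ → E} {l : ℕ}

/-- Moving the starting point of a full turn by one step removes and adds the same letter. -/
theorem wdeg_seg_mul (hA : CyclicWord A l) (r q : ℕ) :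
    Q.wdeg (seg A r (q * l)) = q * Q.wdeg (seg A 0 l) := by
  have h1 : ∀ r, Q.wdeg (seg A r l) = Q.wdeg (seg A 0 l) := by
    intro r
    induction r with
    | zero => rfl
    | succ r ih =>
      rw [← ih]
      have e1 := congrArg Q.wdeg (seg_succ A r l)
      have e2 := congrArg Q.wdeg (seg_concat A r l)
      rw [hA.per] at e2
      simp only [wdeg, List.map_cons, List.sum_cons, List.map_append, List.sum_append,
        List.map_nil, List.sum_nil] at e1 e2 ⊢
      linarith
  induction q generalizing r with
  | zero => simp [wdeg]
  | succ q ih =>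
    rw [Nat.succ_mul, seg_add]
    have := ih r
    have h2 := h1 (r + q * l)
    simp only [wdeg, List.map_append, List.sum_append] at this h2 ⊢
    rw [this, h2]; push_cast; ring

end Degree

section Sign

variable {k : Type*} [Field k] {M : Type*} [AddCommGroup M] [Module k M]

theorem neg_eq_self_of_char [CharP k 2] (x : M) : -x = x := by
  rw [← neg_one_smul k x, CharTwo.neg_eq, one_smul]

/-- Signs whose exponents differ by a multiple of `d` modulo `2` agree if `d` is even or the
characteristic is `2`. -/
theorem negOnePow_smul_congr {d : ℤ} (h : Even d ∨ CharP k 2) {n n' : ℤ} (c : ℤ)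
    (hn : Even (n - n' - d * c)) (x : M) : n.negOnePow • x = n'.negOnePow • x := by
  rcases h with h | h
  · rw [negOnePow_congr]
    have := hn.add (h.mul_right c)
    rwa [sub_add_cancel] at this
  · have key : ∀ n : ℤ, n.negOnePow • x = x := by
      intro n
      rcases negOnePow_cases n with h | h
      · rw [h, one_smul]
      · rw [h, Units.neg_smul, one_smul, neg_eq_self_of_char (k := k)]
    rw [key, key]

end Sign
end GradedGentleQuiver

/-! ### Locality of the differential and of the bracket in the arity. -/

namespace GradedHochschild

section Local

variable {k A : Type*} [Field k] [Ring A] [Algebra k A] (𝒜 : ℤ → Submodule k A) [GradedAlgebra 𝒜]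

/-- Words of length `n + 1` only see the component of arity `n`. This permits arguments with
infinite sums that are finite in each arity. -/
theorem differential_congr (i : ℤ) {f g : List A → A} {n : ℕ}
    (h : ∀ w : List A, w.length = n → f w = g w) (w : List A) (hw : w.length = n + 1) :
    differential 𝒜 i f w = differential 𝒜 i g w := by
  rcases w with _ | ⟨a, w⟩
  · simp at hw
  have hn : w.length = n := by simpa using hw
  change differentialFun 𝒜 i f (a :: w) = differentialFun 𝒜 i g (a :: w)
  simp only [differentialFun]
  rw [h w hn, h (a :: w).dropLast (by simpa using hn)]
  congr 2
  refine Finset.sum_congr rfl fun l hl => ?_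
  rw [h]
  have := Finset.mem_range.1 hl
  simp only [mergeAt, List.length_append, List.length_take, List.length_cons, List.length_drop]
  omega

theorem differential_nil (i : ℤ) (f : List A → A) : differential 𝒜 i f [] = 0 := rfl

/-- The bound is `n + 1` because inserting the value of a component of arity zero lengthens the word
by one letter. -/
theorem circ_congr (j : ℤ) {f f' g g' : List A → A} {n : ℕ}
    (hf : ∀ w : List A, w.length ≤ n + 1 → f w = f' w)
    (hg : ∀ w : List A, w.length ≤ n + 1 → g w = g' w) (w : List A) (hw : w.length = n) :
    circ 𝒜 j f g w = circ 𝒜 j f' g' w := by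
  refine Finset.sum_congr rfl fun p hp => Finset.sum_congr rfl fun q hq => ?_
  have := Finset.mem_range.1 hp
  have := Finset.mem_range.1 hq
  rw [hg _ (by simp; omega), hf]
  simp only [List.length_append, List.length_map, List.length_take, List.length_cons,
    List.length_drop]
  omega

theorem bracket_congr (i j : ℤ) {f f' g g' : List A → A} {n : ℕ}
    (hf : ∀ w : List A, w.length ≤ n + 1 → f w = f' w)
    (hg : ∀ w : List A, w.length ≤ n + 1 → g w = g' w) (w : List A) (hw : w.length = n) :
    bracket 𝒜 i j f g w = bracket 𝒜 i j f' g' w := by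
  rw [bracket, bracket, Pi.sub_apply, Pi.sub_apply, Pi.smul_apply, Pi.smul_apply,
    circ_congr 𝒜 j hf hg w hw, circ_congr 𝒜 i hg hf w hw]

end Local

end GradedHochschild

/-! ### Composition on words of arrows, and degrees along the cycle. -/

namespace GradedGentleQuiver

section CircArrows

variable {V E : Type*} [Fintype V] {Q : GradedGentleQuiver V E} {k : Type*} [Field k]

theorem _root_.GradedHochschild.Multi.arity {f : List (Q.Alg k) → Q.Alg k} (hm : Multi k f) {n : ℕ}
    (h : ∀ l : List Q.NPath, l.length ≠ n → f (pword Q k l) = 0) (w : List (Q.Alg k))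
    (hw : w.length ≠ n) : f w = 0 := by
  classical
  have e : f = fun w => if w.length = n then f w else 0 := by
    refine Multi.ext_pword hm (fun u v c a b => ?_) fun l => ?_
    · simp only [List.length_append, List.length_cons]
      split_ifs
      · exact hm u v c a b
      · simp
    · simp only [length_pword]
      split_ifs with h'
      · rfl
      · exact h l h'
  rw [e]
  exact if_neg hw

theorem parallelCochain_arity (p : List E) (s : ℤ) (b : Q.Alg k) (w : List (Q.Alg k))
    (hw : w.length ≠ p.length) : Q.parallelCochain k p s b w = 0 :=
  (parallelCochain_multi p s b).arity (fun _ hl => parallelCochain_length hl) w hw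

theorem Relative.sum {ι : Type*} {s : Finset ι} {F : ι → List (Q.Alg k) → Q.Alg k}
    (h : ∀ i ∈ s, Relative (F i)) : Relative (∑ i ∈ s, F i) := by
  intro l q hq
  rw [Finset.sum_apply] at hq
  obtain ⟨i, hi, hq⟩ := coef_sum_ne hq
  exact h i hi l q hq

theorem ldeg_aword (v : List E) : ldeg (aword Q v) = Q.wdeg v := by
  simp only [ldeg, aword, List.map_map, wdeg]
  congr 2
  funext a
  simp [NPath.deg, wdeg, arrowPath]

/-- The composition of cochains on a word of arrows, if the second one has arity `n`. -/
theorem circ_aword {f g : List (Q.Alg k) → Q.Alg k} (hm : Multi k f) {n : ℕ}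
    (hg : ∀ w : List (Q.Alg k), w.length ≠ n → g w = 0) (j : ℤ) (v : List E) :
    circ (Q.grading k) j f g (pword Q k (aword Q v)) =
      ∑ p ∈ Finset.range (v.length + 1 - n),
        ((p : ℤ) * ((n : ℤ) - 1) + ((v.length : ℤ) - n) * (j - 1)
          + (j - n) * Q.wdeg (v.take p)).negOnePow •
        f (pword Q k (aword Q (v.take p)) ++ g (pword Q k (aword Q ((v.drop p).take n)))
          :: pword Q k (aword Q (v.drop (p + n)))) := by
  have e1 : ∀ p, ((pword Q k (aword Q v)).take p) = pword Q k (aword Q (v.take p)) := by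
    intro p; simp [pword, aword, List.map_take]
  have e2 : ∀ p n, ((pword Q k (aword Q v)).drop p).take n
      = pword Q k (aword Q ((v.drop p).take n)) := by
    intro p n; simp [pword, aword, List.map_take, List.map_drop]
  have e3 : ∀ p, ((pword Q k (aword Q v)).drop p) = pword Q k (aword Q (v.drop p)) := by
    intro p; simp [pword, aword, List.map_drop]
  have hsub : Finset.range (v.length + 1 - n) ⊆ Finset.range (v.length + 1) :=
    Finset.range_subset_range.2 (Nat.sub_le _ _)
  unfold circ
  simp only [length_pword, length_aword]
  rw [← Finset.sum_subset hsub]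
  · refine Finset.sum_congr rfl fun p hp => ?_
    have hp := Finset.mem_range.1 hp
    rw [Finset.sum_eq_single n]
    · rw [e1, e2, e3]
      have := hm.koszul_pword (j - n) [] (aword Q (v.take p))
        (g (pword Q k (aword Q ((v.drop p).take n))) :: pword Q k (aword Q (v.drop (p + n))))
      simp only [List.nil_append] at this
      rw [this, smul_smul, ← Int.negOnePow_add, ldeg_aword]
    · intro n' hn' hne
      have := Finset.mem_range.1 hn'
      rw [hg _ (by simp; omega), hm.zero, smul_zero]
    · intro h
      exact absurd (Finset.mem_range.2 (by omega)) h
  · intro p hp hp'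
    have := Finset.mem_range.1 hp
    have h2 : ¬ p < v.length + 1 - n := fun h => hp' (Finset.mem_range.2 h)
    refine Finset.sum_eq_zero fun n' hn' => ?_
    have := Finset.mem_range.1 hn'
    rw [hg _ (by simp; omega), hm.zero, smul_zero]

/-- Normalised cochains vanish on words with a multiple of a trivial path. -/
theorem circ_aword_trivial {f g : List (Q.Alg k) → Q.Alg k} (hm : Multi k f) (hf : Relative f)
    {n : ℕ} (hg : ∀ w : List (Q.Alg k), w.length ≠ n → g w = 0)
    (ht : ∀ v : List E, g (pword Q k (aword Q v)) = 0 ∨ ∃ (s : ℤˣ) (x : V),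
      g (pword Q k (aword Q v)) = s • Q.ofPath k (Q.trivialPath x)) (j : ℤ) (v : List E) :
    circ (Q.grading k) j f g (pword Q k (aword Q v)) = 0 := by
  rw [circ_aword hm hg]
  refine Finset.sum_eq_zero fun p _ => ?_
  rcases ht ((v.drop p).take n) with h | ⟨s, x, h⟩
  · rw [h, hm.zero, smul_zero]
  · rw [h, hm.units_smul]
    have := hf.normal.1 (aword Q (v.take p)) (aword Q (v.drop (p + n))) (Q.trivialPath x) rfl
    rw [pword_append, pword_cons] at this
    rw [this, smul_zero, smul_zero]

end CircArrows

section CyclicDegree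

variable {V E : Type*} (Q : GradedGentleQuiver V E) {A : ℕ → E} {l : ℕ}

/-- The degree of `A_0 ⋯ A_{r-1}`. -/
def cdeg (A : ℕ → E) (r : ℕ) : ℤ := Q.wdeg (seg A 0 r)

theorem cdeg_zero (A : ℕ → E) : Q.cdeg A 0 = 0 := rfl

theorem wdeg_seg (A : ℕ → E) (r N : ℕ) : Q.wdeg (seg A r N) = Q.cdeg A (r + N) - Q.cdeg A r := by
  rw [cdeg, cdeg, seg_add, wdeg, wdeg, List.map_append, List.sum_append, zero_add, wdeg]
  ring

theorem cdeg_succ (A : ℕ → E) (r : ℕ) : Q.cdeg A (r + 1) = Q.cdeg A r + Q.deg (A r) := by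
  have := wdeg_seg Q A r 1
  rw [seg_one, wdeg, List.map_singleton, List.sum_singleton] at this
  linarith

theorem cdeg_add_mul (hA : CyclicWord A l) (r q : ℕ) :
    Q.cdeg A (r + q * l) = Q.cdeg A r + q * Q.cdeg A l := by
  have h1 := wdeg_seg Q A r (q * l)
  rw [wdeg_seg_mul Q hA] at h1
  have h2 : Q.cdeg A l = Q.wdeg (seg A 0 l) := rfl
  rw [h2]
  linarith

theorem cdeg_mul (hA : CyclicWord A l) (q : ℕ) : Q.cdeg A (q * l) = q * Q.cdeg A l := by
  have := cdeg_add_mul Q hA 0 q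
  rwa [zero_add, cdeg_zero, zero_add] at this

/-- Sign comparisons become polynomial identities in parities over `ZMod 2`, which a finite check
settles. -/
theorem even_iff_zmod (n : ℤ) : Even n ↔ (n : ZMod 2) = 0 := by
  rw [ZMod.intCast_zmod_eq_zero_iff_dvd, even_iff_two_dvd]; rfl

end CyclicDegree
end GradedGentleQuiver

/-! ### The cocycles of a complete anti-path. -/

namespace GradedGentleQuiver

section Antipath

variable {V E : Type*} [Fintype V] {Q : GradedGentleQuiver V E} {k : Type*} [Field k]
variable {A : ℕ → E} {l : ℕ} {d : ℤ}

/-- The exponent of the sign of the `r`-th summand of `N^0(u^m)` for a complete anti-path `u`. -/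
def antiSign (Q : GradedGentleQuiver V E) (A : ℕ → E) (l m r : ℕ) : ℤ :=
  (r : ℤ) * (m * l) + m * Q.cdeg A l * Q.cdeg A r

theorem tgt_per (hA : CyclicWord A l) (hrel : ∀ t, Q.rel (A t) (A (t + 1))) (m r : ℕ)
    (h : 0 < m * l) : Q.src (A (r + (m * l - 1))) = Q.tgt (A r) := by
  rw [Q.rel_comp _ _ (hrel _), ← hA.per_mul r m]
  congr 2; omega

theorem getLast?_seg (A : ℕ → E) (r : ℕ) {N : ℕ} (h : 0 < N) :
    (seg A r N).getLast? = some (A (r + (N - 1))) := by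
  obtain ⟨N, rfl⟩ := Nat.exists_eq_succ_of_ne_zero h.ne'
  rw [Nat.succ_eq_add_one, seg_concat, List.getLast?_concat]; rfl

theorem antiN0_seg (hA : CyclicWord A l) (hrel : ∀ t, Q.rel (A t) (A (t + 1))) {m : ℕ}
    (hm : 1 ≤ m) : Q.antiN0 k (seg A 0 (m * l)) =
      ∑ r ∈ Finset.range l, (antiSign Q A l m r).negOnePow •
        Q.parallelCochain k (seg A r (m * l)) (-(m * Q.cdeg A l))
          (Q.ofPath k (Q.trivialPath (Q.tgt (A r)))) := by
  have hpos : 0 < m * l := Nat.mul_pos hm hA.pos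
  rw [antiN0, hA.period_seg hm]
  refine Finset.sum_congr rfl fun r hr => ?_
  have hr := Finset.mem_range.1 hr
  have hle : l ≤ m * l := Nat.le_mul_of_pos_left l hm
  have e1 : (seg A 0 (m * l)).take r = seg A 0 r := by
    conv_lhs => rw [show m * l = r + (m * l - r) by omega, seg_add]
    rw [List.take_left' (by simp)]
  have e2 : Q.wdeg (seg A 0 (m * l)) = m * Q.cdeg A l := cdeg_mul Q hA m
  rw [hA.rotate_seg hm, e1, e2, startIdem, getLast?_seg _ _ hpos, Option.elim_some,
    tgt_per hA hrel m r hpos, antiSign, length_seg]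
  push_cast
  rfl

theorem antiN1_seg (hA : CyclicWord A l) {m : ℕ} (hm : 1 ≤ m) :
    Q.antiN1 k (seg A 0 (m * l)) =
      Q.parallelCochain k (seg A (l - 1) (m * l + 1)) (-(m * Q.cdeg A l))
        (Q.wordElt k [A (l - 1)]) := by
  have hpos : 0 < m * l := Nat.mul_pos hm hA.pos
  have hl := hA.pos
  have hle : l ≤ m * l := Nat.le_mul_of_pos_left l hm
  have e : A (0 + (m * l - 1)) = A (l - 1) := by
    obtain ⟨m, rfl⟩ := Nat.exists_eq_succ_of_ne_zero (Nat.one_le_iff_ne_zero.1 hm)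
    rw [← hA.per_mul (l - 1) m]
    congr 1
    rw [Nat.succ_mul]; omega
  have e2 : Q.wdeg (seg A 0 (m * l)) = m * Q.cdeg A l := cdeg_mul Q hA m
  rw [antiN1, getLast?_seg _ _ hpos, Option.elim_some, e, e2, seg_succ,
    hA.seg_congr (r := l - 1 + 1) (s := 0)]
  rw [Nat.sub_add_cancel hl]; simp [Nat.ModEq]

theorem antiN1_mem_cochains (hA : CyclicWord A l) (hd : d = l - Q.cdeg A l) {m : ℕ} (hm : 1 ≤ m) :
    Q.antiN1 k (seg A 0 (m * l)) ∈ cochains (Q.grading k) (m * d + 1) := by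
  rw [antiN1_seg hA hm]
  refine parallelCochain_mem (wordElt_mem _) ?_ ?_
  · rw [seg_succ, hA.seg_congr (r := l - 1 + 1) (s := 0), wdeg_cons, wdeg_cons, wdeg_seg, zero_add,
      cdeg_mul Q hA, cdeg_zero]
    · simp [wdeg]
    · rw [Nat.sub_add_cancel hA.pos]; simp [Nat.ModEq]
  · rw [hd, length_seg]; push_cast; ring

theorem antiN1_parallel (hA : CyclicWord A l) (m : ℕ) :
    ParallelTo (seg A (l - 1) (m * l + 1)) (Q.wordElt k [A (l - 1)]) := by
  intro r hr
  rw [wordElt_singleton] at hr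
  obtain rfl := coef_ofPath_ne hr
  constructor
  · intro a ha
    rw [seg_succ] at ha
    obtain rfl : A (l - 1) = a := by simpa using ha
    rfl
  · intro a ha
    rw [getLast?_seg _ _ (Nat.succ_pos _), Nat.succ_sub_one, hA.per_mul] at ha
    obtain rfl : A (l - 1) = a := by simpa using ha
    rfl

theorem antiN0_parallel (hA : CyclicWord A l) (hrel : ∀ t, Q.rel (A t) (A (t + 1))) {m : ℕ}
    (hpos : 0 < m * l) (r : ℕ) :
    ParallelTo (seg A r (m * l)) (Q.ofPath k (Q.trivialPath (Q.tgt (A r)))) := by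
  intro q hq
  obtain rfl := coef_ofPath_ne hq
  constructor
  · intro a ha
    rw [← Nat.sub_add_cancel hpos, seg_succ] at ha
    obtain rfl : A r = a := by simpa using ha
    rfl
  · intro a ha
    rw [getLast?_seg _ _ hpos] at ha
    obtain rfl : A _ = a := by simpa using ha
    exact (tgt_per hA hrel m r hpos).symm

theorem antiN1_relative (hA : CyclicWord A l) (hrel : ∀ t, Q.rel (A t) (A (t + 1))) {m : ℕ}
    (hm : 1 ≤ m) : Relative (Q.antiN1 k (seg A 0 (m * l))) := by
  rw [antiN1_seg hA hm]
  refine parallelCochain_relative (by rw [seg_succ]; simp) (seg_isChain hrel _ _) _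
    (antiN1_parallel hA m)

theorem antiN0_mem_cochains (hA : CyclicWord A l) (hrel : ∀ t, Q.rel (A t) (A (t + 1)))
    (hd : d = l - Q.cdeg A l) {m : ℕ} (hm : 1 ≤ m) :
    Q.antiN0 k (seg A 0 (m * l)) ∈ cochains (Q.grading k) (m * d) := by
  rw [antiN0_seg hA hrel hm]
  refine sum_mem fun r _ => units_smul_mem _ _ ?_
  refine parallelCochain_mem (n := 0) ?_ ?_ ?_
  · exact ofPath_mem_grading (Q.trivialPath _)
  · rw [wdeg_seg, cdeg_add_mul Q hA]; ring
  · rw [hd, length_seg]; push_cast; ring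

theorem antiN0_relative (hA : CyclicWord A l) (hrel : ∀ t, Q.rel (A t) (A (t + 1))) {m : ℕ}
    (hm : 1 ≤ m) : Relative (Q.antiN0 k (seg A 0 (m * l))) := by
  have hpos : 0 < m * l := Nat.mul_pos hm hA.pos
  rw [antiN0_seg hA hrel hm]
  refine Relative.sum fun r _ => Relative.units_smul ?_ _
  refine parallelCochain_relative (by rw [← List.length_pos_iff, length_seg]; exact hpos)
    (seg_isChain hrel _ _) _ (antiN0_parallel hA hrel hpos r)

theorem antiN0_arity (hA : CyclicWord A l) (hrel : ∀ t, Q.rel (A t) (A (t + 1))) {m : ℕ}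
    (hm : 1 ≤ m) (w : List (Q.Alg k)) (hw : w.length ≠ m * l) :
    Q.antiN0 k (seg A 0 (m * l)) w = 0 := by
  rw [antiN0_seg hA hrel hm, Finset.sum_apply]
  refine Finset.sum_eq_zero fun r _ => ?_
  rw [Pi.smul_apply, parallelCochain_arity _ _ _ _ (by simpa using hw), smul_zero]

theorem antiN1_arity (hA : CyclicWord A l) {m : ℕ} (hm : 1 ≤ m) (w : List (Q.Alg k))
    (hw : w.length ≠ m * l + 1) : Q.antiN1 k (seg A 0 (m * l)) w = 0 := by
  rw [antiN1_seg hA hm, parallelCochain_arity _ _ _ _ (by simpa using hw)]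

theorem antiN1_aword (hA : CyclicWord A l) {m : ℕ} (hm : 1 ≤ m) :
    Q.antiN1 k (seg A 0 (m * l)) (pword Q k (aword Q (seg A (l - 1) (m * l + 1))))
      = Q.ofPath k (Q.arrowPath (A (l - 1))) := by
  rw [antiN1_seg hA hm, parallelCochain_aword (by rw [seg_succ]; simp), if_pos rfl,
    wordElt_singleton]

theorem antiN1_aword_of_ne (hA : CyclicWord A l) {m : ℕ} (hm : 1 ≤ m) {v : List E}
    (hv : v ≠ seg A (l - 1) (m * l + 1)) :
    Q.antiN1 k (seg A 0 (m * l)) (pword Q k (aword Q v)) = 0 := by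
  rw [antiN1_seg hA hm, parallelCochain_aword (by rw [seg_succ]; simp), if_neg hv]

/-- The definition only involves starting points `r < l`. The formula holds for every `r` because
the parity of `d` makes the sign independent of additional full turns. -/
theorem antiN0_aword (hA : CyclicWord A l) (hrel : ∀ t, Q.rel (A t) (A (t + 1)))
    (hd : d = l - Q.cdeg A l) (h2 : Even d ∨ CharP k 2) {m : ℕ} (hm : 1 ≤ m) (r : ℕ) :
    Q.antiN0 k (seg A 0 (m * l)) (pword Q k (aword Q (seg A r (m * l))))
      = (antiSign Q A l m r).negOnePow • Q.ofPath k (Q.trivialPath (Q.tgt (A r))) := by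
  have hpos : 0 < m * l := Nat.mul_pos hm hA.pos
  have hne : ∀ r, seg A r (m * l) ≠ [] := fun r => by
    rw [← List.length_pos_iff, length_seg]; exact hpos
  rw [antiN0_seg hA hrel hm, Finset.sum_apply, Finset.sum_eq_single (r % l)]
  · rw [Pi.smul_apply, parallelCochain_aword (hne _), if_pos, hA.congr (Nat.mod_modEq r l)]
    -- Each of the `r / l` full turns changes the exponent by `m` times the sum of the squares of
    -- `l` and `|u|`, which has the parity of `m * d`.
    · refine negOnePow_smul_congr h2 (m * (r / l)) ?_ _
      have e : (r : ℤ) = (r % l : ℕ) + (r / l : ℕ) * l := by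
        have := Nat.mod_add_div r l
        rw [mul_comm] at this
        exact_mod_cast this.symm
      have e2 := cdeg_add_mul Q hA (r % l) (r / l)
      rw [show r % l + r / l * l = r by rw [mul_comm]; exact Nat.mod_add_div r l] at e2
      unfold antiSign
      have e3 : ((r : ℤ) / (l : ℤ)) = ((r / l : ℕ) : ℤ) := by push_cast; rfl
      rw [e3, e2, e, hd, even_iff_zmod]
      generalize ((r % l : ℕ) : ℤ) = x
      generalize r / l = y
      push_cast
      generalize ((y : ℕ) : ZMod 2) = y
      generalize ((l : ℕ) : ZMod 2) = l'
      generalize ((x : ℤ) : ZMod 2) = x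
      generalize ((m : ℕ) : ZMod 2) = m'
      generalize ((Q.cdeg A l : ℤ) : ZMod 2) = c
      generalize ((Q.cdeg A (r % l) : ℤ) : ZMod 2) = c'
      revert y l' x m' c c'
      decide
    · exact hA.seg_congr (Nat.mod_modEq r l).symm _
  · intro s hs hne'
    rw [Pi.smul_apply, parallelCochain_aword (hne _), if_neg, smul_zero]
    intro h
    apply hne'
    have := hA.seg_inj hpos h
    rw [Nat.ModEq, Nat.mod_eq_of_lt (Finset.mem_range.1 hs)] at this
    exact this.symm
  · intro h
    exact absurd (Finset.mem_range.2 (Nat.mod_lt _ hA.pos)) h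

theorem antiN0_aword_of_ne (hA : CyclicWord A l) (hrel : ∀ t, Q.rel (A t) (A (t + 1)))
    {m : ℕ} (hm : 1 ≤ m) {v : List E} (hv : ∀ r, v ≠ seg A r (m * l)) :
    Q.antiN0 k (seg A 0 (m * l)) (pword Q k (aword Q v)) = 0 := by
  have hpos : 0 < m * l := Nat.mul_pos hm hA.pos
  rw [antiN0_seg hA hrel hm, Finset.sum_apply]
  refine Finset.sum_eq_zero fun r _ => ?_
  rw [Pi.smul_apply, parallelCochain_aword, if_neg (hv r), smul_zero]
  rw [← List.length_pos_iff, length_seg]; exact hpos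

theorem differential_units_sum {ι : Type*} (s : Finset ι) (c : ι → ℤˣ)
    (F : ι → List (Q.Alg k) → Q.Alg k) (i : ℤ) :
    differential (Q.grading k) i (∑ r ∈ s, c r • F r)
      = ∑ r ∈ s, c r • differential (Q.grading k) i (F r) := by
  rw [map_sum]
  refine Finset.sum_congr rfl fun r _ => ?_
  rw [Units.smul_def, Units.smul_def, map_zsmul]

/-- On a critical word an outer term multiplies `A_{l-1}` by an arrow which forms a relation with
it, so it vanishes. -/
theorem antiN1_mem_cocycles (hA : CyclicWord A l) (hrel : ∀ t, Q.rel (A t) (A (t + 1)))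
    (hd : d = l - Q.cdeg A l) {m : ℕ} (hm : 1 ≤ m) :
    Q.antiN1 k (seg A 0 (m * l)) ∈ cocycles (Q.grading k) (m * d + 1) := by
  have hc := antiN1_mem_cochains (k := k) hA hd hm
  have hr := antiN1_relative (k := k) hA hrel hm
  have hne : seg A (l - 1) (m * l + 1) ≠ [] := by rw [seg_succ]; simp
  refine mem_cocycles_of_long_of_crit hc hr ?_ ?_
  · rintro L ⟨s, M, hL⟩
    rw [antiN1_seg hA hm]
    refine differential_parallelCochain_long hne (seg_isChain hrel _ _) ?_ (antiN1_parallel hA m) hL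
    rw [hd, length_seg]; push_cast; ring
  · intro L hL
    obtain ⟨v, hv, rfl⟩ := hL.exists_aword
    rcases v with _ | ⟨x, v⟩
    · rfl
    obtain ⟨w, y, hw⟩ : ∃ w y, x :: v = w ++ [y] :=
      ⟨_, _, (List.dropLast_append_getLast (List.cons_ne_nil x v)).symm⟩
    rw [differential_aword (cochains_multi hc) _ x v w y hv hw]
    have h1 : Q.wordElt k [x] * Q.antiN1 k (seg A 0 (m * l)) (pword Q k (aword Q v)) = 0 := by
      by_cases h : v = seg A (l - 1) (m * l + 1)
      · rw [h, antiN1_aword hA hm, wordElt_singleton]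
        apply arrow_mul_arrow_eq_zero
        rw [h, seg_succ, List.isChain_cons_cons] at hv
        exact fun h' => h'.2 hv.1
      · rw [antiN1_aword_of_ne hA hm h, mul_zero]
    have h2 : Q.antiN1 k (seg A 0 (m * l)) (pword Q k (aword Q w)) * Q.wordElt k [y] = 0 := by
      by_cases h : w = seg A (l - 1) (m * l + 1)
      · rw [h, antiN1_aword hA hm, wordElt_singleton]
        apply arrow_mul_arrow_eq_zero
        rw [hw, h, List.isChain_append] at hv
        have := hv.2.2 (A (l - 1)) (by
          rw [getLast?_seg _ _ (Nat.succ_pos _), Nat.succ_sub_one, hA.per_mul]; rfl) y (by simp)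
        exact fun h' => h'.2 this
      · rw [antiN1_aword_of_ne hA hm h, zero_mul]
    rw [h1, h2]; simp

theorem arrow_mul_trivial (a : E) :
    Q.wordElt k [a] * Q.ofPath k (Q.trivialPath (Q.src a)) = Q.wordElt k [a] := by
  rw [wordElt_singleton]
  exact mul_trivialPath fun q hq => by rw [← coef_ofPath_ne hq]; rfl

theorem trivial_mul_arrow (a : E) :
    Q.ofPath k (Q.trivialPath (Q.tgt a)) * Q.wordElt k [a] = Q.wordElt k [a] := by
  rw [wordElt_singleton]
  exact trivialPath_mul fun q hq => by rw [← coef_ofPath_ne hq]; rfl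

/-- On a stretch of `m l + 1` letters starting at `r` both outer terms are multiples of the arrow
`A_r`, and the values of `antiSign` at `r` and `r + 1` are matched so that they cancel. -/
theorem antiN0_mem_cocycles (hA : CyclicWord A l) (hrel : ∀ t, Q.rel (A t) (A (t + 1)))
    (hd : d = l - Q.cdeg A l) (h2 : Even d ∨ CharP k 2) {m : ℕ} (hm : 1 ≤ m) :
    Q.antiN0 k (seg A 0 (m * l)) ∈ cocycles (Q.grading k) (m * d) := by
  have hpos : 0 < m * l := Nat.mul_pos hm hA.pos
  have hc := antiN0_mem_cochains (k := k) hA hrel hd hm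
  have hr := antiN0_relative (k := k) hA hrel hm
  have hne : ∀ r, seg A r (m * l) ≠ [] := fun r => by
    rw [← List.length_pos_iff, length_seg]; exact hpos
  refine mem_cocycles_of_long_of_crit hc hr ?_ ?_
  · rintro L ⟨s, M, hL⟩
    rw [antiN0_seg hA hrel hm, differential_units_sum, Finset.sum_apply]
    refine Finset.sum_eq_zero fun r _ => ?_
    rw [Pi.smul_apply, differential_parallelCochain_long (hne r) (seg_isChain hrel _ _) ?_
      (antiN0_parallel hA hrel hpos r) hL, smul_zero]
    rw [hd, length_seg]; push_cast; ring
  · intro L hL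
    obtain ⟨v, hv, rfl⟩ := hL.exists_aword
    rcases v with _ | ⟨x, v⟩
    · rfl
    -- Off the cycle neither outer term occurs: an arrow has at most one related neighbour on either
    -- side, so a critical word that contains `m l` consecutive letters of the cycle and one more
    -- arrow stays on the cycle.
    by_cases hs : ∃ r, x :: v = seg A r (m * l + 1)
    · obtain ⟨r, hs⟩ := hs
      have hs1 := hs
      rw [seg_succ] at hs1
      obtain ⟨rfl, rfl⟩ := List.cons.inj hs1
      rw [differential_aword (cochains_multi hc) _ _ _ _ _ hv (hs.trans (seg_concat _ _ _)),
        antiN0_aword hA hrel hd h2 hm, antiN0_aword hA hrel hd h2 hm, hA.per_mul,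
        ← Q.rel_comp _ _ (hrel r), mul_smul_comm, arrow_mul_trivial, smul_mul_assoc,
        trivial_mul_arrow, smul_smul, smul_smul, ← Int.negOnePow_add, ← Int.negOnePow_add,
        length_seg]
      have : ∀ (a b : ℤ) (x : Q.Alg k), Even (a - b - 1) →
          a.negOnePow • x + b.negOnePow • x = 0 := by
        intro a b x h
        rw [show a.negOnePow = (b + 1).negOnePow from negOnePow_congr (by
          rwa [← sub_sub]), Int.negOnePow_succ, Units.neg_smul, neg_add_cancel]
      rw [this, smul_zero]
      unfold antiSign
      rw [cdeg_succ, even_iff_zmod, hd]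
      push_cast
      generalize ((r : ℕ) : ZMod 2) = y
      generalize ((l : ℕ) : ZMod 2) = l'
      generalize ((m : ℕ) : ZMod 2) = m'
      generalize ((Q.cdeg A l : ℤ) : ZMod 2) = c
      generalize ((Q.cdeg A r : ℤ) : ZMod 2) = c'
      generalize ((Q.deg (A r) : ℤ) : ZMod 2) = e
      revert y l' m' c c' e
      decide
    · obtain ⟨w, y, hw⟩ : ∃ w y, x :: v = w ++ [y] :=
        ⟨_, _, (List.dropLast_append_getLast (List.cons_ne_nil x v)).symm⟩
      rw [differential_aword (cochains_multi hc) _ x v w y hv hw,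
        antiN0_aword_of_ne hA hrel hm, antiN0_aword_of_ne hA hrel hm]
      · simp
      · intro r hr
        apply hs
        refine ⟨r, ?_⟩
        have h1 : ∃ v', x :: v = A r :: v' := by
          rw [hw, hr, ← Nat.sub_add_cancel hpos, seg_succ]; exact ⟨_, rfl⟩
        obtain ⟨v', h1⟩ := h1
        have h3 := congrArg List.length hw
        rw [List.length_append, hr, length_seg, h1] at h3
        rw [h1] at hv ⊢
        rw [eq_seg_of_isChain hrel Q.rel_right r v' hv]
        congr 1
      · intro r hr
        apply hs
        have h1 : x = A (r + (l - 1)) := by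
          refine Q.rel_left (A r) _ _ ?_ ?_
          · rw [hr, ← Nat.sub_add_cancel hpos, seg_succ, List.isChain_cons_cons] at hv
            exact hv.1
          · have := hrel (r + (l - 1))
            rwa [show r + (l - 1) + 1 = r + l by have := hA.pos; omega, hA.per] at this
        -- By periodicity this is the position before `r`, without subtracting from `r`.
        refine ⟨r + (l - 1), ?_⟩
        rw [seg_succ, ← h1, hr, show r + (l - 1) + 1 = r + l by have := hA.pos; omega,
          hA.seg_congr (r := r + l) (s := r)]
        simp [Nat.ModEq]

end Antipath
end GradedGentleQuiver

/-! ### Subpaths of a complete path. -/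

namespace GradedGentleQuiver

section SegPath

variable {V E : Type*} {Q : GradedGentleQuiver V E} {A : ℕ → E} {l : ℕ} {d : ℤ}

/-- The path `A_r ⋯ A_{r+N-1}`. -/
def segPath (hn : ∀ t, Q.nonrel (A t) (A (t + 1))) (r N : ℕ) : Q.NPath where
  tgt := Q.tgt (A r)
  word := seg A r N
  chain := seg_isChain hn r N
  tgt_eq a ha := by
    rcases N with _ | N
    · simp at ha
    · rw [seg_succ] at ha
      obtain rfl : A r = a := by simpa using ha
      rfl

theorem segPath_src (hn : ∀ t, Q.nonrel (A t) (A (t + 1))) (r N : ℕ) :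
    (segPath hn r N).src = Q.tgt (A (r + N)) := by
  rcases N with _ | N
  · rfl
  · rw [NPath.src_eq (w := seg A r N) (a := A (r + N)) (seg_concat A r N)]
    exact (hn _).1

theorem segPath_congr (hA : CyclicWord A l) (hn : ∀ t, Q.nonrel (A t) (A (t + 1))) {r s : ℕ}
    (h : r ≡ s [MOD l]) (N : ℕ) : segPath hn r N = segPath hn s N := by
  ext1
  · exact congrArg Q.tgt (hA.congr h)
  · exact hA.seg_congr h N

variable [Fintype V] {k : Type*} [Field k]

theorem arrow_mul_segPath (hn : ∀ t, Q.nonrel (A t) (A (t + 1))) (r N : ℕ) :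
    Q.wordElt k [A r] * Q.ofPath k (segPath hn (r + 1) N) = Q.ofPath k (segPath hn r (N + 1)) := by
  have hc : (Q.arrowPath (A r)).Comp (segPath hn (r + 1) N) := by
    refine ⟨(hn r).1, ?_⟩
    change ([A r] ++ seg A (r + 1) N).IsChain Q.nonrel
    rw [List.singleton_append, ← seg_succ]
    exact seg_isChain hn r _
  rw [wordElt_singleton, ofPath_mul_of_comp hc]
  congr 1
  ext1
  · rfl
  · exact (seg_succ A r N).symm

theorem segPath_mul_arrow (hn : ∀ t, Q.nonrel (A t) (A (t + 1))) (r N : ℕ) :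
    Q.ofPath k (segPath hn r N) * Q.wordElt k [A (r + N)] = Q.ofPath k (segPath hn r (N + 1)) := by
  have hc : (segPath hn r N).Comp (Q.arrowPath (A (r + N))) := by
    refine ⟨segPath_src hn r N, ?_⟩
    change (seg A r N ++ [A (r + N)]).IsChain Q.nonrel
    rw [← seg_concat]
    exact seg_isChain hn r _
  rw [wordElt_singleton, ofPath_mul_of_comp hc]
  congr 1
  ext1
  · rfl
  · exact (seg_concat A r N).symm

theorem segPath_mul_seg (hn : ∀ t, Q.nonrel (A t) (A (t + 1))) (r M N : ℕ) :
    Q.ofPath k (segPath hn r M) * Q.wordElt k (seg A (r + M) N)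
      = Q.ofPath k (segPath hn r (M + N)) := by
  induction N with
  | zero => simp
  | succ N ih =>
    rw [seg_concat, wordElt_append, ← mul_assoc, ih, add_assoc, segPath_mul_arrow, add_assoc]

/-- In a gentle quiver at most one arrow prolongs a given nontrivial path on a given side. -/
theorem arrow_mul_segPath_of_ne (hn : ∀ t, Q.nonrel (A t) (A (t + 1))) {r N : ℕ} (hN : 0 < N)
    {x : E} (hx : x ≠ A r) : Q.wordElt k [x] * Q.ofPath k (segPath hn (r + 1) N) = 0 := by
  obtain ⟨N, rfl⟩ := Nat.exists_eq_succ_of_ne_zero hN.ne'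
  rw [wordElt_singleton]
  apply ofPath_mul_of_not_comp
  rw [comp_iff_of_src (u := []) (a := x) rfl (seg_succ A (r + 1) N)]
  intro h
  exact hx (Q.nonrel_left _ _ _ h.1 h.2 (hn r).1 (hn r).2)

theorem segPath_mul_arrow_of_ne (hn : ∀ t, Q.nonrel (A t) (A (t + 1))) {r N : ℕ} (hN : 0 < N)
    {x : E} (hx : x ≠ A (r + N)) : Q.ofPath k (segPath hn r N) * Q.wordElt k [x] = 0 := by
  obtain ⟨N, rfl⟩ := Nat.exists_eq_succ_of_ne_zero hN.ne'
  rw [wordElt_singleton]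
  apply ofPath_mul_of_not_comp
  rw [comp_iff_of_src (v := []) (b := x) (seg_concat A r N) rfl]
  intro h
  exact hx (Q.nonrel_right _ _ _ h.1 h.2 (hn (r + N)).1 (hn (r + N)).2)

theorem wordElt_seg (hn : ∀ t, Q.nonrel (A t) (A (t + 1))) (r : ℕ) {N : ℕ} (hN : 0 < N) :
    Q.wordElt k (seg A r N) = Q.ofPath k (segPath hn r N) := by
  refine wordElt_path (p := segPath hn r N) ?_
  change seg A r N ≠ []
  rw [← List.length_pos_iff, length_seg]
  exact hN

variable [DecidableEq E]

/-- Each letter occurs once per turn. These multiplicities become the structure constants of the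
bracket. -/
theorem CyclicWord.count_seg (hA : CyclicWord A l) (a r q : ℕ) :
    (seg A r (q * l)).count (A a) = q := by
  have h0 : ∀ r, (seg A r l).count (A a) = (seg A a l).count (A a) := by
    have h1 : ∀ r, (seg A (r + 1) l).count (A a) = (seg A r l).count (A a) := by
      intro r
      have e := (seg_succ A r l).symm.trans (seg_concat A r l)
      rw [hA.per] at e
      have := congrArg (List.count (A a)) e
      simp only [List.count_cons, List.count_append, List.count_nil, zero_add] at this
      omega
    have h2 : ∀ r, (seg A r l).count (A a) = (seg A 0 l).count (A a) := by
      intro r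
      induction r with
      | zero => rfl
      | succ r ih => rw [h1, ih]
    intro r; rw [h2, h2 a]
  have h3 : (seg A a l).count (A a) = 1 := by
    obtain ⟨N, hN⟩ := Nat.exists_eq_succ_of_ne_zero hA.pos.ne'
    have : (seg A (a + 1) N).count (A a) = 0 := by
      rw [List.count_eq_zero]
      intro h
      obtain ⟨t, ht, h⟩ := List.mem_map.1 h
      have ht := List.mem_range.1 ht
      have := hA.inj _ _ h
      rw [add_assoc] at this
      have h4 : 1 + t ≡ 0 [MOD l] := Nat.ModEq.add_left_cancel' a this
      rw [Nat.modEq_zero_iff_dvd] at h4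
      have := Nat.le_of_dvd (by omega) h4
      omega
    rw [hN, Nat.succ_eq_add_one, seg_succ, List.count_cons_self, this]
  induction q generalizing r with
  | zero => simp
  | succ q ih => rw [Nat.succ_mul, seg_add, List.count_append, ih, h0, h3]

/-- The derivation `A_a ↦ A_a ⋯ A_{a+jl}` on the path `A_r ⋯ A_{r+N-1}`. -/
theorem derWord_seg (hA : CyclicWord A l) (hn : ∀ t, Q.nonrel (A t) (A (t + 1)))
    (h2 : Even d ∨ CharP k 2) (a j r N : ℕ) :
    derWord (A a) (j * d) (Q.ofPath k (segPath hn a (j * l + 1))) (seg A r N)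
      = ((seg A r N).count (A a) : k) • Q.ofPath k (segPath hn r (N + j * l)) := by
  classical
  induction N generalizing r with
  | zero => simp [derWord]
  | succ N ih =>
    have e : N + 1 + j * l = N + j * l + 1 := by ring
    -- The Leibniz sign has an exponent divisible by `d`, so it acts trivially.
    rw [seg_succ, derWord, ih, negOnePow_smul_congr h2 (n' := 0) (j * Q.deg (A r)),
      Int.negOnePow_zero, one_smul, mul_smul_comm, arrow_mul_segPath, List.count_cons, e]
    · by_cases h : A r = A a
      · have h3 : Q.ofPath k (segPath hn a (j * l + 1)) * Q.wordElt k (seg A (r + 1) N)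
            = Q.ofPath k (segPath hn r (N + j * l + 1)) := by
          rw [segPath_congr hA hn (hA.inj _ _ h.symm), ← hA.seg_congr (r := r + (j * l + 1)),
            segPath_mul_seg]
          · congr 2; ring
          · have : r + (j * l + 1) = r + 1 + j * l := by ring
            rw [this]
            exact (Nat.ModEq.refl (r + 1)).add ((Nat.modEq_zero_iff_dvd).2 ⟨j, mul_comm _ _⟩)
        rw [if_pos h, h3, if_pos (by simp [h]), Nat.cast_add, add_smul, Nat.cast_one, one_smul,
          add_comm]
      · rw [if_neg h, zero_add, if_neg (by simpa using h), add_zero]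
    · refine ⟨0, ?_⟩; ring

end SegPath

/-! ### The cocycles of a complete path. -/

section PathCocycles

variable {V E : Type*} [Fintype V] {Q : GradedGentleQuiver V E} {k : Type*} [Field k]
variable {A : ℕ → E} {l : ℕ} {d : ℤ}

/-- All exponents in the definition are multiples of `d`, hence the signs act trivially and the
plain sum of the rotations remains. -/
theorem pathN0_seg (hA : CyclicWord A l) (hn : ∀ t, Q.nonrel (A t) (A (t + 1)))
    (hd : d = Q.cdeg A l) (h2 : Even d ∨ CharP k 2) {m : ℕ}
    (hm : 1 ≤ m) : Q.pathN0 k (seg A 0 (m * l)) =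
      Q.parallelCochain k [] (m * d) (∑ r ∈ Finset.range l, Q.ofPath k (segPath hn r (m * l))) := by
  have hpos : 0 < m * l := Nat.mul_pos hm hA.pos
  have e2 : Q.wdeg (seg A 0 (m * l)) = m * d := (cdeg_mul Q hA m).trans (by rw [hd])
  have hsum : ∀ (s : Finset ℕ) (F : ℕ → Q.Alg k), Q.parallelCochain k [] (m * d) (∑ r ∈ s, F r)
      = ∑ r ∈ s, Q.parallelCochain k [] (m * d) (F r) := by
    intro s F
    classical
    induction s using Finset.induction_on with
    | empty => simp [parallelCochain_zero]
    | insert a s ha ih => rw [Finset.sum_insert ha, Finset.sum_insert ha, parallelCochain_add, ih]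
  rw [pathN0, hA.period_seg hm, hsum]
  refine Finset.sum_congr rfl fun r hr => ?_
  rw [e2, negOnePow_smul_congr h2 (n' := 0) (m * Q.wdeg ((seg A 0 (m * l)).take r)),
    Int.negOnePow_zero, one_smul, hA.rotate_seg hm, wordElt_seg hn _ hpos]
  refine ⟨0, ?_⟩; ring

theorem pathN1_seg (hA : CyclicWord A l) (hn : ∀ t, Q.nonrel (A t) (A (t + 1)))
    (hd : d = Q.cdeg A l) {m : ℕ} (hm : 1 ≤ m) :
    Q.pathN1 k (seg A 0 (m * l)) = Q.parallelCochain k [A (l - 1)] (m * d)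
      (Q.ofPath k (segPath hn (l - 1) (m * l + 1))) := by
  have hpos : 0 < m * l := Nat.mul_pos hm hA.pos
  have hl := hA.pos
  have hle : l ≤ m * l := Nat.le_mul_of_pos_left l hm
  have e : A (0 + (m * l - 1)) = A (l - 1) := by
    obtain ⟨m, rfl⟩ := Nat.exists_eq_succ_of_ne_zero (Nat.one_le_iff_ne_zero.1 hm)
    rw [← hA.per_mul (l - 1) m]
    congr 1
    rw [Nat.succ_mul]; omega
  have e2 : Q.wdeg (seg A 0 (m * l)) = m * d := (cdeg_mul Q hA m).trans (by rw [hd])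
  rw [pathN1, getLast?_seg _ _ hpos, Option.elim_some, e, e2, ← wordElt_seg hn _ (Nat.succ_pos _),
    seg_succ, hA.seg_congr (r := l - 1 + 1) (s := 0)]
  rw [Nat.sub_add_cancel hl]; simp [Nat.ModEq]

theorem segPath_deg (hn : ∀ t, Q.nonrel (A t) (A (t + 1))) (r N : ℕ) :
    (segPath hn r N).deg = Q.cdeg A (r + N) - Q.cdeg A r := wdeg_seg Q A r N

theorem pathN0_mem_cochains (hA : CyclicWord A l) (hn : ∀ t, Q.nonrel (A t) (A (t + 1)))
    (hd : d = Q.cdeg A l) (h2 : Even d ∨ CharP k 2) {m : ℕ} (hm : 1 ≤ m) :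
    Q.pathN0 k (seg A 0 (m * l)) ∈ cochains (Q.grading k) (m * d) := by
  rw [pathN0_seg hA hn hd h2 hm]
  refine parallelCochain_mem (n := m * d) (sum_mem fun r _ => ?_) (by simp [wdeg]) (by simp)
  have := ofPath_mem_grading (k := k) (segPath hn r (m * l))
  rwa [segPath_deg, cdeg_add_mul Q hA, add_sub_cancel_left, ← hd] at this

theorem pathN1_mem_cochains (hA : CyclicWord A l) (hn : ∀ t, Q.nonrel (A t) (A (t + 1)))
    (hd : d = Q.cdeg A l) {m : ℕ} (hm : 1 ≤ m) :
    Q.pathN1 k (seg A 0 (m * l)) ∈ cochains (Q.grading k) (m * d + 1) := by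
  rw [pathN1_seg hA hn hd hm]
  refine parallelCochain_mem (ofPath_mem_grading _) ?_ (by simp)
  rw [segPath_deg, ← add_assoc, cdeg_succ, cdeg_add_mul Q hA, hA.per_mul, ← hd]
  simp [wdeg]; ring

theorem pathN0_arity (hA : CyclicWord A l) (hn : ∀ t, Q.nonrel (A t) (A (t + 1)))
    (hd : d = Q.cdeg A l) (h2 : Even d ∨ CharP k 2) {m : ℕ} (hm : 1 ≤ m) (w : List (Q.Alg k))
    (hw : w.length ≠ 0) : Q.pathN0 k (seg A 0 (m * l)) w = 0 := by
  rw [pathN0_seg hA hn hd h2 hm, parallelCochain_arity _ _ _ _ (by simpa using hw)]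

theorem pathN1_arity (hA : CyclicWord A l) (hn : ∀ t, Q.nonrel (A t) (A (t + 1)))
    (hd : d = Q.cdeg A l) {m : ℕ} (hm : 1 ≤ m) (w : List (Q.Alg k))
    (hw : w.length ≠ 1) : Q.pathN1 k (seg A 0 (m * l)) w = 0 := by
  rw [pathN1_seg hA hn hd hm, parallelCochain_arity _ _ _ _ (by simpa using hw)]

theorem pathN0_nil (hA : CyclicWord A l) (hn : ∀ t, Q.nonrel (A t) (A (t + 1)))
    (hd : d = Q.cdeg A l) (h2 : Even d ∨ CharP k 2) {m : ℕ} (hm : 1 ≤ m) :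
    Q.pathN0 k (seg A 0 (m * l)) [] = ∑ r ∈ Finset.range l, Q.ofPath k (segPath hn r (m * l)) := by
  rw [pathN0_seg hA hn hd h2 hm, parallelCochain_nil]

-- The derivation prolongs `A_{l-1}` by `m` turns. Wherever this happens in a subpath of the cycle,
-- the result is the whole subpath prolonged by `m` turns, so the occurrences of the letter are
-- merely counted.
open Classical in
theorem pathN1_path (hA : CyclicWord A l) (hn : ∀ t, Q.nonrel (A t) (A (t + 1)))
    (hd : d = Q.cdeg A l) (h2 : Even d ∨ CharP k 2) {m : ℕ} (hm : 1 ≤ m) (r N : ℕ) :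
    Q.pathN1 k (seg A 0 (m * l)) [Q.ofPath k (segPath hn r N)]
      = ((seg A r N).count (A (l - 1)) : k) • Q.ofPath k (segPath hn r (N + m * l)) := by
  rw [pathN1_seg hA hn hd hm, ← derWord_seg hA hn h2]
  exact parallelCochain_singleton _ _ _ (segPath hn r N)

open Classical in
theorem pathN1_arrow (hA : CyclicWord A l) (hn : ∀ t, Q.nonrel (A t) (A (t + 1)))
    (hd : d = Q.cdeg A l) {m : ℕ} (hm : 1 ≤ m) (x : E) :
    Q.pathN1 k (seg A 0 (m * l)) (pword Q k (aword Q [x]))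
      = if x = A (l - 1) then Q.ofPath k (segPath hn (l - 1) (m * l + 1)) else 0 := by
  rw [pathN1_seg hA hn hd hm, parallelCochain_aword (by simp)]
  simp

theorem pathN0_relative (hA : CyclicWord A l) (hn : ∀ t, Q.nonrel (A t) (A (t + 1)))
    (hd : d = Q.cdeg A l) (h2 : Even d ∨ CharP k 2) {m : ℕ} (hm : 1 ≤ m) :
    Relative (Q.pathN0 k (seg A 0 (m * l))) := by
  intro L q hq
  rcases L with _ | ⟨p, L⟩
  · rw [pword_nil, pathN0_nil hA hn hd h2 hm] at hq
    obtain ⟨r, -, hr⟩ := coef_sum_ne hq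
    obtain rfl := coef_ofPath_ne hr
    change Q.tgt (A r) = _
    rw [segPath_src, hA.per_mul]
  · rw [pathN0_arity hA hn hd h2 hm _ (by simp)] at hq
    simp at hq

theorem pathN1_parallel (hA : CyclicWord A l) (hn : ∀ t, Q.nonrel (A t) (A (t + 1))) (m : ℕ) :
    ParallelTo [A (l - 1)] (Q.ofPath k (segPath hn (l - 1) (m * l + 1))) := by
  intro r hr
  obtain rfl := coef_ofPath_ne hr
  constructor
  · intro a ha
    obtain rfl : A (l - 1) = a := by simpa using ha
    rfl
  · intro a ha
    obtain rfl : A (l - 1) = a := by simpa using ha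
    rw [segPath_src, ← add_assoc, ← (hn _).1]
    congr 1
    exact hA.per_mul _ _

theorem pathN1_relative (hA : CyclicWord A l) (hn : ∀ t, Q.nonrel (A t) (A (t + 1)))
    (hd : d = Q.cdeg A l) {m : ℕ} (hm : 1 ≤ m) : Relative (Q.pathN1 k (seg A 0 (m * l))) := by
  rw [pathN1_seg hA hn hd hm]
  exact parallelCochain_relative (by simp) (List.isChain_singleton _) _ (pathN1_parallel hA hn m)

theorem pathN1_mem_cocycles (hA : CyclicWord A l) (hn : ∀ t, Q.nonrel (A t) (A (t + 1)))
    (hd : d = Q.cdeg A l) {m : ℕ} (hm : 1 ≤ m) :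
    Q.pathN1 k (seg A 0 (m * l)) ∈ cocycles (Q.grading k) (m * d + 1) := by
  classical
  have hc := pathN1_mem_cochains (k := k) hA hn hd hm
  refine mem_cocycles_of_long_of_crit hc (pathN1_relative hA hn hd hm) ?_ ?_
  · rintro L ⟨s, M, hL⟩
    rw [pathN1_seg hA hn hd hm]
    exact differential_parallelCochain_long (by simp) (List.isChain_singleton _) (by simp)
      (pathN1_parallel hA hn m) hL
  · intro L hL
    obtain ⟨v, hv, rfl⟩ := hL.exists_aword
    match v with
    | [] => rfl
    | [x] =>
      rw [differential_aword (cochains_multi hc) _ x [] [] x hv rfl,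
        pathN1_arity hA hn hd hm _ (by simp)]
      simp
    | [x, y] =>
      have hv' := (List.isChain_cons_cons.1 hv).1
      rw [differential_aword (cochains_multi hc) _ x [y] [x] y hv rfl, pathN1_arrow hA hn hd hm,
        pathN1_arrow hA hn hd hm]
      have h1 : Q.wordElt k [x] * (if y = A (l - 1) then
          Q.ofPath k (segPath hn (l - 1) (m * l + 1)) else 0) = 0 := by
        split_ifs with h
        · subst h
          rw [← arrow_mul_segPath, ← mul_assoc, wordElt_singleton, wordElt_singleton,
            arrow_mul_arrow_eq_zero (fun h' => h'.2 hv'), zero_mul]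
        · exact mul_zero _
      have h3 : (if x = A (l - 1) then
          Q.ofPath k (segPath hn (l - 1) (m * l + 1)) else 0) * Q.wordElt k [y] = 0 := by
        split_ifs with h
        · subst h
          rw [← segPath_mul_arrow, hA.per_mul, mul_assoc, wordElt_singleton, wordElt_singleton,
            arrow_mul_arrow_eq_zero (fun h' => h'.2 hv'), mul_zero]
        · exact zero_mul _
      rw [h1, h3]; simp
    | x :: y :: z :: v =>
      obtain ⟨w, y', hw⟩ : ∃ w y', x :: y :: z :: v = w ++ [y'] :=
        ⟨_, _, (List.dropLast_append_getLast (List.cons_ne_nil x _)).symm⟩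
      have := congrArg List.length hw
      rw [differential_aword (cochains_multi hc) _ x _ w y' hv hw,
        pathN1_arity hA hn hd hm _ (by simp), pathN1_arity hA hn hd hm]
      · simp
      · simp at this ⊢; omega

theorem sum_range_rotate {M : Type*} [AddCommGroup M] (g : ℕ → M) (l : ℕ) (h : g l = g 0) :
    ∑ r ∈ Finset.range l, g (r + 1) = ∑ r ∈ Finset.range l, g r := by
  have := (Finset.sum_range_succ' g l).symm.trans (Finset.sum_range_succ g l)
  rw [h] at this
  exact add_right_cancel this

/-- The sum of the rotations commutes with every arrow: an arrow of the cycle carries one rotation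
over to the next, and any other arrow annihilates all of them from both sides. -/
theorem pathN0_mem_cocycles (hA : CyclicWord A l) (hn : ∀ t, Q.nonrel (A t) (A (t + 1)))
    (hd : d = Q.cdeg A l) (h2 : Even d ∨ CharP k 2) {m : ℕ} (hm : 1 ≤ m) :
    Q.pathN0 k (seg A 0 (m * l)) ∈ cocycles (Q.grading k) (m * d) := by
  classical
  have hpos : 0 < m * l := Nat.mul_pos hm hA.pos
  have hc := pathN0_mem_cochains (k := k) hA hn hd h2 hm
  have harity : ∀ n, n ≠ 1 → ∀ w : List (Q.Alg k), w.length = n →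
      differential (Q.grading k) (m * d) (Q.pathN0 k (seg A 0 (m * l))) w = 0 := by
    intro n hn' w hw
    rcases n with _ | n
    · rw [List.length_eq_zero_iff.1 hw]; rfl
    · rw [differential_congr (g := 0) _ _ _ w hw]
      · rw [map_zero]; rfl
      · intro w hw
        exact pathN0_arity hA hn hd h2 hm w (by omega)
  refine mem_cocycles_of_long_of_crit hc (pathN0_relative hA hn hd h2 hm) ?_ ?_
  · rintro L ⟨s, M, hL⟩
    refine harity L.length ?_ _ (by simp)
    cases hL <;> simp
  · intro L hL
    obtain ⟨v, hv, rfl⟩ := hL.exists_aword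
    by_cases h1 : v.length = 1
    · obtain ⟨x, rfl⟩ := List.length_eq_one_iff.1 h1
      rw [differential_aword (cochains_multi hc) _ x [] [] x hv rfl, aword_nil, pword_nil,
        pathN0_nil hA hn hd h2 hm,
        negOnePow_smul_congr h2 (n := _ * _) (n' := 0) (m * Q.deg x) (by
          refine ⟨0, ?_⟩; simp; ring)]
      have e1 : ∀ r, Q.wordElt k [x] * Q.ofPath k (segPath hn (r + 1) (m * l))
          = if x = A r then Q.ofPath k (segPath hn r (m * l + 1)) else 0 := by
        intro r
        split_ifs with h
        · rw [h, arrow_mul_segPath]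
        · exact arrow_mul_segPath_of_ne hn hpos h
      have e2 : ∀ r, Q.ofPath k (segPath hn r (m * l)) * Q.wordElt k [x]
          = if x = A r then Q.ofPath k (segPath hn r (m * l + 1)) else 0 := by
        intro r
        split_ifs with h
        · rw [h, ← hA.per_mul r m, segPath_mul_arrow]
        · exact segPath_mul_arrow_of_ne hn hpos (by rwa [hA.per_mul])
      have e3 : Q.wordElt k [x] * ∑ r ∈ Finset.range l, Q.ofPath k (segPath hn r (m * l))
          = (∑ r ∈ Finset.range l, Q.ofPath k (segPath hn r (m * l))) * Q.wordElt k [x] := by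
        rw [Finset.sum_mul]
        simp only [e2]
        -- Left multiplication by `A_r` picks the rotation starting at `r + 1`, right multiplication
        -- the one starting at `r`, so one of the sums is shifted cyclically.
        rw [← sum_range_rotate (fun r => Q.ofPath k (segPath hn r (m * l))), Finset.mul_sum]
        · simp only [e1]
        · simp only [segPath_congr hA hn (r := l) (s := 0) (by simp [Nat.ModEq])]
      rw [e3]
      simp
    · exact harity v.length h1 _ (by simp)

end PathCocycles
end GradedGentleQuiver

/-! ### Inserting full turns into stretches of the cycle, and the relations of the generators. -/

namespace GradedGentleQuiver

section SegSplit

variable {E : Type*} {A : ℕ → E} {l : ℕ}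

theorem append_eq_seg_iff (X Y : List E) (r N : ℕ) : X ++ Y = seg A r N ↔
    N = X.length + Y.length ∧ X = seg A r X.length ∧ Y = seg A (r + X.length) Y.length := by
  constructor
  · intro h
    have hN : N = X.length + Y.length := by simpa using (congrArg List.length h).symm
    rw [hN, seg_add] at h
    exact ⟨hN, (List.append_inj h (by simp)).1, (List.append_inj h (by simp)).2⟩
  · rintro ⟨hN, h1, h2⟩
    rw [hN, seg_add, ← h1, ← h2]

/-- A letter of the cycle can be traded for the stretch that makes `j` further turns, since
positions only matter modulo `l`. This describes the words on which an insertion of `N^1(u^j)` can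
be nonzero. -/
theorem CyclicWord.insert_seg_iff (hA : CyclicWord A l) (X Y : List E) (r s N j : ℕ) :
    X ++ A s :: Y = seg A r N ↔ X ++ (seg A s (j * l + 1) ++ Y) = seg A r (N + j * l) := by
  rw [append_eq_seg_iff, append_eq_seg_iff, ← List.singleton_append, append_eq_seg_iff,
    append_eq_seg_iff]
  simp only [List.length_append, List.length_singleton, length_seg, seg_one]
  have hY : s ≡ r + X.length [MOD l] →
      seg A (r + X.length + (j * l + 1)) Y.length = seg A (r + X.length + 1) Y.length := by
    intro _
    refine hA.seg_congr ?_ _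
    rw [show r + X.length + (j * l + 1) = r + X.length + 1 + j * l by ring]
    exact (Nat.ModEq.refl _).add ((Nat.modEq_zero_iff_dvd).2 ⟨j, mul_comm _ _⟩)
  constructor
  · rintro ⟨h1, h2, -, h3, h4⟩
    have hs := hA.inj _ _ (List.cons.inj h3).1
    exact ⟨by omega, h2, trivial, hA.seg_congr hs _, by rw [hY hs]; exact h4⟩
  · rintro ⟨h1, h2, -, h3, h4⟩
    have hs := hA.seg_inj (Nat.succ_pos _) h3
    exact ⟨by omega, h2, trivial, by rw [hA.congr hs], by rw [← hY hs]; exact h4⟩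

theorem sum_ite_eq_count [DecidableEq E] {M : Type*} [AddCommGroup M] (a : E) (r N : ℕ) (x : M) :
    ∑ p ∈ Finset.range N, (if A (r + p) = a then x else 0) = (seg A r N).count a • x := by
  induction N with
  | zero => simp
  | succ N ih =>
    rw [Finset.sum_range_succ, ih, seg_concat, List.count_append, add_smul, List.count_singleton]
    congr 1
    by_cases h : A (r + N) = a <;> simp [h]

theorem take_seg (A : ℕ → E) (r : ℕ) {p N : ℕ} (h : p ≤ N) : (seg A r N).take p = seg A r p := by
  obtain ⟨M, rfl⟩ := Nat.exists_eq_add_of_le h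
  rw [seg_add, List.take_left' (by simp)]

theorem drop_seg (A : ℕ → E) (r : ℕ) {p N : ℕ} (h : p ≤ N) :
    (seg A r N).drop p = seg A (r + p) (N - p) := by
  obtain ⟨M, rfl⟩ := Nat.exists_eq_add_of_le h
  rw [seg_add, List.drop_left' (by simp), Nat.add_sub_cancel_left]

end SegSplit

section Family

variable {V E : Type*} [Fintype V] {Q : GradedGentleQuiver V E} {k : Type*} [Field k]

/-- Families of cocycles which satisfy the relations of the generators `e_m`, `f_m` on words of
arrows. -/
structure WittFamily (d : ℤ) (e f : ℕ → List (Q.Alg k) → Q.Alg k) : Prop where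
  e_mem : ∀ m : ℕ, 1 ≤ m → e m ∈ cocycles (Q.grading k) (m * d + 1)
  f_mem : ∀ m : ℕ, 1 ≤ m → f m ∈ cocycles (Q.grading k) (m * d)
  e_rel : ∀ m : ℕ, 1 ≤ m → Relative (e m)
  f_rel : ∀ m : ℕ, 1 ≤ m → Relative (f m)
  ee : ∀ i j : ℕ, 1 ≤ i → 1 ≤ j → ∀ v, bracket (Q.grading k) (i * d + 1) (j * d + 1) (e i) (e j)
    (pword Q k (aword Q v)) = ((i : k) - j) • e (i + j) (pword Q k (aword Q v))
  fe : ∀ i j : ℕ, 1 ≤ i → 1 ≤ j → ∀ v, bracket (Q.grading k) (i * d) (j * d + 1) (f i) (e j)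
    (pword Q k (aword Q v)) = (i : k) • f (i + j) (pword Q k (aword Q v))
  ff : ∀ i j : ℕ, 1 ≤ i → 1 ≤ j → ∀ v, bracket (Q.grading k) (i * d) (j * d) (f i) (f j)
    (pword Q k (aword Q v)) = 0

end Family

/-! ### Brackets for a complete anti-path. -/

section AntipathBracket

variable {V E : Type*} [Fintype V] {Q : GradedGentleQuiver V E} {k : Type*} [Field k]
variable {A : ℕ → E} {l : ℕ} {d : ℤ}

/-- Inserting `N^1(u^j)` into a cochain, evaluated on a word of arrows. -/
theorem insert_antiN1 (hA : CyclicWord A l) {j : ℕ} (hj : 1 ≤ j)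
    {f : List (Q.Alg k) → Q.Alg k} (hm : Multi k f) (X Y mid : List E) :
    f (pword Q k (aword Q X) ++ Q.antiN1 k (seg A 0 (j * l)) (pword Q k (aword Q mid))
      :: pword Q k (aword Q Y)) = 0 ∨
    mid = seg A (l - 1) (j * l + 1) ∧
    f (pword Q k (aword Q X) ++ Q.antiN1 k (seg A 0 (j * l)) (pword Q k (aword Q mid))
      :: pword Q k (aword Q Y)) = f (pword Q k (aword Q (X ++ A (l - 1) :: Y))) := by
  by_cases h : mid = seg A (l - 1) (j * l + 1)
  · right
    refine ⟨h, ?_⟩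
    rw [h, antiN1_aword hA hj, aword_append, aword_cons, pword_append, pword_cons]
  · left
    rw [antiN1_aword_of_ne hA hj h, hm.zero]

theorem take_mid_drop (v : List E) (p n : ℕ) : v.take p ++ ((v.drop p).take n ++ v.drop (p + n)) = v := by
  rw [← List.drop_drop, List.take_append_drop, List.take_append_drop]

open Classical in
/-- The terms of the composition with `N^1(u^j)` on the word `A_r ⋯ A_{r+N+jl-1}`. -/
theorem insert_antiN1_seg (hA : CyclicWord A l) {j : ℕ} (hj : 1 ≤ j)
    {f : List (Q.Alg k) → Q.Alg k} (hm : Multi k f) (r N p : ℕ) (hp : p < N) :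
    f (pword Q k (aword Q ((seg A r (N + j * l)).take p)) ++ Q.antiN1 k (seg A 0 (j * l))
        (pword Q k (aword Q (((seg A r (N + j * l)).drop p).take (j * l + 1))))
      :: pword Q k (aword Q ((seg A r (N + j * l)).drop (p + (j * l + 1)))))
    = if A (r + p) = A (l - 1) then f (pword Q k (aword Q (seg A r N))) else 0 := by
  have e1 : ((seg A r (N + j * l)).drop p).take (j * l + 1) = seg A (r + p) (j * l + 1) := by
    rw [drop_seg _ _ (by omega), take_seg _ _ (by omega)]
  split_ifs with h
  · have e2 : ((seg A r (N + j * l)).drop p).take (j * l + 1) = seg A (l - 1) (j * l + 1) := by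
      rw [e1]; exact hA.seg_congr (hA.inj _ _ h) _
    have e3 := take_mid_drop (seg A r (N + j * l)) p (j * l + 1)
    rw [e2] at e3 ⊢
    rw [← hA.insert_seg_iff] at e3
    rw [antiN1_aword hA hj, ← e3]
    simp only [aword_append, aword_cons, pword_append, pword_cons]
  · rw [antiN1_aword_of_ne hA hj, hm.zero]
    rw [e1]
    intro h'
    exact h (hA.congr (hA.seg_inj (Nat.succ_pos _) h'))

/-- There is one term for each occurrence of `A_{l-1}` in the stretch of `i l + 1` letters that
begins and ends with it, that is `i + 1` terms, all with trivial sign. -/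
theorem circ_antiN1_antiN1 (hA : CyclicWord A l) (hd : d = l - Q.cdeg A l)
    (h2 : Even d ∨ CharP k 2) {i j : ℕ} (hi : 1 ≤ i) (hj : 1 ≤ j) (v : List E) :
    circ (Q.grading k) (j * d + 1) (Q.antiN1 k (seg A 0 (i * l))) (Q.antiN1 k (seg A 0 (j * l)))
        (pword Q k (aword Q v))
      = ((i : k) + 1) • Q.antiN1 k (seg A 0 ((i + j) * l)) (pword Q k (aword Q v)) := by
  classical
  have hm := cochains_multi (antiN1_mem_cochains (k := k) hA hd hi)
  have hl := hA.pos
  rw [circ_aword hm (antiN1_arity hA hj)]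
  by_cases hv : v = seg A (l - 1) ((i * l + 1) + j * l)
  · have e : (i + j) * l + 1 = (i * l + 1) + j * l := by ring
    have hN := antiN1_aword (k := k) (Q := Q) hA (m := i + j) (by omega)
    rw [e] at hN
    rw [hv, hN, length_seg, show i * l + 1 + j * l + 1 - (j * l + 1) = i * l + 1 by omega]
    -- The positions that contribute are multiples of `l`, which makes the exponent a multiple of
    -- `d` modulo 2.
    have : ∀ p ∈ Finset.range (i * l + 1), ∀ s : ℤ, A (l - 1 + p) = A (l - 1) →
        s = ((p : ℤ) * ((j * l + 1 : ℕ) - 1) + ((i * l + 1 + j * l : ℕ) - (j * l + 1 : ℕ)) *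
          (j * d + 1 - 1) + (j * d + 1 - (j * l + 1 : ℕ)) *
            Q.wdeg ((seg A (l - 1) (i * l + 1 + j * l)).take p)) →
        ∀ x : Q.Alg k, s.negOnePow • x = x := by
      intro p hp s hs hs' x
      have hp := Finset.mem_range.1 hp
      have h1 := hA.inj _ _ hs
      have h3 : p ≡ 0 [MOD l] := Nat.ModEq.add_left_cancel' (l - 1) h1
      obtain ⟨q, rfl⟩ := (Nat.modEq_zero_iff_dvd).1 h3
      rw [hs', take_seg _ _ (by omega), mul_comm l q, wdeg_seg_mul Q hA,
        negOnePow_smul_congr h2 (n' := 0) (i * l * j + q * j)]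
      · simp
      · change Even (_ + _ * (q * Q.cdeg A l) - 0 - _)
        rw [hd, even_iff_zmod]
        push_cast
        generalize ((l : ℕ) : ZMod 2) = l'
        generalize ((i : ℕ) : ZMod 2) = i
        generalize ((j : ℕ) : ZMod 2) = j
        generalize ((q : ℕ) : ZMod 2) = q
        generalize ((Q.cdeg A l : ℤ) : ZMod 2) = c
        revert l' i j q c
        decide
    rw [Finset.sum_congr rfl fun p hp => ?_, sum_ite_eq_count (A (l - 1)) (l - 1)
      (x := Q.ofPath k (Q.arrowPath (A (l - 1))))]
    · rw [seg_concat, List.count_append, hA.count_seg, hA.per_mul, List.count_singleton_self,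
        ← Nat.cast_smul_eq_nsmul k]
      push_cast; rfl
    · rw [insert_antiN1_seg hA hj hm _ _ _ (Finset.mem_range.1 hp), antiN1_aword hA hi]
      split_ifs with h
      · exact this p hp _ h rfl _
      · exact smul_zero _
  · rw [antiN1_aword_of_ne hA (by omega), smul_zero]
    · refine Finset.sum_eq_zero fun p hp => ?_
      rcases insert_antiN1 hA hj hm (v.take p) (v.drop (p + (j * l + 1)))
        ((v.drop p).take (j * l + 1)) with h | ⟨h, h'⟩
      · rw [h, smul_zero]
      · rw [h', antiN1_aword_of_ne hA hi, smul_zero]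
        intro h3
        apply hv
        rw [hA.insert_seg_iff _ _ _ _ _ j, ← h, take_mid_drop] at h3
        exact h3
    · rwa [show (i + j) * l + 1 = (i * l + 1) + j * l by ring]

/-- The sign of the generator `e_m`. -/
def antiEps (Q : GradedGentleQuiver V E) (A : ℕ → E) (l m : ℕ) : ℤˣ :=
  (m * Q.cdeg A l * (1 + Q.deg (A (l - 1)))).negOnePow

/-- A stretch of `i` full turns contains `A_{l-1}` exactly `i` times, wherever it starts. All terms
carry the same sign `antiEps Q A l j`, which is multiplicative in `j` and can thus be moved into the
generator `e_j`. -/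
theorem circ_antiN0_antiN1 (hA : CyclicWord A l) (hrel : ∀ t, Q.rel (A t) (A (t + 1)))
    (hd : d = l - Q.cdeg A l)
    (h2 : Even d ∨ CharP k 2) {i j : ℕ} (hi : 1 ≤ i) (hj : 1 ≤ j) (v : List E) :
    circ (Q.grading k) (j * d + 1) (Q.antiN0 k (seg A 0 (i * l))) (Q.antiN1 k (seg A 0 (j * l)))
        (pword Q k (aword Q v))
      = antiEps Q A l j • (i : k) •
        Q.antiN0 k (seg A 0 ((i + j) * l)) (pword Q k (aword Q v)) := by
  classical
  have hm := cochains_multi (antiN0_mem_cochains (k := k) hA hrel hd hi)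
  have hl := hA.pos
  have e : (i + j) * l = i * l + j * l := by ring
  rw [circ_aword hm (antiN1_arity hA hj)]
  by_cases hv : ∃ r, v = seg A r (i * l + j * l)
  · obtain ⟨r, hv⟩ := hv
    have hN := antiN0_aword (k := k) (Q := Q) hA hrel hd h2 (m := i + j) (by omega) r
    rw [e] at hN
    rw [e, hv, hN, length_seg, show i * l + j * l + 1 - (j * l + 1) = i * l by omega]
    -- A contributing position is `l - 1 - r` up to `q` full turns, and `q` enters the exponent only
    -- through a multiple of `d`.
    have : ∀ p ∈ Finset.range (i * l), ∀ s : ℤ, A (r + p) = A (l - 1) →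
        s = ((p : ℤ) * ((j * l + 1 : ℕ) - 1) + ((i * l + j * l : ℕ) - (j * l + 1 : ℕ)) *
          (j * d + 1 - 1) + (j * d + 1 - (j * l + 1 : ℕ)) *
            Q.wdeg ((seg A r (i * l + j * l)).take p)) →
        ∀ x : Q.Alg k, s.negOnePow • (antiSign Q A l i r).negOnePow • x
          = antiEps Q A l j • (antiSign Q A l (i + j) r).negOnePow • x := by
      intro p hp s hs hs' x
      have hp := Finset.mem_range.1 hp
      have h1 := hA.inj _ _ hs
      obtain ⟨q, hq⟩ : ∃ q, r + p = l - 1 + q * l := by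
        have h3 := Nat.mod_add_div (r + p) l
        rw [show (r + p) % l = (l - 1) % l from h1, Nat.mod_eq_of_lt (by omega), mul_comm] at h3
        exact ⟨_, h3.symm⟩
      have hpz : (p : ℤ) = l - 1 + q * l - r := by
        have : r + p + 1 = l + q * l := by omega
        have h4 : ((r + p + 1 : ℕ) : ℤ) = ((l + q * l : ℕ) : ℤ) := by rw [this]
        push_cast at h4
        linarith
      have hc : Q.cdeg A l = Q.cdeg A (l - 1) + Q.deg (A (l - 1)) := by
        rw [← cdeg_succ, Nat.sub_add_cancel hl]
      rw [smul_smul, smul_smul, antiEps, ← Int.negOnePow_add, ← Int.negOnePow_add]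
      refine negOnePow_smul_congr h2 (j * q + (i * l - 1) * j) ?_ _
      rw [hs', take_seg _ _ (by omega), wdeg_seg, hq, cdeg_add_mul Q hA, hpz,
        show Q.cdeg A (l - 1) = Q.cdeg A l - Q.deg (A (l - 1)) by rw [hc]; ring, hd, antiSign,
        antiSign, even_iff_zmod]
      push_cast
      generalize ((l : ℕ) : ZMod 2) = l'
      generalize ((i : ℕ) : ZMod 2) = i
      generalize ((j : ℕ) : ZMod 2) = j
      generalize ((q : ℕ) : ZMod 2) = q
      generalize ((r : ℕ) : ZMod 2) = r'
      generalize ((Q.cdeg A l : ℤ) : ZMod 2) = c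
      generalize ((Q.cdeg A r : ℤ) : ZMod 2) = c'
      generalize ((Q.deg (A (l - 1)) : ℤ) : ZMod 2) = a
      revert l' i j q r' c c' a
      decide
    rw [Finset.sum_congr rfl fun p hp => ?_, sum_ite_eq_count (A (l - 1)) r
      (x := antiEps Q A l j • (antiSign Q A l (i + j) r).negOnePow •
        Q.ofPath k (Q.trivialPath (Q.tgt (A r))))]
    · rw [hA.count_seg, ← Nat.cast_smul_eq_nsmul k, smul_comm]
    · rw [insert_antiN1_seg hA hj hm _ _ _ (Finset.mem_range.1 hp), antiN0_aword hA hrel hd h2 hi]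
      split_ifs with h
      · exact this p hp _ h rfl _
      · exact smul_zero _
  · rw [antiN0_aword_of_ne hA hrel (by omega), smul_zero, smul_zero]
    · refine Finset.sum_eq_zero fun p hp => ?_
      rcases insert_antiN1 hA hj hm (v.take p) (v.drop (p + (j * l + 1)))
        ((v.drop p).take (j * l + 1)) with h | ⟨h, h'⟩
      · rw [h, smul_zero]
      · rw [h', antiN0_aword_of_ne hA hrel hi, smul_zero]
        intro r h3
        apply hv
        rw [hA.insert_seg_iff _ _ _ _ _ j, ← h, take_mid_drop] at h3
        exact ⟨r, h3⟩
    · intro r hr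
      exact hv ⟨r, by rw [hr, e]⟩

/-- On words of arrows `N^0` takes values in multiples of vertices, which a normalised cochain
kills. -/
theorem circ_antiN0_right (hA : CyclicWord A l) (hrel : ∀ t, Q.rel (A t) (A (t + 1)))
    (hd : d = l - Q.cdeg A l)
    (h2 : Even d ∨ CharP k 2) {f : List (Q.Alg k) → Q.Alg k} (hm : Multi k f) (hf : Relative f)
    {j : ℕ} (hj : 1 ≤ j) (i : ℤ) (v : List E) :
    circ (Q.grading k) i f (Q.antiN0 k (seg A 0 (j * l))) (pword Q k (aword Q v)) = 0 := by
  refine circ_aword_trivial hm hf (antiN0_arity hA hrel hj) (fun v => ?_) i v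
  by_cases h : ∃ r, v = seg A r (j * l)
  · obtain ⟨r, rfl⟩ := h
    exact Or.inr ⟨_, _, antiN0_aword hA hrel hd h2 hj r⟩
  · exact Or.inl (antiN0_aword_of_ne hA hrel hj fun r hr => h ⟨r, hr⟩)

theorem antiEps_mul (i j : ℕ) : antiEps Q A l i * antiEps Q A l j = antiEps Q A l (i + j) := by
  rw [antiEps, antiEps, antiEps, ← Int.negOnePow_add]
  congr 1
  push_cast; ring

theorem units_smul_mem_cocycles {i : ℤ} {f : List (Q.Alg k) → Q.Alg k}
    (hf : f ∈ cocycles (Q.grading k) i) (s : ℤˣ) : s • f ∈ cocycles (Q.grading k) i :=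
  units_smul_mem _ _ hf

/-- The constants are `(i + 1) - (j + 1)` and `i`. In the mixed bracket the sign put into `e_j`
cancels the one coming from the composition. -/
theorem anti_wittFamily (hA : CyclicWord A l) (hrel : ∀ t, Q.rel (A t) (A (t + 1)))
    (hd : d = l - Q.cdeg A l) (h2 : Even d ∨ CharP k 2) :
    WittFamily d (fun m => antiEps Q A l m • Q.antiN1 k (seg A 0 (m * l)))
      (fun m => Q.antiN0 k (seg A 0 (m * l))) where
  e_mem m hm := units_smul_mem_cocycles (antiN1_mem_cocycles hA hrel hd hm) _
  f_mem m hm := antiN0_mem_cocycles hA hrel hd h2 hm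
  e_rel m hm := (antiN1_relative hA hrel hm).units_smul _
  f_rel m hm := antiN0_relative hA hrel hm
  ee i j hi hj v := by
    have hmi := cochains_multi (antiN1_mem_cochains (k := k) hA hd hi)
    have hmj := cochains_multi (antiN1_mem_cochains (k := k) hA hd hj)
    simp only [bracket, Pi.sub_apply, Pi.smul_apply, circ_units_smul_left (k := k),
      circ_units_smul_right _ hmi, circ_units_smul_right _ hmj,
      circ_antiN1_antiN1 hA hd h2 hi hj, circ_antiN1_antiN1 hA hd h2 hj hi]
    rw [negOnePow_smul_congr h2 (n' := 0) (i * (j * d)) (by refine ⟨0, ?_⟩; ring),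
      Int.negOnePow_zero, one_smul, smul_smul, smul_smul, antiEps_mul, antiEps_mul, add_comm j i,
      ← smul_sub, ← sub_smul, add_sub_add_right_eq_sub, smul_comm]
  fe i j hi hj v := by
    have hmi := cochains_multi (antiN0_mem_cochains (k := k) hA hrel hd hi)
    have hmj := cochains_multi (antiN1_mem_cochains (k := k) hA hd hj)
    simp only [bracket, Pi.sub_apply, Pi.smul_apply, circ_units_smul_left (k := k),
      circ_units_smul_right _ hmi,
      circ_antiN0_antiN1 hA hrel hd h2 hi hj,
      circ_antiN0_right hA hrel hd h2 hmj (antiN1_relative hA hrel hj) hi]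
    rw [smul_zero, smul_zero, sub_zero, smul_smul, Int.units_mul_self, one_smul]
  ff i j hi hj v := by
    have hmi := cochains_multi (antiN0_mem_cochains (k := k) hA hrel hd hi)
    have hmj := cochains_multi (antiN0_mem_cochains (k := k) hA hrel hd hj)
    simp only [bracket, Pi.sub_apply, Pi.smul_apply,
      circ_antiN0_right hA hrel hd h2 hmj (antiN0_relative hA hrel hj) hi,
      circ_antiN0_right hA hrel hd h2 hmi (antiN0_relative hA hrel hi) hj]
    simp

end AntipathBracket

/-! ### Brackets for a complete path. -/

section PathBracket

variable {V E : Type*} [Fintype V] {Q : GradedGentleQuiver V E} {k : Type*} [Field k]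
variable {A : ℕ → E} {l : ℕ} {d : ℤ}

/-- The inner derivation turns `A_{l-1}` into a path with `j + 1` occurrences of this letter, and
the outer one counts them. -/
theorem circ_pathN1_pathN1 (hA : CyclicWord A l) (hn : ∀ t, Q.nonrel (A t) (A (t + 1)))
    (hd : d = Q.cdeg A l) (h2 : Even d ∨ CharP k 2) {i j : ℕ} (hi : 1 ≤ i) (hj : 1 ≤ j) (a : ℤ)
    (v : List E) :
    circ (Q.grading k) (a + 1) (Q.pathN1 k (seg A 0 (i * l))) (Q.pathN1 k (seg A 0 (j * l)))
        (pword Q k (aword Q v))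
      = ((j : k) + 1) • Q.pathN1 k (seg A 0 ((i + j) * l)) (pword Q k (aword Q v)) := by
  classical
  have hm := cochains_multi (pathN1_mem_cochains (k := k) hA hn hd hi)
  rw [circ_aword hm (pathN1_arity hA hn hd hj)]
  by_cases hv : v.length = 1
  · obtain ⟨x, rfl⟩ := List.length_eq_one_iff.1 hv
    simp only [List.length_singleton, Nat.reduceAdd, Nat.reduceSub, Finset.range_one,
      Finset.sum_singleton, List.take_zero, aword_nil, pword_nil, List.nil_append, zero_add,
      List.drop_zero, List.take_one, List.head?_cons, Option.toList_some, List.drop_one,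
      List.tail_cons]
    rw [pathN1_arrow hA hn hd hj, pathN1_arrow hA hn hd (by omega)]
    split_ifs with h
    · rw [pathN1_path hA hn hd h2 hi, seg_concat, List.count_append, hA.count_seg, hA.per_mul,
        List.count_singleton_self, show j * l + 1 + i * l = (i + j) * l + 1 by ring]
      simp [wdeg]
    · have := hm.zero [] []
      rw [List.nil_append] at this
      rw [this, smul_zero, smul_zero]
  · rw [pathN1_arity hA hn hd (by omega) _ (by simpa using hv), smul_zero]
    refine Finset.sum_eq_zero fun p hp => ?_
    have hp := Finset.mem_range.1 hp
    rw [pathN1_arity hA hn hd hi, smul_zero]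
    simp only [List.length_append, length_pword, length_aword, List.length_take, List.length_cons,
      List.length_drop]
    omega

/-- Every rotation of `u^i` contains `A_{l-1}` exactly `i` times. -/
theorem circ_pathN1_pathN0 (hA : CyclicWord A l) (hn : ∀ t, Q.nonrel (A t) (A (t + 1)))
    (hd : d = Q.cdeg A l) (h2 : Even d ∨ CharP k 2) {i j : ℕ} (hi : 1 ≤ i) (hj : 1 ≤ j) (a : ℤ)
    (v : List E) :
    circ (Q.grading k) a (Q.pathN1 k (seg A 0 (j * l))) (Q.pathN0 k (seg A 0 (i * l)))
        (pword Q k (aword Q v))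
      = (i : k) • Q.pathN0 k (seg A 0 ((i + j) * l)) (pword Q k (aword Q v)) := by
  classical
  have hm := cochains_multi (pathN1_mem_cochains (k := k) hA hn hd hj)
  rw [circ_aword hm (pathN0_arity hA hn hd h2 hi)]
  rcases v with _ | ⟨x, v⟩
  · simp only [List.length_nil, zero_add, Nat.sub_zero, Finset.range_one, Finset.sum_singleton,
      List.take_nil, aword_nil, pword_nil, List.nil_append, List.drop_nil]
    rw [pathN0_nil hA hn hd h2 hi, pathN0_nil hA hn hd h2 (by omega)]
    let L : Q.Alg k →ₗ[k] Q.Alg k :=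
      { toFun := fun b => Q.pathN1 k (seg A 0 (j * l)) [b]
        map_add' := fun a b => hm.add [] [] a b
        map_smul' := fun c a => hm.smul [] [] c a }
    have h3 : Q.pathN1 k (seg A 0 (j * l)) [∑ r ∈ Finset.range l, Q.ofPath k (segPath hn r (i * l))]
        = (i : k) • ∑ r ∈ Finset.range l, Q.ofPath k (segPath hn r ((i + j) * l)) := by
      change L _ = _
      rw [map_sum, Finset.smul_sum]
      refine Finset.sum_congr rfl fun r _ => ?_
      change Q.pathN1 k (seg A 0 (j * l)) [_] = _
      rw [pathN1_path hA hn hd h2 hj, hA.count_seg, add_mul]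
    rw [h3]
    simp [wdeg]
  · rw [pathN0_arity hA hn hd h2 (by omega) _ (by simp), smul_zero]
    refine Finset.sum_eq_zero fun p hp => ?_
    have hp := Finset.mem_range.1 hp
    rw [pathN1_arity hA hn hd hj, smul_zero]
    simp only [List.length_append, length_pword, length_aword, List.length_take, List.length_cons,
      List.length_drop] at hp ⊢
    omega

theorem circ_pathN0_left (hA : CyclicWord A l) (hn : ∀ t, Q.nonrel (A t) (A (t + 1)))
    (hd : d = Q.cdeg A l) (h2 : Even d ∨ CharP k 2) {i : ℕ} (hi : 1 ≤ i) (a : ℤ)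
    (g : List (Q.Alg k) → Q.Alg k) (w : List (Q.Alg k)) :
    circ (Q.grading k) a (Q.pathN0 k (seg A 0 (i * l))) g w = 0 := by
  refine Finset.sum_eq_zero fun p _ => Finset.sum_eq_zero fun n _ => ?_
  rw [pathN0_arity hA hn hd h2 hi _ (by simp), smul_zero]

/-- The bracket of `N^1(u^i)` and `N^1(u^j)` has coefficient `j - i`, and that of `N^0(u^i)` and
`N^1(u^j)` has coefficient `-i`. Taking `e_m` to be minus `N^1(u^m)` corrects both. -/
theorem path_wittFamily (hA : CyclicWord A l) (hn : ∀ t, Q.nonrel (A t) (A (t + 1)))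
    (hd : d = Q.cdeg A l) (h2 : Even d ∨ CharP k 2) :
    WittFamily d (fun m => (-1 : ℤˣ) • Q.pathN1 k (seg A 0 (m * l)))
      (fun m => Q.pathN0 k (seg A 0 (m * l))) where
  e_mem m hm := units_smul_mem_cocycles (pathN1_mem_cocycles hA hn hd hm) _
  f_mem m hm := pathN0_mem_cocycles hA hn hd h2 hm
  e_rel m hm := (pathN1_relative hA hn hd hm).units_smul _
  f_rel m hm := pathN0_relative hA hn hd h2 hm
  ee i j hi hj v := by
    have hmi := cochains_multi (pathN1_mem_cochains (k := k) hA hn hd hi)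
    have hmj := cochains_multi (pathN1_mem_cochains (k := k) hA hn hd hj)
    simp only [bracket, Pi.sub_apply, Pi.smul_apply, circ_units_smul_left (k := k),
      circ_units_smul_right _ hmi, circ_units_smul_right _ hmj,
      circ_pathN1_pathN1 hA hn hd h2 hi hj, circ_pathN1_pathN1 hA hn hd h2 hj hi]
    rw [negOnePow_smul_congr h2 (n' := 0) (i * (j * d)) (by refine ⟨0, ?_⟩; ring),
      Int.negOnePow_zero, one_smul, add_comm j i]
    simp only [Units.neg_smul, one_smul, neg_neg, smul_neg]
    rw [← sub_smul, add_sub_add_right_eq_sub, ← neg_smul, neg_sub]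
  fe i j hi hj v := by
    have hmi := cochains_multi (pathN0_mem_cochains (k := k) hA hn hd h2 hi)
    have hmj := cochains_multi (pathN1_mem_cochains (k := k) hA hn hd hj)
    simp only [bracket, Pi.sub_apply, Pi.smul_apply, circ_units_smul_left (k := k),
      circ_units_smul_right _ hmi, circ_pathN0_left hA hn hd h2 hi,
      circ_pathN1_pathN0 hA hn hd h2 hi hj]
    rw [negOnePow_smul_congr h2 (n' := 0) ((i * d - 1) * j) (by refine ⟨0, ?_⟩; ring),
      Int.negOnePow_zero, one_smul, Units.neg_smul, Units.neg_smul, one_smul, one_smul, neg_zero,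
      zero_sub, neg_neg]
  ff i j hi hj v := by
    simp only [bracket, Pi.sub_apply, Pi.smul_apply, circ_pathN0_left hA hn hd h2 hi,
      circ_pathN0_left hA hn hd h2 hj]
    simp

end PathBracket
end GradedGentleQuiver

/-! ### Bilinearity of the bracket over finite sums. -/

namespace GradedHochschild

section BracketSums

variable {k A : Type*} [Field k] [Ring A] [Algebra k A] {𝒜 : ℤ → Submodule k A}
  [GradedAlgebra 𝒜]

/-- The signs in `bracket` depend on the declared degrees. Summands with a nonzero coefficient have
the right degree, and for a zero coefficient the degree is irrelevant, so the degrees may be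
exchanged term by term. -/
theorem bracket_smul_smul {i j i' j' : ℤ} {f g : List A → A} (hf : Multi k f) (hg : Multi k g)
    {a b : k} (ha : a ≠ 0 → i' = i) (hb : b ≠ 0 → j' = j) (w : List A) :
    bracket 𝒜 i j (a • f) (b • g) w = (a * b) • bracket 𝒜 i' j' f g w := by
  have key : bracket 𝒜 i j (a • f) (b • g) = (a * b) • bracket 𝒜 i j f g := by
    simp only [bracket, circ_smul_left, circ_smul_right j hf, circ_smul_right i hg, smul_sub]
    rw [smul_smul, smul_smul, mul_comm b a, smul_comm _ (a * b)]
  by_cases h1 : a = 0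
  · rw [key, h1, zero_mul, zero_smul, zero_smul]; rfl
  by_cases h2 : b = 0
  · rw [key, h2, mul_zero, zero_smul, zero_smul]; rfl
  rw [key, ha h1, hb h2]; rfl

theorem Multi.sum {ι : Type*} {s : Finset ι} {F : ι → List A → A}
    (h : ∀ m ∈ s, Multi k (F m)) : Multi k (∑ m ∈ s, F m) := by
  classical
  induction s using Finset.induction_on with
  | empty => intro u v c a b; simp
  | insert a s ha ih =>
    rw [Finset.sum_insert ha]
    exact (h a (by simp)).addf (ih fun m hm => h m (by simp [hm]))

theorem bracket_zero_right {i j : ℤ} {f : List A → A} (hf : Multi k f) : bracket 𝒜 i j f 0 = 0 := by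
  have := bracket_add_right (𝒜 := 𝒜) (i := i) (j := j) (g := 0) (g' := 0) hf
  simpa using this

theorem bracket_zero_left {i j : ℤ} {f : List A → A} (hf : Multi k f) : bracket 𝒜 i j 0 f = 0 := by
  have := bracket_add_left (𝒜 := 𝒜) (i := i) (j := j) (f := 0) (f' := 0) hf
  simpa using this

theorem bracket_sum_sum {i j : ℤ} {ι : Type*} (s t : Finset ι) {F G : ι → List A → A}
    (hF : ∀ m ∈ s, Multi k (F m)) (hG : ∀ m ∈ t, Multi k (G m)) :
    bracket 𝒜 i j (∑ m ∈ s, F m) (∑ m ∈ t, G m)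
      = ∑ m ∈ s, ∑ n ∈ t, bracket 𝒜 i j (F m) (G n) := by
  classical
  have h1 : ∀ f : List A → A, Multi k f →
      bracket 𝒜 i j f (∑ m ∈ t, G m) = ∑ n ∈ t, bracket 𝒜 i j f (G n) := by
    intro f hf
    clear hF
    induction t using Finset.induction_on with
    | empty => simpa using bracket_zero_right hf
    | insert a t ha ih =>
      rw [Finset.sum_insert ha, Finset.sum_insert ha, bracket_add_right hf,
        ih fun m hm => hG m (by simp [hm])]
  induction s using Finset.induction_on with
  | empty => simpa using bracket_zero_left (Multi.sum hG)
  | insert a s ha ih =>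
    rw [Finset.sum_insert ha, Finset.sum_insert ha, bracket_add_left (Multi.sum hG),
      ih fun m hm => hF m (by simp [hm]), h1 _ (hF a (by simp))]

end BracketSums

end GradedHochschild

/-! ### Locally finite sums of the generators and their brackets. -/

namespace GradedGentleQuiver

section Series

variable {V E : Type*} [Fintype V] {Q : GradedGentleQuiver V E} {k : Type*} [Field k]
variable {d : ℤ} {e f : ℕ → List (Q.Alg k) → Q.Alg k}

/-- The sum `∑ x_m e_m + ∑ y_m f_m`. -/
noncomputable def series (e f : ℕ → List (Q.Alg k) → Q.Alg k) (x : (ℕ → k) × (ℕ → k))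
    (w : List (Q.Alg k)) : Q.Alg k := ∑ᶠ m, (x.1 m • e m w + x.2 m • f m w)

/-- A partial sum of `series`. -/
noncomputable def partialSum (e f : ℕ → List (Q.Alg k) → Q.Alg k) (x : (ℕ → k) × (ℕ → k)) (M : ℕ) :
    List (Q.Alg k) → Q.Alg k := ∑ m ∈ Finset.range M, (x.1 m • e m + x.2 m • f m)

/-- Local finiteness of the sum `series e f x`. -/
def LocFin (e f : ℕ → List (Q.Alg k) → Q.Alg k) (x : (ℕ → k) × (ℕ → k)) : Prop :=
  ∀ L : ℕ, ∃ M : ℕ, ∀ m, M ≤ m → (x.1 m = 0 ∧ x.2 m = 0) ∨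
    ∀ n, m ≤ n → ∀ w : List (Q.Alg k), w.length ≤ L → e n w = 0 ∧ f n w = 0

/-- Only finitely many terms are visible on words of bounded length, so identities between series
reduce to identities between partial sums. -/
theorem LocFin.series_eq {x : (ℕ → k) × (ℕ → k)} (hx : LocFin e f x) (L : ℕ) :
    ∃ M₀, ∀ M, M₀ ≤ M → ∀ w : List (Q.Alg k), w.length ≤ L →
      series e f x w = partialSum e f x M w := by
  obtain ⟨M₀, h⟩ := hx L
  refine ⟨M₀, fun M hM w hw => ?_⟩
  rw [series, partialSum, Finset.sum_apply, finsum_eq_sum_of_support_subset (s := Finset.range M)]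
  · rfl
  · intro m hm
    rw [Finset.coe_range, Set.mem_Iio]
    by_contra hlt
    apply hm
    dsimp only
    rcases h m (by omega) with ⟨h1, h2⟩ | h
    · rw [h1, h2, zero_smul, zero_smul, add_zero]
    · obtain ⟨h1, h2⟩ := h m le_rfl w hw
      rw [h1, h2, smul_zero, smul_zero, add_zero]

theorem partialSum_add (x y : (ℕ → k) × (ℕ → k)) (M : ℕ) :
    partialSum e f (x + y) M = partialSum e f x M + partialSum e f y M := by
  rw [partialSum, partialSum, partialSum, ← Finset.sum_add_distrib]
  refine Finset.sum_congr rfl fun m _ => ?_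
  simp only [Prod.fst_add, Prod.snd_add, Pi.add_apply, add_smul]
  abel

theorem partialSum_smul (c : k) (x : (ℕ → k) × (ℕ → k)) (M : ℕ) :
    partialSum e f (c • x) M = c • partialSum e f x M := by
  rw [partialSum, partialSum, Finset.smul_sum]
  refine Finset.sum_congr rfl fun m _ => ?_
  simp only [Prod.smul_fst, Prod.smul_snd, Pi.smul_apply, smul_add, smul_assoc]

theorem LocFin.series_add {x y : (ℕ → k) × (ℕ → k)} (hx : LocFin e f x) (hy : LocFin e f y)
    (hxy : LocFin e f (x + y)) : series e f (x + y) = series e f x + series e f y := by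
  funext w
  obtain ⟨M₁, h1⟩ := hx.series_eq w.length
  obtain ⟨M₂, h2⟩ := hy.series_eq w.length
  obtain ⟨M₃, h3⟩ := hxy.series_eq w.length
  let M := max M₁ (max M₂ M₃)
  rw [Pi.add_apply, h1 M (by omega) w le_rfl, h2 M (by omega) w le_rfl, h3 M (by omega) w le_rfl,
    partialSum_add]
  rfl

theorem LocFin.series_smul {x : (ℕ → k) × (ℕ → k)} (c : k) (hx : LocFin e f x)
    (hcx : LocFin e f (c • x)) : series e f (c • x) = c • series e f x := by
  funext w
  obtain ⟨M₁, h1⟩ := hx.series_eq w.length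
  obtain ⟨M₂, h2⟩ := hcx.series_eq w.length
  let M := max M₁ M₂
  rw [Pi.smul_apply, h1 M (by omega) w le_rfl, h2 M (by omega) w le_rfl, partialSum_smul]
  rfl

theorem LocFin.coef_series {x : (ℕ → k) × (ℕ → k)} (hx : LocFin e f x) (m : ℕ)
    (w : List (Q.Alg k)) (q : Q.NPath)
    (h : ∀ n, n ≠ m → coef Q k q (x.1 n • e n w) = 0 ∧ coef Q k q (x.2 n • f n w) = 0) :
    coef Q k q (series e f x w)
      = x.1 m * coef Q k q (e m w) + x.2 m * coef Q k q (f m w) := by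
  obtain ⟨M₀, h0⟩ := hx.series_eq w.length
  rw [h0 (max M₀ (m + 1)) (by omega) w le_rfl, partialSum, Finset.sum_apply, map_sum,
    Finset.sum_eq_single m]
  · rw [Pi.add_apply, map_add, Pi.smul_apply, Pi.smul_apply, map_smul, map_smul]; rfl
  · intro n _ hn
    rw [Pi.add_apply, map_add]
    have := h n hn
    rw [Pi.smul_apply, Pi.smul_apply, this.1, this.2, add_zero]
  · intro h
    exact absurd (Finset.mem_range.2 (by omega)) h

variable {i j : ℤ}

theorem WittFamily.term_mem (hW : WittFamily d e f) {x : (ℕ → k) × (ℕ → k)}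
    (hx : x ∈ completed k d i) (m : ℕ) :
    x.1 m • e m + x.2 m • f m ∈ cocycles (Q.grading k) (i + 1) := by
  refine add_mem ?_ ?_
  · by_cases h : x.1 m = 0
    · rw [h, zero_smul]; exact zero_mem _
    · obtain ⟨h1, h2⟩ := hx.1 m h
      rw [← h2]
      exact Submodule.smul_mem _ _ (hW.e_mem m h1)
  · by_cases h : x.2 m = 0
    · rw [h, zero_smul]; exact zero_mem _
    · obtain ⟨h1, h2⟩ := hx.2 m h
      rw [show i + 1 = m * d by rw [← h2]; ring]
      exact Submodule.smul_mem _ _ (hW.f_mem m h1)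

theorem WittFamily.partialSum_mem (hW : WittFamily d e f) {x : (ℕ → k) × (ℕ → k)}
    (hx : x ∈ completed k d i) (M : ℕ) : partialSum e f x M ∈ cocycles (Q.grading k) (i + 1) :=
  sum_mem fun m _ => hW.term_mem hx m

theorem Relative.smul {f : List (Q.Alg k) → Q.Alg k} (hf : Relative f) (c : k) :
    Relative (c • f) := by
  intro l q h
  refine hf l q fun h0 => h ?_
  rw [Pi.smul_apply, map_smul, h0, smul_zero]

theorem WittFamily.partialSum_relative (hW : WittFamily d e f) {x : (ℕ → k) × (ℕ → k)}
    (hx : x ∈ completed k d i) (M : ℕ) : Relative (partialSum e f x M) := by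
  have h0 : Relative (0 : List (Q.Alg k) → Q.Alg k) := fun l q h => absurd (map_zero _) h
  refine Relative.sum fun m _ => Relative.add ?_ ?_
  · by_cases h : x.1 m = 0
    · rw [h, zero_smul]; exact h0
    · exact (hW.e_rel m (hx.1 m h).1).smul _
  · by_cases h : x.2 m = 0
    · rw [h, zero_smul]; exact h0
    · exact (hW.f_rel m (hx.2 m h).1).smul _

theorem WittFamily.series_mem (hW : WittFamily d e f) {x : (ℕ → k) × (ℕ → k)}
    (hx : x ∈ completed k d i) (hl : LocFin e f x) :
    series e f x ∈ cocycles (Q.grading k) (i + 1) := by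
  constructor
  · refine ⟨fun u v a b => ?_, fun u v c a => ?_, fun w n h => ?_⟩
    · obtain ⟨M, hM⟩ := hl.series_eq (u.length + v.length + 1)
      rw [hM M le_rfl _ (by simp; omega), hM M le_rfl _ (by simp; omega),
        hM M le_rfl _ (by simp; omega)]
      exact (hW.partialSum_mem hx M).1.1 u v a b
    · obtain ⟨M, hM⟩ := hl.series_eq (u.length + v.length + 1)
      rw [hM M le_rfl _ (by simp; omega), hM M le_rfl _ (by simp; omega)]
      exact (hW.partialSum_mem hx M).1.2.1 u v c a
    · obtain ⟨M, hM⟩ := hl.series_eq w.length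
      rw [hM M le_rfl _ le_rfl]
      exact (hW.partialSum_mem hx M).1.2.2 w n h
  · change differential _ _ _ = 0
    funext w
    rcases hw : w with _ | ⟨a, v⟩
    · rfl
    · obtain ⟨M, hM⟩ := hl.series_eq v.length
      rw [differential_congr (n := v.length) _ _ (fun u hu => hM M le_rfl u hu.le) _ rfl]
      exact congrFun (hW.partialSum_mem hx M).2 _

theorem WittFamily.series_relative (hW : WittFamily d e f) {x : (ℕ → k) × (ℕ → k)}
    (hx : x ∈ completed k d i) (hl : LocFin e f x) : Relative (series e f x) := by
  intro l q h
  obtain ⟨M, hM⟩ := hl.series_eq l.length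
  rw [hM M le_rfl _ (by simp)] at h
  exact hW.partialSum_relative hx M l q h

theorem WittFamily.ef (hW : WittFamily d e f) (h2 : Even d ∨ CharP k 2) {p q : ℕ} (hp : 1 ≤ p)
    (hq : 1 ≤ q) (v : List E) : bracket (Q.grading k) (p * d + 1) (q * d) (e p) (f q)
      (pword Q k (aword Q v)) = -(q : k) • f (p + q) (pword Q k (aword Q v)) := by
  rw [bracket_swap, Pi.neg_apply, Pi.smul_apply, hW.fe q p hq hp,
    negOnePow_smul_congr h2 (n' := 0) ((q * d - 1) * p) (by refine ⟨0, ?_⟩; ring),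
    Int.negOnePow_zero, one_smul, neg_smul, add_comm q p]

theorem WittFamily.bracket_terms (hW : WittFamily d e f) (h2 : Even d ∨ CharP k 2)
    {x y : (ℕ → k) × (ℕ → k)} (hx : x ∈ completed k d i) (hy : y ∈ completed k d j) (p q : ℕ)
    (v : List E) :
    bracket (Q.grading k) (i + 1) (j + 1) (x.1 p • e p + x.2 p • f p) (y.1 q • e q + y.2 q • f q)
        (pword Q k (aword Q v))
      = (((p : k) - q) * (x.1 p * y.1 q)) • e (p + q) (pword Q k (aword Q v))
        + ((p : k) * (x.2 p * y.1 q) - (q : k) * (x.1 p * y.2 q)) •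
          f (p + q) (pword Q k (aword Q v)) := by
  have hx1 : x.1 p ≠ 0 → p * d = i := fun h => (hx.1 p h).2
  have hx2 : x.2 p ≠ 0 → p * d = i + 1 := fun h => by rw [← (hx.2 p h).2]; ring
  have hy1 : y.1 q ≠ 0 → q * d = j := fun h => (hy.1 q h).2
  have hy2 : y.2 q ≠ 0 → q * d = j + 1 := fun h => by rw [← (hy.2 q h).2]; ring
  by_cases hp : 1 ≤ p
  swap
  · have h1 : x.1 p = 0 := by by_contra h; exact hp (hx.1 p h).1
    have h3 : x.2 p = 0 := by by_contra h; exact hp (hx.2 p h).1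
    rw [h1, h3, zero_smul, zero_smul, add_zero,
      bracket_zero_left (cochains_multi (hW.term_mem hy q).1)]
    simp
  by_cases hq : 1 ≤ q
  swap
  · have h1 : y.1 q = 0 := by by_contra h; exact hq (hy.1 q h).1
    have h3 : y.2 q = 0 := by by_contra h; exact hq (hy.2 q h).1
    rw [h1, h3, zero_smul, zero_smul, add_zero,
      bracket_zero_right (cochains_multi (hW.term_mem hx p).1)]
    simp
  have me := cochains_multi (hW.e_mem p hp).1
  have mf := cochains_multi (hW.f_mem p hp).1
  have me' := cochains_multi (hW.e_mem q hq).1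
  have mf' := cochains_multi (hW.f_mem q hq).1
  have hy' := cochains_multi (hW.term_mem hy q).1
  have ms : ∀ (c : k) (g : List (Q.Alg k) → Q.Alg k), Multi k g → Multi k (c • g) := by
    intro c g hg u v c' a b
    rw [Pi.smul_apply, Pi.smul_apply, Pi.smul_apply, hg, smul_add, smul_comm]
  rw [bracket_add_left hy', Pi.add_apply, bracket_add_right (ms _ _ me),
    bracket_add_right (ms _ _ mf), Pi.add_apply, Pi.add_apply,
    bracket_smul_smul (i' := p * d + 1) (j' := q * d + 1) me me' (fun h => by rw [hx1 h])
      (fun h => by rw [hy1 h]),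
    bracket_smul_smul (i' := p * d + 1) (j' := q * d) me mf' (fun h => by rw [hx1 h]) hy2,
    bracket_smul_smul (i' := p * d) (j' := q * d + 1) mf me' hx2 (fun h => by rw [hy1 h]),
    bracket_smul_smul (i' := p * d) (j' := q * d) mf mf' hx2 hy2,
    hW.ee p q hp hq, hW.fe p q hp hq, hW.ff p q hp hq, hW.ef h2 hp hq]
  module

/-- The class of the bracket of two series. -/
theorem WittFamily.bracket_series (hW : WittFamily d e f) (h2 : Even d ∨ CharP k 2)
    {x y : (ℕ → k) × (ℕ → k)} (hx : x ∈ completed k d i) (hy : y ∈ completed k d j)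
    (lx : LocFin e f x) (ly : LocFin e f y) (lz : LocFin e f (bracketFun x y)) :
    bracket (Q.grading k) (i + 1) (j + 1) (series e f x) (series e f y)
      - series e f (bracketFun x y) ∈ coboundaries (Q.grading k) (i + j + 1) := by
  have cx := hW.series_mem hx lx
  have cy := hW.series_mem hy ly
  have hz := bracketFun_mem hx hy
  refine mem_coboundaries_of_crit
    (sub_mem (bracket_mem_cocycles cx cy (by ring)) (hW.series_mem hz lz)) ?_ ?_
  · exact (Relative.bracket (cochains_multi cx.1) (hW.series_relative hx lx)
      (cochains_multi cy.1) (hW.series_relative hy ly) _ _).sub (hW.series_relative hz lz)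
  · intro L hL
    obtain ⟨v, -, rfl⟩ := hL.exists_aword
    rw [Pi.sub_apply, sub_eq_zero]
    -- The factors are needed on words one letter longer than `v`, because of components of arity
    -- zero.
    obtain ⟨M₁, h3⟩ := lx.series_eq (v.length + 1)
    obtain ⟨M₂, h4⟩ := ly.series_eq (v.length + 1)
    obtain ⟨M₃, h5⟩ := lz.series_eq v.length
    obtain ⟨M₄, h6⟩ := lx v.length
    obtain ⟨M₅, h7⟩ := ly v.length
    obtain ⟨M, hM1, hM2, hM3, hM4, hM5⟩ : ∃ M, M₁ ≤ M ∧ M₂ ≤ M ∧ M₃ ≤ M ∧ M₄ ≤ M ∧ M₅ ≤ M :=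
      ⟨M₁ + M₂ + M₃ + M₄ + M₅, by omega, by omega, by omega, by omega, by omega⟩
    rw [bracket_congr (n := v.length) _ _ _ (h3 M hM1) (h4 M hM2) _ (by simp),
      h5 (M + M) (by omega) _ (by simp), partialSum, partialSum,
      bracket_sum_sum _ _ (fun m _ => cochains_multi (hW.term_mem hx m).1)
        (fun m _ => cochains_multi (hW.term_mem hy m).1), partialSum, Finset.sum_apply,
      Finset.sum_apply]
    simp only [Finset.sum_apply, hW.bracket_terms h2 hx hy]
    set w := pword Q k (aword Q v) with hw
    have hwl : w.length ≤ v.length := by simp [hw]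
    let G : ℕ × ℕ → Q.Alg k := fun c =>
      (((c.1 : k) - c.2) * (x.1 c.1 * y.1 c.2)) • e (c.1 + c.2) w
        + ((c.1 : k) * (x.2 c.1 * y.1 c.2) - (c.2 : k) * (x.1 c.1 * y.2 c.2)) •
          f (c.1 + c.2) w
    -- In `LocFin` the vanishing on short words holds for all later indices. It therefore applies to
    -- the index `c.1 + c.2` of the product term.
    have hG : ∀ c : ℕ × ℕ, M ≤ c.1 ∨ M ≤ c.2 → G c = 0 := by
      intro c hc
      have key : (x.1 c.1 = 0 ∧ x.2 c.1 = 0) ∨ (y.1 c.2 = 0 ∧ y.2 c.2 = 0) ∨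
          (e (c.1 + c.2) w = 0 ∧ f (c.1 + c.2) w = 0) := by
        rcases hc with hc | hc
        · rcases h6 c.1 (by omega) with h | h
          · exact Or.inl h
          · exact Or.inr (Or.inr (h _ (by omega) w hwl))
        · rcases h7 c.2 (by omega) with h | h
          · exact Or.inr (Or.inl h)
          · exact Or.inr (Or.inr (h _ (by omega) w hwl))
      rcases key with ⟨a1, a2⟩ | ⟨a1, a2⟩ | ⟨a1, a2⟩ <;> simp [G, a1, a2]
    -- The square is regrouped along antidiagonals; the missing parts of the triangles contribute
    -- nothing by `hG`.
    have hL' : ∑ p ∈ Finset.range M, ∑ q ∈ Finset.range M, G (p, q)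
        = ∑ n ∈ Finset.range (M + M), ∑ c ∈ Finset.HasAntidiagonal.antidiagonal n, G c := by
      rw [← Finset.sum_product', ← Finset.sum_fiberwise_of_maps_to
        (s := Finset.range M ×ˢ Finset.range M) (t := Finset.range (M + M))
        (g := fun c : ℕ × ℕ => c.1 + c.2)]
      · refine Finset.sum_congr rfl fun n _ => Finset.sum_subset ?_ ?_
        · intro c hc
          simpa using (Finset.mem_filter.1 hc).2
        · intro c hc hc'
          apply hG
          by_contra! h
          exact hc' (Finset.mem_filter.2 ⟨by simp [h.1, h.2], by simpa using hc⟩)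
      · intro c hc
        simp only [Finset.mem_product, Finset.mem_range] at hc ⊢
        omega
    refine hL'.trans (Finset.sum_congr rfl fun n _ => ?_)
    rw [Pi.add_apply, Pi.smul_apply, Pi.smul_apply, bracketFun, Finset.sum_smul, Finset.sum_smul,
      ← Finset.sum_add_distrib]
    refine Finset.sum_congr rfl fun c hc => ?_
    rw [Finset.HasAntidiagonal.mem_antidiagonal] at hc
    simp only [G, hc]

end Series
end GradedGentleQuiver

/-! ### Reading off coefficients of products, and a telescoping argument. -/

namespace GradedGentleQuiver

section Coefficients

variable {V E : Type*} [Fintype V] {Q : GradedGentleQuiver V E} {k : Type*} [Field k]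

/-- Left multiplication by a path is injective on the basis paths that it does not annihilate, so a
path in the product determines its right factor. -/
theorem coef_ofPath_mul_eq {p r q : Q.NPath} (h : Q.ofPath k p * Q.ofPath k r = Q.ofPath k q)
    (y : Q.Alg k) : coef Q k q (Q.ofPath k p * y) = coef Q k r y := by
  have key : coef Q k q ∘ₗ LinearMap.mulLeft k (Q.ofPath k p) = coef Q k r := by
    refine (Q.pathBasis k).ext fun s => ?_
    change coef Q k q (Q.ofPath k p * Q.ofPath k s) = coef Q k r (Q.ofPath k s)
    by_cases hs : s = r
    · rw [hs, h, coef_ofPath, coef_ofPath, if_pos rfl, if_pos rfl]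
    · rw [coef_ofPath, if_neg hs]
      by_contra h1
      obtain ⟨t, hc, ht, rfl⟩ := coef_ofPath_mul h1
      obtain rfl := coef_ofPath_ne ht
      have h2 : coef Q k (p.comp s hc) (Q.ofPath k p * Q.ofPath k r) ≠ 0 := by
        rw [h, coef_ofPath, if_pos rfl]; exact one_ne_zero
      obtain ⟨t, hc', ht', h3⟩ := coef_ofPath_mul h2
      obtain rfl := coef_ofPath_ne ht'
      refine hs (NPath.ext (hc.1.symm.trans hc'.1) ?_)
      exact List.append_cancel_left (congrArg NPath.word h3)
  exact LinearMap.congr_fun key y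

theorem coef_mul_ofPath_eq {p r q : Q.NPath} (h : Q.ofPath k p * Q.ofPath k r = Q.ofPath k q)
    (y : Q.Alg k) : coef Q k q (y * Q.ofPath k r) = coef Q k p y := by
  have key : coef Q k q ∘ₗ LinearMap.mulRight k (Q.ofPath k r) = coef Q k p := by
    refine (Q.pathBasis k).ext fun s => ?_
    change coef Q k q (Q.ofPath k s * Q.ofPath k r) = coef Q k p (Q.ofPath k s)
    by_cases hs : s = p
    · rw [hs, h, coef_ofPath, coef_ofPath, if_pos rfl, if_pos rfl]
    · rw [coef_ofPath, if_neg hs]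
      by_contra h1
      obtain ⟨t, hc, ht, rfl⟩ := coef_mul_ofPath h1
      obtain rfl := coef_ofPath_ne ht
      have h2 : coef Q k (s.comp r hc) (Q.ofPath k p * Q.ofPath k r) ≠ 0 := by
        rw [h, coef_ofPath, if_pos rfl]; exact one_ne_zero
      obtain ⟨t, hc', ht', h3⟩ := coef_mul_ofPath h2
      obtain rfl := coef_ofPath_ne ht'
      refine hs (NPath.ext ?_ ?_)
      · have h4 : (s.comp r hc).tgt = (p.comp r hc').tgt := by rw [h3]
        exact h4
      · exact List.append_cancel_right (congrArg NPath.word h3)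
  exact LinearMap.congr_fun key y

theorem coef_trivial_arrow_mul (x : V) (a : E) (y : Q.Alg k) :
    coef Q k (Q.trivialPath x) (Q.wordElt k [a] * y) = 0 := by
  by_contra h
  rw [wordElt_singleton] at h
  obtain ⟨t, hc, -, h3⟩ := coef_ofPath_mul h
  simpa [trivialPath, NPath.comp, arrowPath] using congrArg NPath.word h3

theorem coef_trivial_mul_arrow (x : V) (a : E) (y : Q.Alg k) :
    coef Q k (Q.trivialPath x) (y * Q.wordElt k [a]) = 0 := by
  by_contra h
  rw [wordElt_singleton] at h
  obtain ⟨t, hc, -, h3⟩ := coef_mul_ofPath h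
  simpa [trivialPath, NPath.comp, arrowPath] using congrArg NPath.word h3

theorem coef_units_smul (s : ℤˣ) (q : Q.NPath) (a : Q.Alg k) :
    coef Q k q (s • a) = s • coef Q k q a := by
  rcases Int.units_eq_one_or s with rfl | rfl <;> simp

/-- A function on a cycle whose increments vanish at all places but one has no increment there
either. -/
theorem telescope {M : Type*} [AddCommGroup M] {l : ℕ} (hl : 0 < l) (G : ℕ → M) (a : M)
    (h : ∀ r < l, G (r + 1) = G r + if r = l - 1 then a else 0) (h0 : G l = G 0) : a = 0 := by
  have key : ∀ r, r < l → G r = G 0 := by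
    intro r
    induction r with
    | zero => intro _; rfl
    | succ r ih =>
      intro hr
      rw [h r (by omega), ih (by omega), if_neg (by omega), add_zero]
  have h1 := h (l - 1) (by omega)
  rw [Nat.sub_add_cancel hl, h0, key (l - 1) (by omega), if_pos rfl] at h1
  exact left_eq_add.1 h1

end Coefficients

/-! ### Independence of the classes for a complete anti-path. -/

section AntiIndependence

variable {V E : Type*} [Fintype V] {Q : GradedGentleQuiver V E} {k : Type*} [Field k]
  {A : ℕ → E} {l : ℕ} {d : ℤ}

variable (Q k A l) in
/-- The cocycles which represent the generators `e_m` in the case of a complete anti-path. -/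
noncomputable abbrev antiE (m : ℕ) : List (Q.Alg k) → Q.Alg k :=
  Q.antiEps A l m • Q.antiN1 k (seg A 0 (m * l))

variable (Q k A l) in
/-- The cocycles which represent the generators `f_m` in the case of a complete anti-path. -/
noncomputable abbrev antiF (m : ℕ) : List (Q.Alg k) → Q.Alg k := Q.antiN0 k (seg A 0 (m * l))

theorem antiE_arity (hA : CyclicWord A l) {m : ℕ} (hm : 1 ≤ m) (w : List (Q.Alg k))
    (hw : w.length ≠ m * l + 1) : antiE Q k A l m w = 0 := by
  rw [antiE, Pi.smul_apply, antiN1_arity hA hm w hw, smul_zero]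

theorem antiE_aword (hA : CyclicWord A l) {m : ℕ} (hm : 1 ≤ m) {r : ℕ} (hr : r < l) :
    antiE Q k A l m (pword Q k (aword Q (seg A r (m * l + 1))))
      = Q.antiEps A l m • (if r = l - 1 then Q.ofPath k (Q.arrowPath (A r)) else 0) := by
  rw [antiE, Pi.smul_apply]
  split_ifs with h
  · rw [h, antiN1_aword hA hm]
  · rw [antiN1_aword_of_ne hA hm]
    intro h1
    have h2 := hA.seg_inj (Nat.succ_pos _) h1
    rw [Nat.ModEq, Nat.mod_eq_of_lt hr, Nat.mod_eq_of_lt (by omega)] at h2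
    exact h h2

theorem coef_trivial_antiE (hA : CyclicWord A l) {m : ℕ} (hm : 1 ≤ m) (v : List E) (x : V) :
    coef Q k (Q.trivialPath x) (antiE Q k A l m (pword Q k (aword Q v))) = 0 := by
  rw [antiE, Pi.smul_apply, coef_units_smul]
  by_cases h : v = seg A (l - 1) (m * l + 1)
  · rw [h, antiN1_aword hA hm, coef_ofPath, if_neg, smul_zero]
    intro h
    simpa [arrowPath, trivialPath] using congrArg NPath.word h
  · rw [antiN1_aword_of_ne hA hm h, map_zero, smul_zero]

theorem coef_arrow_antiF (hA : CyclicWord A l) (hrel : ∀ t, Q.rel (A t) (A (t + 1)))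
    (hd : d = l - Q.cdeg A l) (h2 : Even d ∨ CharP k 2) {m : ℕ} (hm : 1 ≤ m) (v : List E) (a : E) :
    coef Q k (Q.arrowPath a) (antiF Q k A l m (pword Q k (aword Q v))) = 0 := by
  by_cases h : ∃ r, v = seg A r (m * l)
  · obtain ⟨r, rfl⟩ := h
    rw [antiF, antiN0_aword hA hrel hd h2 hm, coef_units_smul, coef_ofPath, if_neg, smul_zero]
    intro h
    simpa [arrowPath, trivialPath] using congrArg NPath.word h
  · push Not at h
    rw [antiF, antiN0_aword_of_ne hA hrel hm h, map_zero]

theorem anti_locFin (hA : CyclicWord A l) (hrel : ∀ t, Q.rel (A t) (A (t + 1)))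
    (x : (ℕ → k) × (ℕ → k)) : LocFin (antiE Q k A l) (antiF Q k A l) x := by
  intro L
  refine ⟨L + 1, fun m hm => Or.inr fun n hn w hw => ?_⟩
  have h1 : n ≤ n * l := Nat.le_mul_of_pos_right n hA.pos
  exact ⟨antiE_arity hA (by omega) w (by omega), antiN0_arity hA hrel (by omega) w (by omega)⟩

/-- The arity bound `J` is kept since the result has to control approximations modulo the arity
filtration. For `e_m`, the coefficient of `A_r` on the stretch of `m l + 1` letters turns the
differential of `h` into a cyclic difference, which cannot be concentrated at one place. For `f_m`,
a differential has no trivial paths in its values on words of arrows. -/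
theorem anti_independent (hA : CyclicWord A l) (hrel : ∀ t, Q.rel (A t) (A (t + 1)))
    (hd : d = l - Q.cdeg A l) (h2 : Even d ∨ CharP k 2) {i : ℤ} {x : (ℕ → k) × (ℕ → k)}
    (hx : x ∈ completed k d i) {h : List (Q.Alg k) → Q.Alg k} (hm : Multi k h) {J : ℕ}
    (heq : ∀ w : List (Q.Alg k), w.length < J →
      series (antiE Q k A l) (antiF Q k A l) x w = differential (Q.grading k) i h w)
    {m : ℕ} (hJ : m * l + 1 < J) : x.1 m = 0 ∧ x.2 m = 0 := by
  have hl := hA.pos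
  have hlf := anti_locFin (k := k) hA hrel x
  constructor
  · by_contra ham
    obtain ⟨h1m, him⟩ := hx.1 m ham
    set t : ℤ := i - (m * l : ℕ) with ht
    -- The coefficient of `A_r` in an outer term is the coefficient of the vertex at one of its ends
    -- in a value of `h`.
    let H : ℕ → k := fun r =>
      coef Q k (Q.trivialPath (Q.tgt (A r))) (h (pword Q k (aword Q (seg A r (m * l)))))
    have key : ∀ r < l, t.negOnePow • ((t * Q.deg (A r)).negOnePow • H (r + 1)
          + (((m * l : ℕ) : ℤ) + 1).negOnePow • H r)
        = if r = l - 1 then Q.antiEps A l m • x.1 m else 0 := by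
      intro r hr
      have e2 := congrArg (coef Q k (Q.arrowPath (A r)))
        (heq (pword Q k (aword Q (seg A r (m * l + 1)))) (by simpa using hJ))
      rw [hlf.coef_series m _ _ ?_] at e2
      · have e3 : coef Q k (Q.arrowPath (A r))
            (differential (Q.grading k) i h (pword Q k (aword Q (seg A r (m * l + 1)))))
            = t.negOnePow • ((t * Q.deg (A r)).negOnePow • H (r + 1)
              + (((m * l : ℕ) : ℤ) + 1).negOnePow • H r) := by
          have c1 := seg_succ A r (m * l)
          rw [c1, differential_aword hm i (A r) _ (seg A r (m * l)) (A (r + m * l))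
            (c1 ▸ seg_isChain hrel _ _) (c1 ▸ seg_concat A r (m * l)), length_seg, ← ht,
            coef_units_smul, map_add, coef_units_smul, coef_units_smul,
            hA.congr (s := r + m * l) (t := r) (by simp [Nat.ModEq]), wordElt_singleton,
            coef_ofPath_mul_eq (r := Q.trivialPath (Q.src (A r))),
            coef_mul_ofPath_eq (p := Q.trivialPath (Q.tgt (A r))), Q.rel_comp _ _ (hrel r)]
          · rw [← wordElt_singleton, trivial_mul_arrow]
          · rw [← wordElt_singleton, arrow_mul_trivial]
        rw [← e3, ← e2, coef_arrow_antiF hA hrel hd h2 h1m, mul_zero, add_zero,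
          antiE_aword hA h1m hr, coef_units_smul]
        split_ifs
        · rw [coef_ofPath, if_pos rfl, mul_smul_comm, mul_one]
        · rw [map_zero, smul_zero, mul_zero]
      · intro n hn
        constructor
        · by_cases h0 : x.1 n = 0
          · rw [h0, zero_smul, map_zero]
          · rw [antiE_arity hA (hx.1 n h0).1, smul_zero, map_zero]
            simp only [length_pword, length_aword, length_seg]
            intro h3
            exact hn (Nat.eq_of_mul_eq_mul_right hl (by omega))
        · by_cases h0 : x.2 n = 0
          · rw [h0, zero_smul, map_zero]
          · rw [map_smul, coef_arrow_antiF hA hrel hd h2 (hx.2 n h0).1, smul_zero]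
    -- The accumulated signs turn `key` into plain increments. The exponents at `l` and at `0`
    -- differ by a multiple of `d`, so the sequence closes up.
    have h3 := telescope hl
      (fun r => (t * Q.cdeg A r + r * (m * l : ℕ)).negOnePow • H r)
      ((t * Q.cdeg A (l - 1) + ((l - 1 : ℕ) + 1) * (m * l : ℕ) + t).negOnePow •
        Q.antiEps A l m • x.1 m) ?_ ?_
    · rw [smul_eq_zero_iff_eq, smul_eq_zero_iff_eq] at h3
      exact ham h3
    · intro r hr
      have h4 : (t * Q.deg (A r)).negOnePow • H (r + 1) = ((m * l : ℕ) : ℤ).negOnePow • H r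
          + t.negOnePow • if r = l - 1 then Q.antiEps A l m • x.1 m else 0 := by
        rw [← key r hr]
        rcases negOnePow_cases t with h5 | h5 <;> simp [h5, Int.negOnePow_succ]
      have h5 := congrArg (fun z => (t * Q.cdeg A r + (r + 1) * (m * l : ℕ)).negOnePow • z) h4
      simp only [smul_add, smul_smul, ← Int.negOnePow_add] at h5
      rw [cdeg_succ, show t * (Q.cdeg A r + Q.deg (A r)) + ((r + 1 : ℕ) : ℤ) * (m * l : ℕ)
        = t * Q.cdeg A r + (r + 1) * (m * l : ℕ) + t * Q.deg (A r) by push_cast; ring, h5]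
      congr 1
      · rw [negOnePow_congr (n := t * Q.cdeg A r + r * (m * l : ℕ)) ⟨(m * l : ℕ), by ring⟩]
      · split_ifs with h6
        · rw [h6]
        · rw [smul_zero]
    · have h7 : H l = H 0 := by
        simp only [H]
        rw [hA.congr (s := l) (t := 0) (by simp [Nat.ModEq]),
          hA.seg_congr (r := l) (s := 0) (by simp [Nat.ModEq])]
      simp only [h7]
      refine negOnePow_smul_congr h2 (m * (l + Q.cdeg A l)) ⟨0, ?_⟩ _
      rw [cdeg_zero, ht, ← him, hd]
      push_cast
      ring
  · by_contra hbm
    obtain ⟨h1m, him⟩ := hx.2 m hbm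
    have h3 : m ≤ m * l := Nat.le_mul_of_pos_right m hl
    have e2 := congrArg (coef Q k (Q.trivialPath (Q.tgt (A 0))))
      (heq (pword Q k (aword Q (seg A 0 (m * l)))) (by simp; omega))
    rw [hlf.coef_series m _ _ ?_, coef_trivial_antiE hA h1m, mul_zero, zero_add,
      antiF, antiN0_aword hA hrel hd h2 h1m, coef_units_smul, coef_ofPath, if_pos rfl] at e2
    · have e3 : coef Q k (Q.trivialPath (Q.tgt (A 0)))
          (differential (Q.grading k) i h (pword Q k (aword Q (seg A 0 (m * l))))) = 0 := by
        obtain ⟨N, hN⟩ : ∃ N, m * l = N + 1 := ⟨m * l - 1, by omega⟩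
        have c1 := seg_succ A 0 N
        rw [hN, c1, differential_aword hm i (A 0) _ (seg A 0 N) (A (0 + N))
            (c1 ▸ seg_isChain hrel _ _) (c1 ▸ seg_concat A 0 N), coef_units_smul, map_add,
            coef_units_smul, coef_units_smul, coef_trivial_arrow_mul, coef_trivial_mul_arrow]
        simp
      rw [e3] at e2
      apply hbm
      rcases Int.units_eq_one_or (Q.antiSign A l m 0).negOnePow with h4 | h4 <;>
      simpa [h4] using e2
    · intro n hn
      constructor
      · by_cases h0 : x.1 n = 0
        · rw [h0, zero_smul, map_zero]
        · rw [map_smul, coef_trivial_antiE hA (hx.1 n h0).1, smul_zero]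
      · by_cases h0 : x.2 n = 0
        · rw [h0, zero_smul, map_zero]
        · rw [antiF, antiN0_arity hA hrel (hx.2 n h0).1, smul_zero, map_zero]
          simp only [length_pword, length_aword, length_seg]
          intro h3
          exact hn (Nat.eq_of_mul_eq_mul_right hl (by omega))

end AntiIndependence
end GradedGentleQuiver

/-! ### Independence of the classes for a complete path. -/

namespace GradedGentleQuiver

section PathIndependence

variable {V E : Type*} [Fintype V] {Q : GradedGentleQuiver V E} {k : Type*} [Field k]
  {A : ℕ → E} {l : ℕ} {d : ℤ}

variable (Q k A l) in
/-- The cocycles which represent the generators `e_m` in the case of a complete path. -/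
noncomputable abbrev pathE (m : ℕ) : List (Q.Alg k) → Q.Alg k :=
  (-1 : ℤˣ) • Q.pathN1 k (seg A 0 (m * l))

variable (Q k A l) in
/-- The cocycles which represent the generators `f_m` in the case of a complete path. -/
noncomputable abbrev pathF (m : ℕ) : List (Q.Alg k) → Q.Alg k := Q.pathN0 k (seg A 0 (m * l))

theorem uncompleted_locFin {e f : ℕ → List (Q.Alg k) → Q.Alg k} {i : ℤ} {x : (ℕ → k) × (ℕ → k)}
    (hx : x ∈ uncompleted k d i) : LocFin e f x := by
  obtain ⟨N, hN⟩ := (hx.2.1.union hx.2.2).bddAbove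
  refine fun L => ⟨N + 1, fun m hm => Or.inl ⟨?_, ?_⟩⟩
  · by_contra h
    have := hN (Or.inl h)
    omega
  · by_contra h
    have := hN (Or.inr h)
    omega

theorem length_segPath (hn : ∀ t, Q.nonrel (A t) (A (t + 1))) (r N : ℕ) :
    (segPath hn r N).word.length = N := length_seg _ _ _

theorem coef_segPath_ne (hn : ∀ t, Q.nonrel (A t) (A (t + 1))) {r s M N : ℕ} (h : M ≠ N) :
    coef Q k (segPath hn s N) (Q.ofPath k (segPath hn r M)) = 0 := by
  rw [coef_ofPath, if_neg]
  intro h1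
  exact h (by rw [← length_segPath hn r M, h1, length_segPath])

/-- The `e_m` live in arity one: on the arrow `A_r`, the coefficient of the path of `m l + 1`
letters in a differential is a cyclic difference of coefficients of `h []`. The `f_m` live in arity
zero, where coboundaries vanish, and they are separated by the lengths of their paths. -/
theorem path_independent (hA : CyclicWord A l) (hn : ∀ t, Q.nonrel (A t) (A (t + 1)))
    (hd : d = Q.cdeg A l) (h2 : Even d ∨ CharP k 2) {i : ℤ} {x : (ℕ → k) × (ℕ → k)}
    (hx : x ∈ uncompleted k d i) {h : List (Q.Alg k) → Q.Alg k} (hm : Multi k h)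
    (heq : series (pathE Q k A l) (pathF Q k A l) x = differential (Q.grading k) i h) :
    x = 0 := by
  classical
  have hl := hA.pos
  have hlf : LocFin (pathE Q k A l) (pathF Q k A l) x := uncompleted_locFin hx
  have hE : ∀ (c : E) (n : ℕ), 1 ≤ n → pathE Q k A l n (pword Q k (aword Q [c]))
      = -if c = A (l - 1) then Q.ofPath k (segPath hn (l - 1) (n * l + 1)) else 0 := by
    intro c n h1
    rw [pathE, Pi.smul_apply, pathN1_arrow hA hn hd h1, Units.neg_smul, one_smul]
  have ha : ∀ m, x.1 m = 0 := by
    intro m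
    by_contra ham
    obtain ⟨h1m, him⟩ := hx.1.1 m ham
    let H : ℕ → k := fun r => coef Q k (segPath hn r (m * l)) (h [])
    have key : ∀ r < l, i.negOnePow • ((i * Q.deg (A r)).negOnePow • H (r + 1) - H r)
        = if r = l - 1 then - x.1 m else 0 := by
      intro r hr
      have e2 := congrArg (coef Q k (segPath hn r (m * l + 1)))
        (congrFun heq (pword Q k (aword Q [A r])))
      rw [hlf.coef_series m _ _ ?_, differential_aword hm i (A r) [] [] (A r) (by simp) rfl] at e2
      · have e3 : A r = A (r + m * l) := hA.congr (by simp [Nat.ModEq])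
        have c1 := arrow_mul_segPath (k := k) hn r (m * l)
        have c2 := segPath_mul_arrow (k := k) hn r (m * l)
        rw [← e3] at c2
        rw [wordElt_singleton] at c1 c2 e2
        simp only [aword_nil, pword_nil] at e2
        rw [coef_units_smul, map_add, coef_units_smul, coef_units_smul, coef_ofPath_mul_eq c1,
          coef_mul_ofPath_eq c2, hE _ _ h1m, pathF, pathN0_arity hA hn hd h2 h1m _ (by simp),
          map_zero, mul_zero, add_zero] at e2
        simp only [List.length_nil, Nat.cast_zero, sub_zero, zero_add, Int.negOnePow_one] at e2
        rw [Units.neg_smul, one_smul, ← sub_eq_add_neg] at e2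
        rw [show i.negOnePow • ((i * Q.deg (A r)).negOnePow • H (r + 1) - H r) = _ from e2.symm]
        by_cases h5 : r = l - 1
        · rw [if_pos h5, h5, if_pos rfl, map_neg, coef_ofPath, if_pos rfl]; ring
        · rw [if_neg h5, if_neg, neg_zero, map_zero, mul_zero]
          intro h6
          have h7 := hA.inj _ _ h6
          rw [Nat.ModEq, Nat.mod_eq_of_lt hr, Nat.mod_eq_of_lt (by omega)] at h7
          exact h5 h7
      · intro n hnm
        constructor
        · by_cases h0 : x.1 n = 0
          · rw [h0, zero_smul, map_zero]
          · rw [hE _ _ (hx.1.1 n h0).1]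
            split_ifs
            · rw [map_smul, map_neg, coef_segPath_ne, neg_zero, smul_zero]
              intro h3
              exact hnm (Nat.eq_of_mul_eq_mul_right hl (by omega))
            · rw [neg_zero, smul_zero, map_zero]
        · by_cases h0 : x.2 n = 0
          · rw [h0, zero_smul, map_zero]
          · rw [pathF, pathN0_arity hA hn hd h2 (hx.1.2 n h0).1 _ (by simp), smul_zero, map_zero]
    have h3 := telescope hl (fun r => (i * Q.cdeg A r).negOnePow • H r)
      ((i * Q.cdeg A (l - 1) + i).negOnePow • (- x.1 m)) ?_ ?_
    · rw [smul_eq_zero_iff_eq, neg_eq_zero] at h3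
      exact ham h3
    · intro r hr
      have h4 : (i * Q.deg (A r)).negOnePow • H (r + 1) = H r
          + i.negOnePow • if r = l - 1 then - x.1 m else 0 := by
        rw [← key r hr]
        rcases negOnePow_cases i with h5 | h5 <;> simp [h5]
      have h5 := congrArg (fun z => (i * Q.cdeg A r).negOnePow • z) h4
      simp only [smul_add, smul_smul, ← Int.negOnePow_add] at h5
      rw [cdeg_succ, mul_add, h5]
      congr 1
      split_ifs with h6
      · rw [h6]
      · rw [smul_zero]
    · have h7 : H l = H 0 := by
        simp only [H]
        rw [segPath_congr hA hn (r := l) (s := 0) (by simp [Nat.ModEq])]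
      simp only [h7]
      refine negOnePow_smul_congr h2 i ⟨0, ?_⟩ _
      rw [cdeg_zero, hd]
      ring
  have hb : ∀ m, x.2 m = 0 := by
    intro m
    by_contra hbm
    obtain ⟨h1m, him⟩ := hx.1.2 m hbm
    have e2 := congrArg (coef Q k (segPath hn 0 (m * l))) (congrFun heq [])
    rw [hlf.coef_series m _ _ ?_, differential_nil, map_zero, ha, zero_mul, zero_add, pathF,
      pathN0_nil hA hn hd h2 h1m, map_sum, Finset.sum_eq_single 0] at e2
    · rw [coef_ofPath, if_pos rfl, mul_one] at e2
      exact hbm e2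
    · intro r hr hr0
      rw [coef_ofPath, if_neg]
      intro h3
      have h4 := hA.seg_inj (Nat.mul_pos h1m hl) (congrArg NPath.word h3)
      rw [Nat.ModEq, Nat.mod_eq_of_lt (Finset.mem_range.1 hr), Nat.zero_mod] at h4
      exact hr0 h4
    · intro h3
      exact absurd (Finset.mem_range.2 hl) h3
    · intro n hnm
      refine ⟨by rw [ha, zero_smul, map_zero], ?_⟩
      by_cases h0 : x.2 n = 0
      · rw [h0, zero_smul, map_zero]
      · rw [pathF, pathN0_nil hA hn hd h2 (hx.1.2 n h0).1, map_smul, map_sum,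
          Finset.sum_eq_zero, smul_zero]
        intro r _
        refine coef_segPath_ne hn fun h3 => ?_
        exact hnm (Nat.eq_of_mul_eq_mul_right hl h3)
  exact Prod.ext (funext ha) (funext hb)

end PathIndependence

/-! ### The map to cohomology and its image. -/

section ClassMap

variable {V E : Type*} [Fintype V] {Q : GradedGentleQuiver V E} {k : Type*} [Field k]
variable {d : ℤ} {e f : ℕ → List (Q.Alg k) → Q.Alg k} {i j : ℤ}

/-- The map which sends `x` to the class of `series e f x`. -/
noncomputable def WittFamily.toHH (hW : WittFamily d e f) (T : Submodule k ((ℕ → k) × (ℕ → k)))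
    (hT : T ≤ completed k d i) (hl : ∀ x ∈ T, LocFin e f x) : T →ₗ[k] HH (Q.grading k) (i + 1) where
  toFun x := HH.mk (Q.grading k) (i + 1) ⟨series e f x.1, hW.series_mem (hT x.2) (hl _ x.2)⟩
  map_add' x y := by
    rw [← map_add]
    congr 1
    exact Subtype.ext ((hl _ x.2).series_add (hl _ y.2) (hl _ (x + y).2))
  map_smul' c x := by
    rw [RingHom.id_apply, ← map_smul]
    congr 1
    exact Subtype.ext ((hl _ x.2).series_smul c (hl _ (c • x).2))

theorem mk_congr {g g' : List (Q.Alg k) → Q.Alg k} (hg : g ∈ cocycles (Q.grading k) i)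
    (h : g = g') :
    HH.mk (Q.grading k) i ⟨g, hg⟩ = HH.mk (Q.grading k) i ⟨g', h ▸ hg⟩ := by
  subst h; rfl

/-- The classes of `e m` and `f m`, `m ≥ 1`. -/
def classSet (e f : ℕ → List (Q.Alg k) → Q.Alg k) (i : ℤ) : Set (HH (Q.grading k) i) :=
  {x | ∃ m : ℕ, 1 ≤ m ∧
    (HH.IsClassOf (Q.grading k) x (f m) ∨ HH.IsClassOf (Q.grading k) x (e m))}

theorem partialSum_class_mem (hW : WittFamily d e f) {x : (ℕ → k) × (ℕ → k)}
    (hx : x ∈ completed k d i) (M : ℕ) :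
    HH.mk (Q.grading k) (i + 1) ⟨partialSum e f x M, hW.partialSum_mem hx M⟩
      ∈ Submodule.span k (classSet e f (i + 1)) := by
  let S : Submodule k (List (Q.Alg k) → Q.Alg k) :=
    ((Submodule.span k (classSet e f (i + 1))).comap (HH.mk (Q.grading k) (i + 1))).map
      (cocycles (Q.grading k) (i + 1)).subtype
  have hS : partialSum e f x M ∈ S := by
    refine sum_mem fun m _ => add_mem ?_ ?_
    · by_cases h : x.1 m = 0
      · rw [h, zero_smul]; exact zero_mem _
      · obtain ⟨h1, rfl⟩ := hx.1 m h
        exact S.smul_mem _ ⟨⟨e m, hW.e_mem m h1⟩,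
          Submodule.subset_span ⟨m, h1, Or.inr ⟨hW.e_mem m h1, rfl⟩⟩, rfl⟩
    · by_cases h : x.2 m = 0
      · rw [h, zero_smul]; exact zero_mem _
      · obtain ⟨h1, h2⟩ := hx.2 m h
        have h3 : f m ∈ cocycles (Q.grading k) (i + 1) := by
          rw [← h2, sub_add_cancel]; exact hW.f_mem m h1
        exact S.smul_mem _ ⟨⟨f m, h3⟩, Submodule.subset_span ⟨m, h1, Or.inl ⟨h3, rfl⟩⟩, rfl⟩
  obtain ⟨c, hc, hc'⟩ := hS
  have : c = ⟨partialSum e f x M, hW.partialSum_mem hx M⟩ := Subtype.ext hc'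
  rw [← this]
  exact hc

/-- A nonzero value on homogeneous letters determines the total degree. Hence `classSet` needs no
condition on degrees: a generator of another degree can only contribute the class of the zero
cochain. -/
theorem eq_zero_of_mem_cochains {g : List (Q.Alg k) → Q.Alg k} (hi : g ∈ cochains (Q.grading k) i)
    (hj : g ∈ cochains (Q.grading k) j) (h : i ≠ j) : g = 0 := by
  refine Multi.ext_pword (cochains_multi hi) (fun u v c a b => by simp) fun l => ?_
  have hl : List.Forall₂ (fun a n => a ∈ Q.grading k n) (pword Q k l) (l.map NPath.deg) := by
    induction l with
    | nil => simp
    | cons p l ih => exact List.Forall₂.cons (ofPath_mem_grading p) ih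
  by_contra h0
  have := DirectSum.degree_eq_of_mem_mem (Q.grading k) (hi.2.2 _ _ hl) (hj.2.2 _ _ hl) h0
  omega

theorem series_single_left (m : ℕ) (a : k) :
    series e f (Pi.single m a, 0) = a • e m := by
  funext w
  rw [series, finsum_eq_single _ m]
  · simp
  · intro n hn
    simp [hn]

theorem series_single_right (m : ℕ) (a : k) :
    series e f (0, Pi.single m a) = a • f m := by
  funext w
  rw [series, finsum_eq_single _ m]
  · simp
  · intro n hn
    simp [hn]

theorem classSet_subset_range (hW : WittFamily d e f) {T : Submodule k ((ℕ → k) × (ℕ → k))}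
    (hT : T ≤ completed k d i) (hl : ∀ x ∈ T, LocFin e f x) (hU : uncompleted k d i ≤ T) :
    Submodule.span k (classSet e f (i + 1)) ≤ LinearMap.range (hW.toHH T hT hl) := by
  rw [Submodule.span_le]
  rintro z ⟨m, hm, ⟨h, rfl⟩ | ⟨h, rfl⟩⟩
  · by_cases hi : m * d - 1 = i
    · subst hi
      refine ⟨⟨(genF k d m hm).1, hU (genF k d m hm).2⟩, mk_congr _ ?_⟩
      exact (series_single_right m 1).trans (one_smul _ _)
    · have h0 := eq_zero_of_mem_cochains h.1 (hW.f_mem m hm).1 (by omega)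
      have h1 : (⟨f m, h⟩ : cocycles (Q.grading k) (i + 1)) = 0 := Subtype.ext h0
      rw [h1, map_zero]
      exact zero_mem _
  · by_cases hi : m * d = i
    · subst hi
      refine ⟨⟨(genE k d m hm).1, hU (genE k d m hm).2⟩, mk_congr _ ?_⟩
      exact (series_single_left m 1).trans (one_smul _ _)
    · have h0 := eq_zero_of_mem_cochains h.1 (hW.e_mem m hm).1 (by omega)
      have h1 : (⟨e m, h⟩ : cocycles (Q.grading k) (i + 1)) = 0 := Subtype.ext h0
      rw [h1, map_zero]
      exact zero_mem _

theorem uncompleted_le_completed : uncompleted k d i ≤ completed k d i := fun _ h => h.1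

theorem series_eq_partialSum {x : (ℕ → k) × (ℕ → k)} (hx : x ∈ uncompleted k d i) :
    ∃ M, series e f x = partialSum e f x M := by
  obtain ⟨N, hN⟩ := (hx.2.1.union hx.2.2).bddAbove
  refine ⟨N + 1, funext fun w => ?_⟩
  rw [series, partialSum, Finset.sum_apply,
    finsum_eq_sum_of_support_subset (s := Finset.range (N + 1))]
  · rfl
  · intro m hm
    rw [Finset.coe_range, Set.mem_Iio]
    by_contra hlt
    apply hm
    have h1 : x.1 m = 0 := by
      by_contra h
      have := hN (Or.inl h)
      omega
    have h2 : x.2 m = 0 := by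
      by_contra h
      have := hN (Or.inr h)
      omega
    dsimp only
    rw [h1, h2, zero_smul, zero_smul, add_zero]

/-- The classes of the finite sums form the span of the classes of `e m` and `f m`. -/
theorem range_toHH_uncompleted (hW : WittFamily d e f) :
    LinearMap.range (hW.toHH (uncompleted k d i) uncompleted_le_completed
      fun _ h => uncompleted_locFin h) = Submodule.span k (classSet e f (i + 1)) := by
  refine le_antisymm ?_ (classSet_subset_range hW _ _ le_rfl)
  rintro _ ⟨x, rfl⟩
  obtain ⟨M, hM⟩ := series_eq_partialSum (e := e) (f := f) x.2
  have := partialSum_class_mem hW x.2.1 M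
  convert this using 1
  exact mk_congr _ hM

/-- Local independence of the cocycles `e m` and `f m`: their arities grow, and up to a bound on
the arities a sum which bounds has vanishing coefficients. -/
structure ArityFamily (l : ℕ) (d : ℤ) (e f : ℕ → List (Q.Alg k) → Q.Alg k) : Prop where
  pos : 0 < l
  e_arity : ∀ m, 1 ≤ m → ∀ w : List (Q.Alg k), w.length ≠ m * l + 1 → e m w = 0
  f_arity : ∀ m, 1 ≤ m → ∀ w : List (Q.Alg k), w.length ≠ m * l → f m w = 0
  independent : ∀ (i : ℤ) (x : (ℕ → k) × (ℕ → k)), x ∈ completed k d i →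
    ∀ h : List (Q.Alg k) → Q.Alg k, Multi k h → ∀ J : ℕ,
    (∀ w : List (Q.Alg k), w.length < J → series e f x w = differential (Q.grading k) i h w) →
    ∀ m : ℕ, m * l + 1 < J → x.1 m = 0 ∧ x.2 m = 0

theorem ArityFamily.locFin {l : ℕ} (hF : ArityFamily l d e f) (x : (ℕ → k) × (ℕ → k)) :
    LocFin e f x := by
  intro L
  refine ⟨L + 1, fun m hm => Or.inr fun n hn w hw => ?_⟩
  have h1 : n ≤ n * l := Nat.le_mul_of_pos_right n hF.pos
  exact ⟨hF.e_arity n (by omega) w (by omega), hF.f_arity n (by omega) w (by omega)⟩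

/-- Terms with `m * l + 1 ≥ J` are invisible on `w`. The arity of `f m` is one less than that of `e
m`, whence the margin in the bound on the length. -/
theorem ArityFamily.series_congr {l : ℕ} (hF : ArityFamily l d e f) {x y : (ℕ → k) × (ℕ → k)}
    (hx : x ∈ completed k d i) (hy : y ∈ completed k d i) {J : ℕ}
    (h : ∀ m : ℕ, m * l + 1 < J → x.1 m = y.1 m ∧ x.2 m = y.2 m) (w : List (Q.Alg k))
    (hw : w.length + 1 < J) : series e f x w = series e f y w := by
  refine finsum_congr fun m => ?_
  by_cases hm : m * l + 1 < J
  · rw [(h m hm).1, (h m hm).2]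
  have zero : ∀ z : (ℕ → k) × (ℕ → k), z ∈ completed k d i →
      z.1 m • e m w + z.2 m • f m w = 0 := by
    intro z hz
    have h1 : z.1 m • e m w = 0 := by
      by_cases h0 : z.1 m = 0
      · rw [h0, zero_smul]
      · rw [hF.e_arity m (hz.1 m h0).1 w (by omega), smul_zero]
    have h2 : z.2 m • f m w = 0 := by
      by_cases h0 : z.2 m = 0
      · rw [h0, zero_smul]
      · rw [hF.f_arity m (hz.2 m h0).1 w (by omega), smul_zero]
    rw [h1, h2, add_zero]
  rw [zero x hx, zero y hy]

/-- The classes of all sums form the closed span of the classes of `e m` and `f m`. -/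
theorem range_toHH_completed {l : ℕ} (hW : WittFamily d e f) (hF : ArityFamily l d e f) :
    LinearMap.range (hW.toHH (completed k d i) le_rfl fun x _ => hF.locFin x)
      = HH.closedSpan (Q.grading k) (i + 1) (classSet e f (i + 1)) := by
  apply le_antisymm
  · rintro _ ⟨x, rfl⟩
    rw [HH.closedSpan, Submodule.mem_iInf]
    intro J
    obtain ⟨M, hM⟩ := (hF.locFin x.1).series_eq J
    have h1 := partialSum_class_mem hW x.2 M
    refine Submodule.mem_sup.2 ⟨_, h1, _, ⟨⟨series e f x.1, hW.series_mem x.2 (hF.locFin _)⟩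
      - ⟨partialSum e f x.1 M, hW.partialSum_mem x.2 M⟩, ?_, rfl⟩, ?_⟩
    · intro w hw
      exact sub_eq_zero.2 (hM M le_rfl w hw.le)
    · rw [map_sub, add_sub_cancel]
      rfl
  · intro y hy
    obtain ⟨c, rfl⟩ := Submodule.mkQ_surjective _ y
    -- Modulo the filtration step `J` the class is that of a sum, and a representative of the error
    -- is zero on words shorter than `J`.
    have step : ∀ J : ℕ, ∃ x ∈ completed k d i, ∃ h ∈ cochains (Q.grading k) i,
        ∀ w : List (Q.Alg k), w.length < J →
          c.1 w - series e f x w = differential (Q.grading k) i h w := by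
      intro J
      have h1 := (Submodule.mem_iInf _).1 hy J
      obtain ⟨s, hs, _, ⟨g, hg, rfl⟩, hst⟩ := Submodule.mem_sup.1 h1
      obtain ⟨x, rfl⟩ := classSet_subset_range hW le_rfl (fun x _ => hF.locFin x)
        uncompleted_le_completed hs
      have h2 : HH.mk (Q.grading k) (i + 1) c
          = HH.mk (Q.grading k) (i + 1) (⟨series e f x.1, hW.series_mem x.2 (hF.locFin _)⟩ + g) := by
        rw [map_add]; exact hst.symm
      rw [HH.mk_eq_mk_iff] at h2
      obtain ⟨h, hh, h3⟩ := h2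
      rw [add_sub_cancel_right] at hh h3
      refine ⟨x.1, x.2, h, hh, fun w hw => ?_⟩
      rw [h3]
      change _ = c.1 w - (series e f x.1 w + g.1 w)
      rw [hg w hw, add_zero]
    choose x hx h hh key using step
    -- The difference of two approximations bounds on short words, so by local independence its
    -- coefficients vanish in the range seen by both.
    have stable : ∀ J J' m : ℕ, m * l + 1 < J → m * l + 1 < J' →
        (x J).1 m = (x J').1 m ∧ (x J).2 m = (x J').2 m := by
      intro J J' m h1 h2
      have h3 := hF.independent i (x J - x J') (sub_mem (hx J) (hx J')) (h J' - h J)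
        (cochains_multi (sub_mem (hh J') (hh J))) (min J J') ?_ m (by omega)
      · exact ⟨sub_eq_zero.1 h3.1, sub_eq_zero.1 h3.2⟩
      · intro w hw
        have h4 : series e f (x J - x J') w = series e f (x J) w - series e f (x J') w := by
          have := (hF.locFin (x J - x J')).series_add (hF.locFin (x J')) (hF.locFin _)
          rw [sub_add_cancel] at this
          rw [this, Pi.add_apply, add_sub_cancel_right]
        rw [h4, map_sub, Pi.sub_apply, ← key J w (by omega), ← key J' w (by omega)]
        abel
    -- The index `m * l + 2` is the smallest bound at which the coefficients of index `m` have
    -- stabilised.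
    let y : (ℕ → k) × (ℕ → k) := (fun m => (x (m * l + 2)).1 m, fun m => (x (m * l + 2)).2 m)
    have hy' : y ∈ completed k d i :=
      ⟨fun m hm => (hx (m * l + 2)).1 m hm, fun m hm => (hx (m * l + 2)).2 m hm⟩
    refine ⟨⟨y, hy'⟩, ?_⟩
    symm
    -- The primitives need not stabilise, but the differential only links neighbouring arities. On a
    -- word of length `n + 1` it reads words of length `n`, so the shift `3` here matches the
    -- approximation with bound `(n + 1) + 2` used for the value.
    refine (HH.mk_eq_mk_iff _ _).2 ⟨fun w => h (w.length + 3) w, ?_, ?_⟩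
    · rw [add_sub_cancel_right]
      refine ⟨fun u v a b => ?_, fun u v r a => ?_, fun w n hw => (hh _).2.2 w n hw⟩
      · simpa using (hh (u.length + (v.length + 1) + 3)).1 u v a b
      · simpa using (hh (u.length + (v.length + 1) + 3)).2.1 u v r a
    · rw [add_sub_cancel_right]
      funext w
      change _ = c.1 w - series e f y w
      have e1 : series e f y w = series e f (x (w.length + 2)) w :=
        hF.series_congr hy' (hx _) (J := w.length + 2)
          (fun m hm => stable _ _ m (by omega) hm) w (by omega)
      rw [e1, key (w.length + 2) w (by omega)]
      rcases hw : w with _ | ⟨a, v⟩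
      · rfl
      · refine differential_congr (n := v.length) _ _ (fun u hu => ?_) _ rfl
        rw [hu]; rfl

end ClassMap
end GradedGentleQuiver

/-! ### Assembling the isomorphism. -/

namespace GradedGentleQuiver

section Isomorphism

variable {V E : Type*} [Fintype V] {Q : GradedGentleQuiver V E} {k : Type*} [Field k]
variable {d : ℤ} {e f : ℕ → List (Q.Alg k) → Q.Alg k} {i j : ℤ}

theorem WittFamily.isBracket_toHH (hW : WittFamily d e f) (h2 : Even d ∨ CharP k 2)
    {T T' T'' : Submodule k ((ℕ → k) × (ℕ → k))} (hT : T ≤ completed k d i)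
    (hT' : T' ≤ completed k d j) (hT'' : T'' ≤ completed k d (i + j))
    (hl : ∀ x ∈ T, LocFin e f x) (hl' : ∀ x ∈ T', LocFin e f x) (hl'' : ∀ x ∈ T'', LocFin e f x)
    (x : T) (y : T') (z : T'') (hz : z.1 = bracketFun x.1 y.1) :
    HH.IsBracket (Q.grading k) (hW.toHH T hT hl x) (hW.toHH T' hT' hl' y)
      (hW.toHH T'' hT'' hl'' z) := by
  refine HH.isBracket_of_sub_mem _ _ _ (by ring) ?_
  dsimp only
  rw [hz]
  exact hW.bracket_series h2 (hT x.2) (hT' y.2) (hl _ x.2) (hl' _ y.2) (hz ▸ hl'' _ z.2)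

/-- A subspace contains a class together with its negative. One inclusion suffices, since changing
the signs twice is the identity. -/
theorem span_classSet_units_smul_le (ε : ℕ → ℤˣ) :
    Submodule.span k (classSet e f i)
      ≤ Submodule.span k (classSet (fun m => ε m • e m) f i) := by
  rw [Submodule.span_le]
  rintro z ⟨m, hm, hz | ⟨hz, rfl⟩⟩
  · exact Submodule.subset_span ⟨m, hm, Or.inl hz⟩
  · rcases Int.units_eq_one_or (ε m) with h | h
    · exact Submodule.subset_span ⟨m, hm, Or.inr ⟨by simpa [h] using hz, mk_congr _ (by simp [h])⟩⟩
    · rw [SetLike.mem_coe, ← neg_mem_iff, ← map_neg]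
      refine Submodule.subset_span ⟨m, hm, Or.inr ⟨by simpa [h] using hz, ?_⟩⟩
      exact mk_congr (neg_mem hz) (by simp [h])

theorem span_classSet_units_smul (ε : ℕ → ℤˣ) :
    Submodule.span k (classSet (fun m => ε m • e m) f i) = Submodule.span k (classSet e f i) := by
  refine le_antisymm ?_ (span_classSet_units_smul_le ε)
  convert span_classSet_units_smul_le (e := fun m => ε m • e m) (f := f) (i := i) ε using 3
  funext m
  rw [smul_smul, Int.units_mul_self, one_smul]

theorem closedSpan_classSet_units_smul (ε : ℕ → ℤˣ) :
    HH.closedSpan (Q.grading k) i (classSet (fun m => ε m • e m) f i)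
      = HH.closedSpan (Q.grading k) i (classSet e f i) := by
  rw [HH.closedSpan, HH.closedSpan, span_classSet_units_smul]

/-- The isomorphism onto the image of `toHH`. -/
noncomputable def WittFamily.equiv (hW : WittFamily d e f)
    {T : Submodule k ((ℕ → k) × (ℕ → k))} (hT : T ≤ completed k d i)
    (hl : ∀ x ∈ T, LocFin e f x) (hinj : Function.Injective (hW.toHH T hT hl))
    {S : Submodule k (HH (Q.grading k) (i + 1))} (hS : LinearMap.range (hW.toHH T hT hl) = S) :
    T ≃ₗ[k] S :=
  (LinearEquiv.ofInjective _ hinj).trans (LinearEquiv.ofEq _ _ hS)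

theorem WittFamily.isClassOf_toHH (hW : WittFamily d e f)
    {T : Submodule k ((ℕ → k) × (ℕ → k))} (hT : T ≤ completed k d i)
    (hl : ∀ x ∈ T, LocFin e f x) (x : T) {g : List (Q.Alg k) → Q.Alg k}
    (hg : series e f x.1 = g) : HH.IsClassOf (Q.grading k) (hW.toHH T hT hl x) g := by
  subst hg
  exact ⟨hW.series_mem (hT x.2) (hl _ x.2), rfl⟩

/-- A vanishing class means that the sum is the differential of some cochain, so injectivity is
exactly independence modulo coboundaries. -/
theorem WittFamily.toHH_injective (hW : WittFamily d e f)
    {T : Submodule k ((ℕ → k) × (ℕ → k))} (hT : T ≤ completed k d i)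
    (hl : ∀ x ∈ T, LocFin e f x)
    (hind : ∀ x ∈ T, ∀ h : List (Q.Alg k) → Q.Alg k, Multi k h →
      series e f x = differential (Q.grading k) i h → x = 0) :
    Function.Injective (hW.toHH T hT hl) := by
  rw [injective_iff_map_eq_zero]
  intro x hx
  have h1 : HH.mk (Q.grading k) (i + 1) ⟨series e f x.1, hW.series_mem (hT x.2) (hl _ x.2)⟩
      = HH.mk (Q.grading k) (i + 1) 0 := hx.trans (map_zero _).symm
  rw [HH.mk_eq_mk_iff] at h1
  obtain ⟨h, hh, h3⟩ := h1
  rw [add_sub_cancel_right] at hh h3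
  refine Subtype.ext (hind x.1 x.2 h (cochains_multi hh) ?_)
  rw [h3]
  exact (sub_zero _).symm

variable {A : ℕ → E} {l : ℕ}

theorem anti_arityFamily (hA : CyclicWord A l) (hrel : ∀ t, Q.rel (A t) (A (t + 1)))
    (hd : d = l - Q.cdeg A l) (h2 : Even d ∨ CharP k 2) :
    ArityFamily l d (antiE Q k A l) (antiF Q k A l) where
  pos := hA.pos
  e_arity _ hm := antiE_arity hA hm
  f_arity _ hm := antiN0_arity hA hrel hm
  independent _ _ hx _ hm _ heq _ := anti_independent hA hrel hd h2 hx hm heq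

end Isomorphism
end GradedGentleQuiver

theorem mainTheorem4 {k V E : Type*} [Field k] [Fintype V] [Fintype E]
    (Q : GradedGentleQuiver V E) (u : List E) (hu : IsPrimitive u) :
    -- complete anti-paths, with `d = l(u) - |u|`
    (Q.IsCompleteAntipath u →
      ∀ d : ℤ, d = (u.length : ℤ) - Q.wdeg u → (Even d ∨ CharP k 2) →
        (∀ m : ℕ, 1 ≤ m →
          Q.antiN0 k (wpow u m) ∈ cocycles (Q.grading k) (m * d) ∧
          Q.antiN1 k (wpow u m) ∈ cocycles (Q.grading k) (m * d + 1)) ∧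
        (∀ i j : ℤ, ∀ x ∈ Q.antiSpan k u (i + 1), ∀ y ∈ Q.antiSpan k u (j + 1),
          ∃ z ∈ Q.antiSpan k u (i + j + 1), HH.IsBracket (Q.grading k) x y z) ∧
        ∃ φ : ∀ i : ℤ, completed k d i ≃ₗ[k] Q.antiSpan k u (i + 1),
          (∀ (i j : ℤ) (x : completed k d i) (y : completed k d j),
            HH.IsBracket (Q.grading k) (φ i x).1 (φ j y).1
              (φ (i + j) (completed.bracket x y)).1) ∧
          (∃ ε : ℕ → ℤˣ, ∀ (m : ℕ) (hm : 1 ≤ m),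
            HH.IsClassOf (Q.grading k) (φ (m * d) (toCompleted (genE k d m hm))).1
              (ε m • Q.antiN1 k (wpow u m)) ∧
            HH.IsClassOf (Q.grading k) (φ (m * d - 1) (toCompleted (genF k d m hm))).1
              (Q.antiN0 k (wpow u m)))) ∧
    -- complete paths, with `d = |u|`
    (Q.IsCompletePath u →
      ∀ d : ℤ, d = Q.wdeg u → (Even d ∨ CharP k 2) →
        (∀ m : ℕ, 1 ≤ m →
          Q.pathN0 k (wpow u m) ∈ cocycles (Q.grading k) (m * d) ∧
          Q.pathN1 k (wpow u m) ∈ cocycles (Q.grading k) (m * d + 1)) ∧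
        (∀ i j : ℤ, ∀ x ∈ Q.pathSpan k u (i + 1), ∀ y ∈ Q.pathSpan k u (j + 1),
          ∃ z ∈ Q.pathSpan k u (i + j + 1), HH.IsBracket (Q.grading k) x y z) ∧
        ∃ φ : ∀ i : ℤ, uncompleted k d i ≃ₗ[k] Q.pathSpan k u (i + 1),
          (∀ (i j : ℤ) (x : uncompleted k d i) (y : uncompleted k d j),
            HH.IsBracket (Q.grading k) (φ i x).1 (φ j y).1
              (φ (i + j) (uncompleted.bracket x y)).1) ∧
          (∃ ε : ℕ → ℤˣ, ∀ (m : ℕ) (hm : 1 ≤ m),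
            HH.IsClassOf (Q.grading k) (φ (m * d) (genE k d m hm)).1
              (ε m • Q.pathN1 k (wpow u m)) ∧
            HH.IsClassOf (Q.grading k) (φ (m * d - 1) (genF k d m hm)).1
              (Q.pathN0 k (wpow u m)))) := by
  constructor
  · rintro ⟨hne, hc⟩ d hd h2
    -- For each arrow there is at most one right factor that forms a relation with it; this is the
    -- determinism that makes the letters of a primitive anti-path distinct.
    obtain ⟨A, hA, hrel, hseg⟩ := exists_cyclicWord Q.rel_right hne hc hu
    generalize u.length = l at *
    subst hseg
    have hd' : d = l - Q.cdeg A l := hd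
    have hW := anti_wittFamily (k := k) hA hrel hd' h2
    have hF := anti_arityFamily (k := k) hA hrel hd' h2
    have hS : ∀ i : ℤ, LinearMap.range (hW.toHH (completed k d i) le_rfl fun x _ => hF.locFin x)
        = Q.antiSpan k (seg A 0 l) (i + 1) := by
      intro i
      rw [range_toHH_completed hW hF, closedSpan_classSet_units_smul, antiSpan]
      simp only [classSet, hA.wpow_seg]
    have hinj : ∀ i : ℤ, Function.Injective
        (hW.toHH (completed k d i) le_rfl fun x _ => hF.locFin x) := by
      refine fun i => hW.toHH_injective _ _ fun x hx h hm heq => ?_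
      -- The sum agrees with a differential in all arities, so every coefficient is reached by some
      -- bound.
      have h3 := fun m => hF.independent i x hx h hm (m * l + 2) (fun w _ => by rw [heq]) m
        (by omega)
      exact Prod.ext (funext fun m => (h3 m).1) (funext fun m => (h3 m).2)
    let φ : ∀ i : ℤ, completed k d i ≃ₗ[k] Q.antiSpan k (seg A 0 l) (i + 1) := fun i =>
      hW.equiv le_rfl (fun x _ => hF.locFin x) (hinj i) (hS i)
    have hφ : ∀ (i j : ℤ) (x : completed k d i) (y : completed k d j),
        HH.IsBracket (Q.grading k) (φ i x).1 (φ j y).1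
          (φ (i + j) (completed.bracket x y)).1 := fun i j x y =>
      hW.isBracket_toHH h2 le_rfl le_rfl le_rfl (fun x _ => hF.locFin x) (fun x _ => hF.locFin x)
        (fun x _ => hF.locFin x) x y (completed.bracket x y) rfl
    refine ⟨fun m hm => ?_, fun i j x hx y hy => ?_, φ, hφ, fun m => Q.antiEps A l m,
      fun m hm => ⟨?_, ?_⟩⟩
    · rw [hA.wpow_seg]
      exact ⟨antiN0_mem_cocycles hA hrel hd' h2 hm, antiN1_mem_cocycles hA hrel hd' hm⟩
    -- Closure under the bracket is obtained by pulling both classes back along `φ`.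
    · have h3 := hφ i j ((φ i).symm ⟨x, hx⟩) ((φ j).symm ⟨y, hy⟩)
      rw [LinearEquiv.apply_symm_apply, LinearEquiv.apply_symm_apply] at h3
      exact ⟨_, Subtype.property _, h3⟩
    · rw [hA.wpow_seg]
      exact hW.isClassOf_toHH le_rfl (fun x _ => hF.locFin x) _
        ((series_single_left m 1).trans (one_smul _ _))
    · rw [hA.wpow_seg]
      exact hW.isClassOf_toHH le_rfl (fun x _ => hF.locFin x) _
        ((series_single_right m 1).trans (one_smul _ _))
  · rintro ⟨hne, hc⟩ d hd h2
    obtain ⟨A, hA, hn, hseg⟩ := exists_cyclicWord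
      (fun a b c hb hc => Q.nonrel_right a b c hb.1 hb.2 hc.1 hc.2) hne hc hu
    generalize u.length = l at *
    subst hseg
    have hd' : d = Q.cdeg A l := hd
    have hW := path_wittFamily (k := k) hA hn hd' h2
    have hS : ∀ i : ℤ, LinearMap.range (hW.toHH (uncompleted k d i) uncompleted_le_completed
        fun _ h => uncompleted_locFin h) = Q.pathSpan k (seg A 0 l) (i + 1) := by
      intro i
      rw [range_toHH_uncompleted hW, span_classSet_units_smul, pathSpan]
      simp only [classSet, hA.wpow_seg]
    have hinj : ∀ i : ℤ, Function.Injective (hW.toHH (uncompleted k d i) uncompleted_le_completed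
        fun _ h => uncompleted_locFin h) := fun i =>
      hW.toHH_injective _ _ fun x hx h hm heq => path_independent hA hn hd' h2 hx hm heq
    let φ : ∀ i : ℤ, uncompleted k d i ≃ₗ[k] Q.pathSpan k (seg A 0 l) (i + 1) := fun i =>
      hW.equiv uncompleted_le_completed (fun _ h => uncompleted_locFin h) (hinj i) (hS i)
    have hφ : ∀ (i j : ℤ) (x : uncompleted k d i) (y : uncompleted k d j),
        HH.IsBracket (Q.grading k) (φ i x).1 (φ j y).1
          (φ (i + j) (uncompleted.bracket x y)).1 := fun i j x y =>
      hW.isBracket_toHH h2 uncompleted_le_completed uncompleted_le_completed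
        uncompleted_le_completed (fun _ h => uncompleted_locFin h) (fun _ h => uncompleted_locFin h)
        (fun _ h => uncompleted_locFin h) x y (uncompleted.bracket x y) rfl
    refine ⟨fun m hm => ?_, fun i j x hx y hy => ?_, φ, hφ, fun _ => -1, fun m hm => ⟨?_, ?_⟩⟩
    · rw [hA.wpow_seg]
      exact ⟨pathN0_mem_cocycles hA hn hd' h2 hm, pathN1_mem_cocycles hA hn hd' hm⟩
    · have h3 := hφ i j ((φ i).symm ⟨x, hx⟩) ((φ j).symm ⟨y, hy⟩)
      rw [LinearEquiv.apply_symm_apply, LinearEquiv.apply_symm_apply] at h3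
      exact ⟨_, Subtype.property _, h3⟩
    · rw [hA.wpow_seg]
      exact hW.isClassOf_toHH uncompleted_le_completed (fun _ h => uncompleted_locFin h) _
        ((series_single_left m 1).trans (one_smul _ _))
    · rw [hA.wpow_seg]
      exact hW.isClassOf_toHH uncompleted_le_completed (fun _ h => uncompleted_locFin h) _
        ((series_single_right m 1).trans (one_smul _ _))
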